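/- **Theorem 1.** Let $\mathbb T=\mathbb R/\mathbb Z$, $\mathcal H=\{f\in L^2_{\mathbb R}(\mathbb T):\int_0^1 f\,dx=0\}$, $\mathcal H_1=\{f: f,f'\in\mathcal H\}$, and let $\mathfrak H=\mathcal H_1\oplus\mathcal H$ be the space of pairs $\psi=(p,q)$ with the norm $\|\psi\|_1^2=\|p'\|^2+\|q\|^2$, $\|f\|^2=\int_0^1|f|^2dx$; $\mathfrak H_{\mathbb C}$ is its complexification, and $\mathcal B_\varepsilon\subset\mathfrak H$, $\mathcal B_{\mathbb C,\varepsilon}\subset\mathfrak H_{\mathbb C}$ are the open balls of radius $\varepsilon$ about $0$. Consider in $L^2(0,2)$ the operator $$\mathcal L(\psi)y=(y''+py)'+py'+qy,\qquad y(0)=y(1)=y(2)=0,$$ with 1-periodic $p,q$. Let $\mathbb Z_0=\mathbb Z\setminus\{0\}$, $z_n^o=\frac{2\pi n}{\sqrt3}$, $\mu_n^o=(z_n^o)^3$, and $$\mathcal D_n=\{\lambda\in\mathbb C:|\lambda^{1/3}-z_n^o|<1\},\qquad \mathcal D_{-n}=-\mathcal D_n\qquad(n\ge1),$$ with $\arg\lambda^{1/3}\in(-\frac\pi3,\frac\pi3]$.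 There are $\varepsilon_0>0$ and $C>0$ such that for every $\varepsilon\in(0,\varepsilon_0]$ the following holds. 1. For every $\psi\in\mathcal B_{\mathbb C,\varepsilon}$ there is exactly one eigenvalue $\mu_n(\psi)$ of $\mathcal L(\psi)$ in each $\mathcal D_n$, $n\in\mathbb Z_0$; it has algebraic multiplicity one, it is real if $\psi\in\mathcal B_\varepsilon$, and there are no other eigenvalues. 2. Each function $\mu_n$, $n\in\mathbb Z_0$, is analytic on $\mathcal B_{\mathbb C,\varepsilon}$. 3. If $\psi\in\mathcal B_\varepsilon$ and $n\in\mathbb Z_0$, then $h_{cn}=\mu_n(\psi)-\mu_n^o$ satisfies $$\Big|h_{cn}+\frac{\widehat{p}'_{sn}}{\sqrt3}+\widehat q_{cn}-\frac{\widehat{p}'_{cn}}{3}+\frac{\widehat q_{sn}}{\sqrt3}\Big|\le\frac{C\|\psi\|_1^2}{|n|},$$ where $\widehat f_{cn}=\int_0^1 f(x)\cos2\pi nx\,dx$, $\widehat f_{sn}=\int_0^1 f(x)\sin2\pi nx\,dx$, and $\widehat{p}'$ stands for the coefficients of $f=p'$. 4. If $\psi\in\mathcal B_\varepsilon$ and $n\in\mathbb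 Z_0$, then the $L^2$-gradient $\big(\frac{\partial\mu_n(\psi)}{\partial p(t)},\frac{\partial\mu_n(\psi)}{\partial q(t)}\big)$, that is, the pair of real continuous 1-periodic functions of zero mean for which the derivative of $\mu_n$ at $\psi$ in the direction $(u,v)$ is $\int_0^1\big(\frac{\partial\mu_n}{\partial p(t)}u(t)+\frac{\partial\mu_n}{\partial q(t)}v(t)\big)dt$, exists and satisfies $$\sup_{t\in[0,1]}\Big|\frac{\partial\mu_n(\psi)}{\partial p(t)}-z_n^oa_n(t)\Big|\le C\|\psi\|_1,\qquad \sup_{t\in[0,1]}\Big|\frac{\partial\mu_n(\psi)}{\partial q(t)}+a_n(t)\Big|\le\frac{C\|\psi\|_1}{|n|},$$ where $a_n(t)=\cos2\pi nt+\frac{1}{\sqrt3}\sin2\pi nt$. -/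

import Mathlib

open MeasureTheory

noncomputable section

namespace ThreePoint

/-! ### The spaces of coefficients -/

/-- Complex `L²` on the circle `ℝ / ℤ`. -/
abbrev CircleL2 : Type := Lp ℂ 2 (volume : Measure UnitAddCircle)

lemma integrable_circleL2 (f : CircleL2) : Integrable (fun x => f x) volume :=
  (Lp.memLp f).integrable (by norm_num)

/-- The complexification of `𝓗`: functions in `L²(ℝ / ℤ)` with zero mean. -/
def MeanZero : Submodule ℂ CircleL2 where
  carrier := {f | ∫ x, f x = 0}
  zero_mem' := by
    have h : ∫ x, (0 : CircleL2) x = ∫ _ : UnitAddCircle, (0 : ℂ) :=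
      integral_congr_ae (Lp.coeFn_zero ℂ 2 volume)
    rw [integral_zero] at h
    exact h
  add_mem' := by
    intro f g hf hg
    simp only [Set.mem_ofPred_eq] at hf hg ⊢
    have h : ∫ x, (f + g) x = ∫ x, (f x + g x) := integral_congr_ae (Lp.coeFn_add f g)
    rw [h, integral_add (integrable_circleL2 f) (integrable_circleL2 g), hf, hg, add_zero]
  smul_mem' := by
    intro c f hf
    simp only [Set.mem_ofPred_eq] at hf ⊢
    have h : ∫ x, (c • f) x = ∫ x, c • f x := integral_congr_ae (Lp.coeFn_smul c f)
    rw [h, integral_smul, hf, smul_zero]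

/-- The 1-periodic function on the line given by an element of `L²(ℝ / ℤ)`. -/
def onLine (f : MeanZero) (x : ℝ) : ℂ := (f : CircleL2) (x : UnitAddCircle)

lemma ae_onLine {P : UnitAddCircle → Prop} (h : ∀ᵐ x, P x) :
    ∀ᵐ x : ℝ ∂(volume.restrict (Set.Ioc (0 : ℝ) 1)), P (x : UnitAddCircle) := by
  have := (AddCircle.measurePreserving_mk (1 : ℝ) 0).quasiMeasurePreserving.ae h
  simpa using this

lemma onLine_zero_ae :
    onLine 0 =ᵐ[volume.restrict (Set.Ioc (0 : ℝ) 1)] fun _ => 0 := by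
  have := ae_onLine (Lp.coeFn_zero ℂ 2 (volume : Measure UnitAddCircle))
  filter_upwards [this] with x hx
  simpa [onLine] using hx

lemma onLine_add_ae (f g : MeanZero) :
    onLine (f + g) =ᵐ[volume.restrict (Set.Ioc (0 : ℝ) 1)] fun x => onLine f x + onLine g x := by
  have := ae_onLine (Lp.coeFn_add (f : CircleL2) (g : CircleL2))
  filter_upwards [this] with x hx
  simpa [onLine] using hx

lemma onLine_smul_ae (c : ℂ) (f : MeanZero) :
    onLine (c • f) =ᵐ[volume.restrict (Set.Ioc (0 : ℝ) 1)] fun x => c * onLine f x := by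
  have := ae_onLine (Lp.coeFn_smul c (f : CircleL2))
  filter_upwards [this] with x hx
  simpa [onLine] using hx

lemma integrableOn_onLine (f : MeanZero) : IntegrableOn (onLine f) (Set.Ioc (0 : ℝ) 1) := by
  have := (AddCircle.measurePreserving_mk (1 : ℝ) 0).integrable_comp_of_integrable
    (integrable_circleL2 (f : CircleL2))
  rw [zero_add] at this
  exact this

lemma primitive_congr {f g : ℝ → ℂ} (h : f =ᵐ[volume.restrict (Set.Ioc (0 : ℝ) 1)] g)
    {x : ℝ} (hx : x ∈ Set.Ioc (0 : ℝ) 1) : ∫ t in 0..x, f t = ∫ t in 0..x, g t := by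
  rw [intervalIntegral.integral_of_le hx.1.le, intervalIntegral.integral_of_le hx.1.le]
  exact integral_congr_ae (ae_restrict_of_ae_restrict_of_subset (Set.Ioc_subset_Ioc_right hx.2) h)

lemma intervalIntegrable_onLine (f : MeanZero) {x : ℝ} (hx : x ∈ Set.Ioc (0 : ℝ) 1) :
    IntervalIntegrable (onLine f) volume 0 x := by
  rw [intervalIntegrable_iff_integrableOn_Ioc_of_le hx.1.le]
  exact (integrableOn_onLine f).mono_set (Set.Ioc_subset_Ioc_right hx.2)

/-- `g` is the derivative of `f` : almost everywhere `f` is a constant plus the integral of `g`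
(as `g` has zero mean, the primitive is automatically continuous on the circle). -/
def IsDerivOf (f g : MeanZero) : Prop :=
  ∃ c : ℂ, ∀ᵐ x : ℝ ∂(volume.restrict (Set.Ioc (0 : ℝ) 1)),
    onLine f x = c + ∫ t in 0..x, onLine g t

/-- The pairs `(f, f')` with `f, f'` in `L²(ℝ / ℤ)` of zero mean. -/
def derivGraph : Submodule ℂ (MeanZero × MeanZero) where
  carrier := {u | IsDerivOf u.1 u.2}
  zero_mem' := by
    refine ⟨0, ?_⟩
    filter_upwards [onLine_zero_ae, ae_restrict_mem measurableSet_Ioc] with x hx hm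
    have h := primitive_congr onLine_zero_ae hm
    simp only [Prod.fst_zero, Prod.snd_zero]
    rw [h, hx]; simp
  add_mem' := by
    rintro ⟨f, f'⟩ ⟨g, g'⟩ ⟨c, hc⟩ ⟨d, hd⟩
    refine ⟨c + d, ?_⟩
    filter_upwards [hc, hd, onLine_add_ae f g, ae_restrict_mem measurableSet_Ioc]
      with x h1 h2 h3 hm
    simp only [Prod.mk_add_mk] at h1 h2 ⊢
    rw [h3, h1, h2, primitive_congr (onLine_add_ae f' g') hm,
      intervalIntegral.integral_add (intervalIntegrable_onLine f' hm)
        (intervalIntegrable_onLine g' hm)]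
    ring
  smul_mem' := by
    rintro a ⟨f, f'⟩ ⟨c, hc⟩
    refine ⟨a * c, ?_⟩
    filter_upwards [hc, onLine_smul_ae a f, ae_restrict_mem measurableSet_Ioc] with x h1 h3 hm
    simp only [Prod.smul_mk] at h1 ⊢
    rw [h3, h1, primitive_congr (onLine_smul_ae a f') hm, intervalIntegral.integral_const_mul]
    ring

/-- The complexification of `𝓗₁ = {f : f, f' ∈ 𝓗}`. -/
def H1 : Type := derivGraph

instance : AddCommGroup H1 := inferInstanceAs (AddCommGroup derivGraph)

instance : Module ℂ H1 := inferInstanceAs (Module ℂ derivGraph)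

/-- The function `f`. -/
def H1.fn (f : H1) : MeanZero := f.1.1

/-- The derivative `f ↦ f'`. -/
def H1.deriv : H1 →ₗ[ℂ] MeanZero where
  toFun f := f.1.2
  map_add' _ _ := rfl
  map_smul' _ _ := rfl

lemma H1.deriv_injective : Function.Injective H1.deriv := by
  rw [injective_iff_map_eq_zero]
  rintro ⟨⟨f, g⟩, ⟨c, hc⟩⟩ (h : g = 0)
  subst h
  have h1 : ∀ᵐ x : ℝ ∂(volume.restrict (Set.Ioc (0 : ℝ) 1)), onLine f x = c := by
    filter_upwards [hc, ae_restrict_mem measurableSet_Ioc] with x hx hm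
    rw [hx, primitive_congr onLine_zero_ae hm]; simp
  have hmp := AddCircle.measurePreserving_mk (1 : ℝ) 0
  have hS : MeasurableSet {x : UnitAddCircle | ¬ (f : CircleL2) x = c} :=
    ((Lp.stronglyMeasurable (f : CircleL2)).measurable (measurableSet_singleton c)).compl
  have h2 : ∀ᵐ x : UnitAddCircle, (f : CircleL2) x = c := by
    rw [ae_iff, ← hmp.measure_preimage hS.nullMeasurableSet]
    have h3 := ae_iff.1 h1
    simpa [onLine] using h3
  have h4 : ∫ x, (f : CircleL2) x = c := by
    have h6 : (volume : Measure UnitAddCircle).real Set.univ = 1 := by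
      simp [Measure.real]
    rw [integral_congr_ae h2, integral_const, h6, one_smul]
  have h5 : ∫ x, (f : CircleL2) x = 0 := f.2
  have hc0 : c = 0 := h4.symm.trans h5
  have hf : f = 0 := by
    apply Subtype.ext
    apply Lp.ext
    filter_upwards [h2, Lp.coeFn_zero ℂ 2 (volume : Measure UnitAddCircle)] with x hx hx0
    rw [hx, hc0]
    exact hx0.symm
  subst hf
  rfl

/-- The norm on `𝓗₁` is `‖f'‖`. -/
instance : NormedAddCommGroup H1 :=
  NormedAddCommGroup.induced H1 MeanZero H1.deriv H1.deriv_injective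

instance : NormedSpace ℂ H1 := NormedSpace.induced ℂ H1 MeanZero H1.deriv

/-- The complexification of `𝓗₁ ⊕ 𝓗`, pairs `ψ = (p, q)` with norm
`‖ψ‖₁² = ‖p'‖² + ‖q‖²`. -/
abbrev Coeff : Type := WithLp 2 (H1 × MeanZero)

/-- The coefficient `p`, as a 1-periodic function on the line. -/
def Coeff.p (ψ : Coeff) : ℝ → ℂ := onLine ψ.fst.fn

/-- The derivative `p'`, as a 1-periodic function on the line. -/
def Coeff.dp (ψ : Coeff) : ℝ → ℂ := onLine (H1.deriv ψ.fst)

/-- The coefficient `q`, as a 1-periodic function on the line. -/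
def Coeff.q (ψ : Coeff) : ℝ → ℂ := onLine ψ.snd

/-- `p` and `q` are real valued. -/
def Coeff.IsReal (ψ : Coeff) : Prop :=
  ∀ᵐ x : ℝ ∂(volume.restrict (Set.Ioc (0 : ℝ) 1)), (ψ.p x).im = 0 ∧ (ψ.q x).im = 0

/-! ### The operator -/

/-- `y` lies in the domain of the operator `𝓛(ψ)` in `L²(0,2)` and `𝓛(ψ) y = f`, that is,
`y`, `v = y'` and `w = y'' + p y` are absolutely continuous on `[0,2]`,
`w' + p y' + q y = f ∈ L²(0,2)` and `y(0) = y(1) = y(2) = 0`. -/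
def OpEq (ψ : Coeff) (y f : ℝ → ℂ) : Prop :=
  MemLp f 2 (volume.restrict (Set.Ioc (0 : ℝ) 2)) ∧
  ∃ v w : ℝ → ℂ,
    ContinuousOn y (Set.Icc 0 2) ∧ ContinuousOn v (Set.Icc 0 2) ∧ ContinuousOn w (Set.Icc 0 2) ∧
    (∀ x ∈ Set.Icc (0 : ℝ) 2, y x = y 0 + ∫ t in 0..x, v t) ∧
    (∀ x ∈ Set.Icc (0 : ℝ) 2, v x = v 0 + ∫ t in 0..x, (w t - ψ.p t * y t)) ∧
    (∀ x ∈ Set.Icc (0 : ℝ) 2, w x = w 0 + ∫ t in 0..x, (f t - ψ.p t * v t - ψ.q t * y t)) ∧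
    y 0 = 0 ∧ y 1 = 0 ∧ y 2 = 0

/-- `y` is an eigenfunction of `𝓛(ψ)` with the eigenvalue `l`. -/
def IsEigenfunction (ψ : Coeff) (l : ℂ) (y : ℝ → ℂ) : Prop :=
  OpEq ψ y (fun x => l * y x) ∧ ∃ x ∈ Set.Icc (0 : ℝ) 2, y x ≠ 0

/-- `l` is an eigenvalue of `𝓛(ψ)`. -/
def IsEigenvalue (ψ : Coeff) (l : ℂ) : Prop := ∃ y, IsEigenfunction ψ l y

/-- `l` is an eigenvalue of algebraic multiplicity one: the eigenspace is spanned by one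
eigenfunction `y`, and there is no `u` with `(𝓛(ψ) - l) u = y`. -/
def IsSimpleEigenvalue (ψ : Coeff) (l : ℂ) : Prop :=
  ∃ y, IsEigenfunction ψ l y ∧
    (∀ u, OpEq ψ u (fun x => l * u x) → ∃ c : ℂ, ∀ x ∈ Set.Icc (0 : ℝ) 2, u x = c * y x) ∧
    (∀ u, ¬ OpEq ψ u (fun x => l * u x + y x))

/-- `z_n^o = 2πn/√3`, so that `(z_n^o)³` are the eigenvalues for `ψ = 0`. -/
def zo (n : ℤ) : ℝ := 2 * Real.pi * n / Real.sqrt 3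

/-- The domain `{|l^{1/3} - z_n^o| < 1}` for `n ≥ 0`, where the cube root has its argument in
`(-π/3, π/3]`; its reflection in the origin for negative indices. -/
def domD (n : ℤ) : Set ℂ :=
  if 0 ≤ n then {l | ‖l ^ (1 / 3 : ℂ) - (zo n : ℂ)‖ < 1}
  else {l | ‖(-l) ^ (1 / 3 : ℂ) - (zo (-n) : ℂ)‖ < 1}

/-- The eigenvalue `μ_n(ψ)` of `𝓛(ψ)` in the domain `domD n` (meaningful when there is exactly
one). -/
def mu (n : ℤ) (ψ : Coeff) : ℂ :=
  Classical.epsilon fun l => l ∈ domD n ∧ IsEigenvalue ψ l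

/-! ### Fourier coefficients and gradients -/

/-- `∫₀¹ f(x) cos(2πnx) dx`. -/
def fourierCos (f : ℝ → ℂ) (n : ℤ) : ℂ :=
  ∫ x in (0 : ℝ)..1, f x * (Real.cos (2 * Real.pi * n * x) : ℂ)

/-- `∫₀¹ f(x) sin(2πnx) dx`. -/
def fourierSin (f : ℝ → ℂ) (n : ℤ) : ℂ :=
  ∫ x in (0 : ℝ)..1, f x * (Real.sin (2 * Real.pi * n * x) : ℂ)

/-- `a_n(t) = cos 2πnt + sin 2πnt / √3`. -/
def aFun (n : ℤ) (t : ℝ) : ℝ :=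
  Real.cos (2 * Real.pi * n * t) + Real.sin (2 * Real.pi * n * t) / Real.sqrt 3

/-- `(gp, gq)` is the `L²`-gradient `(∂F/∂p(t), ∂F/∂q(t))` of `F` at `ψ`: the derivative of `F`
at `ψ` in the direction `(p, q)` is `∫₀¹ (gp p + gq q) dt`. As all `p`, `q` have zero mean, the
gradient is determined up to constants, and it is normalized to have zero mean itself. -/
def IsGradient (F : Coeff → ℂ) (ψ : Coeff) (gp gq : C(UnitAddCircle, ℝ)) : Prop :=
  (∫ t, gp t = 0) ∧ (∫ t, gq t = 0) ∧ DifferentiableAt ℂ F ψ ∧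
  ∀ φ : Coeff, fderiv ℂ F ψ φ =
    ∫ t in (0 : ℝ)..1,
      ((gp (t : UnitAddCircle) : ℂ) * φ.p t + (gq (t : UnitAddCircle) : ℂ) * φ.q t)

end ThreePoint

end

/-! The problem of order three is reduced to a Dirichlet problem of order two. Write λ = z³ and let
m be a 1-periodic solution, close to z, of the Riccati equation m'' = 3mm' − m³ − 2pm + λ − q + p'.
Then 𝓛 − λ = (D − m)(D² + mD + 2p + m² − m'). If 𝓛y = λy, the image G of y under the second factor
satisfies G' = mG, hence G(x+1) = τG(x) with τ = exp ∫₀¹ m. So y(x+1) − τy(x) is annihilated by the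
second factor and vanishes at 0 and 1. With E(x) = exp(½∫₀ˣ m), the function f = E·(y(·+1) − τy)
solves f'' + Qf = 0, f(0) = f(1) = 0, where Q = 2p + ¾m² − (3/2)m' (`Factor.pair_schrod`). It is not
identically zero, because y(x+1) = τy(x) is impossible for y ≠ 0 (`Factor.eq_zero_of_multiplier`),
and every such f comes from an eigenfunction (`Factor.pair_of_dirichlet`).

For Re λ ≥ 0 the cube root z lies in the sector |arg z| ≤ π/6, where D² ∓ 3zD + 3z² has an inverse
on periodic functions of norm O(|z|⁻²). Values of λ near 0 are excluded directly
(`Pair.eq_zero_of_small`), and Re λ ≤ 0 is reduced to Re λ ≥ 0 by reflection of the interval. Since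
Q = ¾z² + small, f exists only if (√3/2)z is close to some πn (`Factor.exists_base`). Near z_n^o the
Riccati solution, the eigenfunction and the shift H in λ = (z_n^o)³ + z_n^o·H are found together as
the fixed point of one contraction (`exists_joint`). The implicit function theorem makes the fixed
point analytic in the coefficients; its uniqueness gives the labelling and, for real coefficients,
the reality of the eigenvalues.

Derivatives come from an exact formula for the difference of two eigenvalues
(`GradData.sub_mul_integral`): up to a remainder of second order, Δλ·∫g = ∫(g Δq + g_p Δp), where g
is the periodic solution of g'' + 3mg' + (3m² + 2p)g = (3/2)(mf² + 2ff'). So, up to constants, g/∫g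
is the gradient in q; for ψ = 0 one has g = (1 − a_n)/(4z_n^o), and the estimates follow by
perturbation. The fact ∫g ≠ 0 also excludes generalized eigenfunctions (`Factor.isSimplePair`). With
ψ = 0 as one of the two points, the same formula gives the asymptotics: its first order terms are
the Fourier coefficients, and its remainder has the required decay in n because the correction to
the sine is O(1/n) and the linear part of Q is orthogonal to sin 2πnx up to O(1/n)
(`Mode.norm_integral_sin_linV_le`). -/

open MeasureTheory Set

noncomputable section

namespace ThreePoint

/-! ### Absolutely continuous functions on `[0, 1]` -/

/-- On `[0, 1]` the function `f` is a primitive of the integrable function `f'`. -/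
def Prim (f f' : ℝ → ℂ) : Prop :=
  IntervalIntegrable f' volume 0 1 ∧ ∀ x ∈ Icc (0 : ℝ) 1, f x = f 0 + ∫ t in (0 : ℝ)..x, f' t

lemma _root_.IntervalIntegrable.sub01 {f : ℝ → ℂ} (h : IntervalIntegrable f volume 0 1) {x y : ℝ}
    (hx : x ∈ Icc (0 : ℝ) 1) (hy : y ∈ Icc (0 : ℝ) 1) : IntervalIntegrable f volume x y :=
  h.mono_set (by
    rw [uIcc_of_le (zero_le_one : (0 : ℝ) ≤ 1)]
    exact uIcc_subset_Icc hx hy)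

lemma zero_mem01 : (0 : ℝ) ∈ Icc (0 : ℝ) 1 := ⟨le_rfl, zero_le_one⟩

lemma one_mem01 : (1 : ℝ) ∈ Icc (0 : ℝ) 1 := ⟨zero_le_one, le_rfl⟩

lemma reflect_mem01 {x : ℝ} (hx : x ∈ Icc (0 : ℝ) 1) : 1 - x ∈ Icc (0 : ℝ) 1 :=
  ⟨by linarith [hx.2], by linarith [hx.1]⟩

lemma _root_.ContinuousOn.intervalIntegrable01 {f : ℝ → ℂ} (h : ContinuousOn f (Icc 0 1)) :
    IntervalIntegrable f volume 0 1 :=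
  ContinuousOn.intervalIntegrable (by rwa [uIcc_of_le zero_le_one])

lemma integral_congr01 {f g : ℝ → ℂ} {x y : ℝ} (hx : x ∈ Icc (0 : ℝ) 1) (hy : y ∈ Icc (0 : ℝ) 1)
    (h : ∀ t ∈ Icc (0 : ℝ) 1, f t = g t) : ∫ t in x..y, f t = ∫ t in x..y, g t :=
  intervalIntegral.integral_congr fun t ht => h t (uIcc_subset_Icc hx hy ht)

lemma integral_congr01_ae {f g : ℝ → ℂ} {x y : ℝ} (hx : x ∈ Icc (0 : ℝ) 1)
    (hy : y ∈ Icc (0 : ℝ) 1) (h : ∀ᵐ t ∂(volume.restrict (Ioc (0 : ℝ) 1)), f t = g t) :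
    ∫ t in x..y, f t = ∫ t in x..y, g t := by
  apply intervalIntegral.integral_congr_ae
  rw [ae_restrict_iff' measurableSet_Ioc] at h
  filter_upwards [h] with t ht hm
  exact ht (Ioc_subset_Ioc (le_min hx.1 hy.1) (max_le hx.2 hy.2) hm)

namespace Prim

variable {f f' g g' : ℝ → ℂ}

lemma congr_ae (h : Prim f f') (hfg : ∀ x ∈ Icc (0 : ℝ) 1, g x = f x)
    (hfg' : ∀ᵐ x ∂(volume.restrict (Ioc (0 : ℝ) 1)), f' x = g' x) : Prim g g' := by
  refine ⟨?_, fun x hx => ?_⟩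
  · refine h.1.congr_ae ?_
    rwa [uIoc_of_le zero_le_one]
  · rw [hfg x hx, hfg 0 zero_mem01, h.2 x hx, integral_congr01_ae zero_mem01 hx hfg']

lemma congr (h : Prim f f') (hfg : ∀ x ∈ Icc (0 : ℝ) 1, g x = f x)
    (hfg' : ∀ x ∈ Icc (0 : ℝ) 1, g' x = f' x) : Prim g g' :=
  h.congr_ae hfg (by
    filter_upwards [ae_restrict_mem measurableSet_Ioc] with x hx
    exact (hfg' x (Ioc_subset_Icc_self hx)).symm)

lemma continuousOn (h : Prim f f') : ContinuousOn f (Icc 0 1) := by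
  have h1 : ContinuousOn (fun x => f 0 + ∫ t in (0 : ℝ)..x, f' t) (Icc 0 1) := by
    have := intervalIntegral.continuousOn_primitive_interval (a := 0) (b := 1) (f := f') (μ := volume) (by
      rw [uIcc_of_le zero_le_one, integrableOn_Icc_iff_integrableOn_Ioc]
      exact (intervalIntegrable_iff_integrableOn_Ioc_of_le zero_le_one).1 h.1)
    rw [uIcc_of_le zero_le_one] at this
    exact continuousOn_const.add this
  exact h1.congr h.2

lemma sub_eq (h : Prim f f') {x y : ℝ} (hx : x ∈ Icc (0 : ℝ) 1) (hy : y ∈ Icc (0 : ℝ) 1) :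
    f y - f x = ∫ t in x..y, f' t := by
  rw [h.2 x hx, h.2 y hy, ← intervalIntegral.integral_interval_sub_left (h.1.sub01 zero_mem01 hy)
    (h.1.sub01 zero_mem01 hx)]
  ring

lemma integral (h : Prim f f') : ∫ t in (0 : ℝ)..1, f' t = f 1 - f 0 :=
  (h.sub_eq zero_mem01 one_mem01).symm

lemma of_integral (h : IntervalIntegrable f' volume 0 1) (c : ℂ) :
    Prim (fun x => c + ∫ t in (0 : ℝ)..x, f' t) f' :=
  ⟨h, fun x _ => by simp⟩

lemma of_hasDerivAt (h : ∀ x ∈ Icc (0 : ℝ) 1, HasDerivAt f (f' x) x)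
    (hc : ContinuousOn f' (Icc 0 1)) : Prim f f' := by
  refine ⟨hc.intervalIntegrable01, fun x hx => ?_⟩
  rw [intervalIntegral.integral_eq_sub_of_hasDerivAt (f := f) (fun t ht => h t (uIcc_subset_Icc zero_mem01 hx ht))
    (hc.intervalIntegrable01.sub01 zero_mem01 hx)]
  ring

lemma const (c : ℂ) : Prim (fun _ => c) (fun _ => 0) :=
  of_hasDerivAt (fun x _ => hasDerivAt_const x c) continuousOn_const

lemma add (hf : Prim f f') (hg : Prim g g') :
    Prim (fun x => f x + g x) (fun x => f' x + g' x) := by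
  refine ⟨hf.1.add hg.1, fun x hx => ?_⟩
  beta_reduce
  rw [intervalIntegral.integral_add (hf.1.sub01 zero_mem01 hx) (hg.1.sub01 zero_mem01 hx), hf.2 x hx, hg.2 x hx]
  ring

lemma const_mul (c : ℂ) (hf : Prim f f') : Prim (fun x => c * f x) (fun x => c * f' x) := by
  refine ⟨hf.1.const_mul c, fun x hx => ?_⟩
  beta_reduce
  rw [intervalIntegral.integral_const_mul, hf.2 x hx]
  ring

lemma neg (hf : Prim f f') : Prim (fun x => -f x) (fun x => -f' x) :=
  (hf.const_mul (-1)).congr (fun _ _ => by ring) (fun _ _ => by ring)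

lemma sub (hf : Prim f f') (hg : Prim g g') :
    Prim (fun x => f x - g x) (fun x => f' x - g' x) :=
  (hf.add hg.neg).congr (fun _ _ => by ring) (fun _ _ => by ring)

/-- The increments of `f` are dominated by those of the primitive of the norm of `f'`, which is
known to be absolutely continuous. -/
lemma absolutelyContinuous (h : Prim f f') : AbsolutelyContinuousOnInterval f 0 1 := by
  have hn := h.1.norm.absolutelyContinuousOnInterval_intervalIntegral (c := 0) (by simp)
  rw [absolutelyContinuousOnInterval_iff] at hn ⊢
  intro ε hε
  obtain ⟨δ, hδ, hn⟩ := hn ε hε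
  refine ⟨δ, hδ, fun E hE hlt => lt_of_le_of_lt (Finset.sum_le_sum fun i hi => ?_) (hn E hE hlt)⟩
  have hm := hE.1 i hi
  rw [uIcc_of_le zero_le_one] at hm
  rw [dist_comm, dist_eq_norm, dist_comm, dist_eq_norm, h.sub_eq hm.1 hm.2,
    intervalIntegral.integral_interval_sub_left (h.1.norm.mono_set (by
      rw [uIcc_of_le (zero_le_one : (0 : ℝ) ≤ 1)]; exact uIcc_subset_Icc zero_mem01 hm.2))
      (h.1.norm.mono_set (by
      rw [uIcc_of_le (zero_le_one : (0 : ℝ) ≤ 1)]; exact uIcc_subset_Icc zero_mem01 hm.1))]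
  exact intervalIntegral.norm_integral_le_abs_integral_norm

lemma ae_hasDerivAt (h : Prim f f') : ∀ᵐ x, x ∈ Ioo (0 : ℝ) 1 → HasDerivAt f (f' x) x := by
  filter_upwards [h.1.ae_hasDerivAt_integral] with x hx hm
  have hm' := Ioo_subset_Icc_self hm
  have h1 := (hx (by rwa [uIcc_of_le zero_le_one]) 0 (by simp)).const_add (f 0)
  refine h1.congr_of_eventuallyEq ?_
  filter_upwards [Ioo_mem_nhds hm.1 hm.2] with y hy
  exact h.2 y (Ioo_subset_Icc_self hy)

lemma ae_ne_endpoints : ∀ᵐ x : ℝ, x ≠ 0 ∧ x ≠ 1 := by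
  have h0 : ∀ᵐ x : ℝ, x ≠ 0 := by simp [ae_iff, measure_singleton]
  have h1 : ∀ᵐ x : ℝ, x ≠ 1 := by simp [ae_iff, measure_singleton]
  filter_upwards [h0, h1] with x h h' using ⟨h, h'⟩

/-- The difference between `f` and the primitive of `f'` is absolutely continuous with derivative
zero almost everywhere, hence constant. -/
lemma of_absolutelyContinuous (hf : AbsolutelyContinuousOnInterval f 0 1)
    (hi : IntervalIntegrable f' volume 0 1)
    (hd : ∀ᵐ x, x ∈ Ioo (0 : ℝ) 1 → HasDerivAt f (f' x) x) : Prim f f' := by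
  have hP := of_integral hi 0
  have hac : AbsolutelyContinuousOnInterval (f - fun x => 0 + ∫ t in (0 : ℝ)..x, f' t) 0 1 :=
    hf.sub hP.absolutelyContinuous
  obtain ⟨C, hC⟩ := AbsolutelyContinuousOnInterval.const_of_ae_hasDerivAt_zero (F := ℂ)
    (f := f - fun x => 0 + ∫ t in (0 : ℝ)..x, f' t) hac (by
      filter_upwards [hd, hP.ae_hasDerivAt, ae_ne_endpoints] with x h1 h2 h3 hm
      rw [uIcc_of_le zero_le_one] at hm
      have hm' : x ∈ Ioo (0 : ℝ) 1 :=
        ⟨lt_of_le_of_ne hm.1 h3.1.symm, lt_of_le_of_ne hm.2 h3.2⟩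
      have := (h1 hm').sub (h2 hm')
      rwa [sub_self] at this)
  refine ⟨hi, fun x hx => ?_⟩
  have h1 := hC x (by rwa [uIcc_of_le zero_le_one])
  have h2 := hC 0 (by simp)
  simp only [Pi.sub_apply, intervalIntegral.integral_same, zero_add, sub_zero] at h1 h2
  rw [h2, ← h1]; ring

/-- This is the workhorse of the file: `p'` and `q` are only integrable, so every differential
identity below is a product rule for absolutely continuous functions rather than a classical one. -/
lemma mul (hf : Prim f f') (hg : Prim g g') :
    Prim (fun x => f x * g x) (fun x => f' x * g x + f x * g' x) := by
  apply of_absolutelyContinuous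
  · have := AbsolutelyContinuousOnInterval.smul (M := ℂ) (F := ℂ) hf.absolutelyContinuous
      hg.absolutelyContinuous
    exact this
  · exact (hf.1.mul_continuousOn (by rw [uIcc_of_le zero_le_one]; exact hg.continuousOn)).add
      (hg.1.continuousOn_mul (by rw [uIcc_of_le zero_le_one]; exact hf.continuousOn))
  · filter_upwards [hf.ae_hasDerivAt, hg.ae_hasDerivAt] with x h1 h2 hm
    exact (h1 hm).mul (h2 hm)

lemma eq_of_zero (h : Prim f f') (h0 : ∀ x ∈ Icc (0 : ℝ) 1, f' x = 0) {x : ℝ}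
    (hx : x ∈ Icc (0 : ℝ) 1) : f x = f 0 := by
  rw [h.2 x hx, integral_congr01 zero_mem01 hx h0]; simp

lemma reflect (h : Prim f f') : Prim (fun x => f (1 - x)) (fun x => -f' (1 - x)) := by
  have hi : IntervalIntegrable (fun x => f' (1 - x)) volume 0 1 := by
    simpa using (h.1.comp_sub_left 1).symm
  refine ⟨hi.neg, fun x hx => ?_⟩
  have h1 := h.sub_eq one_mem01 (reflect_mem01 hx)
  rw [intervalIntegral.integral_neg, intervalIntegral.integral_comp_sub_left (fun t => f' t) 1,
    sub_zero, ← intervalIntegral.integral_symm, ← h1]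
  ring_nf

lemma conj (h : Prim f f') :
    Prim (fun x => (starRingEnd ℂ) (f x)) (fun x => (starRingEnd ℂ) (f' x)) := by
  refine ⟨?_, fun x hx => ?_⟩
  · exact ⟨Complex.conjCLE.toContinuousLinearMap.integrable_comp h.1.1,
      Complex.conjCLE.toContinuousLinearMap.integrable_comp h.1.2⟩
  · beta_reduce
    rw [h.2 x hx, map_add, intervalIntegral.intervalIntegral_conj]

end Prim

/-! ### The algebra of continuous functions on `[0, 1]` -/

/-- Continuous functions on `[0, 1]`. -/
abbrev Cont : Type := C(unitInterval, ℂ)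

/-- The extension of a continuous function on `[0, 1]` to the line. -/
def ext (a : Cont) : ℝ → ℂ := IccExtend zero_le_one a

@[fun_prop]
lemma continuous_ext (a : Cont) : Continuous (ext a) := a.continuous.Icc_extend'

lemma ext_apply (a : Cont) {x : ℝ} (hx : x ∈ Icc (0 : ℝ) 1) : ext a x = a ⟨x, hx⟩ :=
  IccExtend_of_mem _ _ hx

@[simp] lemma ext_add (a b : Cont) (x : ℝ) : ext (a + b) x = ext a x + ext b x := rfl
@[simp] lemma ext_sub (a b : Cont) (x : ℝ) : ext (a - b) x = ext a x - ext b x := rfl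
@[simp] lemma ext_neg (a : Cont) (x : ℝ) : ext (-a) x = -ext a x := rfl
@[simp] lemma ext_mul (a b : Cont) (x : ℝ) : ext (a * b) x = ext a x * ext b x := rfl
@[simp] lemma ext_smul (c : ℂ) (a : Cont) (x : ℝ) : ext (c • a) x = c * ext a x := rfl
@[simp] lemma ext_one (x : ℝ) : ext 1 x = 1 := rfl
@[simp] lemma ext_zero (x : ℝ) : ext 0 x = 0 := rfl

lemma norm_ext_le (a : Cont) (x : ℝ) : ‖ext a x‖ ≤ ‖a‖ := a.norm_coe_le_norm _

lemma cont_ext {a b : Cont} (h : ∀ x ∈ Icc (0 : ℝ) 1, ext a x = ext b x) : a = b := by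
  ext ⟨x, hx⟩
  have := h x hx
  rwa [ext_apply, ext_apply] at this

lemma norm_cont_le {a : Cont} {C : ℝ} (hC : 0 ≤ C) (h : ∀ x ∈ Icc (0 : ℝ) 1, ‖ext a x‖ ≤ C) :
    ‖a‖ ≤ C := by
  rw [ContinuousMap.norm_le _ hC]
  rintro ⟨x, hx⟩
  have := h x hx
  rwa [ext_apply a hx] at this

/-- The restriction of a function to `[0, 1]`. -/
def toCont (f : ℝ → ℂ) (hf : ContinuousOn f (Icc 0 1)) : Cont := ⟨fun x => f x, by
  exact continuousOn_iff_continuous_domRestrict.1 hf⟩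

lemma ext_toCont {f : ℝ → ℂ} (hf : ContinuousOn f (Icc 0 1)) {x : ℝ} (hx : x ∈ Icc (0 : ℝ) 1) :
    ext (toCont f hf) x = f x := by
  rw [ext_apply _ hx]; rfl

lemma intervalIntegrable_ext (a : Cont) (x y : ℝ) : IntervalIntegrable (ext a) volume x y :=
  (continuous_ext a).intervalIntegrable x y

lemma norm_integral_ext_le (a : Cont) {x : ℝ} (hx : x ∈ Icc (0 : ℝ) 1) :
    ‖∫ t in (0 : ℝ)..x, ext a t‖ ≤ ‖a‖ := by
  refine (intervalIntegral.norm_integral_le_of_norm_le_const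
    (fun t _ => norm_ext_le a t)).trans ?_
  rw [sub_zero, abs_of_nonneg hx.1]
  exact mul_le_of_le_one_right (norm_nonneg _) hx.2

/-- The operator `a ↦ ∫₀ˣ a`. -/
def volterra : Cont →L[ℂ] Cont :=
  LinearMap.mkContinuous
    { toFun := fun a => toCont (fun x => ∫ t in (0 : ℝ)..x, ext a t)
        (intervalIntegral.continuous_primitive (fun x y => intervalIntegrable_ext a x y)
          0).continuousOn
      map_add' := fun a b => by
        apply cont_ext
        intro x hx
        rw [ext_add, ext_toCont _ hx, ext_toCont _ hx, ext_toCont _ hx,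
          ← intervalIntegral.integral_add (intervalIntegrable_ext a 0 x)
            (intervalIntegrable_ext b 0 x)]
        rfl
      map_smul' := fun c a => by
        apply cont_ext
        intro x hx
        rw [RingHom.id_apply, ext_smul, ext_toCont _ hx, ext_toCont _ hx,
          ← intervalIntegral.integral_const_mul]
        rfl } 1 (fun a => by
    rw [one_mul]
    refine norm_cont_le (norm_nonneg a) fun x hx => ?_
    exact (congrArg norm (ext_toCont _ hx)).le.trans (norm_integral_ext_le a hx))

lemma ext_volterra (a : Cont) {x : ℝ} (hx : x ∈ Icc (0 : ℝ) 1) :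
    ext (volterra a) x = ∫ t in (0 : ℝ)..x, ext a t :=
  ext_toCont _ hx

lemma norm_volterra_le (a : Cont) : ‖volterra a‖ ≤ ‖a‖ := by
  refine norm_cont_le (norm_nonneg a) fun x hx => ?_
  rw [ext_volterra a hx]
  exact norm_integral_ext_le a hx

lemma prim_volterra (a : Cont) : Prim (ext (volterra a)) (ext a) :=
  (Prim.of_integral (intervalIntegrable_ext a 0 1) 0).congr
    (fun x hx => by rw [ext_volterra a hx]; ring) (fun _ _ => rfl)

/-- The functional `a ↦ ∫₀¹ a`. -/
def total : Cont →L[ℂ] ℂ := (ContinuousMap.evalCLM ℂ (1 : unitInterval)).comp volterra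

lemma total_apply (a : Cont) : total a = ∫ t in (0 : ℝ)..1, ext a t := by
  rw [← ext_volterra a one_mem01, ext_apply _ one_mem01]; rfl

lemma norm_total_le (a : Cont) : ‖total a‖ ≤ ‖a‖ := by
  rw [total_apply]; exact norm_integral_ext_le a one_mem01

/-! ### The periodic first order equation b' = ρb + a. -/

/-- The function `exp (ρ x)`. -/
def expC (ρ : ℂ) : Cont := toCont (fun x => Complex.exp (ρ * x)) (by fun_prop)

lemma ext_expC (ρ : ℂ) {x : ℝ} (hx : x ∈ Icc (0 : ℝ) 1) : ext (expC ρ) x = Complex.exp (ρ * x) :=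
  ext_toCont _ hx

lemma hasDerivAt_cexp (ρ : ℂ) (x : ℝ) :
    HasDerivAt (fun x : ℝ => Complex.exp (ρ * x)) (ρ * Complex.exp (ρ * x)) x := by
  have h : HasDerivAt (fun x : ℝ => ρ * (x : ℂ)) ρ x := by
    simpa using (Complex.ofRealCLM.hasDerivAt (x := x)).const_mul ρ
  simpa [mul_comm] using h.cexp

lemma prim_exp (ρ : ℂ) : Prim (fun x => Complex.exp (ρ * x)) (fun x => ρ * Complex.exp (ρ * x)) :=
  Prim.of_hasDerivAt (fun x _ => hasDerivAt_cexp ρ x) (by fun_prop)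

/-- The periodic inverse of `D - ρ` on `[0, 1]`. -/
def perInv (ρ : ℂ) : Cont →L[ℂ] Cont :=
  -- Variation of constants gives b(x) = e^{ρx}(c + ∫₀ˣ e^{−ρt} a dt), and b(0) = b(1) forces c =
  -- e^ρ(1 − e^ρ)⁻¹ ∫₀¹ e^{−ρt} a dt.
  (1 - Complex.exp ρ)⁻¹ • (ContinuousLinearMap.mul ℂ Cont (expC ρ)).comp
    ((1 - Complex.exp ρ) • volterra.comp (ContinuousLinearMap.mul ℂ Cont (expC (-ρ))) +
      Complex.exp ρ • (ContinuousLinearMap.toSpanSingleton ℂ (1 : Cont)).comp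
        (total.comp (ContinuousLinearMap.mul ℂ Cont (expC (-ρ)))))

lemma ext_perInv (ρ : ℂ) (a : Cont) {x : ℝ} (hx : x ∈ Icc (0 : ℝ) 1) :
    ext (perInv ρ a) x = (1 - Complex.exp ρ)⁻¹ * (Complex.exp (ρ * x) *
      ((1 - Complex.exp ρ) * ext (volterra (expC (-ρ) * a)) x
        + Complex.exp ρ * total (expC (-ρ) * a))) := by
  rw [← ext_expC ρ hx]
  change (1 - Complex.exp ρ)⁻¹ * (ext (expC ρ) x *
      ((1 - Complex.exp ρ) * ext (volterra (expC (-ρ) * a)) x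
        + Complex.exp ρ * (total (expC (-ρ) * a) * 1))) = _
  rw [mul_one]

lemma exp_ne_one {ρ : ℂ} (hρ : ρ.re ≠ 0) : 1 - Complex.exp ρ ≠ 0 := by
  intro h
  have h1 : ‖Complex.exp ρ‖ = 1 := by rw [← sub_eq_zero.1 h]; simp
  rw [Complex.norm_exp, Real.exp_eq_one_iff] at h1
  exact hρ h1

lemma prim_perInv {ρ : ℂ} (hρ : ρ.re ≠ 0) (a : Cont) :
    Prim (ext (perInv ρ a)) (fun x => ρ * ext (perInv ρ a) x + ext a x) := by
  have h0 := exp_ne_one hρ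
  have h1 := (((((prim_volterra (expC (-ρ) * a)).const_mul (1 - Complex.exp ρ)).add
    (Prim.const (Complex.exp ρ * total (expC (-ρ) * a)))).mul (prim_exp ρ)).const_mul
      (1 - Complex.exp ρ)⁻¹)
  refine h1.congr (fun x hx => ?_) (fun x hx => ?_)
  · rw [ext_perInv ρ a hx]; ring
  · rw [ext_perInv ρ a hx, ext_mul, ext_expC _ hx]
    have h2 : Complex.exp (-ρ * x) * Complex.exp (ρ * x) = 1 := by
      rw [← Complex.exp_add]; simp
    have h4 : (1 - Complex.exp ρ)⁻¹ * (1 - Complex.exp ρ) = 1 := inv_mul_cancel₀ h0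
    linear_combination -(ext a x) * h4 -
      (1 - Complex.exp ρ)⁻¹ * (1 - Complex.exp ρ) * ext a x * h2

lemma perInv_periodic {ρ : ℂ} (hρ : ρ.re ≠ 0) (a : Cont) :
    ext (perInv ρ a) 0 = ext (perInv ρ a) 1 := by
  have h0 := exp_ne_one hρ
  rw [ext_perInv ρ a zero_mem01, ext_perInv ρ a one_mem01, ext_volterra _ zero_mem01,
    ext_volterra _ one_mem01, ← total_apply]
  simp only [intervalIntegral.integral_same, Complex.ofReal_zero, Complex.ofReal_one, mul_zero,
    mul_one, Complex.exp_zero]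
  ring

/-- The equation `b' = ρ b + a` has one periodic solution. -/
lemma eq_perInv {ρ : ℂ} (hρ : ρ.re ≠ 0) {a : Cont} {b : ℝ → ℂ} {F : ℝ → ℂ}
    (hb : Prim b (fun x => ρ * b x + F x)) (hF : ∀ x ∈ Icc (0 : ℝ) 1, F x = ext a x)
    (hper : b 0 = b 1) {x : ℝ} (hx : x ∈ Icc (0 : ℝ) 1) : b x = ext (perInv ρ a) x := by
  -- The difference of two solutions times e^{−ρx} is constant, and periodicity makes (1 − e^{−ρ})
  -- times this constant vanish.
  have h1 := (hb.sub (prim_perInv hρ a)).mul (prim_exp (-ρ))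
  have h2 : ∀ x ∈ Icc (0 : ℝ) 1, (b x - ext (perInv ρ a) x) * Complex.exp (-ρ * x) =
      b 0 - ext (perInv ρ a) 0 := fun x hx => by
    have := h1.eq_of_zero (fun t ht => by rw [hF t ht]; ring) hx
    simpa using this
  have h3 := h2 1 one_mem01
  rw [← hper, ← perInv_periodic hρ a] at h3
  have h4 : (b 0 - ext (perInv ρ a) 0) * (1 - Complex.exp (-ρ)) = 0 := by
    simp only [Complex.ofReal_one, mul_one] at h3
    linear_combination -h3
  have h5 : b 0 - ext (perInv ρ a) 0 = 0 := by
    rcases mul_eq_zero.1 h4 with h | h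
    · exact h
    · exact absurd h (exp_ne_one (by simpa using hρ))
  have h6 := h2 x hx
  rw [h5] at h6
  rcases mul_eq_zero.1 h6 with h | h
  · exact sub_eq_zero.1 h
  · exact absurd h (Complex.exp_ne_zero _)

lemma integral_exp_shift {σ : ℝ} (hσ : σ ≠ 0) (c x y : ℝ) :
    ∫ t in x..y, Real.exp (σ * (c - t)) = (Real.exp (σ * (c - x)) - Real.exp (σ * (c - y))) / σ := by
  have : ∀ t ∈ uIcc x y, HasDerivAt (fun t => -(Real.exp (σ * (c - t)) / σ))
      (Real.exp (σ * (c - t))) t := by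
    intro t _
    have h := ((((hasDerivAt_id t).const_sub c).const_mul σ).exp.div_const σ).neg
    refine h.congr_deriv ?_
    simp only [id]
    field_simp
  rw [intervalIntegral.integral_eq_sub_of_hasDerivAt this
    (by apply Continuous.intervalIntegrable; fun_prop)]
  ring

/-- Splitting the integral over the whole interval at x turns the kernel into (1 − e^ρ)⁻¹e^{ρs},
where s is the distance from t to x measured forward on the circle. With σ = Re ρ the modulus of the
exponential integrates to (e^σ − 1)/σ, and |1 − e^ρ| ≥ |1 − e^σ| cancels the numerator, whatever the
sign of σ. -/
lemma norm_perInv_le {ρ : ℂ} (hρ : ρ.re ≠ 0) (a : Cont) : ‖perInv ρ a‖ ≤ ‖a‖ / |ρ.re| := by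
  have h0 := exp_ne_one hρ
  refine norm_cont_le (by positivity) fun x hx => ?_
  have hint : ∀ x ∈ Icc (0 : ℝ) 1, ∀ y ∈ Icc (0 : ℝ) 1, ∀ c : ℝ,
      Complex.exp (ρ * c) * ∫ t in x..y, ext (expC (-ρ) * a) t =
        ∫ t in x..y, Complex.exp (ρ * (c - t)) * ext a t := by
    intro x hx y hy c
    rw [← intervalIntegral.integral_const_mul]
    refine integral_congr01 hx hy fun t ht => ?_
    rw [ext_mul, ext_expC _ ht, ← mul_assoc, ← Complex.exp_add]
    congr 2; ring
  have hbd : ∀ x y c : ℝ, x ≤ y → ‖∫ t in x..y, Complex.exp (ρ * (c - t)) * ext a t‖ ≤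
      (Real.exp (ρ.re * (c - x)) - Real.exp (ρ.re * (c - y))) / ρ.re * ‖a‖ := by
    intro x y c hxy
    rw [← integral_exp_shift hρ, ← intervalIntegral.integral_mul_const]
    apply intervalIntegral.norm_integral_le_of_norm_le hxy
    · refine Filter.Eventually.of_forall fun t _ => ?_
      rw [norm_mul, Complex.norm_exp]
      have : (ρ * (c - t)).re = ρ.re * (c - t) := by
        rw [← Complex.ofReal_sub, Complex.re_mul_ofReal]
      rw [this]
      exact mul_le_mul_of_nonneg_left (norm_ext_le a t) (Real.exp_pos _).le
    · apply Continuous.intervalIntegrable; fun_prop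
  have hrep : ext (perInv ρ a) x = (1 - Complex.exp ρ)⁻¹ *
      ((∫ t in (0 : ℝ)..x, Complex.exp (ρ * (x - t)) * ext a t) +
        ∫ t in x..1, Complex.exp (ρ * (((x + 1 : ℝ) : ℂ) - t)) * ext a t) := by
    rw [← hint 0 zero_mem01 x hx, ← hint x hx 1 one_mem01, ext_perInv ρ a hx,
      ext_volterra _ hx, total_apply,
      ← intervalIntegral.integral_add_adjacent_intervals (intervalIntegrable_ext _ 0 x)
        (intervalIntegrable_ext _ x 1)]
    have : Complex.exp (ρ * ((x + 1 : ℝ) : ℂ)) = Complex.exp (ρ * x) * Complex.exp ρ := by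
      rw [← Complex.exp_add]; congr 1; push_cast; ring
    rw [this]; ring
  have hden : |1 - Real.exp ρ.re| ≤ ‖1 - Complex.exp ρ‖ := by
    have := abs_norm_sub_norm_le (1 : ℂ) (Complex.exp ρ)
    rwa [norm_one, Complex.norm_exp] at this
  have hden0 : 0 < |1 - Real.exp ρ.re| := by
    rw [abs_pos, sub_ne_zero]
    intro h
    exact hρ (Real.exp_eq_one_iff _ |>.1 h.symm)
  rw [hrep, norm_mul, norm_inv]
  have hsum := norm_add_le (∫ t in (0 : ℝ)..x, Complex.exp (ρ * (x - t)) * ext a t)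
    (∫ t in x..1, Complex.exp (ρ * (((x + 1 : ℝ) : ℂ) - t)) * ext a t)
  have h1 := hbd 0 x x hx.1
  have h2 := hbd x 1 (x + 1) hx.2
  have e1 : (Real.exp (ρ.re * (x - 0)) - Real.exp (ρ.re * (x - x))) / ρ.re * ‖a‖ +
      (Real.exp (ρ.re * (x + 1 - x)) - Real.exp (ρ.re * (x + 1 - 1))) / ρ.re * ‖a‖ =
      (Real.exp ρ.re - 1) / ρ.re * ‖a‖ := by
    simp only [sub_zero, sub_self, mul_zero, Real.exp_zero, add_sub_cancel_left, mul_one,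
      add_sub_cancel_right]
    ring
  have e2 : (Real.exp ρ.re - 1) / ρ.re ≤ |1 - Real.exp ρ.re| / |ρ.re| := by
    rw [← abs_div]
    refine le_trans (le_abs_self _) (le_of_eq ?_)
    rw [abs_div, abs_div, abs_sub_comm]
  have h3 : ‖(∫ t in (0 : ℝ)..x, Complex.exp (ρ * (x - t)) * ext a t) +
        ∫ t in x..1, Complex.exp (ρ * (((x + 1 : ℝ) : ℂ) - t)) * ext a t‖ ≤
      |1 - Real.exp ρ.re| / |ρ.re| * ‖a‖ := by
    refine (hsum.trans (add_le_add h1 h2)).trans ?_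
    rw [e1]
    exact mul_le_mul_of_nonneg_right e2 (norm_nonneg _)
  calc _ ≤ |1 - Real.exp ρ.re|⁻¹ * (|1 - Real.exp ρ.re| / |ρ.re| * ‖a‖) := by gcongr
    _ = ‖a‖ / |ρ.re| := by field_simp

/-! ### Contractions depending analytically on a parameter -/

open scoped ContDiff Topology in
/-- The fixed point of a contraction of a ball that depends analytically on a parameter depends
analytically on the parameter. -/
theorem exists_analytic_fixedPoint {E X : Type*} [NormedAddCommGroup E] [NormedSpace ℂ E]
    [CompleteSpace E] [NormedAddCommGroup X] [NormedSpace ℂ X] [CompleteSpace X]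
    {T : E × X → X} (hT : ContDiff ℂ ω T) {δ : ℝ} (hδ : 0 < δ) {U : Set E} (hU : IsOpen U)
    (hlip : ∀ e ∈ U, ∀ x y : X, ‖x‖ ≤ δ → ‖y‖ ≤ δ → ‖T (e, x) - T (e, y)‖ ≤ 1 / 2 * ‖x - y‖)
    (h0 : ∀ e ∈ U, ‖T (e, 0)‖ ≤ δ / 4) :
    ∃ sol : E → X, ∀ e ∈ U, ‖sol e‖ ≤ 2 * ‖T (e, 0)‖ ∧ T (e, sol e) = sol e ∧
      (∀ x, ‖x‖ ≤ δ → T (e, x) = x → x = sol e) ∧ AnalyticAt ℂ sol e := by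
  have hball : ∀ e ∈ U, ∀ x, ‖x‖ ≤ δ → ‖T (e, x)‖ ≤ δ := fun e he x hx => by
    have h1 := hlip e he x 0 hx (by simpa using hδ.le)
    rw [sub_zero] at h1
    have h2 := norm_le_norm_add_norm_sub' (T (e, x)) (T (e, 0))
    have h3 := h0 e he
    linarith
  have hex : ∀ e ∈ U, ∃ x, ‖x‖ ≤ δ ∧ T (e, x) = x := fun e he => by
    have hs : IsComplete (Metric.closedBall (0 : X) δ) := Metric.isClosed_closedBall.isComplete
    have hmaps : MapsTo (fun x => T (e, x)) (Metric.closedBall (0 : X) δ)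
        (Metric.closedBall (0 : X) δ) := fun x hx => by
      rw [mem_closedBall_zero_iff] at hx ⊢
      exact hball e he x hx
    have hc : ContractingWith (1 / 2 : NNReal) (hmaps.restrict (fun x => T (e, x)) _ _) := by
      refine ⟨by rw [← NNReal.coe_lt_coe]; norm_num, LipschitzWith.of_dist_le_mul ?_⟩
      rintro ⟨x, hx⟩ ⟨y, hy⟩
      rw [mem_closedBall_zero_iff] at hx hy
      have := hlip e he x y hx hy
      simpa [Subtype.dist_eq, dist_eq_norm] using this
    obtain ⟨x, hx, hfix, -⟩ := hc.exists_fixedPoint' hs hmaps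
      (Metric.mem_closedBall_self hδ.le) (edist_ne_top _ _)
    exact ⟨x, mem_closedBall_zero_iff.1 hx, hfix⟩
  classical
  let sol : E → X := fun e => if h : e ∈ U then (hex e h).choose else 0
  have hsol : ∀ e ∈ U, ‖sol e‖ ≤ δ ∧ T (e, sol e) = sol e := fun e he => by
    simp only [sol, dif_pos he]
    exact (hex e he).choose_spec
  have huniq : ∀ e ∈ U, ∀ x, ‖x‖ ≤ δ → T (e, x) = x → x = sol e := fun e he x hx hfx => by
    have h1 := hlip e he x (sol e) hx (hsol e he).1
    rw [hfx, (hsol e he).2] at h1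
    have h2 : ‖x - sol e‖ ≤ 0 := by linarith [norm_nonneg (x - sol e)]
    exact sub_eq_zero.1 (norm_le_zero_iff.1 h2)
  have hbound : ∀ e ∈ U, ‖sol e‖ ≤ 2 * ‖T (e, 0)‖ := fun e he => by
    have h1 := hlip e he (sol e) 0 (hsol e he).1 (by simpa using hδ.le)
    rw [(hsol e he).2, sub_zero] at h1
    have h2 := norm_le_norm_add_norm_sub' (sol e) (T (e, 0))
    linarith
  refine ⟨sol, fun e he => ⟨hbound e he, (hsol e he).2, huniq e he, ?_⟩⟩
  -- The bound 2‖T(e, 0)‖ ≤ δ/2 puts the fixed point strictly inside the ball. Hence the Lipschitz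
  -- estimate bounds the partial derivative of `T` there by 1/2, the implicit function theorem
  -- applies to x − T(e, x), and the implicit function stays in the ball, where uniqueness
  -- identifies it with `sol`.
  have hlt : ‖sol e‖ < δ := by linarith [hbound e he, h0 e he]
  let F : E × X → X := fun u => u.2 - T u
  have hF : ContDiffAt ℂ ω F (e, sol e) := (contDiff_snd.sub hT).contDiffAt
  have hTd : HasFDerivAt T (fderiv ℂ T (e, sol e)) (e, sol e) :=
    (hT.differentiable (by simp)).differentiableAt.hasFDerivAt
  have hFd : fderiv ℂ F (e, sol e) =
      ContinuousLinearMap.snd ℂ E X - fderiv ℂ T (e, sol e) :=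
    (hasFDerivAt_snd.sub hTd).fderiv
  have hpart : HasFDerivAt (fun x => T (e, x))
      (fderiv ℂ T (e, sol e) ∘L .inr ℂ E X) (sol e) :=
    hTd.comp (sol e) (hasFDerivAt_prodMk_right e (sol e))
  have hnorm : ‖fderiv ℂ T (e, sol e) ∘L .inr ℂ E X‖ ≤ 1 / 2 := by
    refine hpart.le_of_lip' (by norm_num) ?_
    have : ∀ᶠ x in 𝓝 (sol e), ‖x‖ < δ := continuous_norm.continuousAt.eventually_lt_const hlt
    filter_upwards [this] with x hx
    exact hlip e he x (sol e) hx.le hlt.le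
  have hinv : (fderiv ℂ F (e, sol e) ∘L .inr ℂ E X).IsInvertible := by
    let D := fderiv ℂ T (e, sol e) ∘L .inr ℂ E X
    have hD : fderiv ℂ F (e, sol e) ∘L .inr ℂ E X = 1 - D := by
      rw [hFd]; ext x; simp [D]
    have hD1 : ‖D‖ < 1 := by linarith
    rw [hD]
    exact ⟨ContinuousLinearEquiv.unitsEquiv ℂ X (Units.oneSub D hD1), by ext; rfl⟩
  have hF0 : F (e, sol e) = 0 := by simp [F, (hsol e he).2]
  have hg := hF.contDiffAt_implicitFunction (by simp) hinv
  have hgc := hg.continuousAt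
  have hg0 := hF.implicitFunction_apply_self (by simp) hinv
  have hev := hF.eventually_apply_implicitFunction (by simp) hinv
  refine (hg.analyticAt).congr ?_
  have hlt' : ∀ᶠ e' in 𝓝 e, ‖hF.implicitFunction (by simp) hinv e'‖ < δ := by
    refine (hgc.norm).eventually_lt_const ?_
    change ‖hF.implicitFunction _ hinv e‖ < δ
    exact (congrArg norm hg0).trans_lt hlt
  filter_upwards [hlt', hev, hU.mem_nhds he] with e' h1 h2 h3
  refine huniq e' h3 _ h1.le ?_
  rw [hF0] at h2
  exact (sub_eq_zero.1 h2).symm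

/-! ### Periodic solutions of second order equations -/

/-- The periodic solution of `(D - ρ₁) (D - ρ₂) u = F + G'`. -/
def perSol (ρ₁ ρ₂ : ℂ) (F G : Cont) : Cont := perInv ρ₁ (perInv ρ₂ (F + ρ₂ • G) + G)

/-- The derivative of the periodic solution of `(D - ρ₁) (D - ρ₂) u = F + G'`. -/
def perSol' (ρ₁ ρ₂ : ℂ) (F G : Cont) : Cont :=
  perInv ρ₂ (F + ρ₂ • G) + G + ρ₁ • perSol ρ₁ ρ₂ F G

section PerSol

variable {ρ₁ ρ₂ : ℂ} (h₁ : ρ₁.re ≠ 0) (h₂ : ρ₂.re ≠ 0) (F : Cont) {G : Cont} {g : ℝ → ℂ}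

include h₁ in
lemma prim_perSol (G : Cont) : Prim (ext (perSol ρ₁ ρ₂ F G)) (ext (perSol' ρ₁ ρ₂ F G)) :=
  (prim_perInv h₁ _).congr (fun _ _ => rfl) (fun x _ => by
    simp only [perSol', perSol, ext_add, ext_smul]; ring)

-- If (D − ρ₂)w = F + ρ₂G, then (D − ρ₂)(w + G) = F + G'. This is why `perSol` contains no
-- derivative of `G`: an integrable source term G' is controlled by the sup norm of `G` alone.
include h₁ h₂ in
lemma prim_perSol' (hG : Prim (ext G) g) : Prim (ext (perSol' ρ₁ ρ₂ F G))
    (fun x => (ρ₁ + ρ₂) * ext (perSol' ρ₁ ρ₂ F G) x - ρ₁ * ρ₂ * ext (perSol ρ₁ ρ₂ F G) x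
      + ext F x + g x) :=
  (((prim_perInv h₂ (F + ρ₂ • G)).add hG).add ((prim_perSol (ρ₂ := ρ₂) h₁ F G).const_mul ρ₁)).congr
    (fun x _ => by simp only [perSol', ext_add, ext_smul])
    (fun x _ => by simp only [perSol', ext_add, ext_smul]; ring)

include h₁ in
lemma perSol_periodic (G : Cont) : ext (perSol ρ₁ ρ₂ F G) 0 = ext (perSol ρ₁ ρ₂ F G) 1 :=
  perInv_periodic h₁ _

include h₁ h₂ in
lemma perSol'_periodic (hper : ext G 0 = ext G 1) :
    ext (perSol' ρ₁ ρ₂ F G) 0 = ext (perSol' ρ₁ ρ₂ F G) 1 := by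
  simp only [perSol', ext_add, ext_smul]
  rw [perInv_periodic h₂, hper, perSol_periodic h₁]

include h₁ h₂ in
lemma eq_perSol (hG : Prim (ext G) g) (hper : ext G 0 = ext G 1) {u u1 f : ℝ → ℂ}
    (hu : Prim u u1) (hf : ∀ x ∈ Icc (0 : ℝ) 1, f x = ext F x)
    (hu1 : Prim u1 (fun x => (ρ₁ + ρ₂) * u1 x - ρ₁ * ρ₂ * u x + f x + g x))
    (h0 : u 0 = u 1) (h1 : u1 0 = u1 1) {x : ℝ} (hx : x ∈ Icc (0 : ℝ) 1) :
    u x = ext (perSol ρ₁ ρ₂ F G) x ∧ u1 x = ext (perSol' ρ₁ ρ₂ F G) x := by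
  have hb : ∀ x ∈ Icc (0 : ℝ) 1, u1 x - ρ₁ * u x - ext G x =
      ext (perInv ρ₂ (F + ρ₂ • G)) x := fun x hx => by
    refine eq_perInv (b := fun x => u1 x - ρ₁ * u x - ext G x) (F := fun x => f x + ρ₂ * ext G x)
      h₂ ?_ (fun x hx => ?_) ?_ hx
    · exact ((hu1.sub (hu.const_mul ρ₁)).sub hG).congr (fun _ _ => rfl) (fun x _ => by ring)
    · rw [hf x hx]; rfl
    · simp only [h0, h1, hper]
  have hu2 : ∀ x ∈ Icc (0 : ℝ) 1, u x = ext (perSol ρ₁ ρ₂ F G) x := fun x hx => by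
    refine eq_perInv (F := fun x => u1 x - ρ₁ * u x) h₁ ?_ (fun x hx => ?_) h0 hx
    · exact hu.congr (fun _ _ => rfl) (fun x _ => by ring)
    · rw [ext_add, ← hb x hx]; ring
  refine ⟨hu2 x hx, ?_⟩
  rw [perSol', ext_add, ext_add, ext_smul, ← hb x hx, ← hu2 x hx]
  ring

end PerSol

/-! ### The sector of cube roots and the roots of the linearized Riccati operator. -/

/-- A root of `ρ² - 3zρ + 3z²`. -/
def rho (z : ℂ) : ℂ := z * (3 + Complex.I * (Real.sqrt 3 : ℝ)) / 2

/-- The other root of `ρ² - 3zρ + 3z²`. -/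
def rho' (z : ℂ) : ℂ := z * (3 - Complex.I * (Real.sqrt 3 : ℝ)) / 2

lemma rho_add (z : ℂ) : rho z + rho' z = 3 * z := by simp only [rho, rho']; ring

lemma sqrt3_sq : ((Real.sqrt 3 : ℝ) : ℂ) ^ 2 = 3 := by
  rw [← Complex.ofReal_pow, Real.sq_sqrt (by norm_num)]; norm_num

lemma rho_mul (z : ℂ) : rho z * rho' z = 3 * z ^ 2 := by
  simp only [rho, rho']
  linear_combination (-z ^ 2 / 4 * Complex.I ^ 2) * sqrt3_sq - (3 / 4 * z ^ 2) * Complex.I_sq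

/-- The part `|arg z| ≤ π / 6`, `|z| ≥ 1 / 3` of the plane. -/
structure Sector (z : ℂ) : Prop where
  le_re : Real.sqrt 3 * |z.im| ≤ z.re
  le_norm : 1 / 3 ≤ ‖z‖

lemma sqrt3_bounds : (1.73 : ℝ) < Real.sqrt 3 ∧ Real.sqrt 3 < 1.74 := by
  constructor
  · rw [Real.lt_sqrt (by norm_num)]; norm_num
  · rw [Real.sqrt_lt' (by norm_num)]; norm_num

namespace Sector

variable {z : ℂ} (hz : Sector z)
include hz

lemma norm_pos : 0 < ‖z‖ := by linarith [hz.le_norm]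

lemma ne_zero : z ≠ 0 := norm_pos_iff.1 hz.norm_pos

/-- The sharp constant is 2/√3, attained at |arg z| = π/6. -/
lemma norm_le : ‖z‖ ≤ 6 / 5 * z.re := by
  have h3 := sqrt3_bounds
  have h0 : 0 ≤ z.re := le_trans (by positivity) hz.le_re
  have h1 : 1.73 * |z.im| ≤ z.re := by
    nlinarith [hz.le_re, abs_nonneg z.im]
  have h2 : ‖z‖ ^ 2 ≤ (6 / 5 * z.re) ^ 2 := by
    rw [← Complex.normSq_eq_norm_sq, Complex.normSq_apply, ← abs_mul_abs_self z.im]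
    nlinarith [abs_nonneg z.im]
  exact abs_le_of_sq_le_sq' h2 (by positivity) |>.2

lemma re_pos : 0 < z.re := by linarith [hz.norm_le, hz.norm_pos]

/-- The real parts are (3 Re z ∓ √3 Im z)/2. In the sector both are at least Re z, so each first
order factor is inverted with norm O(1/|z|). -/
lemma re_le_rho : z.re ≤ (rho z).re ∧ z.re ≤ (rho' z).re := by
  have h1 := hz.le_re
  have h2 := abs_le.1 (le_refl (|z.im|))
  have h3 := sqrt3_bounds
  constructor
  · have : (rho z).re = (3 * z.re - Real.sqrt 3 * z.im) / 2 := by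
      simp [rho]; ring
    rw [this]; nlinarith [le_abs_self z.im]
  · have : (rho' z).re = (3 * z.re + Real.sqrt 3 * z.im) / 2 := by
      simp [rho']; ring
    rw [this]; nlinarith [neg_abs_le z.im]

lemma rho_ne : (rho z).re ≠ 0 ∧ (rho' z).re ≠ 0 :=
  ⟨(hz.re_pos.trans_le hz.re_le_rho.1).ne', (hz.re_pos.trans_le hz.re_le_rho.2).ne'⟩

omit hz in
lemma norm_rho : ‖rho z‖ ≤ 2 * ‖z‖ ∧ ‖rho' z‖ ≤ 2 * ‖z‖ := by
  have h : ∀ y : ℝ, y ^ 2 = 3 → ‖(3 + Complex.I * y : ℂ)‖ ≤ 4 := fun y hy => by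
    refine abs_le_of_sq_le_sq' ?_ (by norm_num) |>.2
    rw [← Complex.normSq_eq_norm_sq, Complex.normSq_apply]
    simp; nlinarith
  have hs : Real.sqrt 3 ^ 2 = 3 := Real.sq_sqrt (by norm_num)
  constructor
  · rw [rho, norm_div, norm_mul]
    have := mul_le_mul_of_nonneg_left (h _ hs) (norm_nonneg z)
    norm_num; linarith
  · have h2 := h (-Real.sqrt 3) (by rw [neg_sq]; exact hs)
    have e : (3 + Complex.I * ((-Real.sqrt 3 : ℝ) : ℂ) : ℂ) = 3 - Complex.I * (Real.sqrt 3 : ℝ) := by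
      push_cast; ring
    rw [e] at h2
    rw [rho', norm_div, norm_mul]
    have := mul_le_mul_of_nonneg_left h2 (norm_nonneg z)
    norm_num; linarith

lemma norm_perInv_le_of {ρ : ℂ} (h : z.re ≤ |ρ.re|) (a : Cont) :
    ‖perInv ρ a‖ ≤ 6 / 5 * ‖a‖ / ‖z‖ := by
  have h0 := hz.re_pos
  have h1 : ρ.re ≠ 0 := fun h' => by rw [h', abs_zero] at h; linarith
  refine (norm_perInv_le h1 a).trans ?_
  rw [div_le_div_iff₀ (h0.trans_le h) hz.norm_pos]
  nlinarith [norm_nonneg a, hz.norm_le, mul_nonneg (norm_nonneg a) (sub_nonneg.2 h),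
    mul_le_mul_of_nonneg_left hz.norm_le (norm_nonneg a)]

/-- The roots of `ρ² ∓ 3zρ + 3z²`. -/
lemma perSol_bound {ρ₁ ρ₂ : ℂ} (h₁ : z.re ≤ |ρ₁.re|) (h₂ : z.re ≤ |ρ₂.re|)
    (h₁' : ‖ρ₁‖ ≤ 2 * ‖z‖) (h₂' : ‖ρ₂‖ ≤ 2 * ‖z‖) (F G : Cont) :
    ‖z‖ * ‖perSol ρ₁ ρ₂ F G‖ ≤ 2 * ‖F‖ / ‖z‖ + 5 * ‖G‖ ∧
      ‖perSol' ρ₁ ρ₂ F G‖ ≤ 5 * ‖F‖ / ‖z‖ + 12 * ‖G‖ := by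
  have hr := hz.norm_pos
  -- The factor ρ₂ in front of `G` has size at most 2|z|, which the gain 1/|z| of `perInv`
  -- compensates: 17/5 = 2·(6/5) + 1.
  have hb : ‖perInv ρ₂ (F + ρ₂ • G) + G‖ ≤ 6 / 5 * ‖F‖ / ‖z‖ + 17 / 5 * ‖G‖ := by
    have e1 := hz.norm_perInv_le_of h₂ (F + ρ₂ • G)
    have e2 : ‖F + ρ₂ • G‖ ≤ ‖F‖ + 2 * ‖z‖ * ‖G‖ := by
      refine (norm_add_le _ _).trans ?_
      rw [norm_smul]
      gcongr
    have e3 : 6 / 5 * ‖F + ρ₂ • G‖ / ‖z‖ ≤ 6 / 5 * ‖F‖ / ‖z‖ + 12 / 5 * ‖G‖ := by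
      calc 6 / 5 * ‖F + ρ₂ • G‖ / ‖z‖ ≤ 6 / 5 * (‖F‖ + 2 * ‖z‖ * ‖G‖) / ‖z‖ := by gcongr
        _ = _ := by field_simp; ring
    have := norm_add_le (perInv ρ₂ (F + ρ₂ • G)) G
    linarith
  have hu := hz.norm_perInv_le_of h₁ (perInv ρ₂ (F + ρ₂ • G) + G)
  have hu' : ‖z‖ * ‖perSol ρ₁ ρ₂ F G‖ ≤ 6 / 5 * ‖perInv ρ₂ (F + ρ₂ • G) + G‖ := by
    rw [perSol]
    calc _ ≤ ‖z‖ * (6 / 5 * ‖perInv ρ₂ (F + ρ₂ • G) + G‖ / ‖z‖) := by gcongr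
      _ = _ := by field_simp
  have hq : 0 ≤ ‖F‖ / ‖z‖ := by positivity
  have e4 : ∀ c : ℝ, c * ‖F‖ / ‖z‖ = c * (‖F‖ / ‖z‖) := fun c => mul_div_assoc _ _ _
  rw [e4] at hb
  rw [e4, e4]
  refine ⟨by linarith [norm_nonneg G], ?_⟩
  rw [perSol']
  have e5 : ‖ρ₁ • perSol ρ₁ ρ₂ F G‖ ≤ 2 * (‖z‖ * ‖perSol ρ₁ ρ₂ F G‖) := by
    rw [norm_smul, ← mul_assoc]; gcongr
  have := norm_add_le (perInv ρ₂ (F + ρ₂ • G) + G) (ρ₁ • perSol ρ₁ ρ₂ F G)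
  linarith [norm_nonneg G]

lemma perSol_bound_rho (F G : Cont) :
    ‖z‖ * ‖perSol (rho z) (rho' z) F G‖ ≤ 2 * ‖F‖ / ‖z‖ + 5 * ‖G‖ ∧
      ‖perSol' (rho z) (rho' z) F G‖ ≤ 5 * ‖F‖ / ‖z‖ + 12 * ‖G‖ :=
  hz.perSol_bound (hz.re_le_rho.1.trans (le_abs_self _)) (hz.re_le_rho.2.trans (le_abs_self _))
    norm_rho.1 norm_rho.2 F G

end Sector

/-! ### The Riccati equation -/

lemma cont_smul_zero (c : ℂ) : c • (0 : Cont) = 0 := by ext; simp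

lemma cont_smul_sub (c : ℂ) (a b : Cont) : c • (a - b) = c • a - c • b := smul_sub c a b

lemma perSol_sub (ρ₁ ρ₂ : ℂ) (F F' G : Cont) :
    perSol ρ₁ ρ₂ F G - perSol ρ₁ ρ₂ F' G = perSol ρ₁ ρ₂ (F - F') 0 := by
  simp only [perSol, ← map_sub, cont_smul_zero, add_zero]
  congr 1
  rw [add_sub_add_right_eq_sub, ← map_sub, add_sub_add_right_eq_sub]

lemma perSol'_sub (ρ₁ ρ₂ : ℂ) (F F' G : Cont) :
    perSol' ρ₁ ρ₂ F G - perSol' ρ₁ ρ₂ F' G = perSol' ρ₁ ρ₂ (F - F') 0 := by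
  simp only [perSol']
  rw [← perSol_sub ρ₁ ρ₂ F F' G, cont_smul_sub, cont_smul_zero, add_zero, add_zero,
    show F - F' = (F + ρ₂ • G) - (F' + ρ₂ • G) by abel, map_sub]
  abel

/-- The scaled nonlinearity of the Riccati equation. -/
def ricK (z : ℂ) (P R X : Cont) : Cont :=
  -((2 : ℂ) • P) + (z ^ 2)⁻¹ • ((3 : ℂ) • (R * X) - (2 : ℂ) • (P * R) - (3 : ℂ) • (R * R))
    - (z ^ 4)⁻¹ • (R * R * R)

/-- The size of the ball in which the fixed points are found. -/
def radius : ℝ := 1 / 10 ^ 6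

lemma norm_mul_sub_mul_le (a b a' b' : Cont) :
    ‖a * b - a' * b'‖ ≤ ‖a‖ * ‖b - b'‖ + ‖a - a'‖ * ‖b'‖ := by
  have : a * b - a' * b' = a * (b - b') + (a - a') * b' := by ring
  rw [this]
  exact (norm_add_le _ _).trans (add_le_add (norm_mul_le _ _) (norm_mul_le _ _))

lemma norm_mul_sub_mul_le_of {a b a' b' : Cont} {δ s t : ℝ} (ha : ‖a‖ ≤ δ) (hb' : ‖b'‖ ≤ δ)
    (hs : ‖a - a'‖ ≤ s) (ht : ‖b - b'‖ ≤ t) : ‖a * b - a' * b'‖ ≤ δ * (s + t) := by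
  have h0 : 0 ≤ δ := (norm_nonneg _).trans ha
  have h1 : ‖a‖ * ‖b - b'‖ ≤ δ * t := by gcongr
  have h2 : ‖a - a'‖ * ‖b'‖ ≤ s * δ :=
    mul_le_mul hs hb' (norm_nonneg _) ((norm_nonneg _).trans hs)
  linarith [norm_mul_sub_mul_le a b a' b']

lemma Sector.inv_bounds {z : ℂ} (hz : Sector z) : ‖(z ^ 2)⁻¹‖ ≤ 9 ∧ ‖(z ^ 4)⁻¹‖ ≤ 81 := by
  have h := hz.le_norm
  constructor
  · rw [norm_inv, norm_pow, inv_le_comm₀ (by have := hz.norm_pos; positivity) (by norm_num)]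
    calc (9 : ℝ)⁻¹ = (1 / 3) ^ 2 := by norm_num
      _ ≤ _ := by gcongr
  · rw [norm_inv, norm_pow, inv_le_comm₀ (by have := hz.norm_pos; positivity) (by norm_num)]
    calc (81 : ℝ)⁻¹ = (1 / 3) ^ 4 := by norm_num
      _ ≤ _ := by gcongr

/-- All terms containing `R` or `X` are at least quadratic in (P, R, X), hence the factor `δ`. The
powers of 1/z are bounded because |z| ≥ 1/3; 400 covers 9·(3 + 2 + 6) + 81·3. -/
lemma ricK_sub_le {z : ℂ} (hz : Sector z) {P R X R' X' : Cont} {δ s t : ℝ} (hδ : δ ≤ 1)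
    (hP : ‖P‖ ≤ δ) (hR : ‖R‖ ≤ δ) (hR' : ‖R'‖ ≤ δ) (hX' : ‖X'‖ ≤ δ) (hs : ‖R - R'‖ ≤ s)
    (ht : ‖X - X'‖ ≤ t) : ‖ricK z P R X - ricK z P R' X'‖ ≤ 400 * δ * (s + t) := by
  have hδ0 : 0 ≤ δ := (norm_nonneg _).trans hP
  have hs0 : 0 ≤ s := (norm_nonneg _).trans hs
  have ht0 : 0 ≤ t := (norm_nonneg _).trans ht
  obtain ⟨h9, h81⟩ := hz.inv_bounds
  have e : ricK z P R X - ricK z P R' X' = (z ^ 2)⁻¹ • ((3 : ℂ) • (R * X - R' * X')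
      - (2 : ℂ) • (P * R - P * R') - (3 : ℂ) • (R * R - R' * R'))
      - (z ^ 4)⁻¹ • (R * R * R - R' * R' * R') := by
    simp only [ricK]; module
  have h1 := norm_mul_sub_mul_le_of hR hX' hs ht
  have h2 := norm_mul_sub_mul_le_of (s := 0) (a' := P) hP hR' (by simp) hs
  have h3 := norm_mul_sub_mul_le_of hR hR' hs hs
  have h4 : ‖R * R * R - R' * R' * R'‖ ≤ 3 * δ * s := by
    have h5 := norm_mul_sub_mul_le (R * R) R (R' * R') R'
    have h6 : ‖R * R‖ ≤ δ := (norm_mul_le _ _).trans (by nlinarith [norm_nonneg R])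
    have h7 : ‖R * R‖ * ‖R - R'‖ ≤ δ * s := by gcongr
    have h8 : ‖R * R - R' * R'‖ * ‖R'‖ ≤ δ * (s + s) * 1 := by
      gcongr; exact hR'.trans hδ
    linarith
  rw [e]
  refine (norm_sub_le _ _).trans ?_
  rw [norm_smul, norm_smul]
  have h10 : ‖(3 : ℂ) • (R * X - R' * X') - (2 : ℂ) • (P * R - P * R')
      - (3 : ℂ) • (R * R - R' * R')‖ ≤ 3 * (δ * (s + t)) + 2 * (δ * (0 + s)) +
        3 * (δ * (s + s)) := by
    refine (norm_sub_le _ _).trans (add_le_add ((norm_sub_le _ _).trans ?_) ?_)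
    · rw [norm_smul, norm_smul]; norm_num; linarith
    · rw [norm_smul]; norm_num; linarith
  have h11 := mul_le_mul h9 h10 (norm_nonneg _) (by norm_num)
  have h12 := mul_le_mul h81 h4 (norm_nonneg _) (by norm_num)
  nlinarith [mul_nonneg hδ0 hs0, mul_nonneg hδ0 ht0]

/-- The map whose fixed points `(R, X)` give the periodic solutions `m = z + R / z`, `m' = X` of
the Riccati equation. -/
def ricMap (z : ℂ) (e : Cont × Cont) (R X : Cont) : Cont × Cont :=
  (z • perSol (rho z) (rho' z) (z • ricK z e.1 R X) e.2,
    perSol' (rho z) (rho' z) (z • ricK z e.1 R X) e.2)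

/-- The factor z in front of `ricK` and the decay 1/|z| of the periodic inverse cancel, so the
constant is uniform in the sector. Here 2000 = 5·400, with the 5 of `Sector.perSol_bound_rho`. -/
lemma ricMap_sub_le {z : ℂ} (hz : Sector z) {e : Cont × Cont} {R X R' X' : Cont} {δ s t : ℝ}
    (hδ : δ ≤ 1) (hP : ‖e‖ ≤ δ) (hR : ‖R‖ ≤ δ) (hR' : ‖R'‖ ≤ δ) (hX' : ‖X'‖ ≤ δ)
    (hs : ‖R - R'‖ ≤ s) (ht : ‖X - X'‖ ≤ t) :
    ‖ricMap z e R X - ricMap z e R' X'‖ ≤ 2000 * δ * (s + t) := by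
  have hK := ricK_sub_le hz hδ ((norm_fst_le e).trans hP) hR hR' hX' hs ht
  have hb := hz.perSol_bound_rho (z • (ricK z e.1 R X - ricK z e.1 R' X')) 0
  rw [norm_smul, norm_zero, mul_zero, add_zero, mul_zero, add_zero, ← mul_assoc, mul_right_comm,
    mul_div_assoc, div_self hz.norm_pos.ne', mul_one, ← mul_assoc, mul_right_comm,
    mul_div_assoc, div_self hz.norm_pos.ne', mul_one] at hb
  rw [Prod.norm_def]
  refine max_le ?_ ?_
  · simp only [ricMap, Prod.fst_sub]
    rw [← cont_smul_sub, perSol_sub, norm_smul, ← cont_smul_sub]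
    linarith [norm_nonneg (ricK z e.1 R X - ricK z e.1 R' X')]
  · simp only [ricMap, Prod.snd_sub]
    rw [perSol'_sub, ← cont_smul_sub]
    linarith

/-- At zero only −2zP + D' is left as source, where D is the second component of the data; 22 = 5·2
+ 12. -/
lemma ricMap_zero_le {z : ℂ} (hz : Sector z) (e : Cont × Cont) :
    ‖ricMap z e 0 0‖ ≤ 22 * ‖e‖ := by
  have hK : ricK z e.1 0 0 = -((2 : ℂ) • e.1) := by simp [ricK, cont_smul_zero]
  have hKn : ‖ricK z e.1 0 0‖ ≤ 2 * ‖e‖ := by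
    rw [hK, norm_neg, norm_smul]; norm_num; exact norm_fst_le e
  have hb := hz.perSol_bound_rho (z • ricK z e.1 0 0) e.2
  have hr := hz.norm_pos
  have e1 : ∀ c : ℝ, c * ‖z • ricK z e.1 0 0‖ / ‖z‖ = c * ‖ricK z e.1 0 0‖ := fun c => by
    rw [norm_smul]; field_simp
  rw [e1, e1] at hb
  have h2 := norm_snd_le e
  rw [Prod.norm_def]
  refine max_le ?_ ?_
  · simp only [ricMap, norm_smul]
    linarith [norm_nonneg e]
  · simp only [ricMap]
    linarith [norm_nonneg e]

/-- For small coefficients the Riccati equation is solvable. -/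
lemma exists_ricMap_fixed {z : ℂ} (hz : Sector z) {e : Cont × Cont}
    (he : ‖e‖ < radius / 100000) :
    ∃ R X : Cont, ‖R‖ ≤ 44 * ‖e‖ ∧ ‖X‖ ≤ 44 * ‖e‖ ∧ ricMap z e R X = (R, X) := by
  obtain ⟨sol, hsol⟩ := exists_analytic_fixedPoint (E := Cont × Cont) (X := Cont × Cont)
    (T := fun u => ricMap z u.1 u.2.1 u.2.2) (by
      unfold ricMap perSol perSol' perSol ricK
      fun_prop) (δ := radius) (by norm_num [radius])
    (U := Metric.ball 0 (radius / 100000)) Metric.isOpen_ball (fun e he x y hx hy => by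
      rw [mem_ball_zero_iff] at he
      have hr : radius = 1 / 10 ^ 6 := rfl
      refine (ricMap_sub_le hz (δ := radius) (by norm_num [hr]) (by linarith)
        ((norm_fst_le x).trans hx) ((norm_fst_le y).trans hy) ((norm_snd_le y).trans hy)
        (norm_fst_le (x - y)) (norm_snd_le (x - y))).trans ?_
      rw [hr]; linarith [norm_nonneg (x - y)]) (fun e he => by
      rw [mem_ball_zero_iff] at he
      refine (ricMap_zero_le hz e).trans ?_
      linarith [norm_nonneg e])
  obtain ⟨h1, h2, -, -⟩ := hsol e (mem_ball_zero_iff.2 he)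
  have h3 := ricMap_zero_le hz e
  refine ⟨(sol e).1, (sol e).2, (norm_fst_le _).trans ?_, (norm_snd_le _).trans ?_, h2⟩
  · simp only [Prod.fst_zero, Prod.snd_zero] at h1; linarith
  · simp only [Prod.fst_zero, Prod.snd_zero] at h1; linarith

/-! ### From fixed points to Riccati solutions and back. -/

/-- Data of a third order equation with periodic coefficients on one period. -/
structure Coeffs (p dp q : ℝ → ℂ) (e : Cont × Cont) : Prop where
  prim_p : Prim p dp
  ext_p : ∀ x ∈ Icc (0 : ℝ) 1, ext e.1 x = p x
  -- The combination p' − q enters the Riccati equation only through its primitive, so sup norms of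
  -- continuous functions suffice as a measure of the coefficients.
  prim_D : Prim (ext e.2) (fun x => dp x - q x)
  per_p : p 0 = p 1
  per_D : ext e.2 0 = ext e.2 1

/-- A periodic solution of the Riccati equation, which gives a factorization
`(D - m) (D² + m D + 2p + m² - m')` of the third order operator. -/
structure Riccati (p dp q : ℝ → ℂ) (l : ℂ) (m m1 : ℝ → ℂ) : Prop where
  prim : Prim m m1
  prim1 : Prim m1 (fun x => 3 * m x * m1 x - m x ^ 3 - 2 * p x * m x + l - q x + dp x)
  per : m 0 = m 1
  per1 : m1 0 = m1 1

/-- For m = z + r the Riccati equation reads r'' − 3zr' + 3z²r = zK + zH + p' − q, with K the value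
of `ricK`. The constant H/(3z) accounts exactly for the shift zH of the spectral parameter, so H
enters only through R = X0 + H/3. -/
lemma Riccati.of_fixed {p dp q : ℝ → ℂ} {e : Cont × Cont} (hc : Coeffs p dp q e) {z : ℂ}
    (hz : Sector z) {X0 X R : Cont} {H : ℂ} (hR : R = X0 + (H / 3) • (1 : Cont))
    (hfix : ricMap z e R X = (X0, X)) :
    Riccati p dp q (z ^ 3 + z * H) (fun x => z + z⁻¹ * ext R x) (ext X) := by
  have hz0 := hz.ne_zero
  obtain ⟨h1, h2⟩ := hz.rho_ne
  set F := z • ricK z e.1 R X with hF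
  have hX0 : X0 = z • perSol (rho z) (rho' z) F e.2 := congrArg Prod.fst hfix.symm
  have hX : X = perSol' (rho z) (rho' z) F e.2 := congrArg Prod.snd hfix.symm
  have hRx : ∀ x, ext R x = z * ext (perSol (rho z) (rho' z) F e.2) x + H / 3 := fun x => by
    rw [hR, hX0]; simp
  have p1 := prim_perSol h1 (ρ₂ := rho' z) F e.2
  have p2 := prim_perSol' h1 h2 F hc.prim_D
  rw [rho_add, rho_mul] at p2
  rw [← hX] at p1 p2
  constructor
  · refine ((p1.const_mul 1).add (Prim.const (z + z⁻¹ * (H / 3)))).congr (fun x _ => ?_)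
      (fun x _ => by ring)
    rw [hRx]; field_simp; ring
  · refine p2.congr (fun _ _ => rfl) (fun x hx => ?_)
    have hu : ext (perSol (rho z) (rho' z) F e.2) x = z⁻¹ * (ext R x - H / 3) := by
      rw [hRx]; field_simp; ring
    rw [hu, hF, ← hc.ext_p x hx]
    simp only [ricK, ext_smul, ext_add, ext_sub, ext_neg, ext_mul]
    field_simp
    ring
  · simp only [hRx, perSol_periodic h1]
  · rw [hX]; exact perSol'_periodic h1 h2 F hc.per_D

/-- Converse of `Riccati.of_fixed`, by uniqueness of periodic solutions of the linear part. It lets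
Riccati solutions obtained elsewhere, by re-expansion or by conjugation, be identified with the
fixed points of the contraction. -/
lemma Riccati.fixed {p dp q : ℝ → ℂ} {e : Cont × Cont} (hc : Coeffs p dp q e) {z : ℂ}
    (hz : Sector z) {R X : Cont} {H : ℂ} {m m1 : ℝ → ℂ}
    (hm : Riccati p dp q (z ^ 3 + z * H) m m1)
    (hR : ∀ x ∈ Icc (0 : ℝ) 1, m x = z + z⁻¹ * ext R x)
    (hX : ∀ x ∈ Icc (0 : ℝ) 1, m1 x = ext X x) :
    ricMap z e R X = (R - (H / 3) • (1 : Cont), X) := by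
  have hz0 := hz.ne_zero
  obtain ⟨h1, h2⟩ := hz.rho_ne
  have key : ∀ x ∈ Icc (0 : ℝ) 1,
      m x - (z + z⁻¹ * (H / 3)) = ext (perSol (rho z) (rho' z) (z • ricK z e.1 R X) e.2) x ∧
      m1 x = ext (perSol' (rho z) (rho' z) (z • ricK z e.1 R X) e.2) x := fun x hx => by
    refine eq_perSol (u := fun x => m x - (z + z⁻¹ * (H / 3))) (u1 := m1)
      (f := ext (z • ricK z e.1 R X)) h1 h2 (z • ricK z e.1 R X) hc.prim_D hc.per_D ?_
      (fun _ _ => rfl) ?_ ?_ hm.per1 hx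
    · exact (hm.prim.sub (Prim.const _)).congr (fun _ _ => rfl) (fun x _ => by ring)
    · refine hm.prim1.congr (fun _ _ => rfl) (fun x hx => ?_)
      rw [rho_add, rho_mul]
      simp only [ricK, ext_smul, ext_add, ext_sub, ext_neg, ext_mul]
      rw [hR x hx, hX x hx, ← hc.ext_p x hx]
      field_simp
      ring
    · simp only [hm.per]
  rw [ricMap]
  congr 1
  · refine cont_ext fun x hx => ?_
    rw [ext_smul, ← (key x hx).1, hR x hx]
    simp only [ext_sub, ext_smul, ext_one]
    field_simp
    ring
  · exact cont_ext fun x hx => by rw [← (key x hx).2, hX x hx]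

/-! ### The eigenvalue problem as a fixed point problem -/

/-- The function `sin κx` on `[0, 1]`. -/
def sinC (κ : ℂ) : Cont := toCont (fun x => Complex.sin (κ * x)) (by fun_prop)

/-- The function `cos κx` on `[0, 1]`. -/
def cosC (κ : ℂ) : Cont := toCont (fun x => Complex.cos (κ * x)) (by fun_prop)

lemma ext_sinC (κ : ℂ) {x : ℝ} (hx : x ∈ Icc (0 : ℝ) 1) : ext (sinC κ) x = Complex.sin (κ * x) :=
  ext_toCont _ hx

lemma ext_cosC (κ : ℂ) {x : ℝ} (hx : x ∈ Icc (0 : ℝ) 1) : ext (cosC κ) x = Complex.cos (κ * x) :=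
  ext_toCont _ hx

lemma prim_sin (κ : ℂ) : Prim (fun x => Complex.sin (κ * x)) (fun x => κ * Complex.cos (κ * x)) :=
  Prim.of_hasDerivAt (fun x _ => by
    have h : HasDerivAt (fun x : ℝ => κ * (x : ℂ)) κ x := by
      simpa using (Complex.ofRealCLM.hasDerivAt (x := x)).const_mul κ
    exact ((Complex.hasDerivAt_sin (κ * x)).comp x h).congr_deriv (mul_comm _ _)) (by fun_prop)

lemma prim_cos (κ : ℂ) : Prim (fun x => Complex.cos (κ * x))
    (fun x => -(κ * Complex.sin (κ * x))) :=
  Prim.of_hasDerivAt (fun x _ => by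
    have h : HasDerivAt (fun x : ℝ => κ * (x : ℂ)) κ x := by
      simpa using (Complex.ofRealCLM.hasDerivAt (x := x)).const_mul κ
    exact ((Complex.hasDerivAt_cos (κ * x)).comp x h).congr_deriv
      (show _ = -(κ * Complex.sin (κ * x)) by ring)) (by fun_prop)

lemma norm_csin_ofReal_le (x : ℝ) : ‖Complex.sin x‖ ≤ 1 := by
  rw [← Complex.ofReal_sin, Complex.norm_real]; exact Real.abs_sin_le_one x

lemma norm_ccos_ofReal_le (x : ℝ) : ‖Complex.cos x‖ ≤ 1 := by
  rw [← Complex.ofReal_cos, Complex.norm_real]; exact Real.abs_cos_le_one x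

lemma norm_sinC_le (κ : ℝ) : ‖sinC κ‖ ≤ 1 :=
  norm_cont_le zero_le_one fun x hx => by
    rw [ext_sinC _ hx, ← Complex.ofReal_mul]; exact norm_csin_ofReal_le _

lemma norm_cosC_le (κ : ℝ) : ‖cosC κ‖ ≤ 1 :=
  norm_cont_le zero_le_one fun x hx => by
    rw [ext_cosC _ hx, ← Complex.ofReal_mul]; exact norm_ccos_ofReal_le _

/-- The operator `a ↦ ∫₀ˣ sin κ(x-t) a(t) dt`. -/
def waveInt (κ : ℂ) (a : Cont) : Cont :=
  sinC κ * volterra (cosC κ * a) - cosC κ * volterra (sinC κ * a)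

lemma waveInt_sub (κ : ℂ) (a b : Cont) : waveInt κ a - waveInt κ b = waveInt κ (a - b) := by
  simp only [waveInt, mul_sub, map_sub]; ring

lemma norm_waveInt_le (κ : ℝ) (a : Cont) : ‖waveInt κ a‖ ≤ 2 * ‖a‖ := by
  have h : ∀ b c : Cont, ‖b‖ ≤ 1 → ‖c‖ ≤ 1 → ‖b * volterra (c * a)‖ ≤ ‖a‖ := fun b c hb hc => by
    calc ‖b * volterra (c * a)‖ ≤ ‖b‖ * ‖volterra (c * a)‖ := norm_mul_le _ _
      _ ≤ 1 * ‖c * a‖ := by gcongr; exact norm_volterra_le _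
      _ ≤ ‖c‖ * ‖a‖ := by rw [one_mul]; exact norm_mul_le _ _
      _ ≤ 1 * ‖a‖ := by gcongr
      _ = ‖a‖ := one_mul _
  have h1 := h _ _ (norm_sinC_le κ) (norm_cosC_le κ)
  have h2 := h _ _ (norm_cosC_le κ) (norm_sinC_le κ)
  rw [waveInt]
  linarith [norm_sub_le (sinC κ * volterra (cosC κ * a)) (cosC κ * volterra (sinC κ * a))]

/-- The frequency of the `n`-th unperturbed eigenfunction. -/
def freq (n : ℕ) : ℝ := Real.pi * n

/-- The cube root of the `n`-th unperturbed eigenvalue. -/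
def base (n : ℕ) : ℝ := 2 * freq n / Real.sqrt 3

lemma three_lt_freq {n : ℕ} (hn : 1 ≤ n) : 3 < freq n := by
  have : (1 : ℝ) ≤ n := by exact_mod_cast hn
  have := Real.pi_gt_three
  rw [freq]; nlinarith

lemma sqrt3_base (n : ℕ) : Real.sqrt 3 * base n = 2 * freq n := by
  rw [base]; field_simp

lemma base_sq (n : ℕ) : 3 / 4 * base n ^ 2 = freq n ^ 2 := by
  have h : (Real.sqrt 3) ^ 2 = 3 := Real.sq_sqrt (by norm_num)
  have := sqrt3_base n
  nlinarith [congrArg (· ^ 2) this]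

lemma freq_le_base {n : ℕ} (hn : 1 ≤ n) : freq n ≤ base n := by
  have h := sqrt3_base n
  have h3 := sqrt3_bounds
  have := three_lt_freq hn
  have hb : 0 < base n := by
    by_contra hb
    nlinarith
  nlinarith

lemma base_le_freq {n : ℕ} (hn : 1 ≤ n) : base n ≤ 2 * freq n := by
  have h := sqrt3_base n
  have h3 := sqrt3_bounds
  have := three_lt_freq hn
  have := freq_le_base hn
  nlinarith

lemma sector_base {n : ℕ} (hn : 1 ≤ n) : Sector (base n : ℂ) := by
  have h1 := three_lt_freq hn
  have h2 := freq_le_base hn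
  constructor
  · simp; linarith
  · rw [Complex.norm_real, Real.norm_of_nonneg (by linarith)]; linarith

lemma norm_base {n : ℕ} (hn : 1 ≤ n) : ‖(base n : ℂ)‖ = base n := by
  rw [Complex.norm_real, Real.norm_of_nonneg (by linarith [three_lt_freq hn, freq_le_base hn])]

lemma csin_freq (n : ℕ) : Complex.sin (freq n) = 0 := by
  rw [← Complex.ofReal_sin, freq, mul_comm, Real.sin_nat_mul_pi]; simp

lemma ccos_freq_sq (n : ℕ) : Complex.cos (freq n) ^ 2 = 1 := by
  have := Complex.sin_sq_add_cos_sq (freq n)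
  rw [csin_freq] at this; simpa using this

/-- The perturbation `Q - ¾ z²` of the reduced second order equation `f'' + Q f = 0`. -/
def potV (z : ℂ) (P R X : Cont) : Cont :=
  (2 : ℂ) • P + (3 / 2 : ℂ) • R - (3 / 2 : ℂ) • X + (3 / 4 * (z ^ 2)⁻¹) • (R * R)

/-- The fixed point problem for the `n`-th eigenvalue `z³ + z H`. -/
structure IsJoint (n : ℕ) (e : Cont × Cont) (R X φ : Cont) (H : ℂ) : Prop where
  ric : ricMap (base n) e R X = (R - (H / 3) • (1 : Cont), X)
  wave : φ = -((freq n : ℂ)⁻¹ • waveInt (freq n) (potV (base n) e.1 R X * (sinC (freq n) + φ)))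
  -- As sin(freq n) = 0, this condition expresses that the function sin + φ defined by `wave`
  -- vanishes at x = 1.
  orth : total (potV (base n) e.1 R X * (sinC (freq n) + φ) * sinC (freq n)) = 0

/-- The map whose fixed points are the solutions of the fixed point problem for an eigenvalue. -/
def jointMap (n : ℕ) (u : (Cont × Cont) × (Cont × Cont × Cont × ℂ)) :
    Cont × Cont × Cont × ℂ :=
  -- The Riccati unknowns are magnified by 100. The potential then depends on them with coefficients
  -- 3/200 instead of 3/2, while the price, a factor 100 in front of `ricMap`, is absorbed by its
  -- very small Lipschitz constant.
  let R := (1 / 100 : ℂ) • u.2.1 + (u.2.2.2.2 / 3) • (1 : Cont)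
  let X := (1 / 100 : ℂ) • u.2.2.1
  let v := potV (base n) u.1.1 R X
  ((100 : ℂ) • (ricMap (base n) u.1 R X).1, (100 : ℂ) • (ricMap (base n) u.1 R X).2,
    -((freq n : ℂ)⁻¹ • waveInt (freq n) (v * (sinC (freq n) + u.2.2.2.1))),
    u.2.2.2.2 - 4 * total (v * (sinC (freq n) + u.2.2.2.1) * sinC (freq n)))

lemma isJoint_of_fixed {n : ℕ} {e : Cont × Cont} {ξ : Cont × Cont × Cont × ℂ}
    (h : jointMap n (e, ξ) = ξ) :
    IsJoint n e ((1 / 100 : ℂ) • ξ.1 + (ξ.2.2.2 / 3) • (1 : Cont)) ((1 / 100 : ℂ) • ξ.2.1) ξ.2.2.1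
      ξ.2.2.2 := by
  obtain ⟨a, b, φ, H⟩ := ξ
  simp only [jointMap, Prod.mk.injEq] at h
  obtain ⟨h1, h2, h3, h4⟩ := h
  refine ⟨Prod.ext ?_ ?_, h3.symm, ?_⟩
  · simp only [add_sub_cancel_right]
    calc _ = (1 / 100 : ℂ) • ((100 : ℂ) • (ricMap (base n) e ((1 / 100 : ℂ) • a +
            (H / 3) • (1 : Cont)) ((1 / 100 : ℂ) • b)).1) := by module
      _ = _ := by rw [h1]
  · calc _ = (1 / 100 : ℂ) • ((100 : ℂ) • (ricMap (base n) e ((1 / 100 : ℂ) • a +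
            (H / 3) • (1 : Cont)) ((1 / 100 : ℂ) • b)).2) := by module
      _ = _ := by rw [h2]
  · have : (4 : ℂ) * total (potV (base n) e.1 ((1 / 100 : ℂ) • a +
            (H / 3) • (1 : Cont)) ((1 / 100 : ℂ) • b) * (sinC (freq n) + φ) * sinC (freq n)) = 0 := by
      linear_combination -h4
    simpa using this

lemma fixed_of_isJoint {n : ℕ} {e : Cont × Cont} {R X φ : Cont} {H : ℂ}
    (h : IsJoint n e R X φ H) : jointMap n (e, ((100 : ℂ) • (R - (H / 3) • (1 : Cont)),
      (100 : ℂ) • X, φ, H)) = ((100 : ℂ) • (R - (H / 3) • (1 : Cont)), (100 : ℂ) • X, φ, H) := by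
  have e1 : (1 / 100 : ℂ) • ((100 : ℂ) • (R - (H / 3) • (1 : Cont))) + (H / 3) • (1 : Cont) = R := by
    module
  have e2 : (1 / 100 : ℂ) • ((100 : ℂ) • X) = X := by module
  simp only [jointMap, e1, e2, h.ric, h.orth, ← h.wave, mul_zero, sub_zero]

lemma total_sinC_sq {n : ℕ} (hn : 1 ≤ n) : total (sinC (freq n) * sinC (freq n)) = 1 / 2 := by
  have hκ : (freq n : ℂ) ≠ 0 := by
    exact_mod_cast (by linarith [three_lt_freq hn] : freq n ≠ 0)
  have h := ((Prim.of_hasDerivAt (f := fun x : ℝ => (x : ℂ)) (f' := fun _ => 1)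
    (fun x _ => Complex.ofRealCLM.hasDerivAt) continuousOn_const).const_mul (1 / 2)).sub
    (((prim_sin (freq n)).mul (prim_cos (freq n))).const_mul (1 / (2 * (freq n : ℂ))))
  rw [total_apply]
  have h2 := (h.congr (g' := ext (sinC (freq n) * sinC (freq n))) (fun _ _ => rfl) (fun x hx => by
    rw [ext_mul, ext_sinC _ hx]
    have := Complex.sin_sq_add_cos_sq ((freq n : ℂ) * x)
    field_simp
    linear_combination this)).integral
  rw [h2]
  simp only [Complex.ofReal_one, mul_one, Complex.ofReal_zero, mul_zero, csin_freq,
    Complex.sin_zero]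
  ring

lemma potV_sub_le {z : ℂ} (hz : Sector z) {P R X R' X' : Cont} {δ s t : ℝ}
    (hR : ‖R‖ ≤ δ) (hR' : ‖R'‖ ≤ δ) (hs : ‖R - R'‖ ≤ s)
    (ht : ‖X - X'‖ ≤ t) : ‖potV z P R X - potV z P R' X'‖ ≤ 3 / 2 * (s + t) + 14 * δ * s := by
  have hδ0 : 0 ≤ δ := (norm_nonneg _).trans hR
  have hs0 : 0 ≤ s := (norm_nonneg _).trans hs
  have e : potV z P R X - potV z P R' X' = (3 / 2 : ℂ) • (R - R') - (3 / 2 : ℂ) • (X - X') +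
      (3 / 4 * (z ^ 2)⁻¹) • (R * R - R' * R') := by
    simp only [potV]; module
  have h1 := norm_mul_sub_mul_le_of hR hR' hs hs
  have h9 := hz.inv_bounds.1
  rw [e]
  refine (norm_add_le _ _).trans ?_
  have h2 : ‖(3 / 4 * (z ^ 2)⁻¹) • (R * R - R' * R')‖ ≤ (3 / 4 * 9) * (δ * (s + s)) := by
    rw [norm_smul, norm_mul]
    norm_num only [norm_div, RCLike.norm_ofNat]
    gcongr
    linarith
  have h3 : ‖(3 / 2 : ℂ) • (R - R') - (3 / 2 : ℂ) • (X - X')‖ ≤ 3 / 2 * s + 3 / 2 * t := by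
    refine (norm_sub_le _ _).trans ?_
    rw [norm_smul, norm_smul]
    norm_num only [norm_div, RCLike.norm_ofNat]
    gcongr
  nlinarith [mul_nonneg hδ0 hs0]

lemma potV_le {z : ℂ} (hz : Sector z) {P R X : Cont} {δ : ℝ} (hδ : δ ≤ 1) (hP : ‖P‖ ≤ δ)
    (hR : ‖R‖ ≤ δ) (hX : ‖X‖ ≤ δ) : ‖potV z P R X‖ ≤ 19 * δ := by
  have h := potV_sub_le hz (P := P) (R' := 0) (X' := 0) (s := δ) (t := δ) hR (by
    rw [norm_zero]; exact (norm_nonneg _).trans hP) (by rwa [sub_zero]) (by rwa [sub_zero])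
  have h0 : potV z P 0 0 = (2 : ℂ) • P := by simp [potV, cont_smul_zero]
  have h1 : ‖(2 : ℂ) • P‖ ≤ 2 * δ := by rw [norm_smul]; norm_num; exact hP
  rw [h0] at h
  have h2 := norm_le_norm_add_norm_sub' (potV z P R X) ((2 : ℂ) • P)
  have hδ0 : 0 ≤ δ := (norm_nonneg _).trans hP
  nlinarith

/-! ### Solution of the fixed point problem -/

lemma cont_zero_smul (a : Cont) : (0 : ℂ) • a = 0 := by ext; simp

/-- The part H/3 of `R` contributes H/2 to the potential, and ∫ sin² = 1/2. So the factor 4 removes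
exactly the leading linear dependence on H: the last component is one step of a simplified Newton
method. -/
lemma jointMap_orth_eq {n : ℕ} (hn : 1 ≤ n) (v φ : Cont) (H : ℂ) :
    H - 4 * total (v * (sinC (freq n) + φ) * sinC (freq n)) =
      -(4 * total ((v - (H / 2) • (1 : Cont)) * sinC (freq n) * sinC (freq n) +
        v * φ * sinC (freq n))) := by
  have e : v * (sinC (freq n) + φ) * sinC (freq n) =
      ((v - (H / 2) • (1 : Cont)) * sinC (freq n) * sinC (freq n) + v * φ * sinC (freq n)) +
        (H / 2) • (sinC (freq n) * sinC (freq n)) := by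
    simp only [sub_mul, smul_mul_assoc, one_mul]; ring
  rw [e, map_add, map_smul, total_sinC_sq hn, smul_eq_mul]
  ring

lemma norm_mul_mul_sinC_le (n : ℕ) (a : Cont) : ‖a * sinC (freq n)‖ ≤ ‖a‖ :=
  (norm_mul_le _ _).trans (mul_le_of_le_one_right (norm_nonneg _) (norm_sinC_le _))

-- The wave component is the critical one: κ⁻¹ ≤ 1/3 with κ = πn, the bound 2 of `norm_waveInt_le`
-- and the Lipschitz constant 3/5 of the potential give about 2/5. The orthogonality component gives
-- 4·(1/20 + 1/1000), the Riccati components 100/1000.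
set_option maxHeartbeats 1000000 in
lemma jointMap_sub_le {n : ℕ} (hn : 1 ≤ n) {e : Cont × Cont} (he : ‖e‖ ≤ radius)
    {x y : Cont × Cont × Cont × ℂ} (hx : ‖x‖ ≤ radius) (hy : ‖y‖ ≤ radius) :
    ‖jointMap n (e, x) - jointMap n (e, y)‖ ≤ 1 / 2 * ‖x - y‖ := by
  have hr : radius = 1 / 10 ^ 6 := rfl
  have hz := sector_base hn
  obtain ⟨a, b, φ, H⟩ := x
  obtain ⟨a', b', φ', H'⟩ := y
  simp only [Prod.norm_def, max_le_iff] at hx hy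
  obtain ⟨ha, hb, hφ, hH⟩ := hx
  obtain ⟨ha', hb', hφ', hH'⟩ := hy
  set d := ‖((a, b, φ, H) : Cont × Cont × Cont × ℂ) - (a', b', φ', H')‖ with hd
  have hd0 : 0 ≤ d := norm_nonneg _
  have hd' := hd.symm.le
  rw [Prod.norm_def, Prod.norm_def, Prod.norm_def] at hd'
  simp only [Prod.mk_sub_mk, max_le_iff] at hd'
  obtain ⟨da, db, dφ, dH⟩ := hd'
  set R := (1 / 100 : ℂ) • a + (H / 3) • (1 : Cont) with hRd
  set R' := (1 / 100 : ℂ) • a' + (H' / 3) • (1 : Cont) with hRd'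
  set X := (1 / 100 : ℂ) • b with hXd
  set X' := (1 / 100 : ℂ) • b' with hXd'
  have nb : ∀ (c : Cont) (t : ℝ), ‖c‖ ≤ t → ‖(1 / 100 : ℂ) • c‖ ≤ t / 100 := fun c t h => by
    rw [norm_smul]; norm_num; linarith
  have nH : ∀ (h : ℂ) (t : ℝ), ‖h‖ ≤ t → ‖(h / 3) • (1 : Cont)‖ ≤ t / 3 := fun h t hh => by
    rw [norm_smul, norm_one, mul_one, norm_div]; norm_num; linarith
  have hR : ‖R‖ ≤ radius := (norm_add_le _ _).trans (by linarith [nb a _ ha, nH H _ hH])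
  have hR' : ‖R'‖ ≤ radius := (norm_add_le _ _).trans (by linarith [nb a' _ ha', nH H' _ hH'])
  have hX : ‖X‖ ≤ radius := by linarith [nb b _ hb]
  have hX' : ‖X'‖ ≤ radius := by linarith [nb b' _ hb']
  have dR : ‖R - R'‖ ≤ d / 100 + d / 3 := by
    have : R - R' = (1 / 100 : ℂ) • (a - a') + ((H - H') / 3) • (1 : Cont) := by
      rw [hRd, hRd']; module
    rw [this]
    exact (norm_add_le _ _).trans (by linarith [nb _ _ da, nH _ _ dH])
  have dX : ‖X - X'‖ ≤ d / 100 := by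
    have : X - X' = (1 / 100 : ℂ) • (b - b') := by rw [hXd, hXd']; module
    rw [this]; exact nb _ _ db
  set v := potV (base n) e.1 R X with hv
  set v' := potV (base n) e.1 R' X' with hv'
  have hric := ricMap_sub_le hz (by norm_num [hr]) he hR hR' hX' dR dX
  have hric' : ‖ricMap (base n) e R X - ricMap (base n) e R' X'‖ ≤ d / 1000 := by
    refine hric.trans ?_
    rw [hr]; linarith
  have dv := potV_sub_le hz (P := e.1) hR hR' dR dX
  rw [← hv, ← hv'] at dv
  have dv1 : ‖v - v'‖ ≤ 3 / 5 * d := by refine dv.trans ?_; rw [hr]; linarith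
  have hvn : ‖v‖ ≤ 19 * radius :=
    potV_le hz (by norm_num [hr]) ((norm_fst_le e).trans he) hR hX
  have hvn' : ‖v'‖ ≤ 19 * radius :=
    potV_le hz (by norm_num [hr]) ((norm_fst_le e).trans he) hR' hX'
  -- the constant part `H / 2` of the potential
  have dw : ‖(v - (H / 2) • (1 : Cont)) - (v' - (H' / 2) • (1 : Cont))‖ ≤ d / 20 := by
    have e1 : (v - (H / 2) • (1 : Cont)) - (v' - (H' / 2) • (1 : Cont)) =
        (3 / 200 : ℂ) • (a - a') - (3 / 200 : ℂ) • (b - b') +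
          (3 / 4 * ((base n : ℂ) ^ 2)⁻¹) • (R * R - R' * R') := by
      rw [hv, hv', potV, potV]
      have : (3 / 2 : ℂ) • R - (3 / 2 : ℂ) • R' = (3 / 200 : ℂ) • (a - a') +
          ((H - H') / 2) • (1 : Cont) := by rw [hRd, hRd']; module
      have h2 : (3 / 2 : ℂ) • X - (3 / 2 : ℂ) • X' = (3 / 200 : ℂ) • (b - b') := by
        rw [hXd, hXd']; module
      rw [cont_smul_sub _ (R * R), ← h2]
      linear_combination (exp := 1) this
        + (by module : ((H - H') / 2) • (1 : Cont) = (H / 2) • (1 : Cont) - (H' / 2) • (1 : Cont))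
    have h1 := norm_mul_sub_mul_le_of hR hR' dR dR
    have h9 := hz.inv_bounds.1
    have h2 : ‖(3 / 4 * ((base n : ℂ) ^ 2)⁻¹) • (R * R - R' * R')‖ ≤
        (3 / 4 * 9) * (radius * ((d / 100 + d / 3) + (d / 100 + d / 3))) := by
      rw [norm_smul, norm_mul]
      norm_num only [norm_div, RCLike.norm_ofNat]
      gcongr
      linarith
    have h3 : ‖(3 / 200 : ℂ) • (a - a') - (3 / 200 : ℂ) • (b - b')‖ ≤ 3 / 200 * d + 3 / 200 * d := by
      refine (norm_sub_le _ _).trans ?_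
      rw [norm_smul, norm_smul]
      norm_num only [norm_div, RCLike.norm_ofNat]
      gcongr
    rw [e1]
    refine (norm_add_le _ _).trans ?_
    rw [hr] at h2
    linarith
  have dvφ : ‖v * φ - v' * φ'‖ ≤ d / 1000 := by
    have h1 := norm_mul_sub_mul_le v φ v' φ'
    have h2 : ‖v‖ * ‖φ - φ'‖ ≤ 19 * radius * d :=
      mul_le_mul hvn dφ (norm_nonneg _) (by norm_num [hr])
    have h3 : ‖v - v'‖ * ‖φ'‖ ≤ 3 / 5 * d * radius := by gcongr
    rw [hr] at h2 h3
    linarith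
  have ej : jointMap n (e, (a, b, φ, H)) = ((100 : ℂ) • (ricMap (base n) e R X).1,
      (100 : ℂ) • (ricMap (base n) e R X).2,
      -((freq n : ℂ)⁻¹ • waveInt (freq n) (v * (sinC (freq n) + φ))),
      H - 4 * total (v * (sinC (freq n) + φ) * sinC (freq n))) := rfl
  have ej' : jointMap n (e, (a', b', φ', H')) = ((100 : ℂ) • (ricMap (base n) e R' X').1,
      (100 : ℂ) • (ricMap (base n) e R' X').2,
      -((freq n : ℂ)⁻¹ • waveInt (freq n) (v' * (sinC (freq n) + φ'))),
      H' - 4 * total (v' * (sinC (freq n) + φ') * sinC (freq n))) := rfl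
  rw [ej, ej', Prod.norm_def, Prod.norm_def, Prod.norm_def]
  simp only [Prod.mk_sub_mk]
  refine max_le ?_ (max_le ?_ (max_le ?_ ?_))
  · rw [← cont_smul_sub, ← Prod.fst_sub, norm_smul]
    have : ‖(ricMap (base n) e R X).1 - (ricMap (base n) e R' X').1‖ ≤ _ :=
      norm_fst_le (ricMap (base n) e R X - ricMap (base n) e R' X')
    norm_num; linarith
  · rw [← cont_smul_sub, ← Prod.snd_sub, norm_smul]
    have : ‖(ricMap (base n) e R X).2 - (ricMap (base n) e R' X').2‖ ≤ _ :=
      norm_snd_le (ricMap (base n) e R X - ricMap (base n) e R' X')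
    norm_num; linarith
  · have e1 : -((freq n : ℂ)⁻¹ • waveInt (freq n) (v * (sinC (freq n) + φ))) -
        -((freq n : ℂ)⁻¹ • waveInt (freq n) (v' * (sinC (freq n) + φ'))) =
        -((freq n : ℂ)⁻¹ • waveInt (freq n) ((v - v') * sinC (freq n) + (v * φ - v' * φ'))) := by
      rw [show (v - v') * sinC (freq n) + (v * φ - v' * φ') = v * (sinC (freq n) + φ) -
        v' * (sinC (freq n) + φ') by ring, ← waveInt_sub]
      module
    have h1 := norm_waveInt_le (freq n) ((v - v') * sinC (freq n) + (v * φ - v' * φ'))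
    have h2 := norm_add_le ((v - v') * sinC (freq n)) (v * φ - v' * φ')
    have h3 := norm_mul_mul_sinC_le n (v - v')
    have h4 : ‖(freq n : ℂ)⁻¹‖ ≤ 1 / 3 := by
      have := three_lt_freq hn
      rw [norm_inv, Complex.norm_real, Real.norm_of_nonneg (by linarith), inv_le_comm₀
        (by linarith) (by norm_num)]
      linarith
    rw [e1, norm_neg, norm_smul]
    have h5 := mul_le_mul h4 h1 (norm_nonneg _) (by norm_num)
    linarith
  · rw [jointMap_orth_eq hn, jointMap_orth_eq hn]
    set w := v - (H / 2) • (1 : Cont)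
    set w' := v' - (H' / 2) • (1 : Cont)
    have e1 : -(4 * total (w * sinC (freq n) * sinC (freq n) + v * φ * sinC (freq n))) -
        -(4 * total (w' * sinC (freq n) * sinC (freq n) + v' * φ' * sinC (freq n))) =
        -(4 * total (((w - w') * sinC (freq n) + (v * φ - v' * φ')) * sinC (freq n))) := by
      rw [show ((w - w') * sinC (freq n) + (v * φ - v' * φ')) * sinC (freq n) =
        (w * sinC (freq n) * sinC (freq n) + v * φ * sinC (freq n)) -
        (w' * sinC (freq n) * sinC (freq n) + v' * φ' * sinC (freq n)) by ring, map_sub]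
      ring
    have h1 := norm_total_le (((w - w') * sinC (freq n) + (v * φ - v' * φ')) * sinC (freq n))
    have h2 := norm_mul_mul_sinC_le n ((w - w') * sinC (freq n) + (v * φ - v' * φ'))
    have h3 := norm_add_le ((w - w') * sinC (freq n)) (v * φ - v' * φ')
    have h4 := norm_mul_mul_sinC_le n (w - w')
    rw [e1, norm_neg, norm_mul]
    norm_num only [RCLike.norm_ofNat]
    linarith

lemma jointMap_zero_le {n : ℕ} (hn : 1 ≤ n) (e : Cont × Cont) :
    ‖jointMap n (e, 0)‖ ≤ 2200 * ‖e‖ := by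
  have hv : potV (base n) e.1 0 0 = (2 : ℂ) • e.1 := by simp [potV, cont_smul_zero]
  have he := norm_nonneg e
  have hvn : ‖potV (base n) e.1 0 0‖ ≤ 2 * ‖e‖ := by
    rw [hv, norm_smul]; norm_num; exact norm_fst_le e
  have hs := norm_mul_mul_sinC_le n (potV (base n) e.1 0 0)
  have hric := ricMap_zero_le (sector_base hn) e
  rw [Prod.norm_def, Prod.norm_def, Prod.norm_def]
  simp only [jointMap, Prod.fst_zero, Prod.snd_zero, cont_smul_zero, zero_div, cont_zero_smul,
    add_zero, zero_sub, norm_neg]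
  refine max_le ?_ (max_le ?_ (max_le ?_ ?_))
  · rw [norm_smul]
    have := norm_fst_le (ricMap (base n) e 0 0)
    norm_num; linarith
  · rw [norm_smul]
    have := norm_snd_le (ricMap (base n) e 0 0)
    norm_num; linarith
  · have h1 := norm_waveInt_le (freq n) (potV (base n) e.1 0 0 * sinC (freq n))
    have h4 : ‖(freq n : ℂ)⁻¹‖ ≤ 1 / 3 := by
      have := three_lt_freq hn
      rw [norm_inv, Complex.norm_real, Real.norm_of_nonneg (by linarith), inv_le_comm₀
        (by linarith) (by norm_num)]
      linarith
    rw [norm_smul]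
    have h5 := mul_le_mul h4 h1 (norm_nonneg _) (by norm_num)
    linarith
  · have h1 := norm_total_le (potV (base n) e.1 0 0 * sinC (freq n) * sinC (freq n))
    have h2 := norm_mul_mul_sinC_le n (potV (base n) e.1 0 0 * sinC (freq n))
    rw [norm_mul]
    norm_num only [RCLike.norm_ofNat]
    linarith

lemma contDiff_jointMap (n : ℕ) : ContDiff ℂ ⊤ (jointMap n) := by
  unfold jointMap potV ricMap perSol perSol' perSol ricK waveInt
  fun_prop

set_option maxHeartbeats 1000000 in
/-- The fixed point problem has a unique small solution, and it is analytic. -/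
theorem exists_joint {n : ℕ} (hn : 1 ≤ n) : ∃ (R X φ : Cont × Cont → Cont) (H : Cont × Cont → ℂ),
    ∀ e : Cont × Cont, ‖e‖ < radius / 100000 →
      IsJoint n e (R e) (X e) (φ e) (H e) ∧
      (‖R e‖ ≤ 4400 * ‖e‖ ∧ ‖X e‖ ≤ 4400 * ‖e‖ ∧ ‖φ e‖ ≤ 4400 * ‖e‖ ∧ ‖H e‖ ≤ 4400 * ‖e‖) ∧
      (AnalyticAt ℂ R e ∧ AnalyticAt ℂ X e ∧ AnalyticAt ℂ φ e ∧ AnalyticAt ℂ H e) ∧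
      ∀ (R' X' φ' : Cont) (H' : ℂ), IsJoint n e R' X' φ' H' → ‖R'‖ ≤ radius / 1000 →
        ‖X'‖ ≤ radius / 1000 → ‖φ'‖ ≤ radius → ‖H'‖ ≤ radius / 1000 →
        R' = R e ∧ X' = X e ∧ φ' = φ e ∧ H' = H e := by
  have hr : radius = 1 / 10 ^ 6 := rfl
  obtain ⟨sol, hsol⟩ := exists_analytic_fixedPoint (E := Cont × Cont)
    (X := Cont × Cont × Cont × ℂ) (T := jointMap n) (contDiff_jointMap n) (δ := radius) (by norm_num [radius])
    (U := Metric.ball 0 (radius / 100000)) Metric.isOpen_ball (fun e he x y hx hy => by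
      rw [mem_ball_zero_iff] at he
      exact jointMap_sub_le hn (by rw [hr] at he ⊢; linarith) hx hy) (fun e he => by
      rw [mem_ball_zero_iff] at he
      refine (jointMap_zero_le hn e).trans ?_
      rw [hr] at he ⊢; linarith)
  refine ⟨fun e => (1 / 100 : ℂ) • (sol e).1 + ((sol e).2.2.2 / 3) • (1 : Cont),
    fun e => (1 / 100 : ℂ) • (sol e).2.1, fun e => (sol e).2.2.1, fun e => (sol e).2.2.2,
    fun e he => ?_⟩
  obtain ⟨h1, h2, h3, h4⟩ := hsol e (mem_ball_zero_iff.2 he)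
  -- The value of the map at zero is at most 2200‖e‖ = 100·22‖e‖, and a fixed point of a map with
  -- Lipschitz constant 1/2 is at most twice as large.
  have h5 : ‖sol e‖ ≤ 4400 * ‖e‖ := by linarith [jointMap_zero_le hn e]
  have h6 := h5
  simp only [Prod.norm_def (sol e), Prod.norm_def (sol e).2, Prod.norm_def (sol e).2.2,
    max_le_iff] at h6
  obtain ⟨na, nb, nφ, nH⟩ := h6
  have fst_of : ∀ {A B : Type} [NormedAddCommGroup A] [NormedSpace ℂ A] [NormedAddCommGroup B]
      [NormedSpace ℂ B] {g : Cont × Cont → A × B}, AnalyticAt ℂ g e →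
      AnalyticAt ℂ (fun e => (g e).1) e ∧ AnalyticAt ℂ (fun e => (g e).2) e := fun {A B} _ _ _ _ g hg =>
    ⟨((ContinuousLinearMap.fst ℂ A B).analyticAt _).comp hg,
      ((ContinuousLinearMap.snd ℂ A B).analyticAt _).comp hg⟩
  obtain ⟨a1, b1⟩ := fst_of h4
  obtain ⟨a2, b2⟩ := fst_of b1
  obtain ⟨a3, a4⟩ := fst_of b2
  refine ⟨isJoint_of_fixed h2, ⟨?_, ?_, nφ, nH⟩, ⟨?_, ?_, ?_, ?_⟩, ?_⟩
  · refine (norm_add_le _ _).trans ?_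
    rw [norm_smul, norm_smul, norm_one, norm_div]
    norm_num; linarith [norm_nonneg e]
  · rw [norm_smul]; norm_num; linarith [norm_nonneg e]
  · exact (a1.const_smul (c := (1 / 100 : ℂ))).add ((a4.div_const (c := 3)).smul analyticAt_const)
  · exact a2.const_smul (c := (1 / 100 : ℂ))
  · exact a3
  · exact a4
  · intro R' X' φ' H' hJ hR hX hφ hH
    have h7 := h3 _ ?_ (fixed_of_isJoint hJ)
    · beta_reduce
      rw [← h7]
      refine ⟨?_, ?_, rfl, rfl⟩
      · module
      · module
    · rw [Prod.norm_def, Prod.norm_def, Prod.norm_def]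
      simp only [max_le_iff]
      refine ⟨?_, ?_, hφ, ?_⟩
      · rw [norm_smul]
        have : ‖R' - (H' / 3) • (1 : Cont)‖ ≤ ‖R'‖ + ‖H'‖ / 3 := by
          refine (norm_sub_le _ _).trans ?_
          rw [norm_smul, norm_one, norm_div]; norm_num
        norm_num
        rw [hr] at hR hH ⊢; linarith
      · rw [norm_smul]; norm_num; rw [hr] at hX ⊢; linarith
      · rw [hr] at hH ⊢; linarith

/-! ### The second order equation -/

lemma Prim.hasDerivWithinAt {f f' : ℝ → ℂ} (h : Prim f f') (hc : ContinuousOn f' (Icc 0 1)) {x : ℝ}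
    (hx : x ∈ Ico (0 : ℝ) 1) : HasDerivWithinAt f (f' x) (Ici x) x := by
  set a := toCont f' hc with ha
  have h1 : HasDerivAt (fun y => f 0 + ∫ t in (0 : ℝ)..y, ext a t) (ext a x) x :=
    ((continuous_ext a).integral_hasStrictDerivAt 0 x).hasDerivAt.const_add _
  have hxm : x ∈ Icc (0 : ℝ) 1 := Ico_subset_Icc_self hx
  rw [ext_toCont hc hxm] at h1
  have h2 : ∀ y ∈ Icc (0 : ℝ) 1, f y = f 0 + ∫ t in (0 : ℝ)..y, ext a t := fun y hy => by
    rw [h.2 y hy]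
    congr 1
    exact integral_congr01 zero_mem01 hy fun t ht => (ext_toCont hc ht).symm
  refine (h1.hasDerivWithinAt (s := Ici x)).congr_of_eventuallyEq ?_ (h2 x hxm)
  filter_upwards [Ico_mem_nhdsGE hx.2] with y hy
  exact h2 y ⟨hx.1.trans hy.1, hy.2.le⟩

/-- The initial value problem `f' = a f + b g`, `g' = c f + d g` with zero data has only the zero
solution. -/
lemma Prim.eq_zero_of_system {f g a b c d : ℝ → ℂ} (ha : ContinuousOn a (Icc 0 1))
    (hb : ContinuousOn b (Icc 0 1)) (hc : ContinuousOn c (Icc 0 1)) (hd : ContinuousOn d (Icc 0 1))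
    (hf : Prim f (fun x => a x * f x + b x * g x)) (hg : Prim g (fun x => c x * f x + d x * g x))
    (hf0 : f 0 = 0) (hg0 : g 0 = 0) {x : ℝ} (hx : x ∈ Icc (0 : ℝ) 1) : f x = 0 ∧ g x = 0 := by
  have hfc := hf.continuousOn
  have hgc := hg.continuousOn
  set K := ‖toCont a ha‖ + ‖toCont b hb‖ + ‖toCont c hc‖ + ‖toCont d hd‖ with hK
  have bd : ∀ {a : ℝ → ℂ} (ha : ContinuousOn a (Icc 0 1)) {x : ℝ}, x ∈ Icc (0 : ℝ) 1 →
      ‖a x‖ ≤ ‖toCont a ha‖ := fun {a} ha {x} hx => by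
    have := norm_ext_le (toCont a ha) x
    rwa [ext_toCont ha hx] at this
  have key := eq_zero_of_abs_deriv_le_mul_abs_self_of_eq_zero_right (K := K)
    (f := fun x => (f x, g x)) (f' := fun x => (a x * f x + b x * g x, c x * f x + d x * g x))
    (a := 0) (b := 1) (hfc.prodMk hgc)
    (fun x hx => (hf.hasDerivWithinAt ((ha.mul hfc).add (hb.mul hgc)) hx).prodMk
      (hg.hasDerivWithinAt ((hc.mul hfc).add (hd.mul hgc)) hx))
    (by simp [hf0, hg0]) (fun x hx => by
      have hxm : x ∈ Icc (0 : ℝ) 1 := Ico_subset_Icc_self hx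
      have h1 : ‖f x‖ ≤ ‖(f x, g x)‖ := norm_fst_le (f x, g x)
      have h2 : ‖g x‖ ≤ ‖(f x, g x)‖ := norm_snd_le (f x, g x)
      have h3 : ∀ u v : ℂ, ∀ s t : ℝ, ‖u‖ ≤ s → ‖v‖ ≤ t → ‖u * f x + v * g x‖ ≤
          (s + t) * ‖(f x, g x)‖ := fun u v s t hs ht => by
        refine (norm_add_le _ _).trans ?_
        rw [norm_mul, norm_mul, add_mul]
        exact add_le_add (mul_le_mul hs h1 (norm_nonneg _) ((norm_nonneg _).trans hs))
          (mul_le_mul ht h2 (norm_nonneg _) ((norm_nonneg _).trans ht))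
      have h4 := h3 _ _ _ _ (bd ha hxm) (bd hb hxm)
      have h5 := h3 _ _ _ _ (bd hc hxm) (bd hd hxm)
      rw [Prod.norm_mk]
      refine max_le (h4.trans ?_) (h5.trans ?_)
      · exact mul_le_mul_of_nonneg_right (by
          rw [hK]; linarith [norm_nonneg (toCont c hc), norm_nonneg (toCont d hd)]) (norm_nonneg _)
      · exact mul_le_mul_of_nonneg_right (by
          rw [hK]; linarith [norm_nonneg (toCont a ha), norm_nonneg (toCont b hb)]) (norm_nonneg _))
  have := key x hx
  simpa using this

/-- Integrating factors. -/
lemma exists_integratingFactor {m : ℝ → ℂ} (hm : ContinuousOn m (Icc 0 1)) (c : ℂ) :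
    ∃ E : ℝ → ℂ, (Prim E fun x => c * m x * E x) ∧ (Prim (fun x => (E x)⁻¹) fun x =>
      -(c * m x * (E x)⁻¹)) ∧ E 0 = 1 ∧ ∀ x, E x ≠ 0 := by
  have h : ∀ c : ℂ, Prim (fun x => Complex.exp (c * ∫ t in (0 : ℝ)..x, ext (toCont m hm) t))
      (fun x => c * m x * Complex.exp (c * ∫ t in (0 : ℝ)..x, ext (toCont m hm) t)) := fun c => by
    refine Prim.of_hasDerivAt (fun x hx => ?_) ?_
    · have h1 := (((continuous_ext (toCont m hm)).integral_hasStrictDerivAt 0 x).hasDerivAt.const_mul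
        c).cexp
      rw [ext_toCont hm hx, mul_comm] at h1
      exact h1
    · refine (continuousOn_const.mul hm).mul (Continuous.continuousOn ?_)
      exact Complex.continuous_exp.comp (continuous_const.mul
        (intervalIntegral.continuous_primitive (fun x y => intervalIntegrable_ext _ x y) 0))
  refine ⟨_, h c, (h (-c)).congr (fun x _ => ?_) (fun x _ => ?_), by simp, fun x =>
    Complex.exp_ne_zero _⟩
  · rw [← Complex.exp_neg, neg_mul]
  · rw [← Complex.exp_neg, neg_mul]; ring_nf

/-- `f'' + Q f = 0`. -/
structure Schrod (Q f fd : ℝ → ℂ) : Prop where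
  prim : Prim f fd
  prim1 : Prim fd (fun x => -(Q x * f x))

namespace Schrod

variable {Q f fd h hd : ℝ → ℂ}

lemma eq_zero (hQ : ContinuousOn Q (Icc 0 1)) (hf : Schrod Q f fd) (f0 : f 0 = 0)
    (fd0 : fd 0 = 0) {x : ℝ} (hx : x ∈ Icc (0 : ℝ) 1) : f x = 0 ∧ fd x = 0 :=
  Prim.eq_zero_of_system (a := fun _ => 0) (b := fun _ => 1) (c := fun x => -Q x)
    (d := fun _ => 0) continuousOn_const continuousOn_const hQ.neg
    continuousOn_const (hf.prim.congr (fun _ _ => rfl) (fun _ _ => by ring))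
    (hf.prim1.congr (fun _ _ => rfl) (fun _ _ => by ring)) f0 fd0 hx

end Schrod

/-- Lagrange's identity for Dirichlet boundary conditions. -/
lemma lagrange_dirichlet {f fd a h hd b : ℝ → ℂ} (hf : Prim f fd) (hfd : Prim fd a)
    (hh : Prim h hd) (hhd : Prim hd b) (f0 : f 0 = 0) (f1 : f 1 = 0) (h0 : h 0 = 0)
    (h1 : h 1 = 0) : ∫ x in (0 : ℝ)..1, (f x * b x - a x * h x) = 0 := by
  have := ((hf.mul hhd).sub (hfd.mul hh)).integral
  simp only [f0, f1, h0, h1, zero_mul, mul_zero, sub_zero] at this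
  rw [← this]
  exact intervalIntegral.integral_congr fun x _ => by ring

/-- Used twice: against sin κx, to obtain the orthogonality condition of the fixed point problem,
and for two different coefficients, as the starting point of the formula for the difference of
eigenvalues. -/
lemma Schrod.integral_mul {Q Q' f fd h hd : ℝ → ℂ} (hf : Schrod Q f fd) (hh : Schrod Q' h hd)
    (f0 : f 0 = 0) (f1 : f 1 = 0) (h0 : h 0 = 0) (h1 : h 1 = 0) :
    ∫ x in (0 : ℝ)..1, (Q x - Q' x) * f x * h x = 0 := by
  rw [← lagrange_dirichlet hf.prim hf.prim1 hh.prim hh.prim1 f0 f1 h0 h1]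
  exact intervalIntegral.integral_congr fun x _ => by ring

/-- The operator `a ↦ ∫₀ˣ cos κ(x-t) a(t) dt`. -/
def waveInt' (κ : ℂ) (a : Cont) : Cont :=
  cosC κ * volterra (cosC κ * a) + sinC κ * volterra (sinC κ * a)

lemma prim_waveInt (κ : ℂ) (a : Cont) :
    Prim (ext (waveInt κ a)) (fun x => κ * ext (waveInt' κ a) x) := by
  refine (((prim_sin κ).mul (prim_volterra (cosC κ * a))).sub
    ((prim_cos κ).mul (prim_volterra (sinC κ * a)))).congr (fun x hx => ?_) (fun x hx => ?_)
  · simp only [waveInt, ext_sub, ext_mul, ext_sinC κ hx, ext_cosC κ hx]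
  · simp only [waveInt', ext_add, ext_mul, ext_sinC κ hx, ext_cosC κ hx]; ring

lemma prim_waveInt' (κ : ℂ) (a : Cont) :
    Prim (ext (waveInt' κ a)) (fun x => ext a x - κ * ext (waveInt κ a) x) := by
  refine (((prim_cos κ).mul (prim_volterra (cosC κ * a))).add
    ((prim_sin κ).mul (prim_volterra (sinC κ * a)))).congr (fun x hx => ?_) (fun x hx => ?_)
  · simp only [waveInt', ext_add, ext_mul, ext_sinC κ hx, ext_cosC κ hx]
  · simp only [waveInt, ext_sub, ext_mul, ext_sinC κ hx, ext_cosC κ hx]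
    linear_combination (-ext a x) * Complex.sin_sq_add_cos_sq (κ * x)

lemma waveInt_zero (κ : ℂ) (a : Cont) : ext (waveInt κ a) 0 = 0 ∧ ext (waveInt' κ a) 0 = 0 := by
  simp [waveInt, waveInt', ext_volterra _ zero_mem01]

/-- Variation of constants. -/
lemma Schrod.variation {κ : ℂ} {v F : Cont} {Q f fd : ℝ → ℂ} (hf : Schrod Q f fd)
    (hQ : ∀ x ∈ Icc (0 : ℝ) 1, Q x = κ ^ 2 + ext v x) (hF : ∀ x ∈ Icc (0 : ℝ) 1, f x = ext F x)
    (f0 : f 0 = 0) : κ • F = fd 0 • sinC κ - waveInt κ (v * F) ∧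
      ∀ x ∈ Icc (0 : ℝ) 1, fd x = fd 0 * Complex.cos (κ * x) - ext (waveInt' κ (v * F)) x := by
  have key : ∀ x ∈ Icc (0 : ℝ) 1, κ * f x - (fd 0 * Complex.sin (κ * x) -
      ext (waveInt κ (v * F)) x) = 0 ∧ fd x - (fd 0 * Complex.cos (κ * x) -
        ext (waveInt' κ (v * F)) x) = 0 := fun x hx =>
    Prim.eq_zero_of_system (a := fun _ => 0) (b := fun _ => κ) (c := fun _ => -κ)
      (d := fun _ => 0) (f := fun x => κ * f x - (fd 0 * Complex.sin (κ * x) -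
        ext (waveInt κ (v * F)) x))
      (g := fun x => fd x - (fd 0 * Complex.cos (κ * x) - ext (waveInt' κ (v * F)) x))
      continuousOn_const continuousOn_const continuousOn_const continuousOn_const
      (((hf.prim.const_mul κ).sub (((prim_sin κ).const_mul (fd 0)).sub (prim_waveInt κ _))).congr
        (fun _ _ => rfl) (fun x _ => by ring))
      ((hf.prim1.sub (((prim_cos κ).const_mul (fd 0)).sub (prim_waveInt' κ _))).congr
        (fun _ _ => rfl) (fun x hx => by
          rw [hQ x hx, ext_mul, ← hF x hx]; ring))
      (by simp [f0, (waveInt_zero κ _).1]) (by simp [(waveInt_zero κ _).2]) hx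
  refine ⟨cont_ext fun x hx => ?_, fun x hx => sub_eq_zero.1 (key x hx).2⟩
  rw [ext_smul, ext_sub, ext_smul, ← hF x hx, ext_sinC _ hx]
  exact sub_eq_zero.1 (key x hx).1

/-- Converse of `Schrod.variation` for the normalization f'(0) = κ. -/
lemma Schrod.of_wave {κ : ℂ} (hκ : κ ≠ 0) {v F : Cont} (h : κ • F = κ • sinC κ - waveInt κ (v * F)) :
    Schrod (fun x => κ ^ 2 + ext v x) (ext F)
      (fun x => κ * Complex.cos (κ * x) - ext (waveInt' κ (v * F)) x) := by
  have hF : ∀ x ∈ Icc (0 : ℝ) 1, κ * ext F x = κ * Complex.sin (κ * x) -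
      ext (waveInt κ (v * F)) x := fun x hx => by
    rw [← ext_smul, h, ext_sub, ext_smul, ext_sinC _ hx]
  constructor
  · refine (((prim_sin κ).sub ((prim_waveInt κ (v * F)).const_mul κ⁻¹))).congr (fun x hx => ?_)
      (fun x _ => by field_simp)
    have := hF x hx
    field_simp
    linear_combination this
  · refine (((prim_cos κ).const_mul κ).sub (prim_waveInt' κ (v * F))).congr (fun _ _ => rfl)
      (fun x hx => ?_)
    rw [ext_mul]
    linear_combination (-κ) * hF x hx

/-! ### The factorization of the third order operator -/

/-- `v = y'`, `w = y'' + p y` and `w' + p y' + q y = l y + F`. -/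
structure Triple (p q : ℝ → ℂ) (l : ℂ) (F y v w : ℝ → ℂ) : Prop where
  prim_y : Prim y v
  prim_v : Prim v (fun x => w x - p x * y x)
  prim_w : Prim w (fun x => (l - q x) * y x - p x * v x + F x)

/-- The expression `y'' + m y' + (2p + m² - m') y` in terms of `y`, `v = y'`, `w = y'' + p y`. -/
def secondOrder (p m m1 y v w : ℝ → ℂ) (x : ℝ) : ℂ :=
  w x + m x * v x + (p x + m x ^ 2 - m1 x) * y x

namespace Triple

variable {p dp q : ℝ → ℂ} {l : ℂ} {F y v w F' y' v' w' m m1 E : ℝ → ℂ}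

lemma sub_mul (c : ℂ) (h : Triple p q l F y v w) (h' : Triple p q l F' y' v' w') :
    Triple p q l (fun x => F x - c * F' x) (fun x => y x - c * y' x) (fun x => v x - c * v' x)
      (fun x => w x - c * w' x) :=
  ⟨h.prim_y.sub (h'.prim_y.const_mul c),
    (h.prim_v.sub (h'.prim_v.const_mul c)).congr (fun _ _ => rfl) (fun _ _ => by ring),
    (h.prim_w.sub (h'.prim_w.const_mul c)).congr (fun _ _ => rfl) (fun _ _ => by ring)⟩

/-- This is the factorization: the derivative of the second order expression, minus m times it,
reproduces 𝓛y − λy exactly because m solves the Riccati equation. -/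
lemma prim_secondOrder (hp : Prim p dp) (hm : Riccati p dp q l m m1) (h : Triple p q l F y v w) :
    Prim (secondOrder p m m1 y v w) (fun x => m x * secondOrder p m m1 y v w x + F x) := by
  refine ((h.prim_w.add (hm.prim.mul h.prim_v)).add
    (((hp.add (hm.prim.mul hm.prim)).sub hm.prim1).mul h.prim_y)).congr (fun x _ => ?_)
      (fun x _ => ?_)
  · simp only [secondOrder]; ring
  · simp only [secondOrder]; ring

/-- The potential of the reduced second order equation. -/
def _root_.ThreePoint.reducedPot (p m m1 : ℝ → ℂ) (x : ℝ) : ℂ :=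
  2 * p x + 3 / 4 * m x ^ 2 - 3 / 2 * m1 x

/-- Liouville's substitution: E = exp(½∫m) removes the first order term of D² + mD + 2p + m² − m',
and the remaining potential is 2p + ¾m² − (3/2)m'. -/
lemma prim_reduced (hm : Riccati p dp q l m m1) (hE : Prim E (fun x => 1 / 2 * m x * E x))
    (h : Triple p q l F y v w) :
    Prim (fun x => E x * y x) (fun x => E x * (v x + m x * y x / 2)) ∧
    Prim (fun x => E x * (v x + m x * y x / 2)) (fun x => -(reducedPot p m m1 x * (E x * y x)) +
      E x * secondOrder p m m1 y v w x) := by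
  constructor
  · exact (hE.mul h.prim_y).congr (fun _ _ => rfl) (fun x _ => by ring)
  · refine (hE.mul (h.prim_v.add ((hm.prim.mul h.prim_y).const_mul (1 / 2)))).congr
      (fun x _ => by ring) (fun x _ => ?_)
    simp only [secondOrder, reducedPot]; ring

/-- Undoing the substitution, y = f/E is annihilated by the right factor, hence by the whole third
order operator. The formula for w is that of `secondOrder` set equal to zero. -/
lemma of_reduced {f fd : ℝ → ℂ} (hp : Prim p dp) (hm : Riccati p dp q l m m1)
    (hE : Prim (fun x => (E x)⁻¹) (fun x => -(1 / 2 * m x * (E x)⁻¹)))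
    (hf : Schrod (reducedPot p m m1) f fd) :
    Triple p q l (fun _ => 0) (fun x => f x * (E x)⁻¹) (fun x => (fd x - m x * f x / 2) * (E x)⁻¹)
      (fun x => -(m x * (fd x - m x * f x / 2) * (E x)⁻¹) -
        (p x + m x ^ 2 - m1 x) * f x * (E x)⁻¹) := by
  have h1 : Prim (fun x => f x * (E x)⁻¹) (fun x => (fd x - m x * f x / 2) * (E x)⁻¹) :=
    (hf.prim.mul hE).congr (fun _ _ => rfl) (fun x _ => by ring)
  have h2 : Prim (fun x => (fd x - m x * f x / 2) * (E x)⁻¹)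
      (fun x => (-(reducedPot p m m1 x * f x) - m1 x * f x / 2 - m x * fd x / 2) * (E x)⁻¹ -
        m x / 2 * (fd x - m x * f x / 2) * (E x)⁻¹) :=
    ((hf.prim1.sub ((hm.prim.mul hf.prim).const_mul (1 / 2))).mul hE).congr
      (fun x _ => by ring) (fun x _ => by ring)
  refine ⟨h1, h2.congr (fun _ _ => rfl) (fun x _ => ?_), ?_⟩
  · simp only [reducedPot]; ring
  · refine ((hm.prim.mul h2).neg.sub
      (((hp.add (hm.prim.mul hm.prim)).sub hm.prim1).mul h1)).congr (fun x _ => by ring)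
      (fun x _ => ?_)
    simp only [reducedPot]; ring

end Triple

/-- A solution of the third order equation on `[0, 2]`, given by its restrictions to `[0, 1]` and
`[1, 2]`, that vanishes at `0`, `1`, `2`. -/
structure Pair (p q : ℝ → ℂ) (l : ℂ) (F₁ F₂ y₁ v₁ w₁ y₂ v₂ w₂ : ℝ → ℂ) : Prop where
  fst : Triple p q l F₁ y₁ v₁ w₁
  snd : Triple p q l F₂ y₂ v₂ w₂
  y₁_zero : y₁ 0 = 0
  y₁_one : y₁ 1 = 0
  y₂_zero : y₂ 0 = 0
  y₂_one : y₂ 1 = 0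
  match_v : v₁ 1 = v₂ 0
  match_w : w₁ 1 = w₂ 0

/-! ### Periodic solutions of perturbed second order equations -/

/-- Periodic solutions of `(D - ρ₁) (D - ρ₂) u + α u' + β u = b`. -/
structure PerEq (ρ₁ ρ₂ : ℂ) (α β b : Cont) (u u1 : ℝ → ℂ) : Prop where
  prim : Prim u u1
  prim1 : Prim u1 (fun x => (ρ₁ + ρ₂) * u1 x - ρ₁ * ρ₂ * u x - ext α x * u1 x - ext β x * u x +
    ext b x)
  per : u 0 = u 1
  per1 : u1 0 = u1 1

/-- Conditions under which `(D - ρ₁) (D - ρ₂)` dominates a perturbation `α D + β`. -/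
structure Dominates (z ρ₁ ρ₂ : ℂ) (α β : Cont) : Prop where
  sector : Sector z
  re₁ : z.re ≤ |ρ₁.re|
  re₂ : z.re ≤ |ρ₂.re|
  norm₁ : ‖ρ₁‖ ≤ 2 * ‖z‖
  norm₂ : ‖ρ₂‖ ≤ 2 * ‖z‖
  norm_α : ‖α‖ ≤ ‖z‖ / 20
  norm_β : ‖β‖ ≤ ‖z‖ ^ 2 / 20

namespace Dominates

variable {z ρ₁ ρ₂ : ℂ} {α β : Cont} (h : Dominates z ρ₁ ρ₂ α β)
include h

lemma ne₁ : ρ₁.re ≠ 0 := fun h' => by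
  have := h.re₁
  rw [h', abs_zero] at this
  linarith [h.sector.re_pos]

lemma ne₂ : ρ₂.re ≠ 0 := fun h' => by
  have := h.re₂
  rw [h', abs_zero] at this
  linarith [h.sector.re_pos]

lemma norm_perSol_le (F : Cont) : ‖z‖ ^ 2 * ‖perSol ρ₁ ρ₂ F 0‖ ≤ 2 * ‖F‖ ∧
    ‖z‖ * ‖perSol' ρ₁ ρ₂ F 0‖ ≤ 5 * ‖F‖ := by
  have hz := h.sector.norm_pos
  obtain ⟨h1, h2⟩ := h.sector.perSol_bound h.re₁ h.re₂ h.norm₁ h.norm₂ F 0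
  rw [norm_zero, mul_zero, add_zero] at h1 h2
  rw [le_div_iff₀ hz] at h1 h2
  exact ⟨by nlinarith, by linarith⟩

/-- With the bounds 1/20 in `Dominates` the perturbation contributes 5/20 + 2/20 < 1/2. -/
lemma norm_pert_le (F : Cont) :
    ‖α * perSol' ρ₁ ρ₂ F 0 + β * perSol ρ₁ ρ₂ F 0‖ ≤ 1 / 2 * ‖F‖ := by
  obtain ⟨h1, h2⟩ := h.norm_perSol_le F
  have e1 : ‖α * perSol' ρ₁ ρ₂ F 0‖ ≤ ‖z‖ / 20 * ‖perSol' ρ₁ ρ₂ F 0‖ :=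
    (norm_mul_le _ _).trans (mul_le_mul_of_nonneg_right h.norm_α (norm_nonneg _))
  have e2 : ‖β * perSol ρ₁ ρ₂ F 0‖ ≤ ‖z‖ ^ 2 / 20 * ‖perSol ρ₁ ρ₂ F 0‖ :=
    (norm_mul_le _ _).trans (mul_le_mul_of_nonneg_right h.norm_β (norm_nonneg _))
  have := norm_add_le (α * perSol' ρ₁ ρ₂ F 0) (β * perSol ρ₁ ρ₂ F 0)
  linarith [norm_nonneg F]

/-- The unknown is the source F with u = `perSol` of F. The equation becomes F = b − A F with a
linear A of norm at most 1/2, a Neumann series. -/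
lemma exists_perEq (b : Cont) : ∃ u u1 : Cont, PerEq ρ₁ ρ₂ α β b (ext u) (ext u1) := by
  set A : Cont → Cont := fun F => α * perSol' ρ₁ ρ₂ F 0 + β * perSol ρ₁ ρ₂ F 0 with hA
  have hsub : ∀ F F', A F - A F' = A (F - F') := fun F F' => by
    simp only [hA]
    rw [← perSol_sub, ← perSol'_sub]
    ring
  have hc : ContractingWith (1 / 2) (fun F => b - A F) := by
    refine ⟨by rw [← NNReal.coe_lt_coe]; norm_num, LipschitzWith.of_dist_le_mul fun F F' => ?_⟩
    rw [dist_eq_norm, dist_eq_norm, sub_sub_sub_cancel_left, hsub, norm_sub_rev]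
    exact h.norm_pert_le _
  obtain ⟨F, hF⟩ : ∃ F, b - A F = F := ⟨hc.fixedPoint, hc.fixedPoint_isFixedPt⟩
  have hG : Prim (ext (0 : Cont)) (fun _ => 0) := (Prim.const 0).congr (fun _ _ => by simp)
    (fun _ _ => rfl)
  refine ⟨perSol ρ₁ ρ₂ F 0, perSol' ρ₁ ρ₂ F 0, prim_perSol (ρ₂ := ρ₂) h.ne₁ F 0,
    (prim_perSol' h.ne₁ h.ne₂ F hG).congr (fun _ _ => rfl) (fun x _ => ?_),
    perSol_periodic h.ne₁ F 0, perSol'_periodic h.ne₁ h.ne₂ F (by simp)⟩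
  have := congrArg (fun a => ext a x) hF
  simp only [hA, ext_sub, ext_add, ext_mul] at this
  linear_combination this

lemma perEq_le {b : Cont} {u u1 : ℝ → ℂ} (hu : PerEq ρ₁ ρ₂ α β b u u1) {x : ℝ}
    (hx : x ∈ Icc (0 : ℝ) 1) : ‖z‖ ^ 2 * ‖u x‖ ≤ 4 * ‖b‖ ∧ ‖z‖ * ‖u1 x‖ ≤ 10 * ‖b‖ := by
  have hz := h.sector.norm_pos
  set U := toCont u hu.prim.continuousOn
  set U1 := toCont u1 hu.prim1.continuousOn
  set F := b - α * U1 - β * U with hF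
  have hG : Prim (ext (0 : Cont)) (fun _ => 0) := (Prim.const 0).congr (fun _ _ => by simp)
    (fun _ _ => rfl)
  have key := fun x (hx : x ∈ Icc (0 : ℝ) 1) => eq_perSol (f := ext F) h.ne₁ h.ne₂ F hG (by simp)
    hu.prim (fun _ _ => rfl) (hu.prim1.congr (fun _ _ => rfl) (fun x hx => by
      rw [hF, ext_sub, ext_sub, ext_mul, ext_mul, ext_toCont _ hx, ext_toCont _ hx]; ring))
    hu.per hu.per1 hx
  have hU : U = perSol ρ₁ ρ₂ F 0 := cont_ext fun x hx => by
    rw [ext_toCont _ hx, (key x hx).1]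
  have hU1 : U1 = perSol' ρ₁ ρ₂ F 0 := cont_ext fun x hx => by
    rw [ext_toCont _ hx, (key x hx).2]
  have h1 := h.norm_pert_le F
  rw [← hU, ← hU1] at h1
  have h2 : ‖F‖ ≤ 2 * ‖b‖ := by
    have : F = b - (α * U1 + β * U) := by rw [hF]; ring
    have h3 := norm_sub_le b (α * U1 + β * U)
    rw [← this] at h3
    linarith
  obtain ⟨h3, h4⟩ := h.norm_perSol_le F
  rw [(key x hx).1, (key x hx).2]
  constructor
  · calc _ ≤ ‖z‖ ^ 2 * ‖perSol ρ₁ ρ₂ F 0‖ := by gcongr; exact norm_ext_le _ _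
      _ ≤ _ := by linarith
  · calc _ ≤ ‖z‖ * ‖perSol' ρ₁ ρ₂ F 0‖ := by gcongr; exact norm_ext_le _ _
      _ ≤ _ := by linarith

end Dominates

/-! ### Factorized equations with small coefficients -/

/-- The function `z + z⁻¹ R`. -/
def mfun (z : ℂ) (R : Cont) (x : ℝ) : ℂ := z + z⁻¹ * ext R x

/-- A factorization of the third order operator with small coefficients. -/
structure Factor (p dp q : ℝ → ℂ) (e : Cont × Cont) (z : ℂ) (R X : Cont) (l : ℂ) : Prop where
  coeffs : Coeffs p dp q e
  sector : Sector z
  riccati : Riccati p dp q l (mfun z R) (ext X)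
  norm_e : ‖e‖ ≤ radius
  norm_R : ‖R‖ ≤ radius
  norm_X : ‖X‖ ≤ radius

namespace Factor

variable {p dp q : ℝ → ℂ} {e : Cont × Cont} {z : ℂ} {R X : Cont} {l : ℂ}
  (h : Factor p dp q e z R X l)
include h

lemma reducedPot_eq {x : ℝ} (hx : x ∈ Icc (0 : ℝ) 1) :
    reducedPot p (mfun z R) (ext X) x = 3 / 4 * z ^ 2 + ext (potV z e.1 R X) x := by
  have hz := h.sector.ne_zero
  simp only [reducedPot, mfun, potV, ext_add, ext_sub, ext_smul, ext_mul, h.coeffs.ext_p x hx]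
  field_simp
  ring

lemma continuousOn_reducedPot : ContinuousOn (reducedPot p (mfun z R) (ext X)) (Icc 0 1) := by
  refine ContinuousOn.congr (f := fun x => 3 / 4 * z ^ 2 + ext (potV z e.1 R X) x) ?_
    (fun x hx => h.reducedPot_eq hx)
  fun_prop

omit h in
/-- The first order coefficient of the perturbation of `D² + 3zD + 3z²`. -/
def alpha (z : ℂ) (R : Cont) : Cont := (3 * z⁻¹) • R

omit h in
/-- The zeroth order coefficient of the perturbation of `D² + 3zD + 3z²`. -/
def beta (z : ℂ) (P R : Cont) : Cont :=
  (6 : ℂ) • R + (3 * (z ^ 2)⁻¹) • (R * R) + (2 : ℂ) • P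

lemma inv_norm_le : ‖z⁻¹‖ ≤ 3 := by
  rw [norm_inv, inv_le_comm₀ h.sector.norm_pos (by norm_num)]
  linarith [h.sector.le_norm]

lemma norm_alpha_le : ‖alpha z R‖ ≤ 9 * ‖R‖ := by
  rw [alpha, norm_smul, norm_mul]
  norm_num
  have := h.inv_norm_le
  rw [norm_inv] at this
  nlinarith [norm_nonneg R]

lemma norm_beta_le : ‖beta z e.1 R‖ ≤ 7 * ‖R‖ + 2 * ‖e‖ := by
  have hr : radius = 1 / 10 ^ 6 := rfl
  have h9 := h.sector.inv_bounds.1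
  have h1 : ‖(3 * (z ^ 2)⁻¹) • (R * R)‖ ≤ 27 * (radius * ‖R‖) := by
    rw [norm_smul, norm_mul]
    have := (norm_mul_le R R).trans (mul_le_mul_of_nonneg_right h.norm_R (norm_nonneg R))
    have h3 : ‖(3 : ℂ)‖ * ‖(z ^ 2)⁻¹‖ ≤ 27 := by norm_num at h9 ⊢; linarith
    exact mul_le_mul h3 this (norm_nonneg _) (by norm_num)
  have h2 : ‖(6 : ℂ) • R‖ = 6 * ‖R‖ := by rw [norm_smul]; norm_num
  have h3 : ‖(2 : ℂ) • e.1‖ ≤ 2 * ‖e‖ := by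
    rw [norm_smul]; norm_num; exact norm_fst_le e
  have := norm_add₃_le (a := (6 : ℂ) • R) (b := (3 * (z ^ 2)⁻¹) • (R * R)) (c := (2 : ℂ) • e.1)
  rw [beta]
  rw [hr] at h1
  linarith [norm_nonneg R]

lemma dominates : Dominates z (-rho z) (-rho' z) (alpha z R) (beta z e.1 R) := by
  have hr : radius = 1 / 10 ^ 6 := rfl
  have hz := h.sector
  have h1 := h.norm_alpha_le
  have h2 := h.norm_beta_le
  have h3 := h.norm_R
  have h4 := h.norm_e
  have h5 := hz.le_norm
  rw [hr] at h3 h4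
  exact ⟨hz, by rw [Complex.neg_re, abs_neg]; exact hz.re_le_rho.1.trans (le_abs_self _),
    by rw [Complex.neg_re, abs_neg]; exact hz.re_le_rho.2.trans (le_abs_self _),
    by rw [norm_neg]; exact Sector.norm_rho.1, by rw [norm_neg]; exact Sector.norm_rho.2,
    by linarith, by nlinarith⟩

/-- With these `alpha` and `beta` the perturbed operator is D² + 3mD + 3m² + 2p. It is the second
factor conjugated by exp ∫m, and also the operator in the equation for the gradient. -/
lemma perEq_iff_coeff {x : ℝ} (hx : x ∈ Icc (0 : ℝ) 1) (u u1 : ℂ) :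
    (-rho z + -rho' z) * u1 - -rho z * -rho' z * u - ext (alpha z R) x * u1 -
      ext (beta z e.1 R) x * u = -(3 * mfun z R x * u1) - (3 * mfun z R x ^ 2 + 2 * p x) * u := by
  have hz := h.sector.ne_zero
  rw [neg_mul_neg, rho_mul, ← neg_add, rho_add]
  simp only [alpha, beta, mfun, ext_add, ext_smul, ext_mul, h.coeffs.ext_p x hx]
  field_simp
  ring

/-- There is no solution `y` with `y(x + 1) = τ y(x)`, where `τ` is the multiplier of the first
order factor. -/
lemma eq_zero_of_multiplier {E y v w : ℝ → ℂ}
    (hE' : Prim (fun x => (E x)⁻¹) (fun x => -(1 / 2 * mfun z R x * (E x)⁻¹)))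
    (E0 : E 0 = 1) (hE0 : ∀ x, E x ≠ 0) (hT : Triple p q l (fun _ => 0) y v w) (y0 : y 0 = 0)
    (y1 : y 1 = 0) (hv : v 1 = E 1 ^ 2 * v 0) {x : ℝ} (hx : x ∈ Icc (0 : ℝ) 1) : y x = 0 := by
  set m := mfun z R with hm
  set G := secondOrder p m (ext X) y v w with hG
  have hF : Prim (fun x => (E x)⁻¹ ^ 2) (fun x => -(m x * (E x)⁻¹ ^ 2)) :=
    (hE'.mul hE').congr (fun x _ => by ring) (fun x _ => by ring)
  have hGc : ∀ x ∈ Icc (0 : ℝ) 1, G x * (E x)⁻¹ ^ 2 = G 0 := fun x hx => by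
    have := ((hT.prim_secondOrder h.coeffs.prim_p h.riccati).mul hF).eq_of_zero
      (fun x _ => by ring) hx
    rw [this, E0, inv_one, one_pow, mul_one]
  -- E² = exp ∫m is the solution of the first order factor, so Y = y/E² is periodic exactly when
  -- y(x+1) = τy(x). It satisfies Y'' + 3mY' + (3m² + 2p)Y = G(0), a constant right side.
  have hY : Prim (fun x => y x * (E x)⁻¹ ^ 2) (fun x => (v x - m x * y x) * (E x)⁻¹ ^ 2) :=
    (hT.prim_y.mul hF).congr (fun _ _ => rfl) (fun x _ => by ring)
  have hz := h.sector.ne_zero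
  have hn := h.sector.norm_pos
  -- The constant c is the solution for the leading part. The difference Y − c has source −cβ with
  -- |β| ≤ |z|²/20, hence |Y − c| ≤ |c|/5 everywhere; but Y(0) = 0, so c = 0 and then Y = 0.
  set c := G 0 / (3 * z ^ 2) with hc
  have hper : PerEq (-rho z) (-rho' z) (alpha z R) (beta z e.1 R) (-(c • beta z e.1 R))
      (fun x => y x * (E x)⁻¹ ^ 2 - c) (fun x => (v x - m x * y x) * (E x)⁻¹ ^ 2) := by
    constructor
    · exact (hY.sub (Prim.const c)).congr (fun _ _ => rfl) (fun x _ => by ring)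
    · refine ((hT.prim_v.sub (h.riccati.prim.mul hT.prim_y)).mul hF).congr (fun x _ => rfl)
        (fun x hx => ?_)
      rw [h.perEq_iff_coeff hx, ← hm]
      have e1 : ext (-(c • beta z e.1 R)) x = -c * (3 * m x ^ 2 + 2 * p x - 3 * z ^ 2) := by
        have hb : ext (beta z e.1 R) x = 3 * m x ^ 2 + 2 * p x - 3 * z ^ 2 := by
          simp only [beta, hm, mfun, ext_add, ext_smul, ext_mul, h.coeffs.ext_p x hx]
          field_simp
          ring
        rw [ext_neg, ext_smul, hb]; ring
      have e2 : c * (3 * z ^ 2) = G 0 := by rw [hc]; field_simp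
      have e3 : (w x + m x * v x + (p x + m x ^ 2 - ext X x) * y x) * (E x)⁻¹ ^ 2 = G 0 := hGc x hx
      rw [e1]
      linear_combination e2 - e3
    · simp [y0, y1]
    · simp only [y0, y1, hv, E0]
      have := hE0 1
      field_simp
      ring
  have hb := (h.dominates.perEq_le hper zero_mem01).1
  simp only [y0, zero_mul, zero_sub, norm_neg, norm_smul] at hb
  have hβ := h.dominates.norm_β
  have hc0 : ‖c‖ = 0 := by
    have h1 : ‖z‖ ^ 2 * ‖c‖ ≤ ‖z‖ ^ 2 * ‖c‖ / 5 := by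
      nlinarith [norm_nonneg c, mul_le_mul_of_nonneg_left hβ (norm_nonneg c)]
    have h2 : 0 < ‖z‖ ^ 2 := by positivity
    have h3 : ‖z‖ ^ 2 * ‖c‖ ≤ 0 := by linarith
    exact le_antisymm (by nlinarith [norm_nonneg c]) (norm_nonneg c)
  have hb := (h.dominates.perEq_le hper hx).1
  have hc1 : c = 0 := norm_eq_zero.1 hc0
  rw [hc1, cont_zero_smul, neg_zero, norm_zero, mul_zero, sub_zero] at hb
  have h2 : 0 < ‖z‖ ^ 2 := by positivity
  have h3 : ‖y x * (E x)⁻¹ ^ 2‖ = 0 := le_antisymm (by nlinarith) (norm_nonneg _)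
  have h4 := norm_eq_zero.1 h3
  have h5 : (E x)⁻¹ ^ 2 ≠ 0 := pow_ne_zero _ (inv_ne_zero (hE0 x))
  exact (mul_eq_zero.1 h4).resolve_right h5

end Factor

/-! ### Zeros of perturbed sines -/

lemma norm_csin_le (w : ℂ) : ‖Complex.sin w‖ ≤ Real.exp |w.im| := by
  have h : ∀ t : ℂ, |t.re| = |w.im| → ‖Complex.exp t‖ ≤ Real.exp |w.im| := fun t ht => by
    rw [Complex.norm_exp]
    exact Real.exp_le_exp.2 (ht ▸ le_abs_self _)
  have h1 := h (-w * Complex.I) (by simp)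
  have h2 := h (w * Complex.I) (by simp)
  rw [Complex.sin, norm_div, norm_mul, Complex.norm_I, mul_one]
  have := norm_sub_le (Complex.exp (-w * Complex.I)) (Complex.exp (w * Complex.I))
  rw [Complex.norm_ofNat]
  linarith

lemma normSq_csin (a b : ℝ) :
    ‖Complex.sin (a + b * Complex.I)‖ ^ 2 = Real.sin a ^ 2 + Real.sinh b ^ 2 := by
  rw [← Complex.normSq_eq_norm_sq, Complex.normSq_apply, Complex.sin_add_mul_I,
    ← Complex.ofReal_sin, ← Complex.ofReal_cos, ← Complex.ofReal_sinh, ← Complex.ofReal_cosh]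
  have h1 := Real.sin_sq_add_cos_sq a
  have h2 := Real.cosh_sq b
  simp only [Complex.add_re, Complex.mul_re, Complex.ofReal_re, Complex.ofReal_im, Complex.I_re,
    Complex.I_im, Complex.add_im, Complex.mul_im]
  linear_combination (Real.sin a ^ 2) * h2 + (Real.sinh b ^ 2) * h1

/-- After subtraction of the nearest multiple of π, |sin(a + ib)|² = sin²a + sinh²b. The bound on
sinh b forces |b| ≤ (5/4)η, so the exponential is harmless, and then |sin a| ≥ (2/π)|a| gives |a| ≤
2η. -/
lemma exists_nat_near {κ : ℂ} (hκ : 0 < κ.re) {η : ℝ} (hη : η ≤ 1 / 10)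
    (h : ‖Complex.sin κ‖ ≤ η * Real.exp |κ.im|) : ∃ n : ℕ, ‖κ - freq n‖ ≤ 6 * η := by
  have hπ := Real.pi_pos
  have h0 : 0 ≤ round (κ.re / Real.pi) := by
    rw [round_eq]
    exact Int.floor_nonneg.2 (by positivity)
  obtain ⟨n, hn⟩ := Int.eq_ofNat_of_zero_le h0
  refine ⟨n, ?_⟩
  set a := κ.re - freq n with ha
  set b := κ.im with hb
  have e : κ - freq n = a + b * Complex.I := by
    apply Complex.ext <;> simp [ha, hb]
  have hsin : ‖Complex.sin (a + b * Complex.I)‖ ≤ η * Real.exp |b| := by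
    rw [← e, freq]
    have : κ - ((Real.pi * n : ℝ) : ℂ) = κ - (n : ℕ) * Real.pi := by push_cast; ring
    rw [this, Complex.sin_antiperiodic.sub_nat_mul_eq, norm_mul]
    simpa using h
  have hη0 : 0 ≤ η := by
    by_contra hc
    have := (norm_nonneg _).trans hsin
    nlinarith [Real.exp_pos |b|]
  have ha2 : |a| ≤ Real.pi / 2 := by
    have h1 := abs_sub_round (κ.re / Real.pi)
    rw [hn] at h1
    have : a = Real.pi * (κ.re / Real.pi - ((n : ℤ) : ℝ)) := by
      rw [ha, freq]; push_cast; field_simp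
    rw [this, abs_mul, abs_of_pos hπ]
    nlinarith
  have hsq := normSq_csin a b
  have hE := Real.exp_pos |b|
  have hsh : |Real.sinh b| ≤ η * Real.exp |b| := by
    refine le_trans ?_ hsin
    exact abs_le_of_sq_le_sq (by nlinarith [sq_nonneg (Real.sin a)]) (norm_nonneg _)
  have hsa : |Real.sin a| ≤ η * Real.exp |b| := by
    refine le_trans ?_ hsin
    exact abs_le_of_sq_le_sq (by nlinarith [sq_nonneg (Real.sinh b)]) (norm_nonneg _)
  have hb1 : |b| ≤ 5 / 4 * η := by
    rw [Real.abs_sinh, Real.sinh_eq] at hsh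
    have h1 : Real.exp |b| * Real.exp (-|b|) = 1 := by rw [← Real.exp_add]; simp
    have h3 : Real.exp (-|b|) * (1 + |b| + |b|) ≤ Real.exp |b| := by
      have h4 := Real.add_one_le_exp (|b| + |b|)
      rw [Real.exp_add] at h4
      have h5 := Real.exp_pos (-|b|)
      nlinarith
    have h5 := Real.exp_pos (-|b|)
    -- `e^{-|b|} ≥ (1 - 2η) e^{|b|}`
    have h6 : (1 - 2 * η) * Real.exp |b| ≤ Real.exp (-|b|) := by linarith
    have h7 : (1 - 2 * η) * (Real.exp (-|b|) * (1 + |b| + |b|)) ≤ Real.exp (-|b|) :=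
      (mul_le_mul_of_nonneg_left h3 (by linarith)).trans h6
    have h8 : (1 - 2 * η) * (1 + |b| + |b|) ≤ 1 := by
      by_contra hc
      push Not at hc
      nlinarith
    nlinarith [abs_nonneg b]
  have hexp : Real.exp |b| ≤ 6 / 5 := by
    have h1 : |b| ≤ 1 / 8 := by linarith
    have h2 := Real.abs_exp_sub_one_sub_id_le (x := |b|) (by rw [abs_abs]; linarith)
    have h3 := (abs_le.1 h2).2
    nlinarith [abs_nonneg b]
  have ha1 : |a| ≤ 2 * η := by
    have h1 := Real.mul_abs_le_abs_sin ha2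
    have h2 : η * Real.exp |b| ≤ 6 / 5 * η := by nlinarith
    have h3 : 2 / Real.pi * |a| ≤ 6 / 5 * η := h1.trans (hsa.trans h2)
    rw [div_mul_eq_mul_div, div_le_iff₀ hπ] at h3
    nlinarith [Real.pi_lt_d2]
  rw [e]
  refine (norm_add_le _ _).trans ?_
  rw [norm_mul, Complex.norm_I, Complex.norm_real, Complex.norm_real, Real.norm_eq_abs,
    Real.norm_eq_abs]
  linarith

lemma ext_waveInt (κ : ℂ) (a : Cont) {x : ℝ} (hx : x ∈ Icc (0 : ℝ) 1) :
    ext (waveInt κ a) x = ∫ t in (0 : ℝ)..x, Complex.sin (κ * (x - t)) * ext a t := by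
  rw [waveInt, ext_sub, ext_mul, ext_mul, ext_volterra _ hx, ext_volterra _ hx,
    ← intervalIntegral.integral_const_mul, ← intervalIntegral.integral_const_mul,
    ← intervalIntegral.integral_sub ((intervalIntegrable_ext _ _ _).const_mul _)
      ((intervalIntegrable_ext _ _ _).const_mul _)]
  refine integral_congr01 zero_mem01 hx fun t ht => ?_
  rw [ext_mul, ext_mul, ext_sinC _ hx, ext_cosC _ hx, ext_sinC _ ht, ext_cosC _ ht, mul_sub,
    Complex.sin_sub]
  ring

/-- Normalized by f'(0) = κ, the solution multiplied by exp(−|Im κ|x) stays bounded by 2, by a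
Volterra estimate independent of the size of Im κ. At x = 1 the integral equation expresses sin κ
through an integral containing `v`. -/
lemma Schrod.norm_csin_le {κ : ℂ} (hκ : κ ≠ 0) {v : Cont} (hv : ‖v‖ ≤ ‖κ‖ / 2) {Q f fd : ℝ → ℂ}
    (hf : Schrod Q f fd) (hQ : ∀ x ∈ Icc (0 : ℝ) 1, Q x = κ ^ 2 + ext v x) (f0 : f 0 = 0)
    (f1 : f 1 = 0) (fd0 : fd 0 ≠ 0) :
    ‖Complex.sin κ‖ ≤ 2 * ‖v‖ / ‖κ‖ * Real.exp |κ.im| := by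
  have hκ' := norm_pos_iff.2 hκ
  set F := (κ * (fd 0)⁻¹) • toCont f hf.prim.continuousOn with hF
  obtain ⟨h1, -⟩ := hf.variation (F := toCont f hf.prim.continuousOn) hQ
    (fun x hx => (ext_toCont _ hx).symm) f0
  have hvar : ∀ x ∈ Icc (0 : ℝ) 1, κ * ext F x = κ * Complex.sin (κ * x) -
      ∫ t in (0 : ℝ)..x, Complex.sin (κ * (x - t)) * (ext v t * ext F t) := fun x hx => by
    have h2 := congrArg (fun a => κ * (fd 0)⁻¹ * ext a x) h1
    simp only [ext_smul, ext_sub, ext_waveInt κ _ hx, ext_sinC _ hx] at h2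
    rw [hF, ext_smul]
    have e : ∫ t in (0 : ℝ)..x, Complex.sin (κ * (x - t)) *
        (ext v t * ext ((κ * (fd 0)⁻¹) • toCont f hf.prim.continuousOn) t) = (κ * (fd 0)⁻¹) *
        ∫ t in (0 : ℝ)..x, Complex.sin (κ * (x - t)) *
          ext (v * toCont f hf.prim.continuousOn) t := by
      rw [← intervalIntegral.integral_const_mul]
      refine intervalIntegral.integral_congr fun t _ => ?_
      simp only [ext_smul, ext_mul]
      ring
    rw [e]
    field_simp at h2 ⊢
    linear_combination h2
  set b := |κ.im| with hb
  set W := F * expC (-(b : ℂ)) with hW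
  have hWx : ∀ x ∈ Icc (0 : ℝ) 1, ext F x = ext W x * Complex.exp (b * x) := fun x hx => by
    rw [hW, ext_mul, ext_expC _ hx, mul_assoc, ← Complex.exp_add]
    simp
  have hint : ∀ x ∈ Icc (0 : ℝ) 1,
      ‖∫ t in (0 : ℝ)..x, Complex.sin (κ * (x - t)) * (ext v t * ext F t)‖ ≤
        ‖v‖ * ‖W‖ * Real.exp (b * x) := fun x hx => by
    have h3 : ∀ t ∈ uIoc 0 x, ‖Complex.sin (κ * (x - t)) * (ext v t * ext F t)‖ ≤
        ‖v‖ * ‖W‖ * Real.exp (b * x) := fun t ht => by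
      rw [uIoc_of_le hx.1] at ht
      have htm : t ∈ Icc (0 : ℝ) 1 := ⟨ht.1.le, ht.2.trans hx.2⟩
      rw [hWx t htm, norm_mul, norm_mul, norm_mul]
      have h4 : ‖Complex.sin (κ * (x - t))‖ ≤ Real.exp (b * (x - t)) := by
        refine (ThreePoint.norm_csin_le _).trans (Real.exp_le_exp.2 ?_)
        rw [← Complex.ofReal_sub, Complex.im_mul_ofReal, abs_mul,
          abs_of_nonneg (by linarith [ht.2] : 0 ≤ x - t)]
      have h5 : ‖Complex.exp (b * t)‖ = Real.exp (b * t) := by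
        rw [← Complex.ofReal_mul, Complex.norm_exp, Complex.ofReal_re]
      rw [h5]
      calc _ ≤ Real.exp (b * (x - t)) * (‖v‖ * (‖W‖ * Real.exp (b * t))) := by
            gcongr
            · exact norm_ext_le _ _
            · exact norm_ext_le _ _
        _ = ‖v‖ * ‖W‖ * (Real.exp (b * (x - t)) * Real.exp (b * t)) := by ring
        _ = _ := by rw [← Real.exp_add]; ring_nf
    refine (intervalIntegral.norm_integral_le_of_norm_le_const h3).trans ?_
    rw [sub_zero, abs_of_nonneg hx.1]
    exact mul_le_of_le_one_right (by positivity) hx.2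
  have hN : ‖W‖ ≤ 2 := by
    have h6 : ‖W‖ ≤ 1 + ‖W‖ / 2 := norm_cont_le (by positivity) fun x hx => by
      have h7 := hvar x hx
      have h8 : ‖κ * ext F x‖ ≤ ‖κ‖ * Real.exp (b * x) + ‖v‖ * ‖W‖ * Real.exp (b * x) := by
        rw [h7]
        refine (norm_sub_le _ _).trans (add_le_add ?_ (hint x hx))
        rw [norm_mul]
        gcongr
        refine (ThreePoint.norm_csin_le _).trans (Real.exp_le_exp.2 ?_)
        rw [Complex.im_mul_ofReal, abs_mul, abs_of_nonneg hx.1]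
      have h9 : ‖ext F x‖ = ‖ext W x‖ * Real.exp (b * x) := by
        rw [hWx x hx, norm_mul, ← Complex.ofReal_mul, Complex.norm_exp, Complex.ofReal_re]
      rw [norm_mul, h9] at h8
      have h10 := Real.exp_pos (b * x)
      have h11 : ‖κ‖ * ‖ext W x‖ ≤ ‖κ‖ + ‖v‖ * ‖W‖ := by
        by_contra hc
        push Not at hc
        nlinarith
      have h12 : ‖κ‖ * ‖ext W x‖ ≤ ‖κ‖ * (1 + ‖W‖ / 2) := by
        nlinarith [norm_nonneg W]
      exact le_of_mul_le_mul_left h12 hκ'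
    linarith
  have h13 := hvar 1 one_mem01
  have h14 := hint 1 one_mem01
  have hF1 : ext F 1 = 0 := by rw [hF, ext_smul, ext_toCont _ one_mem01, f1, mul_zero]
  rw [hF1, mul_zero, Complex.ofReal_one, mul_one] at h13
  rw [Complex.ofReal_one, ← sub_eq_zero.1 h13.symm, norm_mul, mul_one] at h14
  rw [div_mul_eq_mul_div, le_div_iff₀ hκ']
  nlinarith [Real.exp_pos b, norm_nonneg v, mul_le_mul_of_nonneg_left hN (norm_nonneg v),
    mul_nonneg (norm_nonneg v) (Real.exp_pos b).le]

/-! ### Eigenvalues and Dirichlet solutions -/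

namespace Factor

variable {p dp q : ℝ → ℂ} {e : Cont × Cont} {z : ℂ} {R X : Cont} {l : ℂ}

lemma continuousOn_mfun (z : ℂ) (R : Cont) : ContinuousOn (mfun z R) (Icc 0 1) := by
  unfold mfun; fun_prop

/-- The comparison of a solution of the third order equation on `[1, 2]` with its values on
`[0, 1]`. -/
lemma pair_sub (h : Factor p dp q e z R X l) {E F₁ F₂ y₁ v₁ w₁ y₂ v₂ w₂ : ℝ → ℂ}
    (hP : Pair p q l F₁ F₂ y₁ v₁ w₁ y₂ v₂ w₂) :
    ∃ y v w : ℝ → ℂ, Triple p q l (fun x => F₂ x - E 1 ^ 2 * F₁ x) y v w ∧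
      (∀ x, y x = y₂ x - E 1 ^ 2 * y₁ x) ∧ v 0 = v₁ 1 - E 1 ^ 2 * v₁ 0 ∧ y 0 = 0 ∧ y 1 = 0 ∧
      secondOrder p (mfun z R) (ext X) y v w 0 = secondOrder p (mfun z R) (ext X) y₁ v₁ w₁ 1 -
        E 1 ^ 2 * secondOrder p (mfun z R) (ext X) y₁ v₁ w₁ 0 ∧
      secondOrder p (mfun z R) (ext X) y v w 1 = secondOrder p (mfun z R) (ext X) y₂ v₂ w₂ 1 -
        E 1 ^ 2 * secondOrder p (mfun z R) (ext X) y₁ v₁ w₁ 1 := by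
  refine ⟨_, _, _, hP.snd.sub_mul (E 1 ^ 2) hP.fst, fun _ => rfl, by rw [hP.match_v],
    by simp [hP.y₁_zero, hP.y₂_zero], by simp [hP.y₁_one, hP.y₂_one], ?_, ?_⟩
  · simp only [secondOrder, hP.y₁_zero, hP.y₂_zero, hP.match_v, hP.match_w, hP.y₁_one,
      ← h.riccati.per]
    ring
  · simp only [secondOrder, hP.y₁_one, hP.y₂_one]
    ring

lemma prim_inv_sq {E m : ℝ → ℂ} (hE : Prim (fun x => (E x)⁻¹) (fun x => -(1 / 2 * m x * (E x)⁻¹))) :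
    Prim (fun x => (E x)⁻¹ ^ 2) (fun x => -(m x * (E x)⁻¹ ^ 2)) :=
  (hE.mul hE).congr (fun x _ => by ring) (fun x _ => by ring)

/-- Solutions of `G' = m G`. -/
lemma eq_mul_of_prim {E m G : ℝ → ℂ}
    (hE : Prim (fun x => (E x)⁻¹) (fun x => -(1 / 2 * m x * (E x)⁻¹))) (E0 : E 0 = 1)
    (hE0 : ∀ x, E x ≠ 0) (hG : Prim G (fun x => m x * G x)) {x : ℝ} (hx : x ∈ Icc (0 : ℝ) 1) :
    G x = E x ^ 2 * G 0 := by
  have := (hG.mul (prim_inv_sq hE)).eq_of_zero (fun x _ => by ring) hx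
  rw [E0, inv_one, one_pow, mul_one] at this
  rw [← this]
  have := hE0 x
  field_simp

/-- A solution of the homogeneous equation is determined by the difference
`y(x + 1) - τ y(x)`, which is a Dirichlet solution of the second order equation. -/
lemma pair_schrod (h : Factor p dp q e z R X l) {E y₁ v₁ w₁ y₂ v₂ w₂ : ℝ → ℂ}
    (hE : Prim E (fun x => 1 / 2 * mfun z R x * E x))
    (hE' : Prim (fun x => (E x)⁻¹) (fun x => -(1 / 2 * mfun z R x * (E x)⁻¹)))
    (E0 : E 0 = 1) (hE0 : ∀ x, E x ≠ 0)
    (hP : Pair p q l (fun _ => 0) (fun _ => 0) y₁ v₁ w₁ y₂ v₂ w₂) :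
    ∃ f fd : ℝ → ℂ, Schrod (reducedPot p (mfun z R) (ext X)) f fd ∧ f 0 = 0 ∧ f 1 = 0 ∧
      fd 0 = v₁ 1 - E 1 ^ 2 * v₁ 0 ∧ ∀ x, f x = E x * (y₂ x - E 1 ^ 2 * y₁ x) := by
  obtain ⟨y, v, w, hT, hy, hv, hy0, hy1, hG, -⟩ := h.pair_sub (E := E) hP
  have hT' : Triple p q l (fun _ => 0) y v w :=
    ⟨hT.prim_y, hT.prim_v, hT.prim_w.congr (fun _ _ => rfl) (fun _ _ => by ring)⟩
  have hG1 := hP.fst.prim_secondOrder h.coeffs.prim_p h.riccati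
  have hG2 := hT'.prim_secondOrder h.coeffs.prim_p h.riccati
  have e1 := eq_mul_of_prim hE' E0 hE0 (hG1.congr (fun _ _ => rfl) (fun _ _ => by ring)) one_mem01
  rw [e1, sub_self] at hG
  have e2 : ∀ x ∈ Icc (0 : ℝ) 1, secondOrder p (mfun z R) (ext X) y v w x = 0 := fun x hx => by
    rw [eq_mul_of_prim hE' E0 hE0 (hG2.congr (fun _ _ => rfl) (fun _ _ => by ring)) hx, hG, mul_zero]
  obtain ⟨p1, p2⟩ := hT'.prim_reduced h.riccati hE
  refine ⟨_, _, ⟨p1, p2.congr (fun _ _ => rfl) (fun x hx => ?_)⟩, by simp [hy0], by simp [hy1], ?_,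
    fun x => by rw [hy]⟩
  · rw [e2 x hx]; ring
  · rw [E0, hy0, hv]; ring

/-- The number v₁(1) − τv₁(0) is f'(0). If it vanishes, the Dirichlet solution f is zero, so y(x+1)
= τy(x), and this is excluded by `eq_zero_of_multiplier`. Thus an eigenfunction is determined by one
number, which gives geometric simplicity. -/
lemma pair_eq_zero (h : Factor p dp q e z R X l) {E y₁ v₁ w₁ y₂ v₂ w₂ : ℝ → ℂ}
    (hE : Prim E (fun x => 1 / 2 * mfun z R x * E x))
    (hE' : Prim (fun x => (E x)⁻¹) (fun x => -(1 / 2 * mfun z R x * (E x)⁻¹)))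
    (E0 : E 0 = 1) (hE0 : ∀ x, E x ≠ 0)
    (hP : Pair p q l (fun _ => 0) (fun _ => 0) y₁ v₁ w₁ y₂ v₂ w₂)
    (hv : v₁ 1 - E 1 ^ 2 * v₁ 0 = 0) {x : ℝ} (hx : x ∈ Icc (0 : ℝ) 1) : y₁ x = 0 ∧ y₂ x = 0 := by
  obtain ⟨f, fd, hf, f0, -, fd0, hfx⟩ := h.pair_schrod hE hE' E0 hE0 hP
  have h1 := (hf.eq_zero h.continuousOn_reducedPot f0 (fd0.trans hv) hx).1
  have h2 := h.eq_zero_of_multiplier hE' E0 hE0 hP.fst hP.y₁_zero hP.y₁_one (sub_eq_zero.1 hv) hx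
  rw [hfx, h2, mul_zero, sub_zero] at h1
  exact ⟨h2, (mul_eq_zero.1 h1).resolve_left (hE0 x)⟩

lemma exists_dirichlet (h : Factor p dp q e z R X l) {y₁ v₁ w₁ y₂ v₂ w₂ : ℝ → ℂ}
    (hP : Pair p q l (fun _ => 0) (fun _ => 0) y₁ v₁ w₁ y₂ v₂ w₂)
    (hne : ∃ x ∈ Icc (0 : ℝ) 1, y₁ x ≠ 0 ∨ y₂ x ≠ 0) :
    ∃ f fd : ℝ → ℂ, Schrod (reducedPot p (mfun z R) (ext X)) f fd ∧ f 0 = 0 ∧ f 1 = 0 ∧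
      fd 0 ≠ 0 := by
  obtain ⟨E, hE, hE', E0, hE0⟩ := exists_integratingFactor (continuousOn_mfun z R) (1 / 2)
  obtain ⟨f, fd, hf, f0, f1, fd0, -⟩ := h.pair_schrod hE hE' E0 hE0 hP
  refine ⟨f, fd, hf, f0, f1, fun hfd => ?_⟩
  obtain ⟨x, hx, hxy⟩ := hne
  obtain ⟨h1, h2⟩ := h.pair_eq_zero hE hE' E0 hE0 hP (fd0.symm.trans hfd) hx
  tauto

/-- A Dirichlet solution of the second order equation gives a solution of the third order
equation. -/
lemma pair_of_dirichlet (h : Factor p dp q e z R X l) {E f fd : ℝ → ℂ}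
    (hE : Prim (fun x => (E x)⁻¹) (fun x => -(1 / 2 * mfun z R x * (E x)⁻¹)))
    (hf : Schrod (reducedPot p (mfun z R) (ext X)) f fd)
    (f0 : f 0 = 0) (f1 : f 1 = 0) (fd0 : fd 0 ≠ 0) (E0 : E 0 = 1) :
    ∃ y v w y₂ v₂ w₂ : ℝ → ℂ, Pair p q l (fun _ => 0) (fun _ => 0) y v w y₂ v₂ w₂ ∧
      (∀ x, y x = f x * (E x)⁻¹) ∧ (∀ x, v x = (fd x - mfun z R x * f x / 2) * (E x)⁻¹) ∧
      (∀ x, secondOrder p (mfun z R) (ext X) y v w x = 0) ∧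
      (∀ x, y₂ x = v 1 / v 0 * y x) ∧ v 0 = fd 0 ∧
      (∀ x, secondOrder p (mfun z R) (ext X) y₂ v₂ w₂ x = 0) := by
  have hT := Triple.of_reduced h.coeffs.prim_p h.riccati hE hf
  set y := fun x => f x * (E x)⁻¹ with hy
  set v := fun x => (fd x - mfun z R x * f x / 2) * (E x)⁻¹ with hv
  set w := fun x => -(mfun z R x * (fd x - mfun z R x * f x / 2) * (E x)⁻¹) -
    (p x + mfun z R x ^ 2 - ext X x) * f x * (E x)⁻¹ with hw
  have hv0 : v 0 = fd 0 := by simp [hv, f0, E0]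
  have hv0' : v 0 ≠ 0 := hv0 ▸ fd0
  -- The second order equation is periodic and its solutions vanishing at 0 are multiples of one
  -- another, so the continuation to [1, 2] is c times the function on [0, 1].
  set c := v 1 / v 0 with hc
  have hT0 : Triple p q l (fun _ => 0) (fun _ => 0) (fun _ => 0) (fun _ => 0) := by
    refine ⟨Prim.const 0, (Prim.const 0).congr (fun _ _ => rfl) (fun _ _ => by ring),
      (Prim.const 0).congr (fun _ _ => rfl) (fun _ _ => by ring)⟩
  have hT2 := hT0.sub_mul (-c) hT
  have hT2' : Triple p q l (fun _ => 0) (fun x => 0 - -c * y x) (fun x => 0 - -c * v x)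
      (fun x => 0 - -c * w x) :=
    ⟨hT2.prim_y, hT2.prim_v, hT2.prim_w.congr (fun _ _ => rfl) (fun _ _ => by ring)⟩
  refine ⟨y, v, w, _, _, _, ⟨hT, hT2', by simp [hy, f0], by simp [hy, f1], by simp [hy, f0],
    by simp [hy, f1], ?_, ?_⟩, fun _ => rfl, fun _ => rfl, fun x => ?_, fun x => by ring, hv0,
    fun x => ?_⟩
  · rw [hc]; field_simp; ring
  -- Where y vanishes, the second order equation reduces to w = −mv. With m periodic, the matching
  -- of w follows from that of v.
  · have e1 : ∀ x, f x = 0 → w x = -(mfun z R x * v x) := fun x hx => by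
      simp only [hw, hv, hx]; ring
    rw [e1 1 f1, e1 0 f0, ← h.riccati.per, hc]; field_simp; ring
  · simp only [secondOrder, hy, hv, hw]; ring
  · simp only [secondOrder, hy, hv, hw]; ring

end Factor

/-! ### Dirichlet solutions and the fixed point problem -/

namespace IsJoint

variable {p dp q : ℝ → ℂ} {n : ℕ} {e : Cont × Cont} {R X φ : Cont} {H : ℂ}

lemma factor (hn : 1 ≤ n) (h : IsJoint n e R X φ H) (hc : Coeffs p dp q e) (he : ‖e‖ ≤ radius)
    (hR : ‖R‖ ≤ radius) (hX : ‖X‖ ≤ radius) :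
    Factor p dp q e (base n) R X ((base n : ℂ) ^ 3 + base n * H) :=
  ⟨hc, sector_base hn, Riccati.of_fixed hc (sector_base hn) (by abel) h.ric, he, hR, hX⟩

lemma _root_.ThreePoint.base_sq_cast (n : ℕ) :
    (3 / 4 : ℂ) * (base n : ℂ) ^ 2 = (freq n : ℂ) ^ 2 := by
  have := congrArg ((↑) : ℝ → ℂ) (base_sq n)
  push_cast at this
  exact this

lemma _root_.ThreePoint.freq_ne_zero (hn : 1 ≤ n) : (freq n : ℂ) ≠ 0 := by
  exact_mod_cast (by linarith [three_lt_freq hn] : freq n ≠ 0)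

/-- The derivative of the eigenfunction. -/
def _root_.ThreePoint.jointDeriv (n : ℕ) (v f : Cont) (x : ℝ) : ℂ :=
  freq n * Complex.cos (freq n * x) - ext (waveInt' (freq n) (v * f)) x

lemma schrod (hn : 1 ≤ n) (h : IsJoint n e R X φ H) (hF : Factor p dp q e (base n) R X
    ((base n : ℂ) ^ 3 + base n * H)) :
    Schrod (reducedPot p (mfun (base n) R) (ext X)) (ext (sinC (freq n) + φ))
      (jointDeriv n (potV (base n) e.1 R X) (sinC (freq n) + φ)) ∧
    ext (sinC (freq n) + φ) 0 = 0 ∧ ext (sinC (freq n) + φ) 1 = 0 ∧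
    jointDeriv n (potV (base n) e.1 R X) (sinC (freq n) + φ) 0 = freq n := by
  have hκ := freq_ne_zero hn
  have hw : (freq n : ℂ) • (sinC (freq n) + φ) = (freq n : ℂ) • sinC (freq n) -
      waveInt (freq n) (potV (base n) e.1 R X * (sinC (freq n) + φ)) := by
    have := congrArg (fun a => (freq n : ℂ) • a) h.wave
    simp only [smul_neg, smul_smul, mul_inv_cancel₀ hκ, one_smul] at this
    calc _ = (freq n : ℂ) • sinC (freq n) + (freq n : ℂ) • φ := by module
      _ = _ := by rw [this, sub_eq_add_neg]
  have hs := Schrod.of_wave hκ hw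
  have hx : ∀ x ∈ Icc (0 : ℝ) 1, freq n * ext (sinC (freq n) + φ) x =
      freq n * Complex.sin (freq n * x) -
        ext (waveInt (freq n) (potV (base n) e.1 R X * (sinC (freq n) + φ))) x := fun x hx => by
    have := congrArg (fun a => ext a x) hw
    simpa only [ext_smul, ext_sub, ext_sinC _ hx] using this
  refine ⟨⟨hs.prim, hs.prim1.congr (fun _ _ => rfl) (fun x hx => ?_)⟩, ?_, ?_, ?_⟩
  · rw [hF.reducedPot_eq hx, base_sq_cast]
  · have := hx 0 zero_mem01
    rw [(waveInt_zero _ _).1] at this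
    simpa [hκ] using this
  · have h1 := hx 1 one_mem01
    have h2 : ext (waveInt (freq n) (potV (base n) e.1 R X * (sinC (freq n) + φ))) 1 = 0 := by
      have h3 := h.orth
      rw [total_apply] at h3
      rw [waveInt, ext_sub, ext_mul, ext_mul, ext_sinC _ one_mem01, ext_volterra (sinC _ * _)
        one_mem01, mul_comm (sinC _) (_ * _), h3]
      simp [csin_freq]
    rw [h2] at h1
    simpa [hκ, csin_freq] using h1
  · simp [jointDeriv, (waveInt_zero _ _).2]

/-- Normalize f'(0) = κ = freq n. Variation of constants is then the wave equation for φ = f − sin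
κx, and Lagrange's identity against sin κx is the orthogonality condition. -/
lemma of_dirichlet (hn : 1 ≤ n) (hF : Factor p dp q e (base n) R X ((base n : ℂ) ^ 3 + base n * H))
    {f fd : ℝ → ℂ} (hf : Schrod (reducedPot p (mfun (base n) R) (ext X)) f fd)
    (f0 : f 0 = 0) (f1 : f 1 = 0) (fd0 : fd 0 ≠ 0) {δ : ℝ} (hδ : δ ≤ 1 / 100)
    (hv : ‖potV (base n) e.1 R X‖ ≤ δ) :
    ∃ φ, IsJoint n e R X φ H ∧ ‖φ‖ ≤ 2 * δ := by
  have hκ := freq_ne_zero hn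
  have h3 := three_lt_freq hn
  set v := potV (base n) e.1 R X with hvd
  set F := ((freq n : ℂ) * (fd 0)⁻¹) • toCont f hf.prim.continuousOn with hFd
  have hQ : ∀ x ∈ Icc (0 : ℝ) 1, reducedPot p (mfun (base n) R) (ext X) x =
      (freq n : ℂ) ^ 2 + ext v x := fun x hx => by
    rw [hF.reducedPot_eq hx, base_sq_cast]
  obtain ⟨h1, -⟩ := hf.variation (F := toCont f hf.prim.continuousOn) hQ
    (fun x hx => (ext_toCont _ hx).symm) f0
  have hvar : F = sinC (freq n) - (freq n : ℂ)⁻¹ • waveInt (freq n) (v * F) := by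
    refine cont_ext fun x hx => ?_
    have h2 := congrArg (fun a => (fd 0)⁻¹ * ext a x) h1
    simp only [ext_smul, ext_sub, ext_waveInt _ _ hx] at h2
    rw [hFd, ext_smul, ext_sub, ext_smul, ext_waveInt _ _ hx]
    have e1 : ∫ t in (0 : ℝ)..x, Complex.sin (freq n * (x - t)) *
        (ext (v * ((freq n : ℂ) * (fd 0)⁻¹) • toCont f hf.prim.continuousOn) t) =
        ((freq n : ℂ) * (fd 0)⁻¹) * ∫ t in (0 : ℝ)..x, Complex.sin (freq n * (x - t)) *
          ext (v * toCont f hf.prim.continuousOn) t := by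
      rw [← intervalIntegral.integral_const_mul]
      refine intervalIntegral.integral_congr fun t _ => ?_
      simp only [ext_smul, ext_mul]
      ring
    rw [e1]
    field_simp at h2 ⊢
    linear_combination h2
  have hw : ‖(freq n : ℂ)⁻¹ • waveInt (freq n) (v * F)‖ ≤ δ * ‖F‖ := by
    rw [norm_smul, norm_inv, Complex.norm_real, Real.norm_of_nonneg (by linarith)]
    have h4 := norm_waveInt_le (freq n) (v * F)
    have h5 : ‖v * F‖ ≤ δ * ‖F‖ :=
      (norm_mul_le _ _).trans (mul_le_mul_of_nonneg_right hv (norm_nonneg _))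
    have h6 : (freq n)⁻¹ ≤ 1 / 2 := by
      rw [inv_le_comm₀ (by linarith) (by norm_num)]; linarith
    calc _ ≤ 1 / 2 * (2 * (δ * ‖F‖)) := by
          refine mul_le_mul h6 (h4.trans (by linarith)) (norm_nonneg _) (by norm_num)
      _ = _ := by ring
  have hδ0 : 0 ≤ δ := (norm_nonneg _).trans hv
  have hFn : ‖F‖ ≤ 2 := by
    have h7 := norm_sub_le (sinC (freq n)) ((freq n : ℂ)⁻¹ • waveInt (freq n) (v * F))
    rw [← hvar] at h7
    have h8 := norm_sinC_le (freq n)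
    nlinarith [norm_nonneg F]
  have hφ : F - sinC (freq n) = -((freq n : ℂ)⁻¹ • waveInt (freq n) (v * F)) := by
    calc F - sinC (freq n) = (sinC (freq n) - (freq n : ℂ)⁻¹ • waveInt (freq n) (v * F)) -
          sinC (freq n) := by rw [← hvar]
      _ = _ := by abel
  refine ⟨F - sinC (freq n), ⟨?_, ?_, ?_⟩, ?_⟩
  · exact hF.riccati.fixed hF.coeffs hF.sector (fun _ _ => rfl) (fun _ _ => rfl)
  · rw [add_sub_cancel]; exact hφ
  · rw [add_sub_cancel, total_apply]
    have hs : Schrod (fun _ => (freq n : ℂ) ^ 2) (fun x : ℝ => Complex.sin (freq n * x))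
        (fun x => freq n * Complex.cos (freq n * x)) :=
      ⟨prim_sin _, ((prim_cos (freq n)).const_mul (freq n)).congr (fun _ _ => rfl)
        (fun _ _ => by ring)⟩
    have h9 := hf.integral_mul hs f0 f1 (by simp) (by simp [csin_freq])
    have h10 : ∫ x in (0 : ℝ)..1, ext (v * F * sinC (freq n)) x = ((freq n : ℂ) * (fd 0)⁻¹) *
        ∫ x in (0 : ℝ)..1, (reducedPot p (mfun (base n) R) (ext X) x - (freq n : ℂ) ^ 2) * f x *
          Complex.sin (freq n * x) := by
      rw [← intervalIntegral.integral_const_mul]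
      refine integral_congr01 zero_mem01 one_mem01 fun x hx => ?_
      rw [hQ x hx, ext_mul, ext_mul, hFd, ext_smul, ext_toCont _ hx, ext_sinC _ hx]
      ring
    rw [h10, h9, mul_zero]
  · rw [hφ, norm_neg]
    nlinarith

end IsJoint

/-! ### Localization of the eigenvalues -/

/-- The size of the coefficients for which all results hold. -/
def tiny : ℝ := 1 / 10 ^ 15

lemma Prim.norm_sub_le {f f' : ℝ → ℂ} (h : Prim f f') {c : ℂ} {K : ℝ}
    (hK : ∀ x ∈ Icc (0 : ℝ) 1, ‖f' x - c‖ ≤ K) {x : ℝ} (hx : x ∈ Icc (0 : ℝ) 1) :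
    ‖f x - f 0 - c * x‖ ≤ K := by
  have h1 : Prim (fun x : ℝ => f x - c * x) (fun x => f' x - c) :=
    (h.sub ((Prim.of_hasDerivAt (f := fun x : ℝ => (x : ℂ)) (f' := fun _ => 1)
      (fun x _ => Complex.ofRealCLM.hasDerivAt) continuousOn_const).const_mul c)).congr
      (fun _ _ => rfl) (fun _ _ => by ring)
  have h2 := h1.sub_eq zero_mem01 hx
  have h3 : f x - f 0 - c * x = ∫ t in (0 : ℝ)..x, (f' t - c) := by
    rw [← h2]; simp; ring
  have hK0 : 0 ≤ K := (norm_nonneg _).trans (hK 0 zero_mem01)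
  rw [h3]
  refine (intervalIntegral.norm_integral_le_of_norm_le_const (C := K) fun t ht => ?_).trans ?_
  · rw [uIoc_of_le hx.1] at ht
    exact hK t ⟨ht.1.le, ht.2.trans hx.2⟩
  · rw [sub_zero, abs_of_nonneg hx.1]
    exact mul_le_of_le_one_right hK0 hx.2

/-- For small coefficients and small l, y is close to v(0)x + w(0)x²/2. The corrected quantity ω = w
+ (p − D)y, with D the primitive of p' − q, satisfies ω' = ly − Dv: q has disappeared and only sup
norms are needed. -/
lemma Triple.crude_bounds {p dp q : ℝ → ℂ} {e : Cont × Cont} (hc : Coeffs p dp q e) {ε : ℝ}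
    (he : ‖e‖ ≤ ε) {l : ℂ} {y v w : ℝ → ℂ} (hT : Triple p q l (fun _ => 0) y v w) (y0 : y 0 = 0)
    (y1 : y 1 = 0) {S : ℝ} (hS : ∀ x ∈ Icc (0 : ℝ) 1, ‖v x‖ ≤ S) :
    (∀ x ∈ Icc (0 : ℝ) 1, ‖v x‖ ≤ ‖v 0‖ + ‖w 0‖ + (‖l‖ + 4 * ε) * S) ∧
    ‖v 0 + w 0 / 2‖ ≤ (‖l‖ + 4 * ε) * S ∧ ‖v 1 - v 0 - w 0‖ ≤ (‖l‖ + 4 * ε) * S ∧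
    ‖w 1 - w 0‖ ≤ (‖l‖ + 4 * ε) * S ∧ ∀ x ∈ Icc (0 : ℝ) 1, ‖y x‖ ≤ S := by
  have hε : 0 ≤ ε := (norm_nonneg e).trans he
  have hS0 : 0 ≤ S := (norm_nonneg _).trans (hS 0 zero_mem01)
  have hp : ∀ x ∈ Icc (0 : ℝ) 1, ‖p x‖ ≤ ε := fun x hx => by
    rw [← hc.ext_p x hx]; exact (norm_ext_le _ _).trans ((norm_fst_le e).trans he)
  have hD : ∀ x, ‖ext e.2 x‖ ≤ ε := fun x => (norm_ext_le _ _).trans ((norm_snd_le e).trans he)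
  have hy : ∀ x ∈ Icc (0 : ℝ) 1, ‖y x‖ ≤ S := fun x hx => by
    have := hT.prim_y.norm_sub_le (c := 0) (K := S) (fun x hx => by rw [sub_zero]; exact hS x hx) hx
    simpa [y0] using this
  set ω : ℝ → ℂ := fun x => w x + (p x - ext e.2 x) * y x with hω
  have hωp : Prim ω (fun x => l * y x - ext e.2 x * v x) :=
    (hT.prim_w.add ((hc.prim_p.sub hc.prim_D).mul hT.prim_y)).congr (fun _ _ => rfl)
      (fun _ _ => by ring)
  have hω1 : ∀ x ∈ Icc (0 : ℝ) 1, ‖ω x - ω 0‖ ≤ (‖l‖ + ε) * S := fun x hx => by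
    have := hωp.norm_sub_le (c := 0) (K := (‖l‖ + ε) * S) (fun x hx => by
      rw [sub_zero, add_mul]
      refine (norm_sub_le _ _).trans ?_
      rw [norm_mul, norm_mul]
      exact add_le_add (mul_le_mul_of_nonneg_left (hy x hx) (norm_nonneg _))
        (mul_le_mul (hD x) (hS x hx) (norm_nonneg _) hε)) hx
    simpa using this
  have ω0 : ω 0 = w 0 := by simp [hω, y0]
  have ω1 : ω 1 = w 1 := by simp [hω, y1]
  have hv' : ∀ x ∈ Icc (0 : ℝ) 1, ‖w x - p x * y x - w 0‖ ≤ (‖l‖ + 4 * ε) * S := fun x hx => by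
    have e1 : w x - p x * y x - w 0 = (ω x - ω 0) - (p x * y x + (p x * y x - ext e.2 x * y x)) := by
      rw [ω0, hω]; ring
    have e2 : ‖p x * y x‖ ≤ ε * S := by
      rw [norm_mul]; exact mul_le_mul (hp x hx) (hy x hx) (norm_nonneg _) hε
    have e3 : ‖ext e.2 x * y x‖ ≤ ε * S := by
      rw [norm_mul]; exact mul_le_mul (hD x) (hy x hx) (norm_nonneg _) hε
    have e4 := norm_sub_le (ω x - ω 0) (p x * y x + (p x * y x - ext e.2 x * y x))
    have e5 := norm_add_le (p x * y x) (p x * y x - ext e.2 x * y x)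
    have e6 := norm_sub_le (p x * y x) (ext e.2 x * y x)
    have e7 := hω1 x hx
    rw [e1]; linarith
  have hv : ∀ x ∈ Icc (0 : ℝ) 1, ‖v x - v 0 - w 0 * x‖ ≤ (‖l‖ + 4 * ε) * S := fun x hx =>
    hT.prim_v.norm_sub_le hv' hx
  refine ⟨fun x hx => ?_, ?_, by simpa using hv 1 one_mem01, ?_, hy⟩
  · have e1 : v x = v 0 + w 0 * x + (v x - v 0 - w 0 * x) := by ring
    have e2 : ‖w 0 * x‖ ≤ ‖w 0‖ := by
      rw [norm_mul, Complex.norm_real, Real.norm_of_nonneg hx.1]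
      exact mul_le_of_le_one_right (norm_nonneg _) hx.2
    rw [e1]
    exact norm_add₃_le.trans (by linarith [hv x hx])
  · have h2 : Prim (fun x : ℝ => y x - w 0 / 2 * (x * x)) (fun x => v x - w 0 * x) := by
      have hx : Prim (fun x : ℝ => (x : ℂ)) (fun _ => 1) :=
        Prim.of_hasDerivAt (fun x _ => Complex.ofRealCLM.hasDerivAt) continuousOn_const
      exact (hT.prim_y.sub ((hx.mul hx).const_mul (w 0 / 2))).congr (fun _ _ => rfl)
        (fun _ _ => by ring)
    have h3 := h2.norm_sub_le (c := v 0) (K := (‖l‖ + 4 * ε) * S) (fun x hx => by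
      have := hv x hx
      rwa [sub_right_comm]) one_mem01
    rw [← norm_neg]
    simpa [y0, y1, neg_add, add_comm, sub_eq_add_neg] using h3
  · have := hω1 1 one_mem01
    rw [ω0, ω1] at this
    exact this.trans (mul_le_mul_of_nonneg_right (by linarith) hS0)

/-- There are no small eigenvalues. -/
lemma Pair.eq_zero_of_small {p dp q : ℝ → ℂ} {e : Cont × Cont} (hc : Coeffs p dp q e)
    (he : ‖e‖ ≤ tiny) {l : ℂ} (hl : ‖l‖ ≤ 1 / 27) {y₁ v₁ w₁ y₂ v₂ w₂ : ℝ → ℂ}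
    (hP : Pair p q l (fun _ => 0) (fun _ => 0) y₁ v₁ w₁ y₂ v₂ w₂) {x : ℝ}
    (hx : x ∈ Icc (0 : ℝ) 1) : y₁ x = 0 ∧ y₂ x = 0 := by
  set V₁ := toCont v₁ hP.fst.prim_v.continuousOn
  set V₂ := toCont v₂ hP.snd.prim_v.continuousOn
  set S := max ‖V₁‖ ‖V₂‖ with hS
  have b1 : ∀ x ∈ Icc (0 : ℝ) 1, ‖v₁ x‖ ≤ S := fun x hx => by
    rw [← ext_toCont hP.fst.prim_v.continuousOn hx]
    exact (norm_ext_le _ _).trans (le_max_left _ _)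
  have b2 : ∀ x ∈ Icc (0 : ℝ) 1, ‖v₂ x‖ ≤ S := fun x hx => by
    rw [← ext_toCont hP.snd.prim_v.continuousOn hx]
    exact (norm_ext_le _ _).trans (le_max_right _ _)
  obtain ⟨c1, c2, c3, c4, c5⟩ := hP.fst.crude_bounds hc he hP.y₁_zero hP.y₁_one b1
  obtain ⟨d1, d2, -, -, d5⟩ := hP.snd.crude_bounds hc he hP.y₂_zero hP.y₂_one b2
  rw [hP.match_v] at c3
  rw [hP.match_w] at c4
  set θ := (‖l‖ + 4 * tiny) * S with hθ
  have hS0 : 0 ≤ S := (norm_nonneg _).trans (le_max_left _ _)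
  have hθS : θ ≤ 1 / 26 * S := mul_le_mul_of_nonneg_right (by
    rw [tiny]; linarith) hS0
  have half : ∀ a : ℂ, ‖a / 2‖ = ‖a‖ / 2 := fun a => by rw [norm_div]; norm_num
  -- A parabola with zeros 0, 1, 2 vanishes identically; this is the quantitative version, with an
  -- error θ in each relation between the initial data on the two periods.
  have e1 : ‖w₁ 0‖ ≤ 7 / 2 * θ := by
    have : w₁ 0 = (v₂ 0 + w₂ 0 / 2) - (v₁ 0 + w₁ 0 / 2) - (w₂ 0 - w₁ 0) / 2 -
        (v₂ 0 - v₁ 0 - w₁ 0) := by ring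
    rw [this]
    have := half (w₂ 0 - w₁ 0)
    linarith [norm_sub_le (v₂ 0 + w₂ 0 / 2 - (v₁ 0 + w₁ 0 / 2) - (w₂ 0 - w₁ 0) / 2)
      (v₂ 0 - v₁ 0 - w₁ 0), norm_sub_le (v₂ 0 + w₂ 0 / 2 - (v₁ 0 + w₁ 0 / 2)) ((w₂ 0 - w₁ 0) / 2),
      norm_sub_le (v₂ 0 + w₂ 0 / 2) (v₁ 0 + w₁ 0 / 2)]
  have e2 : ‖w₂ 0‖ ≤ 9 / 2 * θ := by
    have : w₂ 0 = w₁ 0 + (w₂ 0 - w₁ 0) := by ring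
    rw [this]; linarith [norm_add_le (w₁ 0) (w₂ 0 - w₁ 0)]
  have e3 : ‖v₁ 0‖ ≤ 4 * θ := by
    have : v₁ 0 = (v₁ 0 + w₁ 0 / 2) - w₁ 0 / 2 := by ring
    rw [this]; linarith [norm_sub_le (v₁ 0 + w₁ 0 / 2) (w₁ 0 / 2), half (w₁ 0), norm_nonneg (w₁ 0)]
  have e4 : ‖v₂ 0‖ ≤ 4 * θ := by
    have : v₂ 0 = (v₂ 0 + w₂ 0 / 2) - w₂ 0 / 2 := by ring
    rw [this]; linarith [norm_sub_le (v₂ 0 + w₂ 0 / 2) (w₂ 0 / 2), half (w₂ 0), norm_nonneg (w₂ 0)]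
  have hθ0 : 0 ≤ θ := (norm_nonneg _).trans c2
  -- Since θ ≤ S/26, this forces S = 0.
  have hS1 : S ≤ 10 * θ := max_le
    (norm_cont_le (by positivity) fun x hx => by
      rw [ext_toCont _ hx]; linarith [c1 x hx])
    (norm_cont_le (by positivity) fun x hx => by
      rw [ext_toCont _ hx]; linarith [d1 x hx])
  have hS2 : S ≤ 0 := by linarith
  exact ⟨norm_le_zero_iff.1 ((c5 x hx).trans hS2), norm_le_zero_iff.1 ((d5 x hx).trans hS2)⟩

/-! ### From an eigenvalue in the right half plane to the joint fixed point problem. -/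

lemma cube_cpow (l : ℂ) : (l ^ (1 / 3 : ℂ)) ^ 3 = l := by
  simp

/-- A third of an argument in [−π/2, π/2] lies in [−π/6, π/6]; this is what confines the Riccati
analysis to Re l ≥ 0. -/
lemma cpow_sector {l : ℂ} (hl : 0 ≤ l.re) :
    Real.sqrt 3 * |(l ^ (1 / 3 : ℂ)).im| ≤ (l ^ (1 / 3 : ℂ)).re := by
  rcases eq_or_ne l 0 with rfl | h0
  · rw [Complex.zero_cpow (by norm_num)]; simp
  have harg := Complex.abs_arg_le_pi_div_two_iff.2 hl
  set θ := l.arg / 3 with hθ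
  have hθ' : |θ| ≤ Real.pi / 6 := by rw [hθ, abs_div]; norm_num; linarith
  have hlog : Complex.log l * (1 / 3) = ((Real.log ‖l‖ / 3 : ℝ) : ℂ) + (θ : ℝ) * Complex.I := by
    rw [Complex.log, hθ]; push_cast; ring
  rw [Complex.cpow_def_of_ne_zero h0, hlog, Complex.exp_re, Complex.exp_im]
  simp only [Complex.add_re, Complex.add_im, Complex.ofReal_re, Complex.ofReal_im, Complex.mul_re,
    Complex.mul_im, Complex.I_re, Complex.I_im, mul_zero, mul_one, sub_zero, add_zero, zero_add]
  have hE := Real.exp_pos (Real.log ‖l‖ / 3)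
  have hπ := Real.pi_pos
  have h1 : |Real.sin θ| ≤ 1 / 2 := by
    rw [← Real.sin_pi_div_six, abs_le, ← Real.sin_neg]
    obtain ⟨ha, hb⟩ := abs_le.1 hθ'
    exact ⟨Real.sin_le_sin_of_le_of_le_pi_div_two (by linarith) (by linarith) ha,
      Real.sin_le_sin_of_le_of_le_pi_div_two (by linarith) (by linarith) hb⟩
  have h2 : Real.sqrt 3 / 2 ≤ Real.cos θ := by
    rw [← Real.cos_pi_div_six, ← Real.cos_abs θ]
    exact Real.cos_le_cos_of_nonneg_of_le_pi (abs_nonneg _) (by linarith) hθ'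
  rw [abs_mul, abs_of_pos hE]
  have h3 : Real.sqrt 3 * |Real.sin θ| ≤ Real.cos θ := by
    nlinarith [Real.sqrt_nonneg 3]
  nlinarith

/-- The frequency of the reduced equation. -/
lemma norm_sqrt3_mul {z : ℂ} (hz : z ≠ 0) : (86 / 100) * ‖z‖ < ‖(Real.sqrt 3 / 2 : ℝ) * z‖ := by
  rw [norm_mul, Complex.norm_real, Real.norm_of_nonneg (by positivity)]
  have := sqrt3_bounds
  have := norm_pos_iff.2 hz
  nlinarith

/-- For κ = (√3/2)z a Dirichlet solution makes sin κ small, of relative size 1/|κ|, so κ is close to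
some πn. The case n = 0 is excluded by |z| ≥ 1/3. The factor ‖z‖ in the bound is that gain 1/|κ|; it
makes z³ − base³ of order `base n` uniformly in n. -/
lemma Factor.exists_base {p dp q : ℝ → ℂ} {e : Cont × Cont} {z : ℂ} {R X : Cont} {l : ℂ}
    (hF : Factor p dp q e z R X l) (he : ‖e‖ ≤ tiny) (hR : ‖R‖ ≤ 44 * tiny) (hX : ‖X‖ ≤ 44 * tiny)
    {f fd : ℝ → ℂ} (hf : Schrod (reducedPot p (mfun z R) (ext X)) f fd) (f0 : f 0 = 0)
    (f1 : f 1 = 0) (fd0 : fd 0 ≠ 0) :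
    ∃ n : ℕ, 1 ≤ n ∧ ‖z - base n‖ * ‖z‖ ≤ 2 / 10 ^ 11 := by
  have ht : tiny = 1 / 10 ^ 15 := rfl
  have hz := hF.sector
  set κ : ℂ := (Real.sqrt 3 / 2 : ℝ) * z with hκ
  have hκn := norm_sqrt3_mul hz.ne_zero
  rw [← hκ] at hκn
  have hz3 := hz.le_norm
  have hv : ‖potV z e.1 R X‖ ≤ 19 * (44 * tiny) :=
    potV_le hz (by norm_num [ht]) (((norm_fst_le e).trans he).trans (by norm_num [ht])) hR hX
  have hκ0 : 0 < ‖κ‖ := by linarith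
  have hsq : (3 / 4 : ℂ) * z ^ 2 = κ ^ 2 := by
    rw [hκ]; push_cast; linear_combination (-z ^ 2 / 4) * sqrt3_sq
  have hsin := hf.norm_csin_le (v := potV z e.1 R X) (norm_pos_iff.1 hκ0) (by rw [ht] at hv; linarith)
    (fun x hx => by rw [hF.reducedPot_eq hx, hsq]) f0 f1 fd0
  have hη : 2 * ‖potV z e.1 R X‖ / ‖κ‖ ≤ 1 / 100 := by
    rw [div_le_iff₀ hκ0]; rw [ht] at hv; linarith
  have hκre : 0 < κ.re := by
    rw [hκ, Complex.re_ofReal_mul]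
    have := hz.re_pos
    positivity
  obtain ⟨n, hn⟩ := exists_nat_near hκre (by linarith) hsin
  have hz' : z - base n = (2 / Real.sqrt 3 : ℝ) * (κ - freq n) := by
    have h3 : ((Real.sqrt 3 : ℝ) : ℂ) ≠ 0 := by
      simp
    rw [hκ, base]; push_cast; field_simp
  refine ⟨n, ?_, ?_⟩
  · by_contra h0
    have : n = 0 := by omega
    subst this
    have h0 : freq 0 = 0 := by simp [freq]
    rw [h0, Complex.ofReal_zero, sub_zero] at hn
    linarith
  · have h3 := sqrt3_bounds
    rw [hz', norm_mul, Complex.norm_real, Real.norm_of_nonneg (by positivity)]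
    have h4 : 2 / Real.sqrt 3 ≤ 12 / 10 := by
      rw [div_le_iff₀ (by linarith)]; linarith
    have h5 : ‖κ - freq n‖ * ‖κ‖ ≤ 12 * (19 * (44 * tiny)) := by
      have h6 : ‖κ - freq n‖ * ‖κ‖ ≤ 6 * (2 * ‖potV z e.1 R X‖ / ‖κ‖) * ‖κ‖ := by gcongr
      have h7 : 6 * (2 * ‖potV z e.1 R X‖ / ‖κ‖) * ‖κ‖ = 12 * ‖potV z e.1 R X‖ := by
        field_simp; ring
      rw [h7] at h6
      linarith
    have h8 : ‖κ - freq n‖ * ‖z‖ ≤ ‖κ - freq n‖ * ‖κ‖ * (12 / 10) := by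
      rw [mul_assoc]
      exact mul_le_mul_of_nonneg_left (by linarith) (norm_nonneg _)
    rw [ht] at h5
    calc _ ≤ 12 / 10 * ‖κ - freq n‖ * ‖z‖ := by gcongr
      _ ≤ _ := by rw [mul_assoc]; linarith

/-- The eigenvalues in the right half plane solve the fixed point problem. -/
theorem Pair.exists_isJoint {p dp q : ℝ → ℂ} {e : Cont × Cont} (hc : Coeffs p dp q e)
    (he : ‖e‖ ≤ tiny) {l : ℂ} (hl : 0 ≤ l.re) {y₁ v₁ w₁ y₂ v₂ w₂ : ℝ → ℂ}
    (hP : Pair p q l (fun _ => 0) (fun _ => 0) y₁ v₁ w₁ y₂ v₂ w₂)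
    (hne : ∃ x ∈ Icc (0 : ℝ) 1, y₁ x ≠ 0 ∨ y₂ x ≠ 0) :
    ∃ n : ℕ, 1 ≤ n ∧ ∃ (R X φ : Cont) (H : ℂ), IsJoint n e R X φ H ∧ ‖R‖ ≤ radius / 1000 ∧
      ‖X‖ ≤ radius / 1000 ∧ ‖φ‖ ≤ radius ∧ ‖H‖ ≤ radius / 1000 ∧
      l = (base n : ℂ) ^ 3 + base n * H := by
  have ht : tiny = 1 / 10 ^ 15 := rfl
  have hr : radius = 1 / 10 ^ 6 := rfl
  set z := l ^ (1 / 3 : ℂ) with hzd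
  have hz3 : z ^ 3 = l := cube_cpow l
  have hsec : Sector z := by
    refine ⟨cpow_sector hl, ?_⟩
    by_contra hlt
    push Not at hlt
    obtain ⟨x, hx, hxy⟩ := hne
    have hsm : ‖l‖ ≤ 1 / 27 := by
      rw [← hz3, norm_pow]
      calc ‖z‖ ^ 3 ≤ (1 / 3) ^ 3 := by gcongr
        _ = 1 / 27 := by norm_num
    obtain ⟨h1, h2⟩ := hP.eq_zero_of_small hc he hsm hx
    tauto
  obtain ⟨R, X, hR, hX, hfix⟩ := exists_ricMap_fixed hsec (e := e) (by rw [ht] at he; norm_num [hr]; linarith)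
  have hR' : ‖R‖ ≤ 44 * tiny := hR.trans (by linarith)
  have hX' : ‖X‖ ≤ 44 * tiny := hX.trans (by linarith)
  have hric := Riccati.of_fixed hc hsec (H := 0) (X0 := R) (by simp [cont_zero_smul]) hfix
  rw [mul_zero, add_zero, hz3] at hric
  have hF : Factor p dp q e z R X l :=
    ⟨hc, hsec, hric, by rw [ht] at he; rw [hr]; linarith, by rw [ht] at hR'; rw [hr]; linarith,
      by rw [ht] at hX'; rw [hr]; linarith⟩
  obtain ⟨f, fd, hf, f0, f1, fd0⟩ := hF.exists_dirichlet hP hne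
  obtain ⟨n, hn, hnz⟩ := hF.exists_base he hR' hX' hf f0 f1 fd0
  have hz0 := hsec.ne_zero
  have hzp := hsec.norm_pos
  have hb3 : 3 ≤ base n := by linarith [three_lt_freq hn, freq_le_base hn]
  have hbn := norm_base hn
  have hb0 : (base n : ℂ) ≠ 0 := norm_pos_iff.1 (by linarith)
  set D := ‖z - base n‖ with hD
  have hD0 : 0 ≤ D := norm_nonneg _
  have hDs : D ≤ 1 / 10 ^ 10 := by
    have := hsec.le_norm
    nlinarith
  have hbz : base n ≤ 101 / 100 * ‖z‖ := by
    have := norm_sub_norm_le (base n : ℂ) z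
    rw [hbn, norm_sub_rev, ← hD] at this
    linarith
  have hzb : ‖z‖ ≤ 101 / 100 * base n := by
    have := norm_sub_norm_le z (base n : ℂ)
    rw [hbn, ← hD] at this
    linarith
  have hDb : D * base n ≤ 3 / 10 ^ 11 := by nlinarith
  -- The same Riccati solution is re-expanded about `base n`: R' is chosen so that base + R'/base =
  -- z + R/z.
  set R' : Cont := ((base n : ℂ) * (z - base n)) • (1 : Cont) + ((base n : ℂ) * z⁻¹) • R with hRd
  have hm : mfun (base n) R' = mfun z R := by
    funext x
    simp only [mfun, hRd, ext_add, ext_smul, ext_one]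
    field_simp
    ring
  -- H stays small for all n because (z − base)(z² + z·base + base²)/base is about 3(z − base)·base,
  -- and the product of |z − base| with `base n` is small.
  set H : ℂ := (z ^ 3 - (base n : ℂ) ^ 3) / base n with hH
  have hlH : l = (base n : ℂ) ^ 3 + base n * H := by rw [hH, ← hz3]; field_simp; ring
  have hR'n : ‖R'‖ ≤ 4 / 10 ^ 11 := by
    refine (norm_add_le _ _).trans ?_
    rw [norm_smul, norm_smul, norm_one, norm_mul, norm_mul, hbn, norm_inv, ← hD]
    have : base n * ‖z‖⁻¹ ≤ 101 / 100 := by rw [← div_eq_mul_inv, div_le_iff₀ hzp]; exact hbz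
    have h2 := mul_le_mul this hR' (norm_nonneg _) (by norm_num)
    rw [ht] at h2
    linarith
  have hHn : ‖H‖ ≤ 1 / 10 ^ 10 := by
    have e1 : H = (z - base n) * (z ^ 2 + z * base n + (base n : ℂ) ^ 2) / base n := by
      rw [hH]; ring
    rw [e1, norm_div, norm_mul, hbn, div_le_iff₀ (by linarith), ← hD]
    have e2 : ‖z ^ 2 + z * base n + (base n : ℂ) ^ 2‖ ≤ ‖z‖ ^ 2 + ‖z‖ * base n + base n ^ 2 := by
      refine norm_add₃_le.trans ?_
      rw [norm_pow, norm_mul, norm_pow, hbn]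
    have e3 : ‖z‖ ^ 2 + ‖z‖ * base n + base n ^ 2 ≤ 33 / 10 * base n ^ 2 := by nlinarith
    calc _ ≤ D * (33 / 10 * base n ^ 2) := mul_le_mul_of_nonneg_left (e2.trans e3) hD0
      _ = 33 / 10 * (D * base n) * base n := by ring
      _ ≤ _ := mul_le_mul_of_nonneg_right (by linarith) (by linarith)
  have hFb : Factor p dp q e (base n) R' X ((base n : ℂ) ^ 3 + base n * H) := by
    rw [← hlH]
    exact ⟨hc, sector_base hn, hm ▸ hF.riccati, hF.norm_e, hR'n.trans (by norm_num [hr]), hF.norm_X⟩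
  have hvn : ‖potV (base n) e.1 R' X‖ ≤ 19 * (4 / 10 ^ 11) :=
    potV_le (sector_base hn) (by norm_num) (((norm_fst_le e).trans he).trans (by norm_num [ht])) hR'n
      (hX'.trans (by norm_num [ht]))
  obtain ⟨φ, hJ, hφ⟩ := IsJoint.of_dirichlet hn hFb (hm.symm ▸ hf) f0 f1 fd0 (by norm_num) hvn
  exact ⟨n, hn, R', X, φ, H, hJ, hR'n.trans (by norm_num [hr]), hX'.trans (by norm_num [ht, hr]),
    hφ.trans (by norm_num [hr]), hHn.trans (by norm_num [hr]), hlH⟩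

/-! ### Simplicity of the eigenvalues -/

/-- `l` is a simple eigenvalue, in terms of pairs of solutions on one period. -/
def IsSimplePair (p q : ℝ → ℂ) (l : ℂ) : Prop :=
  ∃ y v w y₂ v₂ w₂ : ℝ → ℂ, Pair p q l (fun _ => 0) (fun _ => 0) y v w y₂ v₂ w₂ ∧
    (∃ x ∈ Icc (0 : ℝ) 1, y x ≠ 0 ∨ y₂ x ≠ 0) ∧
    (∀ a b c a₂ b₂ c₂ : ℝ → ℂ, Pair p q l (fun _ => 0) (fun _ => 0) a b c a₂ b₂ c₂ →
      ∃ k : ℂ, ∀ x ∈ Icc (0 : ℝ) 1, a x = k * y x ∧ a₂ x = k * y₂ x) ∧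
    ∀ a b c a₂ b₂ c₂ : ℝ → ℂ, ¬ Pair p q l y y₂ a b c a₂ b₂ c₂

lemma Prim.deriv_eq_zero {f f' : ℝ → ℂ} (h : Prim f f') (hc : ContinuousOn f' (Icc 0 1))
    (h0 : ∀ x ∈ Icc (0 : ℝ) 1, f x = 0) : f' 0 = 0 := by
  have h1 := h.hasDerivWithinAt hc (x := 0) ⟨le_rfl, zero_lt_one⟩
  have h2 : HasDerivWithinAt f 0 (Ici 0) 0 := by
    refine (hasDerivWithinAt_const (0 : ℝ) (Ici 0) (0 : ℂ)).congr_of_eventuallyEq ?_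
      (h0 0 zero_mem01)
    filter_upwards [Icc_mem_nhdsGE (zero_lt_one : (0 : ℝ) < 1)] with x hx using h0 x hx
  exact (uniqueDiffWithinAt_Ici (0 : ℝ)).eq_deriv _ h1 h2

lemma Pair.sub_mul {p q : ℝ → ℂ} {l : ℂ} {y₁ v₁ w₁ y₂ v₂ w₂ a₁ b₁ c₁ a₂ b₂ c₂ : ℝ → ℂ} (k : ℂ)
    (h : Pair p q l (fun _ => 0) (fun _ => 0) y₁ v₁ w₁ y₂ v₂ w₂)
    (h' : Pair p q l (fun _ => 0) (fun _ => 0) a₁ b₁ c₁ a₂ b₂ c₂) :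
    Pair p q l (fun _ => 0) (fun _ => 0) (fun x => y₁ x - k * a₁ x) (fun x => v₁ x - k * b₁ x)
      (fun x => w₁ x - k * c₁ x) (fun x => y₂ x - k * a₂ x) (fun x => v₂ x - k * b₂ x)
      (fun x => w₂ x - k * c₂ x) := by
  have h1 := h.fst.sub_mul k h'.fst
  have h2 := h.snd.sub_mul k h'.snd
  refine ⟨⟨h1.prim_y, h1.prim_v, h1.prim_w.congr (fun _ _ => rfl) (fun _ _ => by ring)⟩,
    ⟨h2.prim_y, h2.prim_v, h2.prim_w.congr (fun _ _ => rfl) (fun _ _ => by ring)⟩,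
    ?_, ?_, ?_, ?_, ?_, ?_⟩
  · simp [h.y₁_zero, h'.y₁_zero]
  · simp [h.y₁_one, h'.y₁_one]
  · simp [h.y₂_zero, h'.y₂_zero]
  · simp [h.y₂_one, h'.y₂_one]
  · simp [h.match_v, h'.match_v]
  · simp [h.match_w, h'.match_w]

/-- The right side of the equation for the gradient with respect to `q`. -/
def source (m f fd : ℝ → ℂ) (x : ℝ) : ℂ := 3 / 2 * (m x * f x ^ 2 + 2 * (f x * fd x))

namespace Factor

variable {p dp q : ℝ → ℂ} {e : Cont × Cont} {z : ℂ} {R X : Cont} {l : ℂ}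
  (h : Factor p dp q e z R X l)
include h

lemma dominates_adjoint : Dominates z (rho z) (rho' z) (-alpha z R) (beta z e.1 R - (3 : ℂ) • X) := by
  have hr : radius = 1 / 10 ^ 6 := rfl
  have hz := h.sector
  have h1 := h.norm_alpha_le
  have h2 := h.norm_beta_le
  have h3 := h.norm_R
  have h4 := h.norm_e
  have h5 := hz.le_norm
  have h6 : ‖(3 : ℂ) • X‖ ≤ 3 * radius := by
    rw [norm_smul]; norm_num; exact h.norm_X
  have h7 := norm_sub_le (beta z e.1 R) ((3 : ℂ) • X)
  rw [hr] at h3 h4 h6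
  exact ⟨hz, hz.re_le_rho.1.trans (le_abs_self _), hz.re_le_rho.2.trans (le_abs_self _),
    Sector.norm_rho.1, Sector.norm_rho.2, by rw [norm_neg]; linarith, by nlinarith⟩

lemma perEq_adjoint_coeff {x : ℝ} (hx : x ∈ Icc (0 : ℝ) 1) (u u1 : ℂ) :
    (rho z + rho' z) * u1 - rho z * rho' z * u - ext (-alpha z R) x * u1 -
      ext (beta z e.1 R - (3 : ℂ) • X) x * u =
      3 * mfun z R x * u1 + 3 * ext X x * u - (3 * mfun z R x ^ 2 + 2 * p x) * u := by
  have hz := h.sector.ne_zero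
  rw [rho_mul, rho_add]
  simp only [alpha, beta, mfun, ext_add, ext_sub, ext_neg, ext_smul, ext_mul, h.coeffs.ext_p x hx]
  field_simp
  ring

/-- The two periodic operators are adjoint to each other. -/
lemma integral_adjoint {b c : Cont} {g g1 d d1 : ℝ → ℂ}
    (hg : PerEq (-rho z) (-rho' z) (alpha z R) (beta z e.1 R) b g g1)
    (hd : PerEq (rho z) (rho' z) (-alpha z R) (beta z e.1 R - (3 : ℂ) • X) c d d1) :
    ∫ x in (0 : ℝ)..1, (ext b x * d x - g x * ext c x) = 0 := by
  have h1 := (((hg.prim1.mul hd.prim).sub (hg.prim.mul hd.prim1)).add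
    (((h.riccati.prim.mul hg.prim).mul hd.prim).const_mul 3)).integral
  simp only [hg.per, hg.per1, hd.per, hd.per1, h.riccati.per, sub_self] at h1
  rw [← h1]
  refine integral_congr01 zero_mem01 one_mem01 fun x hx => ?_
  have e1 := h.perEq_iff_coeff hx (g x) (g1 x)
  have e2 := h.perEq_adjoint_coeff hx (d x) (d1 x)
  rw [e1, e2]
  ring

/-- Geometric simplicity is `pair_eq_zero`. For algebraic simplicity, a generalized eigenfunction
produces a Dirichlet problem with a source; its solvability condition against f reads ∫ d·b = 0,
where d is the periodic solution of the adjoint equation with right side 1. By adjointness this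
integral equals ∫g. -/
lemma isSimplePair {f fd : ℝ → ℂ} (hf : Schrod (reducedPot p (mfun z R) (ext X)) f fd)
    (f0 : f 0 = 0) (f1 : f 1 = 0) (fd0 : fd 0 ≠ 0) {b : Cont} {g g1 : ℝ → ℂ}
    (hb : ∀ x ∈ Icc (0 : ℝ) 1, ext b x = source (mfun z R) f fd x)
    (hg : PerEq (-rho z) (-rho' z) (alpha z R) (beta z e.1 R) b g g1)
    (hne : ∫ x in (0 : ℝ)..1, g x ≠ 0) : IsSimplePair p q l := by
  obtain ⟨E, hE, hE', E0, hE0⟩ := exists_integratingFactor (continuousOn_mfun z R) (1 / 2)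
  obtain ⟨y, v, w, y₂, v₂, w₂, hP, hy, hv, hs, hy₂, hv0, -⟩ :=
    h.pair_of_dirichlet hE' hf f0 f1 fd0 E0
  set m := mfun z R with hm
  set c := v 1 / v 0 with hc
  have hv0' : v 0 ≠ 0 := hv0 ▸ fd0
  have hynz : ∃ x ∈ Icc (0 : ℝ) 1, y x ≠ 0 := by
    by_contra hcon
    push Not at hcon
    exact hv0' (hP.fst.prim_y.deriv_eq_zero hP.fst.prim_v.continuousOn hcon)
  have hcv : c * v 0 = v 1 := by rw [hc]; field_simp
  -- If c = τ, the eigenfunction would satisfy y(x+1) = τy(x).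
  have hcτ : c - E 1 ^ 2 ≠ 0 := fun hcon => by
    obtain ⟨x, hx, hxy⟩ := hynz
    refine hxy (h.pair_eq_zero hE hE' E0 hE0 hP ?_ hx).1
    rw [← hcv]; linear_combination v 0 * hcon
  refine ⟨y, v, w, y₂, v₂, w₂, hP, hynz.imp fun x hx => ⟨hx.1, Or.inl hx.2⟩, fun a₁ b₁ c₁ a₂ b₂ c₂ hA => ?_,
    fun a₁ b₁ c₁ a₂ b₂ c₂ hA => ?_⟩
  · have hd : v 1 - E 1 ^ 2 * v 0 ≠ 0 := by
      rw [← hcv, ← sub_mul]; exact mul_ne_zero hcτ hv0'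
    set k := (b₁ 1 - E 1 ^ 2 * b₁ 0) / (v 1 - E 1 ^ 2 * v 0) with hk
    refine ⟨k, fun x hx => ?_⟩
    obtain ⟨h1, h2⟩ := h.pair_eq_zero hE hE' E0 hE0 (hA.sub_mul k hP) (by
      have : k * (v 1 - E 1 ^ 2 * v 0) = b₁ 1 - E 1 ^ 2 * b₁ 0 := by rw [hk]; field_simp
      linear_combination -this) hx
    exact ⟨sub_eq_zero.1 h1, sub_eq_zero.1 h2⟩
  -- U is u(x+1) − τu(x) for a supposed generalized eigenfunction u. Its image G under the right
  -- factor satisfies G' = mG + (c − τ)y.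
  · obtain ⟨d, d1, hd⟩ := h.dominates_adjoint.exists_perEq 1
    obtain ⟨U, V, W, hT, hU, hV, U0, U1, hG0, hG1⟩ := h.pair_sub (E := E) hA
    set G := secondOrder p m (ext X) U V W with hG
    have hGp := hT.prim_secondOrder h.coeffs.prim_p h.riccati
    -- the boundary values of `G`
    have hGc : G 1 = c * G 0 := by
      have q1 := hA.fst.prim_secondOrder h.coeffs.prim_p h.riccati
      have q2 := hA.snd.prim_secondOrder h.coeffs.prim_p h.riccati
      have q3 := eq_mul_of_prim hE' E0 hE0 ((q2.sub (q1.const_mul c)).congr (fun _ _ => rfl)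
        (fun x _ => by rw [hy₂ x]; ring)) one_mem01
      have q4 : secondOrder p m (ext X) a₂ b₂ c₂ 0 = secondOrder p m (ext X) a₁ b₁ c₁ 1 := by
        simp only [secondOrder, hA.y₁_one, hA.y₂_zero, hA.match_v, hA.match_w, hm, h.riccati.per]
        ring
      rw [hG0, hG1]
      simp only [← hm] at q3
      rw [q4] at q3
      linear_combination q3
    -- a solution of the equation for `G`
    set γ : ℝ → ℂ := fun x => -(ext d x * v x + (2 * (m x * ext d x) - ext d1 x) * y x) with hγ
    have hγp : Prim γ (fun x => m x * γ x + y x) := by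
      refine ((hd.prim.mul hP.fst.prim_v).add ((((h.riccati.prim.mul hd.prim).const_mul 2).sub
        hd.prim1).mul hP.fst.prim_y)).neg.congr (fun x _ => rfl) (fun x hx => ?_)
      have e1 := h.perEq_adjoint_coeff hx (ext d x) (ext d1 x)
      have e2 := hs x
      simp only [secondOrder] at e2
      rw [e1, ext_one, ← hm, hγ]
      linear_combination (ext d x) * e2
    have hγc : γ 1 = c * γ 0 := by
      simp only [hγ, hP.y₁_zero, hP.y₁_one, hd.per, ← hcv]; ring
    -- Both sides satisfy the same first order equation and are multiplied by c over one period,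
    -- whereas homogeneous solutions are multiplied by τ ≠ c. So the difference vanishes.
    have hD : ∀ x ∈ Icc (0 : ℝ) 1, G x = (c - E 1 ^ 2) * γ x := fun x hx => by
      have q1 := (hGp.sub (hγp.const_mul (c - E 1 ^ 2))).congr (g := fun x => G x -
        (c - E 1 ^ 2) * γ x) (g' := fun x => m x * (G x - (c - E 1 ^ 2) * γ x)) (fun _ _ => rfl)
        (fun x _ => by rw [hy₂ x]; ring)
      have q2 := eq_mul_of_prim hE' E0 hE0 q1 one_mem01
      rw [hGc, hγc] at q2
      have q3 : (c - E 1 ^ 2) * (G 0 - (c - E 1 ^ 2) * γ 0) = 0 := by linear_combination q2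
      have q4 := (mul_eq_zero.1 q3).resolve_left hcτ
      have q5 := eq_mul_of_prim hE' E0 hE0 q1 hx
      rw [q4, mul_zero] at q5
      exact sub_eq_zero.1 q5
    -- orthogonality
    obtain ⟨p1, p2⟩ := hT.prim_reduced h.riccati hE
    have horth := lagrange_dirichlet hf.prim hf.prim1 p1 p2 f0 f1 (by simp [U0]) (by simp [U1])
    have hint : ∫ x in (0 : ℝ)..1, ext d x * ext b x = 0 := by
      have q1 := ((hd.prim.mul (hf.prim.mul hf.prim))).integral
      simp only [f0, f1, mul_zero, sub_zero] at q1
      have q2 : ∫ x in (0 : ℝ)..1, (f x * (-(reducedPot p m (ext X) x * (E x * U x)) + E x * G x) -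
          -(reducedPot p m (ext X) x * f x) * (E x * U x)) = -(c - E 1 ^ 2) *
          ∫ x in (0 : ℝ)..1, (ext d x * ext b x -
            (ext d1 x * (f x * f x) + ext d x * (fd x * f x + f x * fd x))) := by
        rw [← intervalIntegral.integral_const_mul]
        refine integral_congr01 zero_mem01 one_mem01 fun x hx => ?_
        rw [hD x hx, hb x hx, hγ]
        simp only [source, hy, hv]
        have := hE0 x
        field_simp
        ring
      rw [horth, intervalIntegral.integral_sub, q1, sub_zero] at q2
      · exact (mul_eq_zero.1 q2.symm).resolve_left (neg_ne_zero.2 hcτ)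
      · exact ((continuous_ext d).mul (continuous_ext b)).intervalIntegrable _ _
      · exact (hd.prim.mul (hf.prim.mul hf.prim)).1
    -- The derivative of d·f² was split off above and has zero integral, which leaves ∫ d·b = 0;
    -- adjointness converts this into ∫g = 0.
    have hadj := h.integral_adjoint hg hd
    apply hne
    have q6 : ∫ x in (0 : ℝ)..1, (ext b x * ext d x - g x * ext 1 x) =
        (∫ x in (0 : ℝ)..1, ext d x * ext b x) - ∫ x in (0 : ℝ)..1, g x := by
      rw [← intervalIntegral.integral_sub]
      · exact intervalIntegral.integral_congr fun x _ => by simp only [ext_one]; ring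
      · exact ((continuous_ext d).mul (continuous_ext b)).intervalIntegrable _ _
      · exact hg.prim.continuousOn.intervalIntegrable01
    rw [hadj, hint, zero_sub] at q6
    exact neg_eq_zero.1 q6.symm

end Factor

/-! ### The function that represents the gradient -/

/-- A small solution of the fixed point problem for the `n`-th eigenvalue. -/
structure Mode (p dp q : ℝ → ℂ) (n : ℕ) (e : Cont × Cont) (R X φ : Cont) (H : ℂ) : Prop where
  one_le : 1 ≤ n
  coeffs : Coeffs p dp q e
  joint : IsJoint n e R X φ H
  norm_e : ‖e‖ ≤ tiny
  norm_R : ‖R‖ ≤ 4400 * ‖e‖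
  norm_X : ‖X‖ ≤ 4400 * ‖e‖
  norm_φ : ‖φ‖ ≤ 4400 * ‖e‖
  norm_H : ‖H‖ ≤ 4400 * ‖e‖

/-- The derivative of the eigenfunction `f` of the reduced equation. -/
def slope (n : ℕ) (v f : Cont) : Cont :=
  (freq n : ℂ) • cosC (freq n) - waveInt' (freq n) (v * f)

/-- The `source` as an element of `Cont`. -/
def sourceC (z : ℂ) (R f fd : Cont) : Cont :=
  (3 / 2 : ℂ) • ((z • (1 : Cont) + z⁻¹ • R) * (f * f) + (2 : ℂ) • (f * fd))

/-- The function `a_n`. -/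
def waveA (n : ℕ) (x : ℝ) : ℂ :=
  Complex.cos ((2 * freq n : ℝ) * x) + Complex.sin ((2 * freq n : ℝ) * x) / (Real.sqrt 3 : ℝ)

/-- The derivative of `a_n`. -/
def waveA' (n : ℕ) (x : ℝ) : ℂ :=
  (2 * freq n : ℝ) * (Complex.cos ((2 * freq n : ℝ) * x) / (Real.sqrt 3 : ℝ) -
    Complex.sin ((2 * freq n : ℝ) * x))

lemma prim_waveA (n : ℕ) : Prim (waveA n) (waveA' n) :=
  ((prim_cos _).add ((prim_sin _).const_mul ((Real.sqrt 3 : ℝ) : ℂ)⁻¹)).congr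
    (fun x _ => by simp only [waveA]; ring) (fun x _ => by simp only [waveA']; ring)

lemma prim_waveA' (n : ℕ) : Prim (waveA' n) (fun x => -((2 * freq n : ℝ) ^ 2 * waveA n x)) :=
  ((((prim_cos _).const_mul ((Real.sqrt 3 : ℝ) : ℂ)⁻¹).sub (prim_sin _)).const_mul
    ((2 * freq n : ℝ) : ℂ)).congr
    (fun x _ => by simp only [waveA']; ring) (fun x _ => by simp only [waveA]; ring)

lemma sqrt3_ne : ((Real.sqrt 3 : ℝ) : ℂ) ≠ 0 := by simp

lemma sqrt3_base_cast (n : ℕ) :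
    ((Real.sqrt 3 : ℝ) : ℂ) * base n = 2 * freq n := by
  have := congrArg ((↑) : ℝ → ℂ) (sqrt3_base n)
  push_cast at this
  exact this

lemma waveA_per (n : ℕ) : waveA n 0 = waveA n 1 ∧ waveA' n 0 = waveA' n 1 := by
  have h1 : Complex.sin (2 * freq n) = 0 := by
    rw [Complex.sin_two_mul, csin_freq]; ring
  have h2 : Complex.cos (2 * freq n) = 1 := by
    rw [Complex.cos_two_mul, ccos_freq_sq]; norm_num
  simp [waveA, waveA', h1, h2]

lemma norm_waveA_le (n : ℕ) (x : ℝ) : ‖waveA n x‖ ≤ 2 := by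
  rw [waveA, ← Complex.ofReal_mul]
  refine (norm_add_le _ _).trans ?_
  rw [norm_div, Complex.norm_real, Real.norm_of_nonneg (Real.sqrt_nonneg 3)]
  have h3 := sqrt3_bounds
  have h1 := norm_ccos_ofReal_le (2 * freq n * x)
  have h2 := norm_csin_ofReal_le (2 * freq n * x)
  have h4 : ‖Complex.sin ((2 * freq n * x : ℝ) : ℂ)‖ / Real.sqrt 3 ≤ 1 := by
    rw [div_le_one (by linarith)]; linarith
  linarith

lemma norm_waveA'_le {n : ℕ} (hn : 1 ≤ n) (x : ℝ) : ‖waveA' n x‖ ≤ 4 * freq n := by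
  have hf := three_lt_freq hn
  rw [waveA', ← Complex.ofReal_mul, norm_mul, Complex.norm_real, Real.norm_of_nonneg (by linarith)]
  have h3 := sqrt3_bounds
  have h1 := norm_ccos_ofReal_le (2 * freq n * x)
  have h2 := norm_csin_ofReal_le (2 * freq n * x)
  have h4 : ‖Complex.cos ((2 * freq n * x : ℝ) : ℂ) / (Real.sqrt 3 : ℝ)‖ ≤ 1 := by
    rw [norm_div, Complex.norm_real, Real.norm_of_nonneg (Real.sqrt_nonneg 3),
      div_le_one (by linarith)]
    linarith
  have h5 := norm_sub_le (Complex.cos ((2 * freq n * x : ℝ) : ℂ) / (Real.sqrt 3 : ℝ))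
    (Complex.sin ((2 * freq n * x : ℝ) : ℂ))
  nlinarith

lemma integral_waveA (n : ℕ) (hn : 1 ≤ n) : ∫ x in (0 : ℝ)..1, waveA n x = 0 := by
  have h := (prim_waveA' n).integral
  rw [(waveA_per n).2, sub_self, intervalIntegral.integral_neg, intervalIntegral.integral_const_mul,
    neg_eq_zero] at h
  refine (mul_eq_zero.1 h).resolve_left (pow_ne_zero _ ?_)
  push_cast
  exact mul_ne_zero two_ne_zero (freq_ne_zero hn)

/-- The unperturbed solution of the equation for the gradient. -/
def gZero (n : ℕ) : Cont :=
  toCont (fun x => (4 * base n : ℂ)⁻¹ * (1 - waveA n x)) (by unfold waveA; fun_prop)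

/-- The derivative of the unperturbed solution of the equation for the gradient. -/
def gZero' (n : ℕ) : Cont :=
  toCont (fun x => -((4 * base n : ℂ)⁻¹ * waveA' n x)) (by unfold waveA'; fun_prop)

lemma norm_inv_four_base {n : ℕ} (hn : 1 ≤ n) : ‖(4 * base n : ℂ)⁻¹‖ = (4 * base n)⁻¹ := by
  rw [norm_inv, norm_mul, norm_base hn]; norm_num

lemma norm_gZero_le {n : ℕ} (hn : 1 ≤ n) : base n * ‖gZero n‖ ≤ 3 / 4 := by
  have hb : 3 < base n := by linarith [three_lt_freq hn, freq_le_base hn]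
  have : ‖gZero n‖ ≤ 3 / (4 * base n) := norm_cont_le (by positivity) fun x hx => by
    rw [gZero, ext_toCont _ hx, norm_mul, norm_inv_four_base hn, div_eq_inv_mul]
    refine mul_le_mul_of_nonneg_left ?_ (by positivity)
    have := norm_sub_le 1 (waveA n x)
    rw [norm_one] at this
    linarith [norm_waveA_le n x]
  rw [le_div_iff₀ (by linarith)] at this
  linarith

lemma norm_gZero'_le {n : ℕ} (hn : 1 ≤ n) : ‖gZero' n‖ ≤ 1 := norm_cont_le zero_le_one fun x hx => by
  have hb := freq_le_base hn
  have hf := three_lt_freq hn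
  rw [gZero', ext_toCont _ hx, norm_neg, norm_mul, norm_inv_four_base hn, inv_mul_eq_div, div_le_one
    (by linarith)]
  linarith [norm_waveA'_le hn x]

lemma prim_gZero (n : ℕ) : Prim (ext (gZero n)) (ext (gZero' n)) :=
  (((Prim.const 1).sub (prim_waveA n)).const_mul ((4 * base n : ℂ)⁻¹)).congr
    (fun x hx => by rw [gZero, ext_toCont _ hx]) (fun x hx => by
      rw [gZero', ext_toCont _ hx]; ring)

/-- For ψ = 0 the source is a constant plus the frequency 2κ, and √3·`base n` = 2κ makes the
response (1 − a_n)/(4·base). This is where a_n originates. -/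
lemma prim_gZero' {n : ℕ} (hn : 1 ≤ n) : Prim (ext (gZero' n)) (fun x =>
    -(3 * base n * ext (gZero' n) x) - 3 * (base n : ℂ) ^ 2 * ext (gZero n) x +
      3 / 2 * (base n * Complex.sin (freq n * x) ^ 2 +
        2 * (Complex.sin (freq n * x) * (freq n * Complex.cos (freq n * x))))) := by
  have hz := (sector_base hn).ne_zero
  refine ((prim_waveA' n).const_mul (-(4 * base n : ℂ)⁻¹)).congr
    (fun x hx => by rw [gZero', ext_toCont _ hx]; ring) (fun x hx => ?_)
  rw [gZero', ext_toCont _ hx, gZero, ext_toCont _ hx]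
  have e1 : (((2 * freq n : ℝ) : ℂ) * x) = 2 * (freq n * x) := by push_cast; ring
  simp only [waveA, waveA', e1, Complex.sin_two_mul, Complex.cos_two_mul']
  have e2 := Complex.sin_sq_add_cos_sq ((freq n : ℂ) * x)
  have e3 : (freq n : ℂ) = (Real.sqrt 3 : ℝ) * base n / 2 := by rw [sqrt3_base_cast]; ring
  have e4 := sqrt3_sq
  have e5 := sqrt3_ne
  have e6 : Complex.cos ((freq n : ℂ) * x) ^ 2 = 1 - Complex.sin ((freq n : ℂ) * x) ^ 2 := by
    linear_combination e2
  rw [e6]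
  set S := Complex.sin ((freq n : ℂ) * x)
  set C := Complex.cos ((freq n : ℂ) * x)
  push_cast
  rw [e3]
  set t := ((Real.sqrt 3 : ℝ) : ℂ)
  have e7 : t⁻¹ = t / 3 := by rw [← e4]; field_simp
  simp only [div_eq_mul_inv, e7, mul_inv]
  field_simp
  ring_nf
  have e8 : t ^ 3 = 3 * t := by linear_combination t * e4
  simp only [e4, e8]
  ring

lemma norm_waveInt'_le (κ : ℝ) (a : Cont) : ‖waveInt' κ a‖ ≤ 2 * ‖a‖ := by
  have h : ∀ b : Cont, ‖b‖ ≤ 1 → ‖b * volterra (b * a)‖ ≤ ‖a‖ := fun b hb => by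
    calc ‖b * volterra (b * a)‖ ≤ ‖b‖ * ‖volterra (b * a)‖ := norm_mul_le _ _
      _ ≤ 1 * ‖b * a‖ := by gcongr; exact norm_volterra_le _
      _ ≤ ‖b‖ * ‖a‖ := by rw [one_mul]; exact norm_mul_le _ _
      _ ≤ 1 * ‖a‖ := by gcongr
      _ = ‖a‖ := one_mul _
  rw [waveInt']
  linarith [norm_add_le (cosC κ * volterra (cosC κ * a)) (sinC κ * volterra (sinC κ * a)),
    h _ (norm_sinC_le κ), h _ (norm_cosC_le κ)]

namespace Mode

variable {p dp q : ℝ → ℂ} {n : ℕ} {e : Cont × Cont} {R X φ : Cont} {H : ℂ}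
  (h : Mode p dp q n e R X φ H)
include h

lemma factor : Factor p dp q e (base n) R X ((base n : ℂ) ^ 3 + base n * H) := by
  have he := h.norm_e
  have hR := h.norm_R
  have hX := h.norm_X
  rw [tiny] at he
  exact h.joint.factor h.one_le h.coeffs (by rw [radius]; linarith) (by rw [radius]; linarith)
    (by rw [radius]; linarith)

lemma norm_potV : ‖potV (base n) e.1 R X‖ ≤ 83600 * ‖e‖ := by
  have he := h.norm_e
  rw [tiny] at he
  have := potV_le (sector_base h.one_le) (P := e.1) (δ := 4400 * ‖e‖) (by linarith)
    ((norm_fst_le e).trans (by linarith [norm_nonneg e])) h.norm_R h.norm_X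
  linarith

lemma norm_f : ‖sinC (freq n) + φ‖ ≤ 2 := by
  have he := h.norm_e
  have hφ := h.norm_φ
  rw [tiny] at he
  linarith [norm_add_le (sinC (freq n)) φ, norm_sinC_le (freq n)]

lemma norm_potV_mul : ‖potV (base n) e.1 R X * (sinC (freq n) + φ)‖ ≤ 167200 * ‖e‖ := by
  have := mul_le_mul h.norm_potV h.norm_f (norm_nonneg _) (by positivity)
  linarith [norm_mul_le (potV (base n) e.1 R X) (sinC (freq n) + φ)]

/-- The factor κ⁻¹ in the wave equation makes φ decay like 1/n, which the bound in `Mode` does not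
record. -/
lemma freq_mul_norm_φ : freq n * ‖φ‖ ≤ 334400 * ‖e‖ := by
  have hf := three_lt_freq h.one_le
  have h1 := norm_waveInt_le (freq n) (potV (base n) e.1 R X * (sinC (freq n) + φ))
  have h2 : ‖φ‖ = (freq n)⁻¹ * ‖waveInt (freq n) (potV (base n) e.1 R X * (sinC (freq n) + φ))‖ := by
    conv_lhs => rw [h.joint.wave]
    rw [norm_neg, norm_smul, norm_inv, Complex.norm_real, Real.norm_of_nonneg (by linarith)]
  have h3 : freq n * ‖φ‖ = ‖waveInt (freq n) (potV (base n) e.1 R X * (sinC (freq n) + φ))‖ := by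
    rw [h2]; field_simp
  linarith [h.norm_potV_mul]

lemma norm_slope_sub : ‖slope n (potV (base n) e.1 R X) (sinC (freq n) + φ) -
    (freq n : ℂ) • cosC (freq n)‖ ≤ 334400 * ‖e‖ := by
  rw [slope, sub_sub_cancel_left, norm_neg]
  linarith [norm_waveInt'_le (freq n) (potV (base n) e.1 R X * (sinC (freq n) + φ)),
    h.norm_potV_mul]

omit h in
lemma _root_.ThreePoint.ext_slope (v f : Cont) {x : ℝ} (hx : x ∈ Icc (0 : ℝ) 1) :
    ext (slope n v f) x = jointDeriv n v f x := by
  rw [slope, ext_sub, ext_smul, ext_cosC _ hx, jointDeriv]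

lemma schrod : Schrod (reducedPot p (mfun (base n) R) (ext X)) (ext (sinC (freq n) + φ))
      (ext (slope n (potV (base n) e.1 R X) (sinC (freq n) + φ))) ∧
    ext (sinC (freq n) + φ) 0 = 0 ∧ ext (sinC (freq n) + φ) 1 = 0 ∧
    ext (slope n (potV (base n) e.1 R X) (sinC (freq n) + φ)) 0 = freq n := by
  obtain ⟨h1, h2, h3, h4⟩ := h.joint.schrod h.one_le h.factor
  exact ⟨⟨h1.prim.congr (fun _ _ => rfl) (fun x hx => ext_slope _ _ hx),
    h1.prim1.congr (fun x hx => ext_slope _ _ hx) (fun _ _ => rfl)⟩, h2, h3, by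
    rw [ext_slope _ _ zero_mem01, h4]⟩

end Mode

/-- The solution `g` of the equation for the gradient and its derivative. -/
def IsGrad (n : ℕ) (e : Cont × Cont) (R X φ g g1 : Cont) : Prop :=
  PerEq (-rho (base n)) (-rho' (base n)) (Factor.alpha (base n) R) (Factor.beta (base n) e.1 R)
    (sourceC (base n) R (sinC (freq n) + φ)
      (slope n (potV (base n) e.1 R X) (sinC (freq n) + φ))) (ext g) (ext g1)

namespace Mode

variable {p dp q : ℝ → ℂ} {n : ℕ} {e : Cont × Cont} {R X φ : Cont} {H : ℂ}
  (h : Mode p dp q n e R X φ H)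
include h

lemma exists_isGrad : ∃ g g1 : Cont, IsGrad n e R X φ g g1 :=
  h.factor.dominates.exists_perEq _

/-- The source has size n, but its deviation from the unperturbed one is bounded uniformly in n: φ =
O(1/n) compensates the factors `base n` and `freq n`, and the deviation of the slope is O(1). -/
lemma norm_source_sub : ‖sourceC (base n) R (sinC (freq n) + φ)
      (slope n (potV (base n) e.1 R X) (sinC (freq n) + φ)) - (3 / 2 : ℂ) •
        ((base n : ℂ) • (sinC (freq n) * sinC (freq n)) +
          (2 : ℂ) • (sinC (freq n) * ((freq n : ℂ) • cosC (freq n))))‖ ≤ 7 * 10 ^ 6 * ‖e‖ := by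
  set f := sinC (freq n) + φ with hf
  set fd := slope n (potV (base n) e.1 R X) f with hfd
  have hκ := three_lt_freq h.one_le
  have hzκ := base_le_freq h.one_le
  have hκz := freq_le_base h.one_le
  have he := norm_nonneg e
  have e1 : sourceC (base n) R f fd - (3 / 2 : ℂ) •
        ((base n : ℂ) • (sinC (freq n) * sinC (freq n)) +
          (2 : ℂ) • (sinC (freq n) * ((freq n : ℂ) • cosC (freq n)))) =
      (3 / 2 : ℂ) • ((base n : ℂ) • (φ * (f + sinC (freq n))) + (base n : ℂ)⁻¹ • (R * (f * f)) +
        (2 : ℂ) • (φ * ((freq n : ℂ) • cosC (freq n)) +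
          f * (fd - (freq n : ℂ) • cosC (freq n)))) := by
    refine cont_ext fun x _ => ?_
    simp only [sourceC, ext_sub, ext_smul, ext_add, ext_mul, ext_one, hf]
    ring
  have b1 : ‖(base n : ℂ) • (φ * (f + sinC (freq n)))‖ ≤ 3 * (668800 * ‖e‖) := by
    rw [norm_smul, norm_base h.one_le]
    have k1 : ‖f + sinC (freq n)‖ ≤ 3 := by
      linarith [norm_add_le f (sinC (freq n)), h.norm_f, norm_sinC_le (freq n)]
    have k2 : ‖φ * (f + sinC (freq n))‖ ≤ ‖φ‖ * 3 :=
      (norm_mul_le _ _).trans (mul_le_mul_of_nonneg_left k1 (norm_nonneg _))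
    have k3 := h.freq_mul_norm_φ
    calc _ ≤ (2 * freq n) * (‖φ‖ * 3) := by gcongr
      _ ≤ _ := by linarith
  have b2 : ‖(base n : ℂ)⁻¹ • (R * (f * f))‖ ≤ 1 / 3 * (4400 * ‖e‖ * 4) := by
    rw [norm_smul, norm_inv, norm_base h.one_le]
    have k1 : (base n)⁻¹ ≤ 1 / 3 := by
      rw [inv_le_comm₀ (by linarith) (by norm_num)]; linarith
    have k2 : ‖f * f‖ ≤ 2 * 2 := (norm_mul_le _ _).trans
      (mul_le_mul h.norm_f h.norm_f (norm_nonneg _) (by norm_num))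
    have k3 : ‖R * (f * f)‖ ≤ 4400 * ‖e‖ * 4 := (norm_mul_le _ _).trans
      (mul_le_mul h.norm_R (by linarith) (norm_nonneg _) (by positivity))
    exact mul_le_mul k1 k3 (norm_nonneg _) (by norm_num)
  have b3 : ‖φ * ((freq n : ℂ) • cosC (freq n))‖ ≤ 334400 * ‖e‖ := by
    have k1 : ‖(freq n : ℂ) • cosC (freq n)‖ ≤ freq n := by
      rw [norm_smul, Complex.norm_real, Real.norm_of_nonneg (by linarith)]
      exact mul_le_of_le_one_right (by linarith) (norm_cosC_le _)
    have k2 := h.freq_mul_norm_φ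
    calc _ ≤ ‖φ‖ * freq n := (norm_mul_le _ _).trans (mul_le_mul_of_nonneg_left k1 (norm_nonneg _))
      _ ≤ _ := by linarith
  have b4 : ‖f * (fd - (freq n : ℂ) • cosC (freq n))‖ ≤ 2 * (334400 * ‖e‖) :=
    (norm_mul_le _ _).trans (mul_le_mul h.norm_f h.norm_slope_sub (norm_nonneg _) (by norm_num))
  have b5 := norm_add_le (φ * ((freq n : ℂ) • cosC (freq n)))
    (f * (fd - (freq n : ℂ) • cosC (freq n)))
  rw [e1, norm_smul]
  have b6 := norm_add₃_le (a := (base n : ℂ) • (φ * (f + sinC (freq n))))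
    (b := (base n : ℂ)⁻¹ • (R * (f * f))) (c := (2 : ℂ) • (φ * ((freq n : ℂ) • cosC (freq n)) +
          f * (fd - (freq n : ℂ) • cosC (freq n))))
  rw [norm_smul (2 : ℂ)] at b6
  norm_num at b6 ⊢
  linarith

/-- The comparison of `g` with the unperturbed solution. -/
lemma norm_grad_sub {g g1 : Cont} (hg : IsGrad n e R X φ g g1) :
    base n ^ 2 * ‖g - gZero n‖ ≤ 3 * 10 ^ 7 * ‖e‖ ∧ base n * ‖g1 - gZero' n‖ ≤ 8 * 10 ^ 7 * ‖e‖ := by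
  have hn := h.one_le
  have hF := h.factor
  have hz := (sector_base hn).ne_zero
  have hκ := three_lt_freq hn
  have hκz := freq_le_base hn
  have hsub := h.norm_source_sub
  set b := sourceC (base n) R (sinC (freq n) + φ)
      (slope n (potV (base n) e.1 R X) (sinC (freq n) + φ)) with hb
  set b0 : Cont := (3 / 2 : ℂ) • ((base n : ℂ) • (sinC (freq n) * sinC (freq n)) +
          (2 : ℂ) • (sinC (freq n) * ((freq n : ℂ) • cosC (freq n)))) with hb0
  set α := Factor.alpha (base n) R
  set β := Factor.beta (base n) e.1 R
  -- g − g₀ solves the same perturbed equation; g₀ satisfies only the unperturbed one, so its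
  -- perturbation terms go into the source.
  have hper : PerEq (-rho (base n)) (-rho' (base n)) α β (b - b0 - (α * gZero' n + β * gZero n))
      (ext (g - gZero n)) (ext (g1 - gZero' n)) := by
    constructor
    · exact (hg.prim.sub (prim_gZero n)).congr (fun _ _ => rfl) (fun _ _ => rfl)
    · refine (hg.prim1.sub (prim_gZero' hn)).congr (fun _ _ => rfl) (fun x hx => ?_)
      have e1 : -rho (base n) + -rho' (base n) = -(3 * (base n : ℂ)) := by
        rw [← neg_add, rho_add]
      have e2 : -rho (base n) * -rho' (base n) = 3 * (base n : ℂ) ^ 2 := by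
        rw [neg_mul_neg, rho_mul]
      rw [e1, e2]
      simp only [ext_sub, ext_add, ext_mul, ext_smul, hb0, ext_sinC _ hx, ext_cosC _ hx]
      ring
    · simp only [ext_sub, hg.per]
      rw [gZero, ext_toCont _ zero_mem01, ext_toCont _ one_mem01, (waveA_per n).1]
    · simp only [ext_sub, hg.per1]
      rw [gZero', ext_toCont _ zero_mem01, ext_toCont _ one_mem01, (waveA_per n).2]
  have hα : ‖α * gZero' n‖ ≤ 39600 * ‖e‖ := by
    have k1 := hF.norm_alpha_le
    have k2 := mul_le_mul (k1.trans (mul_le_mul_of_nonneg_left h.norm_R (by norm_num)))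
      (norm_gZero'_le hn) (norm_nonneg _) (by positivity)
    linarith [norm_mul_le α (gZero' n)]
  have hβ : ‖β * gZero n‖ ≤ 31000 * ‖e‖ := by
    have k1 := hF.norm_beta_le
    have k3 : ‖gZero n‖ ≤ 1 := by nlinarith [norm_gZero_le hn, norm_nonneg (gZero n)]
    have k2 := mul_le_mul (k1.trans (add_le_add_left
      (mul_le_mul_of_nonneg_left h.norm_R (by norm_num)) _)) k3 (norm_nonneg _) (by positivity)
    linarith [norm_mul_le β (gZero n), norm_nonneg e]
  have hB : ‖b - b0 - (α * gZero' n + β * gZero n)‖ ≤ 71 / 10 * 10 ^ 6 * ‖e‖ := by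
    have k1 := norm_sub_le (b - b0) (α * gZero' n + β * gZero n)
    have k2 := norm_add_le (α * gZero' n) (β * gZero n)
    linarith [norm_nonneg e]
  have hbd := fun x (hx : x ∈ Icc (0 : ℝ) 1) => hF.dominates.perEq_le hper hx
  rw [norm_base hn] at hbd
  have hb3 : 0 < base n := by linarith
  constructor
  · have : ‖g - gZero n‖ ≤ 3 * 10 ^ 7 * ‖e‖ / base n ^ 2 := norm_cont_le (by positivity) fun x hx => by
      rw [le_div_iff₀ (by positivity)]
      linarith [(hbd x hx).1, norm_nonneg e]
    rw [le_div_iff₀ (by positivity)] at this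
    linarith
  · have : ‖g1 - gZero' n‖ ≤ 8 * 10 ^ 7 * ‖e‖ / base n := norm_cont_le (by positivity) fun x hx => by
      rw [le_div_iff₀ (by positivity)]
      linarith [(hbd x hx).2, norm_nonneg e]
    rw [le_div_iff₀ (by positivity)] at this
    linarith

omit h in
lemma _root_.ThreePoint.total_gZero {n : ℕ} (hn : 1 ≤ n) : total (gZero n) = (4 * base n : ℂ)⁻¹ := by
  rw [total_apply, integral_congr01 zero_mem01 one_mem01 (fun x hx => by
    rw [gZero, ext_toCont _ hx]), intervalIntegral.integral_const_mul,
    intervalIntegral.integral_sub (by simp) (prim_waveA n).continuousOn.intervalIntegrable01,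
    integral_waveA n hn]
  simp

/-- The mean of g₀ is 1/(4·base), and the deviation is smaller by the factor ‖e‖/n. So the integral
of g, the denominator of all gradients, is nonzero and at least half its unperturbed size. -/
lemma norm_total_grad {g g1 : Cont} (hg : IsGrad n e R X φ g g1) :
    base n ^ 2 * ‖total g - (4 * base n : ℂ)⁻¹‖ ≤ 3 * 10 ^ 7 * ‖e‖ ∧
      1 ≤ 8 * base n * ‖total g‖ := by
  have hn := h.one_le
  have hb : 3 < base n := by linarith [three_lt_freq hn, freq_le_base hn]
  have he := h.norm_e
  rw [tiny] at he
  have h1 := (h.norm_grad_sub hg).1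
  have h2 : ‖total g - (4 * base n : ℂ)⁻¹‖ ≤ ‖g - gZero n‖ := by
    rw [← total_gZero hn, ← map_sub]; exact norm_total_le _
  have h3 : base n ^ 2 * ‖total g - (4 * base n : ℂ)⁻¹‖ ≤ 3 * 10 ^ 7 * ‖e‖ :=
    (mul_le_mul_of_nonneg_left h2 (by positivity)).trans h1
  refine ⟨h3, ?_⟩
  have h4 := norm_sub_norm_le ((4 * base n : ℂ)⁻¹) (total g)
  rw [norm_sub_rev, norm_inv_four_base hn] at h4
  have h5 : base n * (4 * base n)⁻¹ = 1 / 4 := by field_simp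
  have h6 : base n * ‖total g - (4 * base n : ℂ)⁻¹‖ ≤ 1 / 8 := by
    nlinarith [norm_nonneg (total g - (4 * base n : ℂ)⁻¹)]
  nlinarith

lemma total_grad_ne {g g1 : Cont} (hg : IsGrad n e R X φ g g1) : total g ≠ 0 := fun h0 => by
  have := (h.norm_total_grad hg).2
  rw [h0, norm_zero, mul_zero] at this
  linarith

omit h in
lemma _root_.ThreePoint.ext_sourceC (z : ℂ) (R f fd : Cont) (x : ℝ) :
    ext (sourceC z R f fd) x = source (mfun z R) (ext f) (ext fd) x := by
  simp only [sourceC, source, mfun, ext_smul, ext_add, ext_mul, ext_one]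
  ring

theorem isSimplePair : IsSimplePair p q ((base n : ℂ) ^ 3 + base n * H) := by
  obtain ⟨g, g1, hg⟩ := h.exists_isGrad
  obtain ⟨hs, f0, f1, fd0⟩ := h.schrod
  refine h.factor.isSimplePair hs f0 f1 (by rw [fd0]; exact freq_ne_zero h.one_le)
    (fun x _ => ext_sourceC _ _ _ _ x) hg ?_
  rw [← total_apply]
  exact h.total_grad_ne hg

end Mode

/-! ### Differences of eigenvalues and the derivative of an eigenvalue -/

/-- A solution of a Riccati equation, a Dirichlet eigenfunction `f` of the reduced equation, and the
solution `g` of the equation for the gradient. -/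
structure GradData (p dp q : ℝ → ℂ) (l : ℂ) (m m1 f fd g g1 : ℝ → ℂ) : Prop where
  prim_p : Prim p dp
  per_p : p 0 = p 1
  int_q : IntervalIntegrable q volume 0 1
  riccati : Riccati p dp q l m m1
  schrod : Schrod (reducedPot p m m1) f fd
  f_zero : f 0 = 0
  f_one : f 1 = 0
  prim_g : Prim g g1
  prim_g1 : Prim g1 (fun x => -(3 * m x * g1 x) - (3 * m x ^ 2 + 2 * p x) * g x + source m f fd x)
  per_g : g 0 = g 1
  per_g1 : g1 0 = g1 1

/-- The gradient with respect to `p`, up to a factor. -/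
def gradP (m f g g1 : ℝ → ℂ) (x : ℝ) : ℂ := g1 x + 2 * m x * g x - 2 * f x ^ 2

/-- The second order remainder in the difference of two eigenvalues. -/
def remainder (m g f f' d d1 Δp : ℝ → ℂ) (x : ℝ) : ℂ :=
  d x * (g x * (3 * d1 x - 3 * m x * d x - d x ^ 2 - 2 * Δp x) + 3 / 4 * d x * f' x * f x) +
    (2 * Δp x + 3 / 2 * m x * d x - 3 / 2 * d1 x) * f x * (f' x - f x)

/-- The difference of two eigenvalues. -/
theorem GradData.sub_mul_integral {p dp q m m1 f fd g g1 p' dp' q' m' m1' f' fd' : ℝ → ℂ} {l l' : ℂ}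
    (h : GradData p dp q l m m1 f fd g g1) (hp' : Prim p' dp') (per_p' : p' 0 = p' 1)
    (hq' : IntervalIntegrable q' volume 0 1) (hr' : Riccati p' dp' q' l' m' m1')
    (hs' : Schrod (reducedPot p' m' m1') f' fd') (f0 : f' 0 = 0) (f1 : f' 1 = 0) :
    (l' - l) * ∫ x in (0 : ℝ)..1, g x =
      (∫ x in (0 : ℝ)..1, (g x * (q' x - q x) + gradP m f g g1 x * (p' x - p x))) -
      ∫ x in (0 : ℝ)..1, remainder m g f f' (fun x => m' x - m x) (fun x => m1' x - m1 x)
        (fun x => p' x - p x) x := by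
  -- Two Dirichlet solutions of the reduced equations: the difference of the reduced potentials is
  -- orthogonal to the product of the eigenfunctions.
  have hA := hs'.integral_mul h.schrod f0 f1 h.f_zero h.f_one
  have hd := hr'.prim.sub h.riccati.prim
  have hd1 := hr'.prim1.sub h.riccati.prim1
  have hΔ := hp'.sub h.prim_p
  -- With δ the difference of the two Riccati solutions and f the unprimed eigenfunction, the
  -- periodic function gδ' − g'δ − 3mgδ − gΔp + (3/2)δf² has a derivative of zero integral. This
  -- tests the Riccati equation for δ against g. The equation for g is the one for which all terms
  -- linear in δ and δ' cancel against those in the difference of the potentials; what survives is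
  -- Δλ, Δq, Δp and the quadratic `remainder`.
  have hW := (((((h.prim_g.mul hd1).sub (h.prim_g1.mul hd)).sub
    ((h.riccati.prim.mul (h.prim_g.mul hd)).const_mul 3)).sub (h.prim_g.mul hΔ)).add
    ((hd.mul (h.schrod.prim.mul h.schrod.prim)).const_mul (3 / 2))).integral
  simp only [h.f_zero, h.f_one, h.per_g, h.per_g1, h.riccati.per, h.riccati.per1, hr'.per, hr'.per1,
    h.per_p, per_p', sub_self] at hW
  have cg := h.prim_g.continuousOn
  have cg1 := h.prim_g1.continuousOn
  have cm := h.riccati.prim.continuousOn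
  have cm1 := h.riccati.prim1.continuousOn
  have cm' := hr'.prim.continuousOn
  have cm1' := hr'.prim1.continuousOn
  have cf := h.schrod.prim.continuousOn
  have cf' := hs'.prim.continuousOn
  have cp := h.prim_p.continuousOn
  have cp' := hp'.continuousOn
  have i1 : IntervalIntegrable (fun x => (l' - l) * g x) volume 0 1 :=
    (continuousOn_const.mul cg).intervalIntegrable01
  have i2 : IntervalIntegrable (fun x => g x * (q' x - q x) + gradP m f g g1 x * (p' x - p x))
      volume 0 1 := by
    refine ((hq'.sub h.int_q).continuousOn_mul ?_).add (ContinuousOn.intervalIntegrable01 ?_)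
    · rwa [uIcc_of_le zero_le_one]
    · unfold gradP; fun_prop
  have i3 : IntervalIntegrable (remainder m g f f' (fun x => m' x - m x) (fun x => m1' x - m1 x)
        (fun x => p' x - p x)) volume 0 1 := by
    refine ContinuousOn.intervalIntegrable01 ?_
    unfold remainder; fun_prop
  have i4 : IntervalIntegrable (fun x => (reducedPot p' m' m1' x - reducedPot p m m1 x) * f' x * f x)
      volume 0 1 := by
    refine ContinuousOn.intervalIntegrable01 ?_
    unfold reducedPot; fun_prop
  rw [← intervalIntegral.integral_const_mul, eq_sub_iff_add_eq, ← sub_eq_zero,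
    ← intervalIntegral.integral_add i1 i3, ← intervalIntegral.integral_sub (i1.add i3) i2]
  have e : ∀ x ∈ Icc (0 : ℝ) 1, (l' - l) * g x + remainder m g f f' (fun x => m' x - m x)
      (fun x => m1' x - m1 x) (fun x => p' x - p x) x -
        (g x * (q' x - q x) + gradP m f g g1 x * (p' x - p x)) =
      (reducedPot p' m' m1' x - reducedPot p m m1 x) * f' x * f x +
        (((l' - l) * g x + remainder m g f f' (fun x => m' x - m x)
      (fun x => m1' x - m1 x) (fun x => p' x - p x) x -
        (g x * (q' x - q x) + gradP m f g g1 x * (p' x - p x))) -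
      (reducedPot p' m' m1' x - reducedPot p m m1 x) * f' x * f x) := fun x _ => by ring
  rw [integral_congr01 zero_mem01 one_mem01 e, intervalIntegral.integral_add i4
    (((i1.add i3).sub i2).sub i4), hA, zero_add]
  rw [show (0 : ℂ) = ∫ x in (0 : ℝ)..1, _ from (hW.trans (by ring)).symm]
  refine integral_congr01 zero_mem01 one_mem01 fun x _ => ?_
  simp only [remainder, gradP, reducedPot, source]
  ring

lemma Coeffs.intervalIntegrable_q {p dp q : ℝ → ℂ} {e : Cont × Cont} (h : Coeffs p dp q e) :
    IntervalIntegrable q volume 0 1 :=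
  (h.prim_p.1.sub h.prim_D.1).congr fun x _ => by simp

lemma Coeffs.add_smul {p dp q u du v : ℝ → ℂ} {e e' : Cont × Cont} (h : Coeffs p dp q e)
    (h' : Coeffs u du v e') (t : ℂ) : Coeffs (fun x => p x + t * u x) (fun x => dp x + t * du x)
      (fun x => q x + t * v x) (e + t • e') := by
  refine ⟨h.prim_p.add (h'.prim_p.const_mul t), fun x hx => ?_, (h.prim_D.add
    (h'.prim_D.const_mul t)).congr (fun x _ => ?_) (fun x _ => by ring), ?_, ?_⟩
  · simp only [Prod.fst_add, Prod.smul_fst, ext_add, ext_smul, h.ext_p x hx, h'.ext_p x hx]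
  · simp only [Prod.snd_add, Prod.smul_snd, ext_add, ext_smul]
  · simp only [h.per_p, h'.per_p]
  · simp only [Prod.snd_add, Prod.smul_snd, ext_add, ext_smul, h.per_D, h'.per_D]

/-- The small solutions of the fixed point problem, as functions of the coefficients. -/
def IsBranch (n : ℕ) (R X φ : Cont × Cont → Cont) (H : Cont × Cont → ℂ) : Prop :=
  1 ≤ n ∧ ∀ e : Cont × Cont, ‖e‖ < radius / 100000 →
      IsJoint n e (R e) (X e) (φ e) (H e) ∧
      (‖R e‖ ≤ 4400 * ‖e‖ ∧ ‖X e‖ ≤ 4400 * ‖e‖ ∧ ‖φ e‖ ≤ 4400 * ‖e‖ ∧ ‖H e‖ ≤ 4400 * ‖e‖) ∧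
      (AnalyticAt ℂ R e ∧ AnalyticAt ℂ X e ∧ AnalyticAt ℂ φ e ∧ AnalyticAt ℂ H e) ∧
      ∀ (R' X' φ' : Cont) (H' : ℂ), IsJoint n e R' X' φ' H' → ‖R'‖ ≤ radius / 1000 →
        ‖X'‖ ≤ radius / 1000 → ‖φ'‖ ≤ radius → ‖H'‖ ≤ radius / 1000 →
        R' = R e ∧ X' = X e ∧ φ' = φ e ∧ H' = H e

lemma IsBranch.mode {n : ℕ} {R X φ : Cont × Cont → Cont} {H : Cont × Cont → ℂ}
    (h : IsBranch n R X φ H) {p dp q : ℝ → ℂ} {e : Cont × Cont} (hc : Coeffs p dp q e)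
    (he : ‖e‖ ≤ tiny) : Mode p dp q n e (R e) (X e) (φ e) (H e) := by
  obtain ⟨h1, ⟨h2, h3, h4, h5⟩, -, -⟩ := h.2 e (by
    rw [tiny] at he; rw [radius]; linarith)
  exact ⟨h.1, hc, h1, he, h2, h3, h4, h5⟩

lemma Mode.gradData {p dp q : ℝ → ℂ} {n : ℕ} {e : Cont × Cont} {R X φ : Cont} {H : ℂ}
    (h : Mode p dp q n e R X φ H) {g g1 : Cont} (hg : IsGrad n e R X φ g g1) :
    GradData p dp q ((base n : ℂ) ^ 3 + base n * H) (mfun (base n) R) (ext X)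
      (ext (sinC (freq n) + φ)) (ext (slope n (potV (base n) e.1 R X) (sinC (freq n) + φ)))
      (ext g) (ext g1) := by
  obtain ⟨hs, f0, f1, -⟩ := h.schrod
  refine ⟨h.coeffs.prim_p, h.coeffs.per_p, h.coeffs.intervalIntegrable_q, h.factor.riccati, hs, f0,
    f1, hg.prim, hg.prim1.congr (fun _ _ => rfl) (fun x hx => ?_), hg.per, hg.per1⟩
  rw [h.factor.perEq_iff_coeff hx, ext_sourceC]

lemma hasDerivAt_mul_zero {a b : ℂ → Cont} (ha : DifferentiableAt ℂ a 0)
    (hb : DifferentiableAt ℂ b 0) (a0 : a 0 = 0) (b0 : b 0 = 0) :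
    HasDerivAt (fun t => a t * b t) 0 0 := by
  have := ha.hasDerivAt.mul hb.hasDerivAt
  rwa [a0, b0, mul_zero, zero_mul, add_zero] at this

/-- The derivative of an eigenvalue. -/
theorem IsBranch.fderiv_mul_total {n : ℕ} {R X φ : Cont × Cont → Cont} {H : Cont × Cont → ℂ}
    (h : IsBranch n R X φ H) {p dp q u du v : ℝ → ℂ} {e e' : Cont × Cont} (hc : Coeffs p dp q e)
    (hc' : Coeffs u du v e') (he : ‖e‖ < tiny) {g g1 : Cont}
    (hg : IsGrad n e (R e) (X e) (φ e) g g1) :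
    base n * fderiv ℂ H e e' * total g = ∫ x in (0 : ℝ)..1, (ext g x * v x +
      gradP (mfun (base n) (R e)) (ext (sinC (freq n) + φ e)) (ext g) (ext g1) x * u x) := by
  obtain ⟨-, -, ⟨aR, aX, aφ, aH⟩, -⟩ := h.2 e (by
    rw [tiny] at he; rw [radius]; linarith)
  have hline : HasDerivAt (fun t : ℂ => e + t • e') e' 0 := by
    simpa using ((hasDerivAt_id (0 : ℂ)).smul_const e').const_add e
  have e0 : e + (0 : ℂ) • e' = e := by
    refine Prod.ext ?_ ?_
    · rw [Prod.fst_add, Prod.smul_fst, cont_zero_smul, add_zero]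
    · rw [Prod.snd_add, Prod.smul_snd, cont_zero_smul, add_zero]
  obtain ⟨Rt, hRt⟩ : ∃ f : ℂ → Cont, f = fun t => R (e + t • e') := ⟨_, rfl⟩
  have dR : DifferentiableAt ℂ Rt 0 := by
    rw [hRt]
    exact DifferentiableAt.comp (0 : ℂ) (by rw [e0]; exact aR.differentiableAt) hline.differentiableAt
  obtain ⟨Xt, hXt⟩ : ∃ f : ℂ → Cont, f = fun t => X (e + t • e') := ⟨_, rfl⟩
  have dX : DifferentiableAt ℂ Xt 0 := by
    rw [hXt]
    exact DifferentiableAt.comp (0 : ℂ) (by rw [e0]; exact aX.differentiableAt) hline.differentiableAt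
  obtain ⟨φt, hφt⟩ : ∃ f : ℂ → Cont, f = fun t => φ (e + t • e') := ⟨_, rfl⟩
  have dφ : DifferentiableAt ℂ φt 0 := by
    rw [hφt]
    exact DifferentiableAt.comp (0 : ℂ) (by rw [e0]; exact aφ.differentiableAt) hline.differentiableAt
  have dH : HasDerivAt (fun t : ℂ => H (e + t • e')) (fderiv ℂ H e e') 0 :=
    HasFDerivAt.comp_hasDerivAt (0 : ℂ) (by rw [e0]; exact aH.differentiableAt.hasFDerivAt) hline
  set z : ℂ := ((base n : ℝ) : ℂ) with hz
  obtain ⟨dC, hdC⟩ : ∃ f : ℂ → Cont, f = fun t => z⁻¹ • (Rt t - R e) := ⟨_, rfl⟩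
  obtain ⟨δC, hδC⟩ : ∃ f : ℂ → Cont, f = fun t => Xt t - X e := ⟨_, rfl⟩
  set mC : Cont := z • (1 : Cont) + z⁻¹ • R e with hmC
  set fC : Cont := sinC (freq n) + φ e with hfC
  -- The remainder along the line e + t·e', written as a continuous function. It is a sum of
  -- products of two factors that both vanish at t = 0, so its derivative at 0 is zero.
  set rem : ℂ → Cont := fun t => dC t * (g * ((3 : ℂ) • δC t - (3 : ℂ) • (mC * dC t) -
    dC t * dC t - (2 * t) • e'.1) + (3 / 4 : ℂ) • (dC t * (sinC (freq n) + φt t) * fC)) +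
    (((2 * t) • e'.1 + (3 / 2 : ℂ) • (mC * dC t) - (3 / 2 : ℂ) • δC t) * fC) *
      (φt t - φ e) with hrem
  have hdC0 : dC 0 = 0 := by simp only [hdC, hRt, e0, sub_self, cont_smul_zero]
  have hδC0 : δC 0 = 0 := by simp only [hδC, hXt, e0, sub_self]
  have ddC : DifferentiableAt ℂ dC 0 := by rw [hdC]; fun_prop
  have dδC : DifferentiableAt ℂ δC 0 := by rw [hδC]; fun_prop
  have hrem' : HasDerivAt rem 0 0 := by
    have := (hasDerivAt_mul_zero (a := dC) (b := fun t => g * ((3 : ℂ) • δC t -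
      (3 : ℂ) • (mC * dC t) - dC t * dC t - (2 * t) • e'.1) +
      (3 / 4 : ℂ) • (dC t * (sinC (freq n) + φt t) * fC)) ddC (by fun_prop) hdC0 (by
        simp [hdC0, hδC0, cont_smul_zero, cont_zero_smul])).add (hasDerivAt_mul_zero
      (a := fun t => ((2 * t) • e'.1 + (3 / 2 : ℂ) • (mC * dC t) - (3 / 2 : ℂ) • δC t) * fC)
      (b := fun t => φt t - φ e) (by fun_prop) (by fun_prop) (by
        simp [hdC0, hδC0, cont_smul_zero, cont_zero_smul]) (by simp only [hφt, e0, sub_self]))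
    rwa [add_zero] at this
  have htot : HasDerivAt (fun t => total (rem t)) 0 0 := by
    have := total.hasFDerivAt.comp_hasDerivAt (0 : ℂ) hrem'
    rwa [map_zero] at this
  set G := ∫ x in (0 : ℝ)..1, (ext g x * v x +
      gradP (mfun z (R e)) (ext fC) (ext g) (ext g1) x * u x) with hG
  have key : ∀ᶠ t in nhds (0 : ℂ), (z * (H (e + t • e') - H e)) * total g = t * G - total (rem t) := by
    have hev : ∀ᶠ t in nhds (0 : ℂ), ‖e + t • e'‖ < tiny := by
      refine (hline.continuousAt.norm).eventually_lt continuousAt_const ?_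
      simpa only [e0] using he
    filter_upwards [hev] with t ht
    have M := h.mode hc he.le
    have M' := h.mode (hc.add_smul hc' t) ht.le
    obtain ⟨hs', f0', f1', -⟩ := M'.schrod
    have hd := (M.gradData hg).sub_mul_integral M'.coeffs.prim_p M'.coeffs.per_p
      M'.coeffs.intervalIntegrable_q M'.factor.riccati hs' f0' f1'
    rw [← hz] at hd
    rw [show z * (H (e + t • e') - H e) = z ^ 3 + z * H (e + t • e') - (z ^ 3 + z * H e) by ring,
      total_apply, hd, total_apply, hG, ← intervalIntegral.integral_const_mul]
    congr 1
    · refine integral_congr01 zero_mem01 one_mem01 fun x _ => ?_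
      ring
    · refine integral_congr01 zero_mem01 one_mem01 fun x hx => ?_
      simp only [remainder, mfun, hrem, hdC, hδC, hRt, hXt, hφt, hmC, hfC, ext_add, ext_sub, ext_mul, ext_smul,
        ext_one, hc'.ext_p x hx]
      ring
  have h1 : HasDerivAt (fun t : ℂ => (z * (H (e + t • e') - H e)) * total g)
      (z * fderiv ℂ H e e' * total g) 0 := ((dH.sub_const (H e)).const_mul z).mul_const _
  have h2 : HasDerivAt (fun t : ℂ => t * G - total (rem t)) G 0 := by
    have := ((hasDerivAt_id (0 : ℂ)).mul_const G).sub htot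
    rwa [one_mul, sub_zero] at this
  exact h1.unique (h2.congr_of_eventuallyEq key)

/-! ### Real coefficients -/

lemma ext_star (a : Cont) (x : ℝ) : ext (star a) x = (starRingEnd ℂ) (ext a x) := rfl

lemma norm_star_le (a : Cont) : ‖star a‖ ≤ ‖a‖ := norm_cont_le (norm_nonneg a) fun x _ => by
  rw [ext_star, RCLike.norm_conj]; exact norm_ext_le a x

lemma star_sinC (κ : ℝ) : star (sinC κ) = sinC κ := cont_ext fun x hx => by
  rw [ext_star, ext_sinC _ hx, ← Complex.sin_conj, map_mul, Complex.conj_ofReal, Complex.conj_ofReal]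

lemma star_cosC (κ : ℝ) : star (cosC κ) = cosC κ := cont_ext fun x hx => by
  rw [ext_star, ext_cosC _ hx, ← Complex.cos_conj, map_mul, Complex.conj_ofReal, Complex.conj_ofReal]

lemma star_volterra (a : Cont) : star (volterra a) = volterra (star a) := cont_ext fun x hx => by
  rw [ext_star, ext_volterra _ hx, ext_volterra _ hx, ← intervalIntegral.intervalIntegral_conj]
  rfl

lemma star_total (a : Cont) : (starRingEnd ℂ) (total a) = total (star a) := by
  rw [total_apply, total_apply, ← intervalIntegral.intervalIntegral_conj]
  rfl

lemma star_waveInt (κ : ℝ) (a : Cont) : star (waveInt κ a) = waveInt κ (star a) := by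
  simp only [waveInt, star_sub, star_mul', star_volterra, star_sinC, star_cosC]

lemma star_waveInt' (κ : ℝ) (a : Cont) : star (waveInt' κ a) = waveInt' κ (star a) := by
  simp only [waveInt', star_add, star_mul', star_volterra, star_sinC, star_cosC]

lemma star_smul_ofReal (c : ℝ) (a : Cont) : star ((c : ℂ) • a) = (c : ℂ) • star a := by
  rw [star_smul, Complex.star_def, Complex.conj_ofReal]

lemma star_potV (z : ℝ) (P R X : Cont) :
    star (potV z P R X) = potV z (star P) (star R) (star X) := by
  refine cont_ext fun x _ => ?_
  simp only [potV, ext_star, ext_add, ext_sub, ext_smul, ext_mul, map_add, map_sub, map_mul,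
    map_div₀, map_inv₀, map_pow, Complex.conj_ofReal, map_ofNat]

/-- The coefficients are real. -/
structure RealCoeffs (p dp q : ℝ → ℂ) : Prop where
  p : ∀ x ∈ Icc (0 : ℝ) 1, (starRingEnd ℂ) (p x) = p x
  dp : ∀ᵐ x ∂(volume.restrict (Ioc (0 : ℝ) 1)), (starRingEnd ℂ) (dp x) = dp x
  q : ∀ᵐ x ∂(volume.restrict (Ioc (0 : ℝ) 1)), (starRingEnd ℂ) (q x) = q x

lemma RealCoeffs.riccati {p dp q m m1 : ℝ → ℂ} {l : ℂ} (h : RealCoeffs p dp q)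
    (hm : Riccati p dp q l m m1) : Riccati p dp q ((starRingEnd ℂ) l)
      (fun x => (starRingEnd ℂ) (m x)) (fun x => (starRingEnd ℂ) (m1 x)) := by
  refine ⟨hm.prim.conj, hm.prim1.conj.congr_ae (fun _ _ => rfl) ?_, by rw [hm.per],
    by rw [hm.per1]⟩
  filter_upwards [h.dp, h.q, ae_restrict_mem measurableSet_Ioc] with x h1 h2 h3
  simp only [map_add, map_sub, map_mul, map_pow, map_ofNat, h1, h2, h.p x (Ioc_subset_Icc_self h3)]

lemma star_fst {p dp q : ℝ → ℂ} {e : Cont × Cont} (hc : Coeffs p dp q e)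
    (hr : RealCoeffs p dp q) : star e.1 = e.1 := cont_ext fun x hx => by
  rw [ext_star, hc.ext_p x hx, hr.p x hx]

lemma Mode.star_joint {p dp q : ℝ → ℂ} {n : ℕ} {e : Cont × Cont} {R X φ : Cont} {H : ℂ}
    (h : Mode p dp q n e R X φ H) (hr : RealCoeffs p dp q) :
    IsJoint n e (star R) (star X) (star φ) ((starRingEnd ℂ) H) := by
  have hP := star_fst h.coeffs hr
  have hv : star (potV (base n) e.1 R X) = potV (base n) e.1 (star R) (star X) := by
    rw [star_potV, hP]
  refine ⟨?_, ?_, ?_⟩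
  · have h1 := hr.riccati h.factor.riccati
    rw [map_add, map_mul, map_pow, Complex.conj_ofReal] at h1
    exact h1.fixed h.coeffs (sector_base h.one_le) (R := star R) (X := star X)
      (fun x _ => by simp [mfun, ext_star]) (fun x _ => by rw [ext_star])
  · conv_lhs => rw [h.joint.wave]
    rw [star_neg, ← Complex.ofReal_inv, star_smul_ofReal, star_waveInt, star_mul', star_add,
      star_sinC, hv]
  · have := congrArg (starRingEnd ℂ) h.joint.orth
    rw [star_total, map_zero, star_mul', star_mul', star_add, star_sinC, hv] at this
    exact this

/-- For real coefficients the complex conjugate of the solution is again a small solution of the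
same fixed point problem, so uniqueness makes all components real. -/
lemma IsBranch.star_eq {n : ℕ} {R X φ : Cont × Cont → Cont} {H : Cont × Cont → ℂ}
    (h : IsBranch n R X φ H) {p dp q : ℝ → ℂ} {e : Cont × Cont} (hc : Coeffs p dp q e)
    (he : ‖e‖ ≤ tiny) (hr : RealCoeffs p dp q) : star (R e) = R e ∧ star (X e) = X e ∧
      star (φ e) = φ e ∧ (starRingEnd ℂ) (H e) = H e := by
  have M := h.mode hc he
  have ht : tiny = 1 / 10 ^ 15 := rfl
  have hra : radius = 1 / 10 ^ 6 := rfl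
  rw [ht] at he
  refine (h.2 e (by rw [hra]; linarith)).2.2.2 _ _ _ _ (M.star_joint hr) ?_ ?_ ?_ ?_
  · linarith [M.norm_R, norm_star_le (R e)]
  · linarith [M.norm_X, norm_star_le (X e)]
  · linarith [M.norm_φ, norm_star_le (φ e)]
  · rw [RCLike.norm_conj]; linarith [M.norm_H]

lemma Dominates.unique {z ρ₁ ρ₂ : ℂ} {α β b : Cont} (h : Dominates z ρ₁ ρ₂ α β) {u u1 v v1 : Cont}
    (hu : PerEq ρ₁ ρ₂ α β b (ext u) (ext u1)) (hv : PerEq ρ₁ ρ₂ α β b (ext v) (ext v1)) :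
    u = v ∧ u1 = v1 := by
  have hd : PerEq ρ₁ ρ₂ α β 0 (ext (u - v)) (ext (u1 - v1)) := by
    refine ⟨(hu.prim.sub hv.prim).congr (fun _ _ => by rw [ext_sub]) (fun _ _ => by rw [ext_sub]),
      (hu.prim1.sub hv.prim1).congr (fun _ _ => by rw [ext_sub]) (fun _ _ => ?_), ?_, ?_⟩
    · simp only [ext_sub, ext_zero]; ring
    · simp only [ext_sub, hu.per, hv.per]
    · simp only [ext_sub, hu.per1, hv.per1]
  have hz := h.sector.norm_pos
  have key := fun x (hx : x ∈ Icc (0 : ℝ) 1) => h.perEq_le hd hx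
  simp only [norm_zero, mul_zero] at key
  refine ⟨cont_ext fun x hx => ?_, cont_ext fun x hx => ?_⟩
  · have := (key x hx).1
    have h0 : ‖ext (u - v) x‖ = 0 := by
      by_contra hne
      have := norm_nonneg (ext (u - v) x)
      have : 0 < ‖z‖ ^ 2 * ‖ext (u - v) x‖ := by positivity
      linarith
    rw [norm_eq_zero, ext_sub, sub_eq_zero] at h0
    exact h0
  · have := (key x hx).2
    have h0 : ‖ext (u1 - v1) x‖ = 0 := by
      by_contra hne
      have := norm_nonneg (ext (u1 - v1) x)
      have : 0 < ‖z‖ * ‖ext (u1 - v1) x‖ := by positivity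
      linarith
    rw [norm_eq_zero, ext_sub, sub_eq_zero] at h0
    exact h0

lemma Mode.star_grad {p dp q : ℝ → ℂ} {n : ℕ} {e : Cont × Cont} {R X φ : Cont} {H : ℂ}
    (h : Mode p dp q n e R X φ H) (hP : star e.1 = e.1) (hR : star R = R) (hX : star X = X)
    (hφ : star φ = φ) {g g1 : Cont} (hg : IsGrad n e R X φ g g1) : star g = g ∧ star g1 = g1 := by
  refine h.factor.dominates.unique ⟨hg.prim.conj, hg.prim1.conj.congr (fun _ _ => rfl)
    (fun x hx => ?_), by simp only [ext_star, hg.per], by simp only [ext_star, hg.per1]⟩ hg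
  have hp : (starRingEnd ℂ) (p x) = p x := by
    rw [← h.coeffs.ext_p x hx, ← ext_star, hP]
  have hm : (starRingEnd ℂ) (mfun (base n) R x) = mfun (base n) R x := by
    simp only [mfun, map_add, map_mul, map_inv₀, Complex.conj_ofReal, ← ext_star, hR]
  have hf : star (sinC (freq n) + φ) = sinC (freq n) + φ := by rw [star_add, star_sinC, hφ]
  have hfd : star (slope n (potV (base n) e.1 R X) (sinC (freq n) + φ)) =
      slope n (potV (base n) e.1 R X) (sinC (freq n) + φ) := by
    rw [slope, star_sub, star_smul_ofReal, star_cosC, star_waveInt', star_mul', hf, star_potV, hP,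
      hR, hX]
  rw [h.factor.perEq_iff_coeff hx, h.factor.perEq_iff_coeff hx, ext_sourceC]
  simp only [source, map_add, map_sub, map_neg, map_mul, map_pow, map_div₀, map_ofNat, hm, hp,
    ext_star]
  rw [← ext_star (sinC (freq n) + φ), ← ext_star (slope n _ _), hf, hfd]

/-! ### The gradient -/

/-- The gradient with respect to `p` as an element of `Cont`. -/
def gradC (n : ℕ) (R φ g g1 : Cont) : Cont :=
  g1 + (2 : ℂ) • (((base n : ℂ) • (1 : Cont) + (base n : ℂ)⁻¹ • R) * g) -
    (2 : ℂ) • ((sinC (freq n) + φ) * (sinC (freq n) + φ))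

lemma ext_gradC (n : ℕ) (R φ g g1 : Cont) (x : ℝ) : ext (gradC n R φ g g1) x =
    gradP (mfun (base n) R) (ext (sinC (freq n) + φ)) (ext g) (ext g1) x := by
  simp only [gradC, gradP, mfun, ext_add, ext_sub, ext_smul, ext_mul, ext_one]
  ring

/-- Division by ∫g₀ = 1/(4·base) gives base·(a_n − 2), whose zero mean part is the unperturbed
gradient in p. -/
lemma ext_gradC_zero {n : ℕ} (hn : 1 ≤ n) {x : ℝ} (hx : x ∈ Icc (0 : ℝ) 1) :
    ext (gradC n 0 0 (gZero n) (gZero' n)) x = (waveA n x - 2) / 4 := by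
  have hz := (sector_base hn).ne_zero
  simp only [gradC, ext_add, ext_sub, ext_smul, ext_mul, ext_one, ext_zero, ext_sinC _ hx, gZero,
    gZero', ext_toCont _ hx]
  have e1 : (((2 * freq n : ℝ) : ℂ) * x) = 2 * (freq n * x) := by push_cast; ring
  simp only [waveA, waveA', e1]
  have e2 : Complex.sin ((freq n : ℂ) * x) ^ 2 = (1 - Complex.cos (2 * (freq n * x))) / 2 := by
    rw [Complex.cos_two_mul, Complex.cos_sq']; ring
  have e3 : ((2 * freq n : ℝ) : ℂ) = (Real.sqrt 3 : ℝ) * base n := by rw [sqrt3_base_cast]; push_cast; ring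
  have e4 := sqrt3_sq
  have e5 := sqrt3_ne
  rw [e3]
  set S := Complex.sin (2 * ((freq n : ℂ) * x))
  set C := Complex.cos (2 * ((freq n : ℂ) * x))
  set t := ((Real.sqrt 3 : ℝ) : ℂ)
  have e7 : t⁻¹ = t / 3 := by rw [← e4]; field_simp
  simp only [div_eq_mul_inv, e7]
  have e8 := e2
  simp only [add_zero, mul_zero]
  rw [← pow_two, e2]
  field_simp
  ring_nf
  simp only [e4]
  ring

namespace Mode

variable {p dp q : ℝ → ℂ} {n : ℕ} {e : Cont × Cont} {R X φ : Cont} {H : ℂ}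
  (h : Mode p dp q n e R X φ H)
include h

lemma norm_gradC_sub {g g1 : Cont} (hg : IsGrad n e R X φ g g1) :
    base n * ‖gradC n R φ g g1 - gradC n 0 0 (gZero n) (gZero' n)‖ ≤ 3 / 2 * 10 ^ 8 * ‖e‖ := by
  have hn := h.one_le
  have hb : 3 < base n := by linarith [three_lt_freq hn, freq_le_base hn]
  have he := norm_nonneg e
  obtain ⟨h1, h2⟩ := h.norm_grad_sub hg
  have e1 : gradC n R φ g g1 - gradC n 0 0 (gZero n) (gZero' n) =
      (g1 - gZero' n) + (2 * base n : ℂ) • (g - gZero n) + (2 * (base n : ℂ)⁻¹) • (R * g) -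
        (2 : ℂ) • (φ * (sinC (freq n) + φ + sinC (freq n))) := by
    refine cont_ext fun x _ => ?_
    simp only [gradC, ext_add, ext_sub, ext_smul, ext_mul, ext_one, ext_zero]
    ring
  have nb : ‖(2 * base n : ℂ)‖ = 2 * base n := by rw [norm_mul, norm_base hn]; norm_num
  have nb' : ‖(2 * (base n : ℂ)⁻¹)‖ = 2 * (base n)⁻¹ := by
    rw [norm_mul, norm_inv, norm_base hn]; norm_num
  have hgn : ‖g‖ ≤ 1 := by
    have k1 := norm_gZero_le hn
    have k2 := norm_le_norm_add_norm_sub' g (gZero n)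
    have k3 := h.norm_e
    rw [tiny] at k3
    nlinarith [norm_nonneg (gZero n), norm_nonneg (g - gZero n)]
  have b1 : base n * ‖(2 * base n : ℂ) • (g - gZero n)‖ ≤ 6 * 10 ^ 7 * ‖e‖ := by
    rw [norm_smul, nb]; nlinarith
  have b2 : base n * ‖(2 * (base n : ℂ)⁻¹) • (R * g)‖ ≤ 8800 * ‖e‖ := by
    rw [norm_smul, nb']
    have k1 : ‖R * g‖ ≤ 4400 * ‖e‖ := (norm_mul_le _ _).trans
      ((mul_le_of_le_one_right (norm_nonneg _) hgn).trans h.norm_R)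
    have k2 : base n * (2 * (base n)⁻¹ * ‖R * g‖) = 2 * ‖R * g‖ := by field_simp
    rw [k2]; linarith
  have b3 : base n * ‖(2 : ℂ) • (φ * (sinC (freq n) + φ + sinC (freq n)))‖ ≤ 4012800 * ‖e‖ := by
    have k1 : ‖sinC (freq n) + φ + sinC (freq n)‖ ≤ 3 := by
      linarith [norm_add_le (sinC (freq n) + φ) (sinC (freq n)), h.norm_f, norm_sinC_le (freq n)]
    have k2 : ‖φ * (sinC (freq n) + φ + sinC (freq n))‖ ≤ ‖φ‖ * 3 :=
      (norm_mul_le _ _).trans (mul_le_mul_of_nonneg_left k1 (norm_nonneg _))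
    have k3 := h.freq_mul_norm_φ
    have k4 := base_le_freq hn
    rw [norm_smul]
    norm_num
    have k5 : base n * ‖φ‖ ≤ 2 * freq n * ‖φ‖ := mul_le_mul_of_nonneg_right k4 (norm_nonneg _)
    have k6 := mul_le_mul_of_nonneg_left k2 (by linarith : (0 : ℝ) ≤ base n)
    linarith
  rw [e1]
  have t1 := norm_sub_le ((g1 - gZero' n) + (2 * base n : ℂ) • (g - gZero n) +
    (2 * (base n : ℂ)⁻¹) • (R * g)) ((2 : ℂ) • (φ * (sinC (freq n) + φ + sinC (freq n))))
  have t2 := norm_add₃_le (a := g1 - gZero' n) (b := (2 * base n : ℂ) • (g - gZero n))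
    (c := (2 * (base n : ℂ)⁻¹) • (R * g))
  have t3 := mul_le_mul_of_nonneg_left (t1.trans (add_le_add_left t2 _))
    (by linarith : (0 : ℝ) ≤ base n)
  refine t3.trans ?_
  linarith

/-- Comparison of quotients by the integral of `g`. -/
lemma norm_quot_sub {g g1 : Cont} (hg : IsGrad n e R X φ g g1) {a a0 : Cont} {K K0 : ℝ}
    (hK : base n * ‖a - a0‖ ≤ K) (hK0 : ‖a0‖ ≤ K0) :
    ‖(total g)⁻¹ • a - (4 * base n : ℂ) • a0‖ ≤ 8 * K + 96 * 10 ^ 7 * K0 * ‖e‖ := by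
  have hn := h.one_le
  have hb : 3 < base n := by linarith [three_lt_freq hn, freq_le_base hn]
  have hz := (sector_base hn).ne_zero
  obtain ⟨h1, h2⟩ := h.norm_total_grad hg
  have hI := h.total_grad_ne hg
  have hIn : ‖(total g)⁻¹‖ ≤ 8 * base n := by
    rw [norm_inv, inv_le_iff_one_le_mul₀ (norm_pos_iff.2 hI)]
    exact h2
  have e1 : (total g)⁻¹ • a - (4 * base n : ℂ) • a0 = (total g)⁻¹ • (a - a0) -
      ((4 * base n : ℂ) * (total g)⁻¹ * (total g - (4 * base n : ℂ)⁻¹)) • a0 := by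
    refine cont_ext fun x _ => ?_
    simp only [ext_sub, ext_smul]
    field_simp
    ring
  have nb : ‖(4 * base n : ℂ)‖ = 4 * base n := by rw [norm_mul, norm_base hn]; norm_num
  have b1 : ‖(total g)⁻¹ • (a - a0)‖ ≤ 8 * K := by
    rw [norm_smul]
    have := mul_le_mul_of_nonneg_right hIn (norm_nonneg (a - a0))
    linarith
  have b2 : ‖((4 * base n : ℂ) * (total g)⁻¹ * (total g - (4 * base n : ℂ)⁻¹))‖ ≤
      96 * 10 ^ 7 * ‖e‖ := by
    rw [norm_mul, norm_mul, nb]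
    calc _ ≤ 4 * base n * (8 * base n) * ‖total g - (4 * base n : ℂ)⁻¹‖ := by gcongr
      _ ≤ _ := by linarith
  rw [e1]
  refine (norm_sub_le _ _).trans ?_
  rw [norm_smul (_ * _)]
  have b3 := mul_le_mul b2 hK0 (norm_nonneg _) (by positivity)
  linarith

end Mode

/-- If `a` is within K of b + c and b has zero mean, the mean of `a` is within K of c; so passing to
zero means costs only a factor 2 and the value of c is irrelevant. -/
lemma norm_sub_total_le {a : Cont} {b : ℝ → ℂ} (hb : ContinuousOn b (Icc 0 1))
    (hb0 : ∫ x in (0 : ℝ)..1, b x = 0) {c : ℂ} {K : ℝ}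
    (h : ∀ x ∈ Icc (0 : ℝ) 1, ‖ext a x - (b x + c)‖ ≤ K) {x : ℝ} (hx : x ∈ Icc (0 : ℝ) 1) :
    ‖ext (a - (total a) • (1 : Cont)) x - b x‖ ≤ 2 * K := by
  have h1 : total a - c = ∫ x in (0 : ℝ)..1, (ext a x - (b x + c)) := by
    have i1 : IntervalIntegrable (fun x => b x + c) volume 0 1 :=
      (hb.add continuousOn_const).intervalIntegrable01
    rw [intervalIntegral.integral_sub (intervalIntegrable_ext a 0 1) i1,
      intervalIntegral.integral_add hb.intervalIntegrable01 (by simp), hb0, total_apply]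
    simp
  have h2 : ‖total a - c‖ ≤ K := by
    rw [h1]
    have := intervalIntegral.norm_integral_le_of_norm_le_const (a := (0 : ℝ)) (b := 1) (C := K)
      (f := fun x => ext a x - (b x + c)) (fun t ht => h t (by
        rw [uIoc_of_le zero_le_one] at ht; exact Ioc_subset_Icc_self ht))
    simpa using this
  have h3 : ext (a - (total a) • (1 : Cont)) x - b x = (ext a x - (b x + c)) - (total a - c) := by
    simp only [ext_sub, ext_smul, ext_one]; ring
  rw [h3]
  linarith [norm_sub_le (ext a x - (b x + c)) (total a - c), h x hx]

/-- The gradient of an eigenvalue and its comparison with the unperturbed gradient. -/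
theorem IsBranch.exists_gradient {n : ℕ} {R X φ : Cont × Cont → Cont} {H : Cont × Cont → ℂ}
    (h : IsBranch n R X φ H) {p dp q : ℝ → ℂ} {e : Cont × Cont} (hc : Coeffs p dp q e)
    (hr : RealCoeffs p dp q) (he : ‖e‖ < tiny) :
    ∃ A B : Cont, (star A = A ∧ star B = B) ∧ (total A = 0 ∧ total B = 0) ∧
      (ext A 0 = ext A 1 ∧ ext B 0 = ext B 1) ∧
      (∀ (u du v : ℝ → ℂ) (e' : Cont × Cont), Coeffs u du v e' → ∫ x in (0 : ℝ)..1, u x = 0 →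
        ∫ x in (0 : ℝ)..1, v x = 0 →
        base n * fderiv ℂ H e e' = ∫ x in (0 : ℝ)..1, (ext A x * u x + ext B x * v x)) ∧
      ∀ x ∈ Icc (0 : ℝ) 1, ‖ext A x - base n * waveA n x‖ ≤ 6 * 10 ^ 9 * ‖e‖ ∧
        base n * ‖ext B x + waveA n x‖ ≤ 2 * 10 ^ 9 * ‖e‖ := by
  have M := h.mode hc he.le
  have hn := M.one_le
  have hb : 3 < base n := by linarith [three_lt_freq hn, freq_le_base hn]
  have hz := (sector_base hn).ne_zero
  obtain ⟨sR, sX, sφ, -⟩ := h.star_eq hc he.le hr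
  obtain ⟨g, g1, hg⟩ := M.exists_isGrad
  obtain ⟨sg, sg1⟩ := M.star_grad (star_fst hc hr) sR sX sφ hg
  have hI := M.total_grad_ne hg
  set G := gradC n (R e) (φ e) g g1 with hG
  have sG : star G = G := by
    refine cont_ext fun x _ => ?_
    rw [ext_star, hG]
    simp only [gradC, ext_add, ext_sub, ext_smul, ext_mul, ext_one, map_add, map_sub, map_mul,
      map_inv₀, map_ofNat, map_one, Complex.conj_ofReal]
    simp only [← ext_star, sg, sg1, sR, sφ, star_sinC]
  have sI : (starRingEnd ℂ) (total g) = total g := by rw [star_total, sg]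
  have sQ : ∀ a : Cont, star a = a → star ((total g)⁻¹ • a) = (total g)⁻¹ • a := fun a ha => by
    rw [star_smul, Complex.star_def, map_inv₀, sI, ha]
  have sM : ∀ a : Cont, star a = a → star (a - total a • (1 : Cont)) = a - total a • (1 : Cont) :=
    fun a ha => by
      rw [star_sub, star_smul, Complex.star_def, star_total, ha, star_one]
  have tM : ∀ a : Cont, total (a - total a • (1 : Cont)) = 0 := fun a => by
    rw [map_sub, map_smul, total_apply 1]
    simp
  have e0 := ((M.schrod).2.1)
  have e1 := ((M.schrod).2.2.1)
  have hGper : ext G 0 = ext G 1 := by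
    rw [hG, ext_gradC, ext_gradC, gradP, gradP, e0, e1, hg.per, hg.per1, M.factor.riccati.per]
  have perM : ∀ (a : Cont) (c : ℂ), ext a 0 = ext a 1 →
      ext (c • a - total (c • a) • (1 : Cont)) 0 = ext (c • a - total (c • a) • (1 : Cont)) 1 :=
    fun a c ha => by simp only [ext_sub, ext_smul, ha, ext_one]
  -- These represent the derivative up to additive constants; subtracting their means changes
  -- nothing when tested against directions of zero mean.
  set A := (total g)⁻¹ • G
  set B := (total g)⁻¹ • g
  have hwc : ContinuousOn (waveA n) (Icc 0 1) := (prim_waveA n).continuousOn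
  refine ⟨A - total A • (1 : Cont), B - total B • (1 : Cont), ⟨sM _ (sQ _ sG), sM _ (sQ _ sg)⟩,
    ⟨tM A, tM B⟩, ⟨perM _ _ hGper, perM _ _ hg.per⟩, fun u du v e' hc' hu hv => ?_,
    fun x hx => ⟨?_, ?_⟩⟩
  · have hd := h.fderiv_mul_total hc hc' he hg
    have iu : IntervalIntegrable u volume 0 1 := hc'.prim_p.continuousOn.intervalIntegrable01
    have iv := hc'.intervalIntegrable_q
    have ia : ∀ (a : Cont) (f : ℝ → ℂ), IntervalIntegrable f volume 0 1 →
        IntervalIntegrable (fun x => ext a x * f x) volume 0 1 := fun a f hf =>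
      hf.continuousOn_mul (continuous_ext a).continuousOn
    have hmul : ∀ (a : Cont) (f : ℝ → ℂ), IntervalIntegrable f volume 0 1 →
        ∫ x in (0 : ℝ)..1, f x = 0 → ∫ x in (0 : ℝ)..1,
          ext ((total g)⁻¹ • a - total ((total g)⁻¹ • a) • (1 : Cont)) x * f x =
        (total g)⁻¹ * ∫ x in (0 : ℝ)..1, ext a x * f x := fun a f hf h0 => by
      have e2 : ∀ x, ext ((total g)⁻¹ • a - total ((total g)⁻¹ • a) • (1 : Cont)) x * f x =
          (total g)⁻¹ * (ext a x * f x) - total ((total g)⁻¹ • a) * f x := fun x => by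
        simp only [ext_sub, ext_smul, ext_one]; ring
      simp only [e2]
      rw [intervalIntegral.integral_sub ((ia a f hf).const_mul _) (hf.const_mul _),
        intervalIntegral.integral_const_mul, intervalIntegral.integral_const_mul, h0]
      ring
    rw [intervalIntegral.integral_add (ia _ _ iu) (ia _ _ iv), hmul G u iu hu, hmul g v iv hv]
    simp only [← ext_gradC] at hd
    rw [intervalIntegral.integral_add (ia _ _ iv) (ia _ _ iu)] at hd
    rw [← hG] at hd
    field_simp
    linear_combination hd
  -- The constant −2·base is the mean of 4·base·(a_n − 2)/4; K covers 8·(3/2)·10⁸ + 96·10⁷ from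
  -- `norm_quot_sub`.
  · refine (norm_sub_total_le (K := 3 * 10 ^ 9 * ‖e‖) (c := -(2 * base n))
      (b := fun x => base n * waveA n x) (by fun_prop) ?_ (fun x hx => ?_) hx).trans (by linarith)
    · rw [intervalIntegral.integral_const_mul, integral_waveA n hn, mul_zero]
    · have k0 : ‖gradC n 0 0 (gZero n) (gZero' n)‖ ≤ 1 := norm_cont_le zero_le_one fun x hx => by
        rw [ext_gradC_zero hn hx, norm_div]
        norm_num
        have := norm_sub_le (waveA n x) 2
        norm_num at this
        linarith [norm_waveA_le n x]
      have k1 := M.norm_quot_sub hg (M.norm_gradC_sub hg) k0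
      have k2 := norm_ext_le (A - (4 * base n : ℂ) • gradC n 0 0 (gZero n) (gZero' n)) x
      rw [ext_sub, ext_smul (4 * base n : ℂ), ext_gradC_zero hn hx] at k2
      have k3 : ext A x - (base n * waveA n x + -(2 * base n)) =
          ext A x - 4 * base n * ((waveA n x - 2) / 4) := by ring
      rw [k3]
      linarith [norm_nonneg e]
  -- The unperturbed quotient is 1 − a_n. The comparison is made for base·g, which supplies the
  -- extra decay 1/base.
  · have hk : ∀ x ∈ Icc (0 : ℝ) 1, ‖ext B x - (-waveA n x + 1)‖ ≤ 10 ^ 9 * ‖e‖ / base n := by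
      intro x hx
      have k1 := M.norm_quot_sub hg (a := (base n : ℂ) • g) (a0 := (base n : ℂ) • gZero n)
        (K := 3 * 10 ^ 7 * ‖e‖) (K0 := 3 / 4) (by
          rw [← cont_smul_sub, norm_smul, norm_base hn]
          linarith [(M.norm_grad_sub hg).1]) (by
          rw [norm_smul, norm_base hn]; exact norm_gZero_le hn)
      have k2 := norm_ext_le ((total g)⁻¹ • (base n : ℂ) • g -
        (4 * base n : ℂ) • (base n : ℂ) • gZero n) x
      have k3 : ext ((total g)⁻¹ • (base n : ℂ) • g - (4 * base n : ℂ) • (base n : ℂ) • gZero n) x =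
          base n * (ext B x - (-waveA n x + 1)) := by
        simp only [ext_sub, ext_smul, gZero, ext_toCont _ hx, B]
        field_simp
        ring
      rw [k3, norm_mul, norm_base hn] at k2
      rw [le_div_iff₀ (by linarith)]
      linarith [norm_nonneg e]
    have := norm_sub_total_le (b := fun x => -waveA n x) (c := 1) hwc.neg (by
      rw [intervalIntegral.integral_neg, integral_waveA n hn, neg_zero]) hk hx
    rw [sub_neg_eq_add, mul_div_assoc', le_div_iff₀ (by linarith)] at this
    linarith

/-! ### Asymptotics of the eigenvalues -/

lemma norm_integral_mul_le {σ f : ℝ → ℂ} (hσ : ∀ x, ‖σ x‖ ≤ 1) (hf : IntervalIntegrable f volume 0 1)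
    {y : ℝ} (hy : y ∈ Icc (0 : ℝ) 1) :
    ‖∫ t in (0 : ℝ)..y, σ t * f t‖ ≤ ∫ t in (0 : ℝ)..1, ‖f t‖ := by
  calc ‖∫ t in (0 : ℝ)..y, σ t * f t‖ ≤ ∫ t in (0 : ℝ)..y, ‖f t‖ :=
        intervalIntegral.norm_integral_le_of_norm_le hy.1 (Filter.Eventually.of_forall fun t _ => by
          rw [norm_mul]; exact mul_le_of_le_one_left (norm_nonneg _) (hσ t))
          (hf.norm.mono_set (by
            rw [uIcc_of_le (zero_le_one : (0 : ℝ) ≤ 1)]; exact uIcc_subset_Icc zero_mem01 hy))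
    _ ≤ ∫ t in (0 : ℝ)..1, ‖f t‖ :=
        intervalIntegral.integral_mono_interval le_rfl hy.1 hy.2
          (Filter.Eventually.of_forall fun t => norm_nonneg _) hf.norm

/-- Integration by parts against trigonometric functions. -/
lemma Prim.integral_trig {f f' : ℝ → ℂ} (h : Prim f f') (k : ℝ) {y : ℝ} (hy : y ∈ Icc (0 : ℝ) 1) :
    (k * (∫ t in (0 : ℝ)..y, Complex.cos (k * t) * f t) + (∫ t in (0 : ℝ)..y, Complex.sin (k * t) * f' t)
      = Complex.sin (k * y) * f y) ∧
    (-(k * (∫ t in (0 : ℝ)..y, Complex.sin (k * t) * f t)) +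
      (∫ t in (0 : ℝ)..y, Complex.cos (k * t) * f' t) = Complex.cos (k * y) * f y - f 0) := by
  have i1 : ∀ σ : ℝ → ℂ, Continuous σ → IntervalIntegrable (fun t => σ t * f t) volume 0 y :=
    fun σ hσ => (hσ.continuousOn.mul h.continuousOn).intervalIntegrable01.sub01 zero_mem01 hy
  have i2 : ∀ σ : ℝ → ℂ, Continuous σ → IntervalIntegrable (fun t => σ t * f' t) volume 0 y :=
    fun σ hσ => (h.1.continuousOn_mul hσ.continuousOn).sub01 zero_mem01 hy
  have hs : Continuous fun t : ℝ => Complex.sin (k * t) := by fun_prop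
  have hc : Continuous fun t : ℝ => Complex.cos (k * t) := by fun_prop
  constructor
  · have h1 := ((prim_sin k).mul h).sub_eq zero_mem01 hy
    simp only [Complex.ofReal_zero, mul_zero, Complex.sin_zero, zero_mul, sub_zero] at h1
    rw [h1, ← intervalIntegral.integral_const_mul, ← intervalIntegral.integral_add
      ((i1 _ hc).const_mul _) (i2 _ hs)]
    exact integral_congr01 zero_mem01 hy fun t _ => by ring
  · have h1 := ((prim_cos k).mul h).sub_eq zero_mem01 hy
    simp only [Complex.ofReal_zero, mul_zero, Complex.cos_zero, one_mul] at h1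
    rw [h1, ← intervalIntegral.integral_const_mul, neg_add_eq_sub,
      ← intervalIntegral.integral_sub (i2 _ hc) ((i1 _ hs).const_mul _)]
    exact integral_congr01 zero_mem01 hy fun t _ => by ring

/-- The linear part of the potential of the reduced equation. -/
def linV (e : Cont × Cont) (R X : Cont) : Cont :=
  (2 : ℂ) • e.1 + (3 / 2 : ℂ) • R - (3 / 2 : ℂ) • X

namespace Mode

variable {p dp q : ℝ → ℂ} {n : ℕ} {e : Cont × Cont} {R X φ : Cont} {H : ℂ}
  (h : Mode p dp q n e R X φ H)
include h

lemma norm_linV_le : ‖linV e R X‖ ≤ 13202 * ‖e‖ := by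
  rw [linV]
  have t1 := norm_sub_le ((2 : ℂ) • e.1 + (3 / 2 : ℂ) • R) ((3 / 2 : ℂ) • X)
  have t2 := norm_add_le ((2 : ℂ) • e.1) ((3 / 2 : ℂ) • R)
  rw [norm_smul, norm_smul] at t2
  rw [norm_smul (3 / 2 : ℂ) X] at t1
  norm_num at t1 t2
  linarith [h.norm_R, h.norm_X, norm_fst_le e]

/-- The linear part of the Riccati equation. -/
lemma exists_linear_riccati {N : ℝ} (he : ‖e‖ ≤ N) (hdp : ∫ x in (0 : ℝ)..1, ‖dp x‖ ≤ N)
    (hq : ∫ x in (0 : ℝ)..1, ‖q x‖ ≤ N) : ∃ E : ℝ → ℂ,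
      Prim (fun x => ext R x - H / 3) (fun x => base n * ext X x) ∧
      Prim (ext X) (fun x => 3 * base n * ext X x - 3 * base n * (ext R x - H / 3) -
        2 * base n * p x + E x) ∧
      IntervalIntegrable E volume 0 1 ∧ ∫ x in (0 : ℝ)..1, ‖E x‖ ≤ 40000 * N := by
  have hn := h.one_le
  have hz := (sector_base hn).ne_zero
  have hb : 3 < base n := by linarith [three_lt_freq hn, freq_le_base hn]
  have he' := h.norm_e
  rw [tiny] at he'
  have hric := h.factor.riccati
  set z : ℂ := (base n : ℂ) with hzd
  -- The nonlinear terms of the Riccati equation and the term pR/z; each is bounded by a multiple of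
  -- ‖R‖, the other factors being at most 1. The rest of E is p' − q, which is controlled only in
  -- the mean.
  set nl : Cont := (3 * z⁻¹) • (R * X) - (3 * z⁻¹) • (R * R) - (z⁻¹ ^ 3) • (R * R * R) -
    (2 * z⁻¹) • (e.1 * R) with hnl
  have iq := h.coeffs.intervalIntegrable_q
  have idp := h.coeffs.prim_p.1
  have iE : IntervalIntegrable (fun x => ext nl x + (dp x - q x)) volume 0 1 :=
    (intervalIntegrable_ext nl 0 1).add (idp.sub iq)
  refine ⟨fun x => ext nl x + (dp x - q x), ?_, ?_, iE, ?_⟩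
  · refine ((hric.prim.const_mul z).sub (Prim.const (z ^ 2 + H / 3))).congr (fun x _ => ?_)
      (fun x _ => by ring)
    simp only [mfun]
    field_simp
    ring
  · refine hric.prim1.congr (fun _ _ => rfl) (fun x hx => ?_)
    simp only [hnl, mfun, ext_sub, ext_smul, ext_mul, h.coeffs.ext_p x hx]
    field_simp
    ring
  · have hzi : ‖z⁻¹‖ ≤ 1 := by
      rw [norm_inv, hzd, norm_base hn]
      exact inv_le_one_of_one_le₀ (by linarith)
    have hR := h.norm_R
    have hX := h.norm_X
    have hR1 : ‖R‖ ≤ 1 := by linarith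
    have hX1 : ‖X‖ ≤ 1 := by linarith
    have hP1 : ‖e.1‖ ≤ 1 := by linarith [norm_fst_le e]
    have mR : ∀ a : Cont, ‖a‖ ≤ 1 → ‖a * R‖ ≤ ‖R‖ := fun a ha => (norm_mul_le _ _).trans
      (mul_le_of_le_one_left (norm_nonneg _) ha)
    have b0 : ‖R * R‖ ≤ ‖R‖ := mR R hR1
    have b1 : ‖(3 * z⁻¹) • (R * X)‖ ≤ 3 * ‖R‖ := by
      rw [norm_smul, norm_mul, mul_comm R X]
      norm_num only [RCLike.norm_ofNat]
      have := mR X hX1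
      nlinarith [norm_nonneg (z⁻¹), norm_nonneg (X * R)]
    have b2 : ‖(3 * z⁻¹) • (R * R)‖ ≤ 3 * ‖R‖ := by
      rw [norm_smul, norm_mul]
      norm_num only [RCLike.norm_ofNat]
      nlinarith [norm_nonneg (z⁻¹), norm_nonneg (R * R)]
    have b3 : ‖(z⁻¹ ^ 3) • (R * R * R)‖ ≤ ‖R‖ := by
      rw [norm_smul, norm_pow]
      have k1 := mR (R * R) (b0.trans hR1)
      have k2 : ‖z⁻¹‖ ^ 3 ≤ 1 := pow_le_one₀ (norm_nonneg _) hzi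
      calc _ ≤ 1 * ‖R * R * R‖ := by gcongr
        _ ≤ _ := by rw [one_mul]; exact k1
    have b4 : ‖(2 * z⁻¹) • (e.1 * R)‖ ≤ 2 * ‖R‖ := by
      rw [norm_smul, norm_mul]
      norm_num only [RCLike.norm_ofNat]
      have := mR e.1 hP1
      nlinarith [norm_nonneg (z⁻¹), norm_nonneg (e.1 * R)]
    have hnl' : ‖nl‖ ≤ 9 * ‖R‖ := by
      rw [hnl]
      linarith [norm_sub_le ((3 * z⁻¹) • (R * X) - (3 * z⁻¹) • (R * R) - (z⁻¹ ^ 3) • (R * R * R))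
        ((2 * z⁻¹) • (e.1 * R)), norm_sub_le ((3 * z⁻¹) • (R * X) - (3 * z⁻¹) • (R * R))
        ((z⁻¹ ^ 3) • (R * R * R)), norm_sub_le ((3 * z⁻¹) • (R * X)) ((3 * z⁻¹) • (R * R))]
    have hint : ∫ x in (0 : ℝ)..1, ‖ext nl x + (dp x - q x)‖ ≤
        ∫ x in (0 : ℝ)..1, (‖nl‖ + (‖dp x‖ + ‖q x‖)) := by
      refine intervalIntegral.integral_mono_on zero_le_one iE.norm
        (intervalIntegrable_const.add (idp.norm.add iq.norm)) fun x _ => ?_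
      linarith [norm_add_le (ext nl x) (dp x - q x), norm_sub_le (dp x) (q x), norm_ext_le nl x]
    rw [intervalIntegral.integral_add intervalIntegrable_const (idp.norm.add iq.norm),
      intervalIntegral.integral_add idp.norm iq.norm, intervalIntegral.integral_const] at hint
    simp only [sub_zero, smul_eq_mul, one_mul] at hint
    refine hint.trans ?_
    linarith [norm_nonneg e]

/-- The linear part of the potential is nearly orthogonal to rapid oscillations. -/
lemma norm_integral_sin_linV_le {N : ℝ} (he : ‖e‖ ≤ N) (hdp : ∫ x in (0 : ℝ)..1, ‖dp x‖ ≤ N)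
    (hq : ∫ x in (0 : ℝ)..1, ‖q x‖ ≤ N) {y : ℝ} (hy : y ∈ Icc (0 : ℝ) 1) :
    base n * ‖∫ t in (0 : ℝ)..y, Complex.sin ((2 * freq n : ℝ) * t) * ext (linV e R X) t‖ ≤
      10 ^ 5 * N := by
  obtain ⟨E, hR, hX, iE, hE⟩ := h.exists_linear_riccati he hdp hq
  have hn := h.one_le
  have hz := (sector_base hn).ne_zero
  have hb : 3 < base n := by linarith [three_lt_freq hn, freq_le_base hn]
  set k : ℝ := 2 * freq n with hk
  have hkz : (k : ℂ) = (Real.sqrt 3 : ℝ) * base n := by rw [sqrt3_base_cast, hk]; push_cast; ring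
  have ns : ∀ x : ℝ, ‖Complex.sin (k * x)‖ ≤ 1 := fun x => by
    rw [← Complex.ofReal_mul]; exact norm_csin_ofReal_le _
  have nc : ∀ x : ℝ, ‖Complex.cos (k * x)‖ ≤ 1 := fun x => by
    rw [← Complex.ofReal_mul]; exact norm_ccos_ofReal_le _
  have hs : Continuous fun t : ℝ => Complex.sin (k * t) := by fun_prop
  have hc : Continuous fun t : ℝ => Complex.cos (k * t) := by fun_prop
  have ic : ∀ σ : ℝ → ℂ, Continuous σ → ∀ f : ℝ → ℂ, ContinuousOn f (Icc 0 1) →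
      IntervalIntegrable (fun t => σ t * f t) volume 0 y := fun σ hσ f hf =>
    (hσ.continuousOn.mul hf).intervalIntegrable01.sub01 zero_mem01 hy
  have iE' : ∀ σ : ℝ → ℂ, Continuous σ → IntervalIntegrable (fun t => σ t * E t) volume 0 y :=
    fun σ hσ => (iE.continuousOn_mul hσ.continuousOn).sub01 zero_mem01 hy
  have cX := hX.continuousOn
  have cR := hR.continuousOn
  have cp := h.coeffs.prim_p.continuousOn
  have split : ∀ σ : ℝ → ℂ, Continuous σ → (∫ t in (0 : ℝ)..y, σ t * (3 * base n * ext X t -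
      3 * base n * (ext R t - H / 3) - 2 * base n * p t + E t)) =
      3 * base n * (∫ t in (0 : ℝ)..y, σ t * ext X t) -
      3 * base n * (∫ t in (0 : ℝ)..y, σ t * (ext R t - H / 3)) -
      2 * base n * (∫ t in (0 : ℝ)..y, σ t * p t) + ∫ t in (0 : ℝ)..y, σ t * E t := fun σ hσ => by
    rw [← intervalIntegral.integral_const_mul, ← intervalIntegral.integral_const_mul,
      ← intervalIntegral.integral_const_mul, ← intervalIntegral.integral_sub
        ((ic σ hσ _ cX).const_mul _) ((ic σ hσ _ cR).const_mul _), ← intervalIntegral.integral_sub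
        (((ic σ hσ _ cX).const_mul _).sub ((ic σ hσ _ cR).const_mul _))
        ((ic σ hσ _ cp).const_mul _), ← intervalIntegral.integral_add
        ((((ic σ hσ _ cX).const_mul _).sub ((ic σ hσ _ cR).const_mul _)).sub
        ((ic σ hσ _ cp).const_mul _)) (iE' σ hσ)]
    exact integral_congr01 zero_mem01 hy fun t _ => by ring
  have pull : ∀ σ : ℝ → ℂ, (∫ t in (0 : ℝ)..y, σ t * (base n * ext X t)) =
      base n * ∫ t in (0 : ℝ)..y, σ t * ext X t := fun σ => by
    rw [← intervalIntegral.integral_const_mul]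
    exact integral_congr01 zero_mem01 hy fun t _ => by ring
  obtain ⟨r1, r2⟩ := hR.integral_trig k hy
  obtain ⟨x1, x2⟩ := hX.integral_trig k hy
  obtain ⟨p1, p2⟩ := h.coeffs.prim_p.integral_trig k hy
  obtain ⟨-, o2⟩ := (Prim.const (H / 3)).integral_trig k hy
  have E1 := norm_integral_mul_le ns iE hy
  have E2 := norm_integral_mul_le nc iE hy
  have D1 := norm_integral_mul_le ns h.coeffs.prim_p.1 hy
  have D2 := norm_integral_mul_le nc h.coeffs.prim_p.1 hy
  rw [split _ hs] at x1
  rw [split _ hc] at x2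
  rw [pull] at r1 r2
  simp only [mul_zero, intervalIntegral.integral_zero, add_zero] at o2
  have goal : (∫ t in (0 : ℝ)..y, Complex.sin (k * t) * ext (linV e R X) t) =
      2 * (∫ t in (0 : ℝ)..y, Complex.sin (k * t) * p t) +
      3 / 2 * (∫ t in (0 : ℝ)..y, Complex.sin (k * t) * (ext R t - H / 3)) +
      3 / 2 * (∫ t in (0 : ℝ)..y, Complex.sin (k * t) * (H / 3)) -
      3 / 2 * (∫ t in (0 : ℝ)..y, Complex.sin (k * t) * ext X t) := by
    rw [← intervalIntegral.integral_const_mul, ← intervalIntegral.integral_const_mul,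
      ← intervalIntegral.integral_const_mul, ← intervalIntegral.integral_const_mul,
      ← intervalIntegral.integral_add
        ((ic _ hs _ cp).const_mul _) ((ic _ hs _ cR).const_mul _), ← intervalIntegral.integral_add
        (((ic _ hs _ cp).const_mul _).add ((ic _ hs _ cR).const_mul _))
        ((ic _ hs _ continuousOn_const).const_mul _), ← intervalIntegral.integral_sub
        ((((ic _ hs _ cp).const_mul _).add ((ic _ hs _ cR).const_mul _)).add
        ((ic _ hs _ continuousOn_const).const_mul _)) ((ic _ hs _ cX).const_mul _)]
    refine integral_congr01 zero_mem01 hy fun t ht => ?_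
    have ht' : t ∈ Icc (0 : ℝ) 1 := ht
    rw [← h.coeffs.ext_p t ht']
    simp only [linV, ext_add, ext_sub, ext_smul]
    ring
  rw [goal]
  set Xs := ∫ t in (0 : ℝ)..y, Complex.sin (k * t) * ext X t
  set Xc := ∫ t in (0 : ℝ)..y, Complex.cos (k * t) * ext X t
  set Rs := ∫ t in (0 : ℝ)..y, Complex.sin (k * t) * (ext R t - H / 3)
  set Rc := ∫ t in (0 : ℝ)..y, Complex.cos (k * t) * (ext R t - H / 3)
  set Ps := ∫ t in (0 : ℝ)..y, Complex.sin (k * t) * p t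
  set Pc := ∫ t in (0 : ℝ)..y, Complex.cos (k * t) * p t
  set Os := ∫ t in (0 : ℝ)..y, Complex.sin (k * t) * (H / 3)
  set Es := ∫ t in (0 : ℝ)..y, Complex.sin (k * t) * E t
  set Ec := ∫ t in (0 : ℝ)..y, Complex.cos (k * t) * E t
  set Ds := ∫ t in (0 : ℝ)..y, Complex.sin (k * t) * dp t
  set Dc := ∫ t in (0 : ℝ)..y, Complex.cos (k * t) * dp t
  have hN : 0 ≤ N := (norm_nonneg e).trans he
  -- the right hand sides
  have b : ∀ (f : ℝ → ℂ) (K : ℝ), (∀ x ∈ Icc (0 : ℝ) 1, ‖f x‖ ≤ K) →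
      ‖Complex.sin (k * y) * f y‖ ≤ K ∧ ‖Complex.cos (k * y) * f y - f 0‖ ≤ 2 * K := by
    intro f K hf
    have h1 : ‖Complex.sin (k * y) * f y‖ ≤ K := by
      rw [norm_mul]; exact (mul_le_of_le_one_left (norm_nonneg _) (ns y)).trans (hf y hy)
    have h2 : ‖Complex.cos (k * y) * f y‖ ≤ K := by
      rw [norm_mul]; exact (mul_le_of_le_one_left (norm_nonneg _) (nc y)).trans (hf y hy)
    exact ⟨h1, (norm_sub_le _ _).trans (by linarith [hf 0 zero_mem01])⟩
  have hH : ‖H / 3‖ ≤ 1500 * N := by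
    rw [norm_div]; norm_num; linarith [h.norm_H]
  obtain ⟨bX1, bX2⟩ := b (ext X) (4400 * N) fun x _ => by
    linarith [norm_ext_le X x, h.norm_X]
  obtain ⟨bR1, bR2⟩ := b (fun x => ext R x - H / 3) (5900 * N) fun x _ => by
    linarith [norm_sub_le (ext R x) (H / 3), norm_ext_le R x, h.norm_R]
  obtain ⟨bP1, bP2⟩ := b p N fun x hx => by
    rw [← h.coeffs.ext_p x hx]; linarith [norm_ext_le e.1 x, norm_fst_le e]
  obtain ⟨-, bO2⟩ := b (fun _ => H / 3) (1500 * N) fun x _ => hH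
  rw [← x1] at bX1
  rw [← x2] at bX2
  rw [← r1] at bR1
  rw [← r2] at bR2
  rw [← p1] at bP1
  rw [← p2] at bP2
  rw [← o2] at bO2
  rw [hkz] at bX1 bX2 bR1 bR2 bP1 bP2 bO2
  have ht2 := sqrt3_sq
  have htne := sqrt3_ne
  have ht3 := sqrt3_bounds
  have htn : ‖((Real.sqrt 3 : ℝ) : ℂ)‖ = Real.sqrt 3 := by
    rw [Complex.norm_real, Real.norm_of_nonneg (Real.sqrt_nonneg 3)]
  set t : ℂ := ((Real.sqrt 3 : ℝ) : ℂ)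
  set z : ℂ := (base n : ℂ)
  -- Integration by parts shows that each bracket is a boundary value, hence O(N), and the integrals
  -- of p' and E are O(N) by their L¹ bounds. The coefficients are those that eliminate the cosine
  -- integrals of p, R and X, using t² = 3; what remains is 3tz times the wanted sine integral.
  have hfin : 3 * t * (z * (2 * Ps + 3 / 2 * Rs + 3 / 2 * Os - 3 / 2 * Xs)) =
      3 * Dc + -(3 : ℂ) * (-(t * z * Ps) + Dc) + t * (t * z * Pc + Ds) + -t * Ds +
      3 / 2 * (-(t * z * Xs) + (3 * z * Xc - 3 * z * Rc - 2 * z * Pc + Ec)) +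
      3 / 2 * t * (t * z * Rc + z * Xs) + -(3 / 2 : ℂ) * Ec + -(9 / 2 : ℂ) * -(t * z * Os) +
      3 / 2 * t * Es +
      -(3 / 2 * t) * (t * z * Xc + (3 * z * Xs - 3 * z * Rs - 2 * z * Ps + Es)) := by
    linear_combination (-z * Pc - 3 / 2 * z * Rc + 3 / 2 * z * Xc) * ht2
  have hmul : ∀ (c u : ℂ) (s K : ℝ), ‖c‖ ≤ s → ‖u‖ ≤ K → ‖c * u‖ ≤ s * K := fun c u s K hc hu => by
    rw [norm_mul]; exact mul_le_mul hc hu (norm_nonneg _) ((norm_nonneg _).trans hc)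
  have ht4 : ‖t‖ ≤ 2 := by rw [htn]; linarith
  have ht5 : ‖3 / 2 * t‖ ≤ 3 := by rw [norm_mul]; norm_num; linarith
  have hall := norm_add_le_of_le (norm_add_le_of_le (norm_add_le_of_le (norm_add_le_of_le
    (norm_add_le_of_le (norm_add_le_of_le (norm_add_le_of_le (norm_add_le_of_le (norm_add_le_of_le
    (hmul 3 Dc 3 N (by norm_num) (D2.trans hdp))
    (hmul (-3) _ 3 _ (by norm_num) bP2)) (hmul t _ 2 _ ht4 bP1))
    (hmul (-t) Ds 2 N (by rwa [norm_neg]) (D1.trans hdp)))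
    (hmul (3 / 2) _ (3 / 2) _ (by norm_num) bX2)) (hmul (3 / 2 * t) _ 3 _ ht5 bR1))
    (hmul (-(3 / 2)) Ec (3 / 2) _ (by norm_num) (E2.trans hE)))
    (hmul (-(9 / 2)) _ (9 / 2) _ (by norm_num) bO2))
    (hmul (3 / 2 * t) Es 3 _ ht5 (E1.trans hE)))
    (hmul (-(3 / 2 * t)) _ 3 _ (by rwa [norm_neg]) bX1)
  rw [← hfin, norm_mul, norm_mul, norm_mul z, htn, norm_base hn] at hall
  norm_num at hall
  set S := base n * ‖2 * Ps + 3 / 2 * Rs + 3 / 2 * Os - 3 / 2 * Xs‖ with hS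
  have hS0 : 0 ≤ S := by positivity
  nlinarith

-- With u and b the primitives of sin·a and cos·a, the integrand is u'b − b'u, so its integral is
-- 2∫u'b − u(1)b(1). Hence smallness of b alone suffices, although u need not be small.
omit h in
lemma _root_.ThreePoint.norm_total_mul_waveInt_le (n : ℕ) {a w : Cont} {K : ℝ}
    (ha : a = w * sinC (freq n)) (hK : ∀ x ∈ Icc (0 : ℝ) 1,
      ‖ext (volterra (cosC (freq n) * a)) x‖ ≤ K) :
    ‖total (a * waveInt (freq n) a)‖ ≤ 3 * ‖w‖ * K := by
  have hK0 : 0 ≤ K := (norm_nonneg _).trans (hK 0 zero_mem01)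
  set u := volterra (sinC (freq n) * a) with hu
  set b := volterra (cosC (freq n) * a) with hb
  have hprod := ((prim_volterra (sinC (freq n) * a)).mul (prim_volterra (cosC (freq n) * a))).integral
  rw [ext_volterra _ zero_mem01, intervalIntegral.integral_same, zero_mul, sub_zero, ← hu, ← hb]
    at hprod
  have hsa : ‖sinC (freq n) * a‖ ≤ ‖w‖ := by
    rw [ha]
    have h1 := norm_sinC_le (freq n)
    have h2 := (norm_mul_le w (sinC (freq n))).trans (mul_le_of_le_one_right (norm_nonneg _) h1)
    exact (norm_mul_le _ _).trans ((mul_le_of_le_one_left (norm_nonneg _) h1).trans h2)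
  have hbK : ‖b‖ ≤ K := norm_cont_le hK0 hK
  have hub : ‖ext u 1 * ext b 1‖ ≤ ‖w‖ * K := by
    rw [norm_mul]
    exact mul_le_mul (((norm_ext_le _ _).trans (norm_volterra_le _)).trans hsa)
      (hK 1 one_mem01) (norm_nonneg _) (norm_nonneg _)
  have e1 : total (a * waveInt (freq n) a) =
      2 * total (sinC (freq n) * a * b) - ext u 1 * ext b 1 := by
    rw [← hprod, total_apply, total_apply, ← intervalIntegral.integral_const_mul,
      ← intervalIntegral.integral_sub ((intervalIntegrable_ext _ 0 1).const_mul _) (by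
        refine ContinuousOn.intervalIntegrable01 ?_
        exact Continuous.continuousOn (by fun_prop))]
    refine integral_congr01 zero_mem01 one_mem01 fun x _ => ?_
    simp only [waveInt, ext_mul, ext_sub, hu, hb]
    ring
  have h3 : ‖total (sinC (freq n) * a * b)‖ ≤ ‖w‖ * K := (norm_total_le _).trans
    ((norm_mul_le _ _).trans (mul_le_mul hsa hbK (norm_nonneg _) (norm_nonneg _)))
  rw [e1]
  refine (norm_sub_le _ _).trans ?_
  rw [norm_mul]
  norm_num only [RCLike.norm_ofNat]
  linarith

/-- One factor 1/n comes from φ = −κ⁻¹·`waveInt`(v·f). In the leading part of φ, v·f is replaced by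
w·sin with w the linear part; then sin·cos = ½ sin 2κx appears and the oscillation of w against it
gives the second factor 1/n. The rest is cubic in the coefficients and has already the additional
decay. -/
lemma norm_total_linV_mul_le {N : ℝ} (he : ‖e‖ ≤ N) (hdp : ∫ x in (0 : ℝ)..1, ‖dp x‖ ≤ N)
    (hq : ∫ x in (0 : ℝ)..1, ‖q x‖ ≤ N) :
    base n ^ 2 * ‖total (linV e R X * sinC (freq n) * φ)‖ ≤ 5 * 10 ^ 9 * N ^ 2 := by
  have hn := h.one_le
  have hz := (sector_base hn).ne_zero
  have hκ := freq_ne_zero hn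
  have hb : 3 < base n := by linarith [three_lt_freq hn, freq_le_base hn]
  have hf := three_lt_freq hn
  have he' := h.norm_e
  rw [tiny] at he'
  have hN : 0 ≤ N := (norm_nonneg e).trans he
  have hν := norm_nonneg e
  set w := linV e R X with hw
  set s := sinC (freq n) with hs
  set v := potV (base n) e.1 R X with hv
  have hwn : ‖w‖ ≤ 13202 * ‖e‖ := h.norm_linV_le
  have hws : ‖w * s‖ ≤ 13202 * ‖e‖ :=
    (norm_mul_le _ _).trans ((mul_le_of_le_one_right (norm_nonneg _) (norm_sinC_le _)).trans hwn)
  have hφ : (freq n : ℂ) • φ = -waveInt (freq n) (v * (s + φ)) := by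
    conv_lhs => rw [h.joint.wave]
    refine cont_ext fun x _ => ?_
    simp only [ext_smul, ext_neg]
    field_simp
    rfl
  have hsplit : waveInt (freq n) (v * (s + φ)) = waveInt (freq n) (w * s) +
      waveInt (freq n) (v * (s + φ) - w * s) := by
    rw [← waveInt_sub]; ring
  have hdiff : v * (s + φ) - w * s = (3 / 4 * ((base n : ℂ) ^ 2)⁻¹) • (R * R * (s + φ)) + w * φ := by
    refine cont_ext fun x _ => ?_
    simp only [hv, hw, potV, linV, ext_add, ext_sub, ext_mul, ext_smul]
    ring
  have hφn := h.freq_mul_norm_φ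
  have hbf := base_le_freq hn
  have hfs : ‖s + φ‖ ≤ 2 := h.norm_f
  have hrest : base n * ‖v * (s + φ) - w * s‖ ≤ 10 ^ 10 * ‖e‖ ^ 2 := by
    have c1 : ‖(3 / 4 * ((base n : ℂ) ^ 2)⁻¹ : ℂ)‖ = 3 / 4 * ((base n) ^ 2)⁻¹ := by
      rw [norm_mul, norm_inv, norm_pow, norm_base hn]; norm_num
    have c2 : ‖R * R * (s + φ)‖ ≤ (4400 * ‖e‖) ^ 2 * 2 := by
      refine (norm_mul_le _ _).trans (mul_le_mul ?_ hfs (norm_nonneg _) (by positivity))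
      rw [pow_two]
      exact (norm_mul_le _ _).trans (mul_le_mul h.norm_R h.norm_R (norm_nonneg _) (by positivity))
    have c3 : ‖w * φ‖ ≤ 13202 * ‖e‖ * ‖φ‖ :=
      (norm_mul_le _ _).trans (mul_le_mul_of_nonneg_right hwn (norm_nonneg _))
    have c4 : base n * ‖φ‖ ≤ 668800 * ‖e‖ := by nlinarith [norm_nonneg φ]
    have c5 : base n * (3 / 4 * ((base n) ^ 2)⁻¹) ≤ 1 := by
      have : base n * (3 / 4 * ((base n) ^ 2)⁻¹) = 3 / 4 / base n := by field_simp
      rw [this, div_le_one (by linarith)]; linarith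
    rw [hdiff]
    have c6 := norm_add_le ((3 / 4 * ((base n : ℂ) ^ 2)⁻¹) • (R * R * (s + φ))) (w * φ)
    rw [norm_smul, c1] at c6
    have c7 : base n * (3 / 4 * ((base n) ^ 2)⁻¹ * ‖R * R * (s + φ)‖) ≤ (4400 * ‖e‖) ^ 2 * 2 := by
      rw [← mul_assoc]
      calc _ ≤ 1 * ‖R * R * (s + φ)‖ := by gcongr
        _ ≤ _ := by rw [one_mul]; exact c2
    have c8 : base n * ‖w * φ‖ ≤ 13202 * ‖e‖ * (668800 * ‖e‖) := by
      calc _ ≤ base n * (13202 * ‖e‖ * ‖φ‖) := by gcongr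
        _ = 13202 * ‖e‖ * (base n * ‖φ‖) := by ring
        _ ≤ _ := by gcongr
    have c9 := mul_le_mul_of_nonneg_left c6 (by linarith : (0 : ℝ) ≤ base n)
    nlinarith
  -- the main term
  have hJ : ‖total (w * s * waveInt (freq n) (w * s))‖ ≤ 3 * ‖w‖ * (5 * 10 ^ 4 * N / base n) := by
    refine norm_total_mul_waveInt_le n rfl fun x hx => ?_
    have k1 := h.norm_integral_sin_linV_le he hdp hq hx
    have k2 : ext (volterra (cosC (freq n) * (w * s))) x = (1 / 2 : ℂ) *
        ∫ t in (0 : ℝ)..x, Complex.sin ((2 * freq n : ℝ) * t) * ext w t := by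
      rw [ext_volterra _ hx, ← intervalIntegral.integral_const_mul]
      refine integral_congr01 zero_mem01 hx fun t ht => ?_
      have e1 : (((2 * freq n : ℝ) : ℂ) * t) = 2 * (freq n * t) := by push_cast; ring
      rw [e1, Complex.sin_two_mul]
      simp only [ext_mul, ext_cosC _ ht, hs, ext_sinC _ ht]
      ring
    rw [← hw] at k1
    rw [k2, norm_mul, le_div_iff₀ (by linarith), show ‖(1 / 2 : ℂ)‖ = 1 / 2 by norm_num]
    linarith
  have hkey : (freq n : ℂ) * total (w * s * φ) = -(total (w * s * waveInt (freq n) (w * s)) +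
      total (w * s * waveInt (freq n) (v * (s + φ) - w * s))) := by
    rw [← smul_eq_mul, ← map_smul, ← map_add, ← map_neg]
    congr 1
    calc (freq n : ℂ) • (w * s * φ) = w * s * ((freq n : ℂ) • φ) := by
          rw [mul_smul_comm]
      _ = _ := by rw [hφ, hsplit]; ring
  have hsecond : base n * ‖total (w * s * waveInt (freq n) (v * (s + φ) - w * s))‖ ≤ N ^ 2 := by
    have d1 : ‖total (w * s * waveInt (freq n) (v * (s + φ) - w * s))‖ ≤
        13202 * ‖e‖ * (2 * ‖v * (s + φ) - w * s‖) := (norm_total_le _).trans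
      ((norm_mul_le _ _).trans (mul_le_mul hws (norm_waveInt_le _ _) (norm_nonneg _) (by positivity)))
    calc _ ≤ base n * (13202 * ‖e‖ * (2 * ‖v * (s + φ) - w * s‖)) := by gcongr
      _ = 26404 * ‖e‖ * (base n * ‖v * (s + φ) - w * s‖) := by ring
      _ ≤ 26404 * ‖e‖ * (10 ^ 10 * ‖e‖ ^ 2) := by gcongr
      _ = (26404 * 10 ^ 10 * ‖e‖) * ‖e‖ ^ 2 := by ring
      _ ≤ 1 * ‖e‖ ^ 2 := by gcongr; linarith
      _ ≤ N ^ 2 := by rw [one_mul]; gcongr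
  have hfirst : base n * ‖total (w * s * waveInt (freq n) (w * s))‖ ≤ 2 * 10 ^ 9 * N ^ 2 := by
    calc _ ≤ base n * (3 * ‖w‖ * (5 * 10 ^ 4 * N / base n)) := by gcongr
      _ = 15 * 10 ^ 4 * ‖w‖ * N := by field_simp; ring
      _ ≤ 15 * 10 ^ 4 * (13202 * N) * N := by gcongr; linarith
      _ ≤ _ := by nlinarith
  have hnorm : freq n * ‖total (w * s * φ)‖ ≤ ‖total (w * s * waveInt (freq n) (w * s))‖ +
      ‖total (w * s * waveInt (freq n) (v * (s + φ) - w * s))‖ := by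
    have := congrArg norm hkey
    rw [norm_mul, norm_neg, Complex.norm_real, Real.norm_of_nonneg (by linarith)] at this
    rw [this]
    exact norm_add_le _ _
  calc base n ^ 2 * ‖total (w * s * φ)‖ = base n * (base n * ‖total (w * s * φ)‖) := by ring
    _ ≤ base n * (2 * freq n * ‖total (w * s * φ)‖) := by gcongr
    _ = 2 * (base n * (freq n * ‖total (w * s * φ)‖)) := by ring
    _ ≤ 2 * (base n * (‖total (w * s * waveInt (freq n) (w * s))‖ +
      ‖total (w * s * waveInt (freq n) (v * (s + φ) - w * s))‖)) := by gcongr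
    _ ≤ _ := by nlinarith

-- The zero coefficients serve as base point: the difference formula is exact, so comparison with ψ
-- = 0 needs no Taylor expansion.
omit h in
lemma _root_.ThreePoint.gradData_zero {n : ℕ} (hn : 1 ≤ n) :
    GradData (fun _ => 0) (fun _ => 0) (fun _ => 0) ((base n : ℂ) ^ 3) (fun _ => base n)
      (fun _ => 0) (ext (sinC (freq n))) (ext ((freq n : ℂ) • cosC (freq n))) (ext (gZero n))
      (ext (gZero' n)) := by
  refine ⟨Prim.const 0, rfl, by simp, ⟨Prim.const _, ?_, rfl, rfl⟩, ⟨?_, ?_⟩, ?_, ?_, prim_gZero n,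
    ?_, ?_, ?_⟩
  · exact (Prim.const 0).congr (fun _ _ => rfl) (fun _ _ => by ring)
  · exact (prim_sin (freq n)).congr (fun x hx => ext_sinC _ hx)
      (fun x hx => by rw [ext_smul, ext_cosC _ hx])
  · refine ((prim_cos (freq n)).const_mul (freq n : ℂ)).congr
      (fun x hx => by rw [ext_smul, ext_cosC _ hx]) (fun x hx => ?_)
    have : (3 / 4 * (base n : ℂ) ^ 2) = (freq n : ℂ) ^ 2  := by
      have := congrArg ((↑) : ℝ → ℂ) (base_sq n)
      push_cast at this
      exact this
    rw [ext_sinC _ hx, reducedPot]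
    linear_combination (-Complex.sin (freq n * x)) * this
  · rw [ext_sinC _ zero_mem01]; simp
  · rw [ext_sinC _ one_mem01]; simp [csin_freq]
  · refine (prim_gZero' hn).congr (fun _ _ => rfl) (fun x hx => ?_)
    simp only [source, ext_sinC _ hx, ext_smul, ext_cosC _ hx]
    ring
  · rw [gZero, ext_toCont _ zero_mem01, ext_toCont _ one_mem01, (waveA_per n).1]
  · rw [gZero', ext_toCont _ zero_mem01, ext_toCont _ one_mem01, (waveA_per n).2]

/-- The asymptotics of the eigenvalues. -/
theorem norm_asymptotic {N : ℝ} (he : ‖e‖ ≤ N) (hdp : ∫ x in (0 : ℝ)..1, ‖dp x‖ ≤ N)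
    (hq : ∫ x in (0 : ℝ)..1, ‖q x‖ ≤ N) (p0 : ∫ x in (0 : ℝ)..1, p x = 0)
    (q0 : ∫ x in (0 : ℝ)..1, q x = 0) :
    base n * ‖base n * H +
      (∫ x in (0 : ℝ)..1, Complex.sin ((2 * freq n : ℝ) * x) * dp x) / (Real.sqrt 3 : ℝ) +
      (∫ x in (0 : ℝ)..1, Complex.cos ((2 * freq n : ℝ) * x) * q x) -
      (∫ x in (0 : ℝ)..1, Complex.cos ((2 * freq n : ℝ) * x) * dp x) / 3 +
      (∫ x in (0 : ℝ)..1, Complex.sin ((2 * freq n : ℝ) * x) * q x) / (Real.sqrt 3 : ℝ)‖ ≤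
      3 * 10 ^ 10 * N ^ 2 := by
  have hn := h.one_le
  have hz := (sector_base hn).ne_zero
  have hb : 3 < base n := by linarith [three_lt_freq hn, freq_le_base hn]
  have he' := h.norm_e
  rw [tiny] at he'
  have hN : 0 ≤ N := (norm_nonneg e).trans he
  have hν := norm_nonneg e
  obtain ⟨hs', f0', f1', -⟩ := h.schrod
  have hd := (gradData_zero hn).sub_mul_integral h.coeffs.prim_p h.coeffs.per_p
    h.coeffs.intervalIntegrable_q h.factor.riccati hs' f0' f1'
  rw [← total_apply, total_gZero hn] at hd
  set s := sinC (freq n) with hs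
  set D : Cont := ((base n : ℂ)⁻¹ • R) * (gZero n * ((3 : ℂ) • X - (3 : ℂ) • R -
    ((base n : ℂ) ^ 2)⁻¹ • (R * R) - (2 : ℂ) • e.1) + (3 / 4 * (base n : ℂ)⁻¹) •
      (R * (s + φ) * s)) with hD
  -- The remainder is split into `D`, which carries an explicit factor of order base⁻², and the
  -- product with φ, whose decay needs the oscillation argument.
  have hrem : (∫ x in (0 : ℝ)..1, remainder (fun _ => base n) (ext (gZero n)) (ext s) (ext (s + φ))
      (fun x => mfun (base n) R x - base n) (fun x => ext X x - 0) (fun x => p x - 0) x) =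
      total D + total (linV e R X * s * φ) := by
    rw [← map_add, total_apply]
    refine integral_congr01 zero_mem01 one_mem01 fun x hx => ?_
    simp only [remainder, mfun, hD, linV, ext_add, ext_sub, ext_mul, ext_smul,
      h.coeffs.ext_p x hx]
    field_simp
    ring
  rw [hrem] at hd
  -- the first order terms
  have ip : IntervalIntegrable p volume 0 1 := h.coeffs.prim_p.continuousOn.intervalIntegrable01
  have iq := h.coeffs.intervalIntegrable_q
  have hsc : Continuous fun t : ℝ => Complex.sin ((2 * freq n : ℝ) * t) := by fun_prop
  have hcc : Continuous fun t : ℝ => Complex.cos ((2 * freq n : ℝ) * t) := by fun_prop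
  have im : ∀ (σ f : ℝ → ℂ), Continuous σ → IntervalIntegrable f volume 0 1 →
      IntervalIntegrable (fun t => σ t * f t) volume 0 1 := fun σ f hσ hf =>
    hf.continuousOn_mul hσ.continuousOn
  have hlin : (∫ x in (0 : ℝ)..1, (ext (gZero n) x * (q x - 0) +
      gradP (fun _ => base n) (ext s) (ext (gZero n)) (ext (gZero' n)) x * (p x - 0))) =
      (4 * base n : ℂ)⁻¹ * (-(∫ x in (0 : ℝ)..1, Complex.cos ((2 * freq n : ℝ) * x) * q x) -
        (∫ x in (0 : ℝ)..1, Complex.sin ((2 * freq n : ℝ) * x) * q x) / (Real.sqrt 3 : ℝ)) +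
      1 / 4 * ((∫ x in (0 : ℝ)..1, Complex.cos ((2 * freq n : ℝ) * x) * p x) +
        (∫ x in (0 : ℝ)..1, Complex.sin ((2 * freq n : ℝ) * x) * p x) / (Real.sqrt 3 : ℝ)) := by
    have e1 : ∀ x ∈ Icc (0 : ℝ) 1, ext (gZero n) x * (q x - 0) +
        gradP (fun _ => base n) (ext s) (ext (gZero n)) (ext (gZero' n)) x * (p x - 0) =
        ((4 * base n : ℂ)⁻¹ * q x - 1 / 2 * p x) +
        ((-(4 * base n : ℂ)⁻¹) * (Complex.cos ((2 * freq n : ℝ) * x) * q x) +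
        (-(4 * base n : ℂ)⁻¹ * ((Real.sqrt 3 : ℝ) : ℂ)⁻¹) *
          (Complex.sin ((2 * freq n : ℝ) * x) * q x)) +
        (1 / 4 * (Complex.cos ((2 * freq n : ℝ) * x) * p x) +
        (1 / 4 * ((Real.sqrt 3 : ℝ) : ℂ)⁻¹) * (Complex.sin ((2 * freq n : ℝ) * x) * p x)) := by
      intro x hx
      have k1 := ext_gradC_zero hn hx
      rw [ext_gradC, add_zero] at k1
      have k2 : mfun (base n) 0 = fun _ => (base n : ℂ) := by
        funext y; simp [mfun]
      rw [k2] at k1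
      rw [hs, k1, gZero, ext_toCont _ hx]
      simp only [waveA]
      ring
    rw [integral_congr01 zero_mem01 one_mem01 e1, intervalIntegral.integral_add
      (((iq.const_mul _).sub (ip.const_mul _)).add (((im _ _ hcc iq).const_mul _).add
        ((im _ _ hsc iq).const_mul _))) (((im _ _ hcc ip).const_mul _).add
        ((im _ _ hsc ip).const_mul _)), intervalIntegral.integral_add
      ((iq.const_mul _).sub (ip.const_mul _)) (((im _ _ hcc iq).const_mul _).add
        ((im _ _ hsc iq).const_mul _)), intervalIntegral.integral_sub (iq.const_mul _)
        (ip.const_mul _), intervalIntegral.integral_add ((im _ _ hcc iq).const_mul _)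
        ((im _ _ hsc iq).const_mul _), intervalIntegral.integral_add ((im _ _ hcc ip).const_mul _)
        ((im _ _ hsc ip).const_mul _)]
    simp only [intervalIntegral.integral_const_mul, p0, q0]
    ring
  -- Integration by parts over a full period replaces base·(coefficients of p) by coefficients of
  -- p', cosine becoming sine and conversely with the factor 2κ = √3·base.
  obtain ⟨t1, t2⟩ := h.coeffs.prim_p.integral_trig (2 * freq n) one_mem01
  have hs1 : Complex.sin ((2 * freq n : ℝ) * (1 : ℝ)) = 0 := by
    push_cast; rw [mul_one, Complex.sin_two_mul, csin_freq]; ring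
  have hc1 : Complex.cos ((2 * freq n : ℝ) * (1 : ℝ)) = 1 := by
    push_cast; rw [mul_one, Complex.cos_two_mul, ccos_freq_sq]; norm_num
  rw [hs1, zero_mul] at t1
  rw [hc1, one_mul, h.coeffs.per_p, sub_self] at t2
  have hkz : ((2 * freq n : ℝ) : ℂ) = (Real.sqrt 3 : ℝ) * base n := by
    rw [sqrt3_base_cast]; push_cast; ring
  have hmain : base n * H +
      (∫ x in (0 : ℝ)..1, Complex.sin ((2 * freq n : ℝ) * x) * dp x) / (Real.sqrt 3 : ℝ) +
      (∫ x in (0 : ℝ)..1, Complex.cos ((2 * freq n : ℝ) * x) * q x) -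
      (∫ x in (0 : ℝ)..1, Complex.cos ((2 * freq n : ℝ) * x) * dp x) / 3 +
      (∫ x in (0 : ℝ)..1, Complex.sin ((2 * freq n : ℝ) * x) * q x) / (Real.sqrt 3 : ℝ) =
      -(4 * base n * (total D + total (linV e R X * s * φ))) := by
    rw [hlin] at hd
    set cp := ∫ x in (0 : ℝ)..1, Complex.cos ((2 * freq n : ℝ) * x) * p x
    set sp := ∫ x in (0 : ℝ)..1, Complex.sin ((2 * freq n : ℝ) * x) * p x
    set cq := ∫ x in (0 : ℝ)..1, Complex.cos ((2 * freq n : ℝ) * x) * q x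
    set sq := ∫ x in (0 : ℝ)..1, Complex.sin ((2 * freq n : ℝ) * x) * q x
    set cd := ∫ x in (0 : ℝ)..1, Complex.cos ((2 * freq n : ℝ) * x) * dp x
    set sd := ∫ x in (0 : ℝ)..1, Complex.sin ((2 * freq n : ℝ) * x) * dp x
    rw [hkz] at t1 t2
    have hsd : sd = -(((Real.sqrt 3 : ℝ) : ℂ) * base n * cp) := by linear_combination t1
    have hcd : cd = ((Real.sqrt 3 : ℝ) : ℂ) * base n * sp := by linear_combination t2
    have ht2 := sqrt3_sq
    have htne := sqrt3_ne
    rw [hsd, hcd]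
    set t := ((Real.sqrt 3 : ℝ) : ℂ)
    have e7 : t⁻¹ = t / 3 := by rw [← ht2]; field_simp
    set z := (base n : ℂ)
    have hd4 : z * H = -cq - sq / t + z * (cp + sp / t) - 4 * z * (total D +
        total (linV e R X * s * φ)) := by
      have e8 : z * H = 4 * z * ((z ^ 3 + z * H - z ^ 3) * (4 * z)⁻¹) := by field_simp; ring
      rw [e8, hd]
      field_simp
    rw [hd4]
    simp only [div_eq_mul_inv, e7]
    ring_nf
    simp only [ht2]
    ring
  rw [hmain, norm_neg, norm_mul, norm_mul, norm_base hn]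
  norm_num only [RCLike.norm_ofNat]
  have hlast := h.norm_total_linV_mul_le he hdp hq
  -- One factor 1/base stands in front of R, another comes from g₀ or from the coefficient of f·sin.
  have hDn : base n ^ 2 * ‖D‖ ≤ 2 * 10 ^ 8 * N ^ 2 := by
    have hi : ‖(base n : ℂ)⁻¹‖ = (base n)⁻¹ := by rw [norm_inv, norm_base hn]
    have hi1 : (base n)⁻¹ ≤ 1 := inv_le_one_of_one_le₀ (by linarith)
    have hi0 : 0 ≤ (base n)⁻¹ := by positivity
    have hR := h.norm_R
    have hX := h.norm_X
    have q1 : ‖(base n : ℂ)⁻¹ • R‖ ≤ (base n)⁻¹ * (4400 * ‖e‖) := by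
      rw [norm_smul, hi]; gcongr
    have q2 : ‖R * R‖ ≤ 4400 * ‖e‖ := by
      have : ‖R‖ ≤ 1 := by linarith
      exact (norm_mul_le _ _).trans ((mul_le_of_le_one_left (norm_nonneg _) this).trans hR)
    have q3 : ‖(3 : ℂ) • X - (3 : ℂ) • R - ((base n : ℂ) ^ 2)⁻¹ • (R * R) - (2 : ℂ) • e.1‖ ≤
        30802 * ‖e‖ := by
      have k1 := norm_sub_le ((3 : ℂ) • X - (3 : ℂ) • R - ((base n : ℂ) ^ 2)⁻¹ • (R * R))
        ((2 : ℂ) • e.1)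
      have k2 := norm_sub_le ((3 : ℂ) • X - (3 : ℂ) • R) (((base n : ℂ) ^ 2)⁻¹ • (R * R))
      have k3 := norm_sub_le ((3 : ℂ) • X) ((3 : ℂ) • R)
      have k4 : ‖((base n : ℂ) ^ 2)⁻¹ • (R * R)‖ ≤ 4400 * ‖e‖ := by
        rw [norm_smul, norm_inv, norm_pow, norm_base hn]
        exact (mul_le_of_le_one_left (norm_nonneg _) (inv_le_one_of_one_le₀ (by nlinarith))).trans q2
      rw [norm_smul, norm_smul] at k3
      rw [norm_smul (2 : ℂ)] at k1
      norm_num at k1 k3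
      linarith [norm_fst_le e]
    have q4 : ‖gZero n‖ ≤ 3 / 4 * (base n)⁻¹ := by
      rw [← div_eq_mul_inv, le_div_iff₀ (by linarith)]
      linarith [norm_gZero_le hn]
    have q5 : ‖R * (s + φ) * s‖ ≤ 4400 * ‖e‖ * 2 := by
      refine (norm_mul_le _ _).trans ((mul_le_of_le_one_right (norm_nonneg _)
        (norm_sinC_le _)).trans ?_)
      exact (norm_mul_le _ _).trans (mul_le_mul hR h.norm_f (norm_nonneg _) (by positivity))
    have q6 : ‖(3 / 4 * (base n : ℂ)⁻¹) • (R * (s + φ) * s)‖ ≤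
        3 / 4 * (base n)⁻¹ * (4400 * ‖e‖ * 2) := by
      rw [norm_smul, norm_mul, hi]
      norm_num only [norm_div, RCLike.norm_ofNat]
      gcongr
    have q7 := norm_add_le_of_le ((norm_mul_le _ _).trans (mul_le_mul q4 q3 (norm_nonneg _)
      (by positivity))) q6
    have q8 := (norm_mul_le _ _).trans (mul_le_mul q1 q7 (norm_nonneg _) (by positivity))
    rw [← hD] at q8
    calc base n ^ 2 * ‖D‖ ≤ _ := mul_le_mul_of_nonneg_left q8 (by positivity)
      _ = 4400 * (3 / 4 * 30802 + 6600) * ‖e‖ ^ 2 := by field_simp; ring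
      _ ≤ 2 * 10 ^ 8 * N ^ 2 := by nlinarith [pow_le_pow_left₀ hν he 2, sq_nonneg N]
  have r1 : ‖total D + total (linV e R X * s * φ)‖ ≤ ‖D‖ + ‖total (linV e R X * s * φ)‖ :=
    (norm_add_le _ _).trans (add_le_add_left (norm_total_le D) _)
  calc _ ≤ base n * (4 * base n * (‖D‖ + ‖total (linV e R X * s * φ)‖)) := by gcongr
    _ = 4 * (base n ^ 2 * ‖D‖ + base n ^ 2 * ‖total (linV e R X * s * φ)‖) := by ring
    _ ≤ _ := by nlinarith

end Mode

/-! ### Solutions on two periods -/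

/-- On `[0, 2]`, the function `f` is a primitive of `f'`. -/
def Prim₂ (f f' : ℝ → ℂ) : Prop :=
  IntervalIntegrable f' volume 0 2 ∧ ∀ x ∈ Icc (0 : ℝ) 2, f x = f 0 + ∫ t in (0 : ℝ)..x, f' t

lemma Icc01_subset : Icc (0 : ℝ) 1 ⊆ Icc 0 2 := Icc_subset_Icc le_rfl (by norm_num)

lemma add_one_mem {x : ℝ} (hx : x ∈ Icc (0 : ℝ) 1) : x + 1 ∈ Icc (0 : ℝ) 2 :=
  ⟨by linarith [hx.1], by linarith [hx.2]⟩

namespace Prim₂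

variable {f f' : ℝ → ℂ}

lemma mono (h : IntervalIntegrable f' volume 0 2) {x y : ℝ} (hx : x ∈ Icc (0 : ℝ) 2)
    (hy : y ∈ Icc (0 : ℝ) 2) : IntervalIntegrable f' volume x y :=
  h.mono_set (by
    rw [uIcc_of_le (by norm_num : (0 : ℝ) ≤ 2)]
    exact uIcc_subset_Icc hx hy)

lemma continuousOn (h : Prim₂ f f') : ContinuousOn f (Icc 0 2) := by
  have h2 : (0 : ℝ) ≤ 2 := by norm_num
  have h1 : ContinuousOn (fun x => f 0 + ∫ t in (0 : ℝ)..x, f' t) (Icc 0 2) := by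
    have := intervalIntegral.continuousOn_primitive_interval (a := 0) (b := 2) (f := f')
      (μ := volume) (by
        rw [uIcc_of_le h2, integrableOn_Icc_iff_integrableOn_Ioc]
        exact (intervalIntegrable_iff_integrableOn_Ioc_of_le h2).1 h.1)
    rw [uIcc_of_le h2] at this
    exact continuousOn_const.add this
  exact h1.congr h.2

lemma left (h : Prim₂ f f') : Prim f f' :=
  ⟨mono h.1 ⟨le_rfl, by norm_num⟩ ⟨by norm_num, by norm_num⟩, fun x hx => h.2 x (Icc01_subset hx)⟩

lemma right (h : Prim₂ f f') : Prim (fun x => f (x + 1)) (fun x => f' (x + 1)) := by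
  have h0 : (0 : ℝ) ∈ Icc (0 : ℝ) 2 := ⟨le_rfl, by norm_num⟩
  have h1 : (1 : ℝ) ∈ Icc (0 : ℝ) 2 := ⟨by norm_num, by norm_num⟩
  refine ⟨?_, fun x hx => ?_⟩
  · have := (mono h.1 h1 (y := 2) ⟨by norm_num, le_rfl⟩).comp_add_right 1
    norm_num at this
    exact this
  · have hx' := add_one_mem hx
    beta_reduce
    rw [intervalIntegral.integral_comp_add_right (fun t => f' t) 1, zero_add, h.2 _ hx', h.2 1 h1,
      add_assoc, intervalIntegral.integral_add_adjacent_intervals (mono h.1 h0 h1)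
        (mono h.1 h1 hx')]

lemma of_left_right (hl : Prim f f') (hr : Prim (fun x => f (x + 1)) (fun x => f' (x + 1))) :
    Prim₂ f f' := by
  have i2 : IntervalIntegrable f' volume 1 2 := by
    have := hr.1.comp_add_right (-1)
    norm_num at this
    exact this
  have hi : IntervalIntegrable f' volume 0 2 := hl.1.trans i2
  refine ⟨hi, fun x hx => ?_⟩
  rcases le_or_gt x 1 with h | h
  · exact hl.2 x ⟨hx.1, h⟩
  · have hx' : x - 1 ∈ Icc (0 : ℝ) 1 := ⟨by linarith, by linarith [hx.2]⟩
    have k := hr.2 _ hx'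
    beta_reduce at k
    rw [intervalIntegral.integral_comp_add_right (fun t => f' t) 1, sub_add_cancel, zero_add,
      hl.2 1 one_mem01, add_assoc, intervalIntegral.integral_add_adjacent_intervals hl.1
        (mono hi ⟨by norm_num, by norm_num⟩ hx)] at k
    exact k

end Prim₂

/-- The function equal to `f` on `[0, 1]` and to `g(x - 1)` on `[1, 2]`. -/
def glue (f g : ℝ → ℂ) (x : ℝ) : ℂ := if x ≤ 1 then f x else g (x - 1)

lemma glue_left (f g : ℝ → ℂ) {x : ℝ} (hx : x ∈ Icc (0 : ℝ) 1) : glue f g x = f x := if_pos hx.2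

lemma glue_right {f g : ℝ → ℂ} (h : f 1 = g 0) {x : ℝ} (hx : x ∈ Icc (0 : ℝ) 1) :
    glue f g (x + 1) = g x := by
  rcases hx.1.eq_or_lt with h0 | h0
  · rw [← h0, zero_add, glue_left f g one_mem01, h]
  · rw [glue, if_neg (by linarith), add_sub_cancel_right]

lemma onLine_add_one (f : MeanZero) (x : ℝ) : onLine f (x + 1) = onLine f x := by
  rw [onLine, onLine, AddCircle.coe_add_period]

lemma intervalIntegrable_onLine₂ (f : MeanZero) : IntervalIntegrable (onLine f) volume 0 2 := by
  have h1 := intervalIntegrable_onLine f (x := 1) ⟨by norm_num, le_rfl⟩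
  have h2 := h1.comp_add_right (-1)
  norm_num at h2
  refine h1.trans (h2.congr fun x _ => ?_)
  have := onLine_add_one f (x + -1)
  rw [neg_add_cancel_right] at this
  exact this.symm

section

variable {ψ : Coeff} {p : ℝ → ℂ}

/-- A solution of the equation on `[0, 2]` gives a pair of solutions on `[0, 1]`. -/
theorem OpEq.exists_pair (hp : ∀ᵐ x ∂(volume.restrict (Ioc (0 : ℝ) 1)), ψ.p x = p x)
    {y F : ℝ → ℂ} {l : ℂ} (hF : ContinuousOn F (Icc 0 2))
    (h : OpEq ψ y (fun x => l * y x + F x)) :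
    ∃ v w : ℝ → ℂ, Pair p ψ.q l F (fun x => F (x + 1)) y v w (fun x => y (x + 1))
      (fun x => v (x + 1)) (fun x => w (x + 1)) := by
  obtain ⟨-, v, w, cy, cv, cw, hy, hv, hw, y0, y1, y2⟩ := h
  have u2 : uIcc (0 : ℝ) 2 = Icc 0 2 := uIcc_of_le (by norm_num)
  have ip : IntervalIntegrable ψ.p volume 0 2 := intervalIntegrable_onLine₂ _
  have iq : IntervalIntegrable ψ.q volume 0 2 := intervalIntegrable_onLine₂ _
  have ic : ∀ {f : ℝ → ℂ}, ContinuousOn f (Icc 0 2) → IntervalIntegrable f volume 0 2 :=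
    fun hf => ContinuousOn.intervalIntegrable (by rwa [u2])
  have Py : Prim₂ y v := ⟨ic cv, hy⟩
  have Pv : Prim₂ v (fun t => w t - ψ.p t * y t) :=
    ⟨(ic cw).sub (ip.mul_continuousOn (by rwa [u2])), hv⟩
  have Pw : Prim₂ w (fun t => l * y t + F t - ψ.p t * v t - ψ.q t * y t) :=
    ⟨((ic ((continuousOn_const.mul cy).add hF)).sub (ip.mul_continuousOn (by rwa [u2]))).sub
      (iq.mul_continuousOn (by rwa [u2])), hw⟩
  have pp : ∀ x, ψ.p (x + 1) = ψ.p x := fun x => onLine_add_one _ x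
  have pq : ∀ x, ψ.q (x + 1) = ψ.q x := fun x => onLine_add_one _ x
  refine ⟨v, w, ⟨Py.left, Pv.left.congr_ae (fun _ _ => rfl) ?_, Pw.left.congr_ae (fun _ _ => rfl) ?_⟩,
    ⟨Py.right, Pv.right.congr_ae (fun _ _ => rfl) ?_, Pw.right.congr_ae (fun _ _ => rfl) ?_⟩,
    y0, y1, by simpa using y1, by norm_num; exact y2, by simp, by simp⟩
  · filter_upwards [hp] with x hx
    rw [hx]
  · filter_upwards [hp] with x hx
    rw [hx]; ring
  · filter_upwards [hp] with x hx
    rw [pp, hx]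
  · filter_upwards [hp] with x hx
    rw [pp, pq, hx]; ring

/-- A pair of solutions on `[0, 1]` gives a solution of the equation on `[0, 2]`. -/
theorem Pair.opEq (hp : ∀ᵐ x ∂(volume.restrict (Ioc (0 : ℝ) 1)), ψ.p x = p x)
    {y₁ v₁ w₁ y₂ v₂ w₂ : ℝ → ℂ} {l : ℂ}
    (h : Pair p ψ.q l (fun _ => 0) (fun _ => 0) y₁ v₁ w₁ y₂ v₂ w₂) :
    OpEq ψ (glue y₁ y₂) (fun x => l * glue y₁ y₂ x) := by
  have my : y₁ 1 = y₂ 0 := by rw [h.y₁_one, h.y₂_zero]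
  have pp : ∀ x, ψ.p (x + 1) = ψ.p x := fun x => onLine_add_one _ x
  have pq : ∀ x, ψ.q (x + 1) = ψ.q x := fun x => onLine_add_one _ x
  have Py : Prim₂ (glue y₁ y₂) (glue v₁ v₂) := Prim₂.of_left_right
    (h.fst.prim_y.congr (fun x hx => glue_left _ _ hx) (fun x hx => glue_left _ _ hx))
    (h.snd.prim_y.congr (fun x hx => glue_right my hx) (fun x hx => glue_right h.match_v hx))
  have Pv : Prim₂ (glue v₁ v₂) (fun t => glue w₁ w₂ t - ψ.p t * glue y₁ y₂ t) := by
    refine Prim₂.of_left_right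
      (h.fst.prim_v.congr_ae (fun x hx => glue_left _ _ hx) ?_)
      (h.snd.prim_v.congr_ae (fun x hx => glue_right h.match_v hx) ?_)
    · filter_upwards [hp, ae_restrict_mem measurableSet_Ioc] with x hx hm
      have hm' := Ioc_subset_Icc_self hm
      rw [glue_left _ _ hm', glue_left _ _ hm', hx]
    · filter_upwards [hp, ae_restrict_mem measurableSet_Ioc] with x hx hm
      have hm' := Ioc_subset_Icc_self hm
      rw [glue_right h.match_w hm', glue_right my hm', pp, hx]
  have Pw : Prim₂ (glue w₁ w₂) (fun t => l * glue y₁ y₂ t - ψ.p t * glue v₁ v₂ t -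
      ψ.q t * glue y₁ y₂ t) := by
    refine Prim₂.of_left_right
      (h.fst.prim_w.congr_ae (fun x hx => glue_left _ _ hx) ?_)
      (h.snd.prim_w.congr_ae (fun x hx => glue_right h.match_w hx) ?_)
    · filter_upwards [hp, ae_restrict_mem measurableSet_Ioc] with x hx hm
      have hm' := Ioc_subset_Icc_self hm
      rw [glue_left _ _ hm', glue_left _ _ hm', hx]; ring
    · filter_upwards [hp, ae_restrict_mem measurableSet_Ioc] with x hx hm
      have hm' := Ioc_subset_Icc_self hm
      rw [glue_right h.match_v hm', glue_right my hm', pp, pq, hx]; ring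
  refine ⟨?_, _, _, Py.continuousOn, Pv.continuousOn, Pw.continuousOn, Py.2, Pv.2, Pw.2, ?_, ?_, ?_⟩
  · have hc : ContinuousOn (fun x => l * glue y₁ y₂ x) (Icc 0 2) :=
      continuousOn_const.mul Py.continuousOn
    obtain ⟨K, hK⟩ := isCompact_Icc.exists_bound_of_continuousOn hc
    exact MemLp.of_bound ((hc.mono Ioc_subset_Icc_self).aestronglyMeasurable measurableSet_Ioc) K
      (ae_restrict_of_forall_mem measurableSet_Ioc fun x hx => hK x (Ioc_subset_Icc_self hx))
  · rw [glue_left _ _ zero_mem01, h.y₁_zero]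
  · rw [glue_left _ _ one_mem01, h.y₁_one]
  · have := glue_right my one_mem01
    rw [h.y₂_one] at this
    rw [← this]; norm_num

lemma IsEigenvalue.exists_pair (hp : ∀ᵐ x ∂(volume.restrict (Ioc (0 : ℝ) 1)), ψ.p x = p x) {l : ℂ}
    (h : IsEigenvalue ψ l) : ∃ y₁ v₁ w₁ y₂ v₂ w₂ : ℝ → ℂ,
      Pair p ψ.q l (fun _ => 0) (fun _ => 0) y₁ v₁ w₁ y₂ v₂ w₂ ∧
      ∃ x ∈ Icc (0 : ℝ) 1, y₁ x ≠ 0 ∨ y₂ x ≠ 0 := by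
  obtain ⟨y, hy, x, hx, hne⟩ := h
  obtain ⟨v, w, hP⟩ := OpEq.exists_pair hp (F := fun _ => 0) (l := l) continuousOn_const
    (by simpa using hy)
  refine ⟨_, _, _, _, _, _, hP, ?_⟩
  rcases le_or_gt x 1 with h1 | h1
  · exact ⟨x, ⟨hx.1, h1⟩, Or.inl hne⟩
  · exact ⟨x - 1, ⟨by linarith, by linarith [hx.2]⟩, Or.inr (by rwa [sub_add_cancel])⟩

lemma Triple.congr_source {p q : ℝ → ℂ} {l : ℂ} {F G y v w : ℝ → ℂ} (h : Triple p q l F y v w)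
    (hFG : ∀ x ∈ Icc (0 : ℝ) 1, F x = G x) : Triple p q l G y v w :=
  ⟨h.prim_y, h.prim_v, h.prim_w.congr (fun _ _ => rfl) (fun x hx => by rw [hFG x hx])⟩

theorem IsSimplePair.isSimpleEigenvalue
    (hp : ∀ᵐ x ∂(volume.restrict (Ioc (0 : ℝ) 1)), ψ.p x = p x) {l : ℂ}
    (h : IsSimplePair p ψ.q l) : IsSimpleEigenvalue ψ l := by
  obtain ⟨y, v, w, y₂, v₂, w₂, hP, ⟨x, hx, hne⟩, hs, hn⟩ := h
  have my : y 1 = y₂ 0 := by rw [hP.y₁_one, hP.y₂_zero]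
  have hO := hP.opEq hp
  refine ⟨glue y y₂, ⟨hO, ?_⟩, fun u hu => ?_, fun u hu => ?_⟩
  · rcases hne with hne | hne
    · exact ⟨x, Icc01_subset hx, by rwa [glue_left _ _ hx]⟩
    · exact ⟨x + 1, add_one_mem hx, by rwa [glue_right my hx]⟩
  · obtain ⟨v', w', hP'⟩ := OpEq.exists_pair hp (F := fun _ => 0) (l := l) continuousOn_const
      (by simpa using hu)
    obtain ⟨k, hk⟩ := hs _ _ _ _ _ _ hP'
    refine ⟨k, fun x hx => ?_⟩
    rcases le_or_gt x 1 with h1 | h1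
    · have hx' : x ∈ Icc (0 : ℝ) 1 := ⟨hx.1, h1⟩
      rw [glue_left _ _ hx', (hk x hx').1]
    · have hx' : x - 1 ∈ Icc (0 : ℝ) 1 := ⟨by linarith, by linarith [hx.2]⟩
      have := (hk _ hx').2
      rw [sub_add_cancel] at this
      rw [this, ← glue_right my hx', sub_add_cancel]
  · obtain ⟨-, v', w', hc, -⟩ := hO
    obtain ⟨v'', w'', hP'⟩ := OpEq.exists_pair hp (l := l) hc hu
    exact hn _ _ _ _ _ _ ⟨hP'.fst.congr_source fun x hx => glue_left _ _ hx,
      hP'.snd.congr_source fun x hx => glue_right my hx, hP'.y₁_zero, hP'.y₁_one, hP'.y₂_zero,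
      hP'.y₂_one, hP'.match_v, hP'.match_w⟩

lemma IsSimpleEigenvalue.isEigenvalue {l : ℂ} (h : IsSimpleEigenvalue ψ l) : IsEigenvalue ψ l := by
  obtain ⟨y, hy, -⟩ := h
  exact ⟨y, hy⟩

end

/-! ### Reflection -/

lemma Triple.reflect {p q : ℝ → ℂ} {l : ℂ} {F y v w : ℝ → ℂ} (h : Triple p q l F y v w) :
    Triple (fun x => p (1 - x)) (fun x => -q (1 - x)) (-l) (fun x => -F (1 - x))
      (fun x => y (1 - x)) (fun x => -v (1 - x)) (fun x => w (1 - x)) :=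
  ⟨h.prim_y.reflect, h.prim_v.reflect.neg.congr (fun _ _ => rfl) (fun _ _ => by ring),
    h.prim_w.reflect.congr (fun _ _ => rfl) (fun _ _ => by ring)⟩

/-- Under x ↦ 2 − x the two periods are exchanged and each is reversed. The odd order terms change
sign, so p is kept while q and λ change sign; this carries the left half plane to the right one. -/
lemma Pair.reflect {p q : ℝ → ℂ} {l : ℂ} {F₁ F₂ y₁ v₁ w₁ y₂ v₂ w₂ : ℝ → ℂ}
    (h : Pair p q l F₁ F₂ y₁ v₁ w₁ y₂ v₂ w₂) :
    Pair (fun x => p (1 - x)) (fun x => -q (1 - x)) (-l) (fun x => -F₂ (1 - x))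
      (fun x => -F₁ (1 - x)) (fun x => y₂ (1 - x)) (fun x => -v₂ (1 - x)) (fun x => w₂ (1 - x))
      (fun x => y₁ (1 - x)) (fun x => -v₁ (1 - x)) (fun x => w₁ (1 - x)) :=
  ⟨h.snd.reflect, h.fst.reflect, by simp [h.y₂_one], by simp [h.y₂_zero], by simp [h.y₁_one],
    by simp [h.y₁_zero], by simp [h.match_v], by simp [h.match_w]⟩

lemma Pair.reflect_zero {p q : ℝ → ℂ} {l : ℂ} {y₁ v₁ w₁ y₂ v₂ w₂ : ℝ → ℂ}
    (h : Pair p q l (fun _ => 0) (fun _ => 0) y₁ v₁ w₁ y₂ v₂ w₂) :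
    Pair (fun x => p (1 - x)) (fun x => -q (1 - x)) (-l) (fun _ => 0) (fun _ => 0)
      (fun x => y₂ (1 - x)) (fun x => -v₂ (1 - x)) (fun x => w₂ (1 - x))
      (fun x => y₁ (1 - x)) (fun x => -v₁ (1 - x)) (fun x => w₁ (1 - x)) := by
  have := h.reflect
  simp only [neg_zero] at this
  exact this

lemma IsSimplePair.reflect {p q : ℝ → ℂ} {l : ℂ} (h : IsSimplePair p q l) :
    IsSimplePair (fun x => p (1 - x)) (fun x => -q (1 - x)) (-l) := by
  obtain ⟨y, v, w, y₂, v₂, w₂, hP, ⟨x, hx, hne⟩, hs, hn⟩ := h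
  refine ⟨_, _, _, _, _, _, hP.reflect_zero, ⟨1 - x, reflect_mem01 hx, ?_⟩,
    fun a b c a₂ b₂ c₂ hA => ?_, fun a b c a₂ b₂ c₂ hA => ?_⟩
  · simp only [sub_sub_cancel]; exact hne.symm
  · have h1 := hA.reflect_zero
    simp only [sub_sub_cancel, neg_neg] at h1
    obtain ⟨k, hk⟩ := hs _ _ _ _ _ _ h1
    refine ⟨k, fun x hx => ?_⟩
    have := hk _ (reflect_mem01 hx)
    simp only [sub_sub_cancel] at this
    exact ⟨this.2, this.1⟩
  · have h1 := hA.reflect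
    simp only [sub_sub_cancel, neg_neg] at h1
    have e1 : ∀ {F y v w : ℝ → ℂ}, Triple p q l (fun x => -F x) y v w →
        Triple p q l F (fun x => -y x) (fun x => -v x) (fun x => -w x) := fun hT =>
      ⟨hT.prim_y.neg, hT.prim_v.neg.congr (fun _ _ => rfl) (fun _ _ => by ring),
        hT.prim_w.neg.congr (fun _ _ => rfl) (fun _ _ => by ring)⟩
    exact hn _ _ _ _ _ _ ⟨e1 h1.fst, e1 h1.snd, by simpa using h1.y₁_zero,
      by simpa using h1.y₁_one, by simpa using h1.y₂_zero, by simpa using h1.y₂_one,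
      by simpa using h1.match_v, by simpa using h1.match_w⟩

/-! ### The coefficients as continuous functions -/

lemma integral_onLine (f : MeanZero) : ∫ x in (0 : ℝ)..1, onLine f x = 0 := by
  have := UnitAddCircle.intervalIntegral_preimage 0 (fun x => (f : CircleL2) x)
  rw [zero_add] at this
  exact this.trans f.2

lemma intervalIntegrable_onLine01 (f : MeanZero) : IntervalIntegrable (onLine f) volume 0 1 :=
  intervalIntegrable_onLine f ⟨zero_lt_one, le_rfl⟩

lemma integral_norm_onLine_le (f : MeanZero) : ∫ x in (0 : ℝ)..1, ‖onLine f x‖ ≤ ‖f‖ := by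
  have h := UnitAddCircle.intervalIntegral_preimage 0 (fun x => ‖(f : CircleL2) x‖)
  rw [zero_add] at h
  have hprob : IsProbabilityMeasure (volume : Measure UnitAddCircle) := ⟨UnitAddCircle.measure_univ⟩
  have h1 : ∫ x, ‖(f : CircleL2) x‖ = (eLpNorm (f : CircleL2) 1 volume).toReal := by
    rw [eLpNorm_one_eq_lintegral_enorm, integral_norm_eq_lintegral_enorm
      (Lp.aestronglyMeasurable _)]
  have h2 : (eLpNorm (f : CircleL2) 1 volume).toReal ≤ (eLpNorm (f : CircleL2) 2 volume).toReal :=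
    ENNReal.toReal_mono (Lp.memLp (f : CircleL2)).2.ne
      (eLpNorm_le_eLpNorm_of_exponent_le (by norm_num) (Lp.aestronglyMeasurable _))
  refine (h.trans h1).le.trans (h2.trans ?_)
  rw [← Lp.norm_def]
  rfl

/-- The primitive of a function in `L²`. -/
def primL : MeanZero →L[ℂ] Cont :=
  LinearMap.mkContinuous
    { toFun := fun f => toCont (fun x => 0 + ∫ t in (0 : ℝ)..x, onLine f t)
        (Prim.of_integral (intervalIntegrable_onLine01 f) 0).continuousOn
      map_add' := fun f g => by
        refine cont_ext fun x hx => ?_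
        rw [ext_add, ext_toCont _ hx, ext_toCont _ hx, ext_toCont _ hx,
          integral_congr01_ae zero_mem01 hx (onLine_add_ae f g), intervalIntegral.integral_add
          ((intervalIntegrable_onLine01 f).sub01 zero_mem01 hx)
          ((intervalIntegrable_onLine01 g).sub01 zero_mem01 hx)]
        ring
      map_smul' := fun c f => by
        refine cont_ext fun x hx => ?_
        rw [RingHom.id_apply, ext_smul, ext_toCont _ hx, ext_toCont _ hx,
          integral_congr01_ae zero_mem01 hx (onLine_smul_ae c f),
          intervalIntegral.integral_const_mul]
        ring } 1 (fun f => by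
    rw [one_mul]
    refine norm_cont_le (norm_nonneg f) fun x hx => ?_
    refine (congrArg norm (ext_toCont _ hx)).le.trans ?_
    have := norm_integral_mul_le (σ := fun _ => 1) (fun _ => norm_one.le)
      (intervalIntegrable_onLine01 f) hx
    simp only [one_mul] at this
    rw [zero_add]
    exact this.trans (integral_norm_onLine_le f))

lemma norm_primL_le (f : MeanZero) : ‖primL f‖ ≤ ‖f‖ := by
  have := primL.le_of_opNorm_le (LinearMap.mkContinuous_norm_le _ zero_le_one _) f
  rwa [one_mul] at this

lemma prim_primL (f : MeanZero) : Prim (ext (primL f)) (onLine f) :=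
  (Prim.of_integral (intervalIntegrable_onLine01 f) 0).congr (fun _ hx => ext_toCont _ hx)
    (fun _ _ => rfl)

lemma primL_per (f : MeanZero) : ext (primL f) 0 = ext (primL f) 1 := by
  have := (prim_primL f).integral
  rw [integral_onLine] at this
  exact (sub_eq_zero.1 this.symm).symm

/-- The derivative as a continuous linear map. -/
def derivL : H1 →L[ℂ] MeanZero := LinearMap.mkContinuous H1.deriv 1 fun f => by
  rw [one_mul]; exact le_rfl

/-- The continuous version of `p`, and `p` minus a primitive of `q`. -/
def contCoeff : Coeff →L[ℂ] Cont × Cont :=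
  -- The primitive of p' is determined up to a constant, which is fixed by the zero mean of p. In
  -- this form P is visibly linear and bounded.
  let P : Coeff →L[ℂ] Cont :=
    (ContinuousLinearMap.id ℂ Cont - total.smulRight (1 : Cont)).comp
      (primL.comp (derivL.comp (WithLp.fstL 2 ℂ H1 MeanZero)))
  P.prod (P - primL.comp (WithLp.sndL 2 ℂ H1 MeanZero))

lemma contCoeff_fst (ψ : Coeff) : (contCoeff ψ).1 =
    primL (H1.deriv ψ.fst) - total (primL (H1.deriv ψ.fst)) • (1 : Cont) := rfl

lemma contCoeff_snd (ψ : Coeff) : (contCoeff ψ).2 = (contCoeff ψ).1 - primL ψ.snd := rfl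

lemma norm_deriv_le (ψ : Coeff) : ‖H1.deriv ψ.fst‖ ≤ ‖ψ‖ := WithLp.norm_fst_le (p := 2) _ ψ

lemma norm_snd_coeff_le (ψ : Coeff) : ‖ψ.snd‖ ≤ ‖ψ‖ := WithLp.norm_snd_le (p := 2) _ ψ

lemma norm_contCoeff_le (ψ : Coeff) : ‖contCoeff ψ‖ ≤ 3 * ‖ψ‖ := by
  have h1 : ‖(contCoeff ψ).1‖ ≤ 2 * ‖ψ‖ := by
    rw [contCoeff_fst]
    have k1 := (norm_primL_le (H1.deriv ψ.fst)).trans (norm_deriv_le ψ)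
    have k2 := norm_total_le (primL (H1.deriv ψ.fst))
    have k3 := norm_sub_le (primL (H1.deriv ψ.fst)) (total (primL (H1.deriv ψ.fst)) • (1 : Cont))
    rw [norm_smul, norm_one, mul_one] at k3
    linarith
  rw [Prod.norm_def]
  refine max_le (by linarith [norm_nonneg ψ]) ?_
  rw [contCoeff_snd]
  linarith [norm_sub_le (contCoeff ψ).1 (primL ψ.snd), (norm_primL_le ψ.snd).trans
    (norm_snd_coeff_le ψ)]

/-- The continuous version of `p`. -/
def contP (ψ : Coeff) : ℝ → ℂ := ext (contCoeff ψ).1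

lemma prim_contP (ψ : Coeff) : Prim (contP ψ) ψ.dp :=
  ((prim_primL (H1.deriv ψ.fst)).sub (Prim.const _)).congr (fun x _ => by
    rw [contP, contCoeff_fst, ext_sub, ext_smul, ext_one, mul_one]) (fun x _ => by
    rw [Coeff.dp, sub_zero])

lemma coeffs_contCoeff (ψ : Coeff) : Coeffs (contP ψ) ψ.dp ψ.q (contCoeff ψ) := by
  have hper : contP ψ 0 = contP ψ 1 := by
    simp only [contP, contCoeff_fst, ext_sub, ext_smul, ext_one, primL_per]
  refine ⟨prim_contP ψ, fun _ _ => rfl, ?_, hper, ?_⟩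
  · exact ((prim_contP ψ).sub (prim_primL ψ.snd)).congr (fun x _ => by
      rw [contCoeff_snd, ext_sub]; rfl) (fun _ _ => rfl)
  · rw [contCoeff_snd, ext_sub, ext_sub, primL_per]
    exact congrArg (· - _) hper

lemma integral_contP (ψ : Coeff) : ∫ x in (0 : ℝ)..1, contP ψ x = 0 := by
  rw [contP, ← total_apply, contCoeff_fst, map_sub, map_smul, total_apply 1]
  simp

lemma integral_q (ψ : Coeff) : ∫ x in (0 : ℝ)..1, ψ.q x = 0 := integral_onLine _

/-- An element of `H1` is almost everywhere a constant plus the primitive of its derivative, and the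
zero means identify the constant. -/
lemma p_ae_eq (ψ : Coeff) : ∀ᵐ x ∂(volume.restrict (Ioc (0 : ℝ) 1)), ψ.p x = contP ψ x := by
  obtain ⟨c, hc⟩ := ψ.fst.2
  have hc' : ∀ᵐ x ∂(volume.restrict (Ioc (0 : ℝ) 1)), ψ.p x = c + ext (primL (H1.deriv ψ.fst)) x := by
    filter_upwards [hc, ae_restrict_mem measurableSet_Ioc] with x hx hm
    refine Eq.trans hx ?_
    rw [show ext (primL (H1.deriv ψ.fst)) x = 0 + ∫ t in (0 : ℝ)..x, onLine (H1.deriv ψ.fst) t from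
      ext_toCont _ (Ioc_subset_Icc_self hm), zero_add]
    rfl
  have h0 : ∫ x in (0 : ℝ)..1, ψ.p x = 0 := integral_onLine _
  rw [integral_congr01_ae zero_mem01 one_mem01 hc', intervalIntegral.integral_add (by simp)
    (intervalIntegrable_ext _ _ _), ← total_apply] at h0
  simp only [intervalIntegral.integral_const, sub_zero, one_smul] at h0
  filter_upwards [hc'] with x hx
  rw [hx, contP, contCoeff_fst, ext_sub, ext_smul, ext_one, mul_one]
  linear_combination h0

lemma Prim.ae_eq_of_eq {f f' g' : ℝ → ℂ} (h : Prim f f') (h' : Prim f g') :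
    ∀ᵐ x ∂(volume.restrict (Ioc (0 : ℝ) 1)), f' x = g' x := by
  rw [ae_restrict_iff' measurableSet_Ioc]
  filter_upwards [h.ae_hasDerivAt, h'.ae_hasDerivAt, ae_ne_endpoints] with x h1 h2 h3 hm
  have hm' : x ∈ Ioo (0 : ℝ) 1 := ⟨hm.1, lt_of_le_of_ne hm.2 h3.2⟩
  exact (h1 hm').unique (h2 hm')

/-- Reality of p' is not part of `IsReal`. The continuous p equals its conjugate everywhere, and two
densities with the same primitive agree almost everywhere. -/
lemma Coeff.IsReal.realCoeffs {ψ : Coeff} (h : ψ.IsReal) : RealCoeffs (contP ψ) ψ.dp ψ.q := by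
  have hP : ∀ x ∈ Icc (0 : ℝ) 1, (starRingEnd ℂ) (contP ψ x) = contP ψ x := by
    have hae : (fun x => (starRingEnd ℂ) (contP ψ x)) =ᵐ[volume.restrict (Icc (0 : ℝ) 1)]
        contP ψ := by
      rw [← Measure.restrict_congr_set Ioc_ae_eq_Icc]
      filter_upwards [h, p_ae_eq ψ] with x h1 h2
      rw [← h2]
      exact Complex.conj_eq_iff_im.2 h1.1
    have hc := (prim_contP ψ).continuousOn
    exact fun x hx => Measure.eqOn_Icc_of_ae_eq volume zero_ne_one hae
      (Complex.continuous_conj.comp_continuousOn hc) hc hx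
  refine ⟨hP, ?_, ?_⟩
  · exact Prim.ae_eq_of_eq ((prim_contP ψ).conj.congr (fun x hx => (hP x hx).symm) (fun _ _ => rfl))
      (prim_contP ψ)
  · filter_upwards [h] with x hx
    exact Complex.conj_eq_iff_im.2 hx.2

/-! ### Reflected coefficients -/

/-- Reflection of continuous functions. -/
def flip : Cont →L[ℂ] Cont := LinearMap.mkContinuous
  { toFun := fun a => a.comp ⟨unitInterval.symm, unitInterval.continuous_symm⟩
    map_add' := fun _ _ => rfl
    map_smul' := fun _ _ => rfl } 1 (fun a => by
      rw [one_mul]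
      exact (ContinuousMap.norm_le _ (norm_nonneg a)).2 fun x => a.norm_coe_le_norm _)

lemma ext_flip (a : Cont) {x : ℝ} (hx : x ∈ Icc (0 : ℝ) 1) : ext (flip a) x = ext a (1 - x) := by
  rw [ext_apply _ hx, ext_apply _ (reflect_mem01 hx)]
  rfl

lemma norm_flip_le (a : Cont) : ‖flip a‖ ≤ ‖a‖ := norm_cont_le (norm_nonneg a) fun x hx => by
  rw [ext_flip _ hx]; exact norm_ext_le _ _

/-- The reflected coefficients. -/
def flipCoeff : Coeff →L[ℂ] Cont × Cont := (flip.prodMap flip).comp contCoeff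

lemma norm_flipCoeff_le (ψ : Coeff) : ‖flipCoeff ψ‖ ≤ 3 * ‖ψ‖ := by
  refine le_trans ?_ (norm_contCoeff_le ψ)
  rw [Prod.norm_def]
  exact max_le ((norm_flip_le _).trans (norm_fst_le _)) ((norm_flip_le _).trans (norm_snd_le _))

lemma coeffs_flipCoeff (ψ : Coeff) : Coeffs (fun x => contP ψ (1 - x)) (fun x => -ψ.dp (1 - x))
    (fun x => -ψ.q (1 - x)) (flipCoeff ψ) := by
  have h := coeffs_contCoeff ψ
  refine ⟨h.prim_p.reflect, fun x hx => ext_flip _ hx, h.prim_D.reflect.congr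
    (fun x hx => ext_flip _ hx) (fun x _ => by ring), by simp [h.per_p], ?_⟩
  rw [show (flipCoeff ψ).2 = flip (contCoeff ψ).2 from rfl, ext_flip _ zero_mem01,
    ext_flip _ one_mem01, sub_zero, sub_self, h.per_D]

lemma ae_reflect {P : ℝ → Prop} (h : ∀ᵐ x ∂(volume.restrict (Ioc (0 : ℝ) 1)), P x) :
    ∀ᵐ x ∂(volume.restrict (Ioc (0 : ℝ) 1)), P (1 - x) := by
  rw [ae_restrict_iff' measurableSet_Ioc] at h ⊢
  have h1 := (Measure.measurePreserving_sub_left (volume : Measure ℝ) 1).quasiMeasurePreserving.ae h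
  filter_upwards [h1, Prim.ae_ne_endpoints] with x hx hne hm
  exact hx ⟨by linarith [lt_of_le_of_ne hm.2 hne.2], by linarith [hm.1]⟩

lemma RealCoeffs.reflect {p dp q : ℝ → ℂ} (h : RealCoeffs p dp q) :
    RealCoeffs (fun x => p (1 - x)) (fun x => -dp (1 - x)) (fun x => -q (1 - x)) := by
  refine ⟨fun x hx => h.p _ (reflect_mem01 hx), ?_, ?_⟩
  · filter_upwards [ae_reflect h.dp] with x hx
    rw [map_neg, hx]
  · filter_upwards [ae_reflect h.q] with x hx
    rw [map_neg, hx]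

lemma integral_reflect {E : Type*} [NormedAddCommGroup E] [NormedSpace ℝ E] (f : ℝ → E) :
    ∫ x in (0 : ℝ)..1, f (1 - x) = ∫ x in (0 : ℝ)..1, f x := by
  rw [intervalIntegral.integral_comp_sub_left]; simp

/-! ### The domains containing the eigenvalues -/

/-- The numbers whose cube root is close to `base m`. -/
def near (m : ℕ) : Set ℂ := {l | ‖l ^ (1 / 3 : ℂ) - (base m : ℂ)‖ < 1}

lemma three_lt_base {m : ℕ} (hm : 1 ≤ m) : 3 < base m := by
  linarith [three_lt_freq hm, freq_le_base hm]

lemma nat_le_base (m : ℕ) : (m : ℝ) ≤ base m := by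
  rcases Nat.eq_zero_or_pos m with rfl | hm
  · simp [base, freq]
  · have h1 : (m : ℝ) ≤ freq m := by
      rw [freq]
      exact le_mul_of_one_le_left (Nat.cast_nonneg m) (by linarith [Real.pi_gt_three])
    exact h1.trans (freq_le_base hm)

lemma zo_natCast (m : ℕ) : zo m = base m := by
  rw [zo, base, freq, Int.cast_natCast, mul_assoc]

lemma zo_neg (n : ℤ) : zo (-n) = -zo n := by
  simp only [zo]; push_cast; ring

lemma mem_domD_natCast {m : ℕ} {l : ℂ} : l ∈ domD m ↔ l ∈ near m := by
  rw [domD, if_pos (Int.natCast_nonneg m), zo_natCast]; rfl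

lemma mem_domD_neg_natCast {m : ℕ} (hm : 1 ≤ m) {l : ℂ} : l ∈ domD (-m) ↔ -l ∈ near m := by
  rw [domD, if_neg (by omega), neg_neg, zo_natCast]; rfl

/-- Re w³ = Re w·((Re w)² − 3(Im w)²) with Re w > 2 and |Im w| < 1; so the domains for opposite
labels lie in opposite half planes. -/
lemma re_pos_of_mem_near {m : ℕ} (hm : 1 ≤ m) {l : ℂ} (h : l ∈ near m) : 0 < l.re := by
  set w := l ^ (1 / 3 : ℂ) with hw
  have hn : ‖w - base m‖ < 1 := h
  have h1 := (abs_lt.1 ((Complex.abs_re_le_norm _).trans_lt hn)).1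
  have h2 := (abs_lt.1 ((Complex.abs_im_le_norm _).trans_lt hn))
  rw [Complex.sub_re, Complex.ofReal_re] at h1
  rw [Complex.sub_im, Complex.ofReal_im, sub_zero] at h2
  have hb := three_lt_base hm
  have e1 : l.re = w.re * (w.re ^ 2 - 3 * w.im ^ 2) := by
    rw [← cube_cpow l, ← hw, pow_succ, pow_two]
    simp only [Complex.mul_re, Complex.mul_im]
    ring
  rw [e1]
  have h3 : w.im ^ 2 < 1 := by nlinarith
  exact mul_pos (by linarith) (by nlinarith)

/-- Distinct centres differ by some `base k` with k ≥ 1, which exceeds 3, so the unit discs are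
disjoint. -/
lemma eq_of_mem_near {m k : ℕ} {l : ℂ} (h : l ∈ near m) (h' : l ∈ near k) : m = k := by
  have key : ∀ {m k : ℕ}, l ∈ near m → l ∈ near k → ¬ m < k := by
    intro m k h h' hlt
    obtain ⟨j, rfl⟩ := Nat.exists_eq_add_of_lt hlt
    have h1 : ‖l ^ (1 / 3 : ℂ) - base m‖ < 1 := h
    have h2 : ‖l ^ (1 / 3 : ℂ) - base (m + j + 1)‖ < 1 := h'
    have e : (base (m + j + 1) : ℝ) = base m + base (j + 1) := by
      simp only [base, freq]; push_cast; ring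
    have h3 := three_lt_base (Nat.le_add_left 1 j)
    have h4 : ‖(base (j + 1) : ℂ)‖ < 2 := by
      have : (base (j + 1) : ℂ) =
          (l ^ (1 / 3 : ℂ) - base m) - (l ^ (1 / 3 : ℂ) - base (m + j + 1)) := by
        rw [e]; push_cast; ring
      rw [this]
      linarith [norm_sub_le (l ^ (1 / 3 : ℂ) - base m) (l ^ (1 / 3 : ℂ) - base (m + j + 1))]
    rw [norm_base (Nat.le_add_left 1 j)] at h4
    linarith
  exact le_antisymm (not_lt.1 (key h' h)) (not_lt.1 (key h h'))

/-- If w³ = z³ + zh with w in the sector, then (w − z)(w² + wz + z²) = zh, and the real part of the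
second factor is at least z². -/
lemma mem_near {m : ℕ} (hm : 1 ≤ m) {h : ℂ} (hh : ‖h‖ ≤ 1 / 10) :
    (base m : ℂ) ^ 3 + base m * h ∈ near m := by
  have hb := three_lt_base hm
  set z := base m with hz
  set l : ℂ := (z : ℂ) ^ 3 + z * h with hl
  have hre : 0 ≤ l.re := by
    have e : l.re = z ^ 3 + z * h.re := by
      rw [hl, Complex.add_re, ← Complex.ofReal_pow, Complex.ofReal_re, Complex.re_ofReal_mul]
    have h1 := (abs_le.1 ((Complex.abs_re_le_norm h).trans hh)).1
    rw [e]
    nlinarith [mul_pos (by linarith : 0 < z) (by linarith : 0 < z)]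
  have hsec := cpow_sector hre
  have hcube := cube_cpow l
  set w := l ^ (1 / 3 : ℂ) with hw
  have hre0 : 0 ≤ w.re := (by positivity : (0 : ℝ) ≤ √3 * |w.im|).trans hsec
  have him : |w.im| ≤ w.re := by nlinarith [sqrt3_bounds.1, abs_nonneg w.im]
  have hsq : w.im ^ 2 ≤ w.re ^ 2 := by
    rw [← sq_abs w.im]; gcongr
  have hge : z ^ 2 ≤ ‖w ^ 2 + w * z + (z : ℂ) ^ 2‖ := by
    refine le_trans ?_ (Complex.re_le_norm _)
    rw [Complex.add_re, Complex.add_re, ← Complex.ofReal_pow, Complex.ofReal_re, mul_comm w,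
      Complex.re_ofReal_mul, pow_two w, Complex.mul_re]
    nlinarith
  have hmul : (w - z) * (w ^ 2 + w * z + (z : ℂ) ^ 2) = z * h := by
    linear_combination hcube
  have hnm : ‖w - z‖ * ‖w ^ 2 + w * z + (z : ℂ) ^ 2‖ = z * ‖h‖ := by
    rw [← norm_mul, hmul, norm_mul, Complex.norm_of_nonneg (by linarith)]
  change ‖w - z‖ < 1
  by_contra! hcon
  nlinarith [mul_le_mul hcon hge (by positivity) (norm_nonneg _)]

/-! ### The eigenvalues -/

/-- `H` is quantified first so that it alone can be fixed by choice; the other components are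
recovered whenever they are needed. -/
lemma exists_branch {m : ℕ} (hm : 1 ≤ m) : ∃ (H : Cont × Cont → ℂ) (R X φ : Cont × Cont → Cont),
    IsBranch m R X φ H := by
  obtain ⟨R, X, φ, H, h⟩ := exists_joint hm
  exact ⟨H, R, X, φ, hm, h⟩

/-- The deviation of the cube of `base m` in a branch of eigenvalues. -/
def branchH (m : ℕ) : Cont × Cont → ℂ :=
  Classical.epsilon fun H => ∃ R X φ : Cont × Cont → Cont, IsBranch m R X φ H

lemma isBranch_branchH {m : ℕ} (hm : 1 ≤ m) :
    ∃ R X φ : Cont × Cont → Cont, IsBranch m R X φ (branchH m) :=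
  Classical.epsilon_spec (exists_branch hm)

/-- The eigenvalue close to the cube of `base m`. -/
def branchVal (m : ℕ) (e : Cont × Cont) : ℂ := (base m : ℂ) ^ 3 + base m * branchH m e

lemma tiny_lt_radius {x : ℝ} (h : x ≤ tiny) : x < radius / 100000 := by
  rw [tiny] at h; rw [radius]; linarith

lemma branchVal_mem_near {m : ℕ} (hm : 1 ≤ m) {e : Cont × Cont} (he : ‖e‖ ≤ tiny) :
    branchVal m e ∈ near m := by
  obtain ⟨R, X, φ, h⟩ := isBranch_branchH hm
  refine mem_near hm ((h.2 e (tiny_lt_radius he)).2.1.2.2.2.trans ?_)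
  rw [tiny] at he
  linarith

lemma analyticAt_branchVal {m : ℕ} (hm : 1 ≤ m) {e : Cont × Cont} (he : ‖e‖ ≤ tiny) :
    AnalyticAt ℂ (branchVal m) e := by
  obtain ⟨R, X, φ, h⟩ := isBranch_branchH hm
  exact analyticAt_const.add (analyticAt_const.mul (h.2 e (tiny_lt_radius he)).2.2.1.2.2.2)

lemma fderiv_branchVal {m : ℕ} (hm : 1 ≤ m) {e : Cont × Cont} (he : ‖e‖ ≤ tiny) (e' : Cont × Cont) :
    fderiv ℂ (branchVal m) e e' = base m * fderiv ℂ (branchH m) e e' := by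
  obtain ⟨R, X, φ, h⟩ := isBranch_branchH hm
  have hd := (h.2 e (tiny_lt_radius he)).2.2.1.2.2.2.differentiableAt
  have := ((hd.hasFDerivAt.const_mul (base m : ℂ)).const_add ((base m : ℂ) ^ 3)).fderiv
  rw [show branchVal m = fun e => (base m : ℂ) ^ 3 + base m * branchH m e from rfl, this]
  rfl

section

variable {p dp q : ℝ → ℂ} {e : Cont × Cont}

lemma Coeffs.isSimplePair_branchVal (hc : Coeffs p dp q e) (he : ‖e‖ ≤ tiny) {m : ℕ} (hm : 1 ≤ m) :
    IsSimplePair p q (branchVal m e) := by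
  obtain ⟨R, X, φ, h⟩ := isBranch_branchH hm
  exact (h.mode hc he).isSimplePair

lemma Pair.exists_branchVal (hc : Coeffs p dp q e) (he : ‖e‖ ≤ tiny) {l : ℂ} (hl : 0 ≤ l.re)
    {y₁ v₁ w₁ y₂ v₂ w₂ : ℝ → ℂ} (hP : Pair p q l (fun _ => 0) (fun _ => 0) y₁ v₁ w₁ y₂ v₂ w₂)
    (hne : ∃ x ∈ Icc (0 : ℝ) 1, y₁ x ≠ 0 ∨ y₂ x ≠ 0) : ∃ m : ℕ, 1 ≤ m ∧ l = branchVal m e := by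
  obtain ⟨m, hm, R, X, φ, H, hj, h1, h2, h3, h4, h5⟩ := hP.exists_isJoint hc he hl hne
  obtain ⟨R', X', φ', h⟩ := isBranch_branchH hm
  have := ((h.2 e (tiny_lt_radius he)).2.2.2 R X φ H hj h1 h2 h3 h4).2.2.2
  exact ⟨m, hm, by rw [h5, this, branchVal]⟩

lemma Coeffs.im_branchVal (hc : Coeffs p dp q e) (hr : RealCoeffs p dp q) (he : ‖e‖ ≤ tiny) {m : ℕ}
    (hm : 1 ≤ m) : (branchVal m e).im = 0 := by
  obtain ⟨R, X, φ, h⟩ := isBranch_branchH hm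
  have h1 := (h.star_eq hc he hr).2.2.2
  rw [← Complex.conj_eq_iff_im, branchVal, map_add, map_mul, map_pow, Complex.conj_ofReal, h1]

lemma Coeffs.norm_branchVal (hc : Coeffs p dp q e) (he : ‖e‖ ≤ tiny) {m : ℕ} (hm : 1 ≤ m) {N : ℝ}
    (heN : ‖e‖ ≤ N) (hdp : ∫ x in (0 : ℝ)..1, ‖dp x‖ ≤ N) (hq : ∫ x in (0 : ℝ)..1, ‖q x‖ ≤ N)
    (p0 : ∫ x in (0 : ℝ)..1, p x = 0) (q0 : ∫ x in (0 : ℝ)..1, q x = 0) :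
    ‖branchVal m e - (base m : ℂ) ^ 3 +
      (∫ x in (0 : ℝ)..1, Complex.sin ((2 * freq m : ℝ) * x) * dp x) / (Real.sqrt 3 : ℝ) +
      (∫ x in (0 : ℝ)..1, Complex.cos ((2 * freq m : ℝ) * x) * q x) -
      (∫ x in (0 : ℝ)..1, Complex.cos ((2 * freq m : ℝ) * x) * dp x) / 3 +
      (∫ x in (0 : ℝ)..1, Complex.sin ((2 * freq m : ℝ) * x) * q x) / (Real.sqrt 3 : ℝ)‖ ≤
      3 * 10 ^ 10 * N ^ 2 / m := by
  obtain ⟨R, X, φ, h⟩ := isBranch_branchH hm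
  have h1 := (h.mode hc he).norm_asymptotic heN hdp hq p0 q0
  rw [branchVal, add_sub_cancel_left, le_div_iff₀ (by exact_mod_cast hm), mul_comm]
  exact (mul_le_mul_of_nonneg_right (nat_le_base m) (norm_nonneg _)).trans h1

end

/-! ### Gradients on the circle -/

/-- Self-conjugacy makes the function real, and equal values at the endpoints let it descend to a
continuous function on the circle. -/
lemma exists_circle {a : Cont} (ha : star a = a) (ha' : ext a 0 = ext a 1) (h0 : total a = 0) :
    ∃ g : C(UnitAddCircle, ℝ), (∀ t ∈ Icc (0 : ℝ) 1, ((g (t : UnitAddCircle) : ℝ) : ℂ) = ext a t) ∧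
      ∫ t, g t = 0 := by
  set f : ℝ → ℝ := fun x => (ext a x).re with hf
  have hre : ∀ x, ((f x : ℝ) : ℂ) = ext a x := fun x =>
    Complex.conj_eq_iff_re.1 (by rw [← ext_star, ha])
  have hc : Continuous f := Complex.continuous_re.comp (continuous_ext a)
  have hper : f 0 = f 1 := congrArg Complex.re ha'
  have hg : ∀ t ∈ Icc (0 : ℝ) 1, AddCircle.liftIco 1 0 f (t : UnitAddCircle) = f t := by
    intro t ht
    rcases ht.2.eq_or_lt with rfl | h1
    · have e : ((1 : ℝ) : UnitAddCircle) = ((0 : ℝ) : UnitAddCircle) := by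
        have := AddCircle.coe_period (1 : ℝ)
        rw [this, AddCircle.coe_zero]
      rw [e, ← hper]
      exact AddCircle.liftIco_zero_coe_apply ⟨le_rfl, zero_lt_one⟩
    · exact AddCircle.liftIco_zero_coe_apply ⟨ht.1, h1⟩
  refine ⟨⟨AddCircle.liftIco 1 0 f, AddCircle.liftIco_zero_continuous hper hc.continuousOn⟩,
    fun t ht => by rw [← hre, ← hg t ht]; rfl, ?_⟩
  have h1 := UnitAddCircle.intervalIntegral_preimage 0 (AddCircle.liftIco (1 : ℝ) 0 f)
  rw [zero_add] at h1
  refine h1.symm.trans ?_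
  rw [intervalIntegral.integral_congr (g := f) (fun t ht => hg t (by
    rwa [uIcc_of_le zero_le_one] at ht))]
  have h2 : ((∫ t in (0 : ℝ)..1, f t : ℝ) : ℂ) = 0 := by
    rw [← h0, total_apply, ← intervalIntegral.integral_ofReal]
    simp only [hre]
  exact_mod_cast h2

lemma exists_isGradient {F : Coeff → ℂ} {ψ : Coeff} {a b : Cont} (ha : star a = a) (hb : star b = b)
    (ha0 : total a = 0) (hb0 : total b = 0) (ha' : ext a 0 = ext a 1) (hb' : ext b 0 = ext b 1)
    (hd : DifferentiableAt ℂ F ψ)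
    (hf : ∀ φ : Coeff, fderiv ℂ F ψ φ =
      ∫ x in (0 : ℝ)..1, (ext a x * contP φ x + ext b x * φ.q x)) :
    ∃ gp gq : C(UnitAddCircle, ℝ), IsGradient F ψ gp gq ∧ ∀ t ∈ Icc (0 : ℝ) 1,
      ((gp (t : UnitAddCircle) : ℝ) : ℂ) = ext a t ∧
      ((gq (t : UnitAddCircle) : ℝ) : ℂ) = ext b t := by
  obtain ⟨gp, h1, h2⟩ := exists_circle ha ha' ha0
  obtain ⟨gq, h3, h4⟩ := exists_circle hb hb' hb0
  refine ⟨gp, gq, ⟨h2, h4, hd, fun φ => ?_⟩, fun t ht => ⟨h1 t ht, h3 t ht⟩⟩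
  rw [hf φ]
  refine integral_congr01_ae zero_mem01 one_mem01 ?_
  filter_upwards [p_ae_eq φ, ae_restrict_mem measurableSet_Ioc] with x hx hm
  rw [h1 x (Ioc_subset_Icc_self hm), h3 x (Ioc_subset_Icc_self hm), hx]

/-! ### Fourier coefficients -/

lemma two_freq_mul (m : ℕ) (x : ℝ) : 2 * freq m * x = 2 * Real.pi * ((m : ℤ) : ℝ) * x := by
  rw [freq, Int.cast_natCast]; ring

lemma fourierSin_natCast (f : ℝ → ℂ) (m : ℕ) : fourierSin f m =
    ∫ x in (0 : ℝ)..1, Complex.sin ((2 * freq m : ℝ) * x) * f x := by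
  refine intervalIntegral.integral_congr fun x _ => ?_
  rw [← two_freq_mul, mul_comm]
  push_cast
  rfl

lemma fourierCos_natCast (f : ℝ → ℂ) (m : ℕ) : fourierCos f m =
    ∫ x in (0 : ℝ)..1, Complex.cos ((2 * freq m : ℝ) * x) * f x := by
  refine intervalIntegral.integral_congr fun x _ => ?_
  rw [← two_freq_mul, mul_comm]
  push_cast
  rfl

lemma fourierSin_neg (f : ℝ → ℂ) (n : ℤ) : fourierSin f (-n) = -fourierSin f n := by
  rw [fourierSin, fourierSin, ← intervalIntegral.integral_neg]
  refine intervalIntegral.integral_congr fun x _ => ?_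
  rw [show 2 * Real.pi * ((-n : ℤ) : ℝ) * x = -(2 * Real.pi * n * x) by push_cast; ring,
    Real.sin_neg]
  push_cast
  ring

lemma fourierCos_neg (f : ℝ → ℂ) (n : ℤ) : fourierCos f (-n) = fourierCos f n := by
  refine intervalIntegral.integral_congr fun x _ => ?_
  rw [show 2 * Real.pi * ((-n : ℤ) : ℝ) * x = -(2 * Real.pi * n * x) by push_cast; ring,
    Real.cos_neg]

lemma fourierSin_reflect (f : ℝ → ℂ) (n : ℤ) : fourierSin (fun x => -f (1 - x)) n =
    fourierSin f n := by
  have h := integral_reflect fun x => f x * (Real.sin (2 * Real.pi * n * x) : ℂ)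
  rw [fourierSin, fourierSin, ← h]
  refine intervalIntegral.integral_congr fun x _ => ?_
  rw [show 2 * Real.pi * n * (1 - x) = n * (2 * Real.pi) - 2 * Real.pi * n * x by ring,
    Real.sin_int_mul_two_pi_sub]
  push_cast
  ring

lemma fourierCos_reflect (f : ℝ → ℂ) (n : ℤ) : fourierCos (fun x => -f (1 - x)) n =
    -fourierCos f n := by
  have h := integral_reflect fun x => f x * (Real.cos (2 * Real.pi * n * x) : ℂ)
  rw [fourierCos, fourierCos, ← h, ← intervalIntegral.integral_neg]
  refine intervalIntegral.integral_congr fun x _ => ?_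
  rw [show 2 * Real.pi * n * (1 - x) = n * (2 * Real.pi) - 2 * Real.pi * n * x by ring,
    Real.cos_int_mul_two_pi_sub]
  ring

lemma waveA_eq (m : ℕ) (x : ℝ) : waveA m x = aFun m x := by
  rw [waveA, aFun, ← two_freq_mul]
  push_cast
  rfl

lemma aFun_neg (n : ℤ) (t : ℝ) : aFun (-n) t = aFun n (1 - t) := by
  rw [aFun, aFun, show 2 * Real.pi * n * (1 - t) = n * (2 * Real.pi) - 2 * Real.pi * n * t by ring,
    Real.cos_int_mul_two_pi_sub, Real.sin_int_mul_two_pi_sub,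
    show 2 * Real.pi * ((-n : ℤ) : ℝ) * t = -(2 * Real.pi * n * t) by push_cast; ring,
    Real.cos_neg, Real.sin_neg]

/-! ### Labelling of the eigenvalues -/

/-- The eigenvalue with the label `n`. -/
def muVal (n : ℤ) (ψ : Coeff) : ℂ :=
  if 0 ≤ n then branchVal n.natAbs (contCoeff ψ) else -branchVal n.natAbs (flipCoeff ψ)

lemma muVal_natCast (m : ℕ) : muVal m = fun ψ => branchVal m (contCoeff ψ) := by
  funext ψ; simp [muVal]

lemma muVal_neg_natCast {m : ℕ} (hm : 1 ≤ m) :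
    muVal (-m) = fun ψ => -branchVal m (flipCoeff ψ) := by
  funext ψ
  rw [muVal, if_neg (by omega)]; simp

lemma exists_natCast {n : ℤ} (hn : n ≠ 0) : ∃ m : ℕ, 1 ≤ m ∧ (n = m ∨ n = -m) :=
  ⟨n.natAbs, Int.natAbs_pos.2 hn, Int.natAbs_eq n⟩

/-- The radius of the ball of coefficients. -/
def ballRadius : ℝ := 1 / 10 ^ 16

section

variable {ψ : Coeff} (hψ : ‖ψ‖ < ballRadius)
include hψ

lemma norm_contCoeff_lt : ‖contCoeff ψ‖ < tiny := by
  rw [ballRadius] at hψ; rw [tiny]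
  linarith [norm_contCoeff_le ψ]

lemma norm_flipCoeff_lt : ‖flipCoeff ψ‖ < tiny := by
  rw [ballRadius] at hψ; rw [tiny]
  linarith [norm_flipCoeff_le ψ]

lemma isSimpleEigenvalue_muVal {n : ℤ} (hn : n ≠ 0) : IsSimpleEigenvalue ψ (muVal n ψ) := by
  obtain ⟨m, hm, rfl | rfl⟩ := exists_natCast hn
  · rw [muVal_natCast]
    exact ((coeffs_contCoeff ψ).isSimplePair_branchVal (norm_contCoeff_lt hψ).le
      hm).isSimpleEigenvalue (p_ae_eq ψ)
  · rw [muVal_neg_natCast hm]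
    have h := ((coeffs_flipCoeff ψ).isSimplePair_branchVal (norm_flipCoeff_lt hψ).le hm).reflect
    simp only [sub_sub_cancel, neg_neg] at h
    exact h.isSimpleEigenvalue (p_ae_eq ψ)

lemma muVal_mem_domD {n : ℤ} (hn : n ≠ 0) : muVal n ψ ∈ domD n := by
  obtain ⟨m, hm, rfl | rfl⟩ := exists_natCast hn
  · rw [muVal_natCast, mem_domD_natCast]
    exact branchVal_mem_near hm (norm_contCoeff_lt hψ).le
  · rw [muVal_neg_natCast hm, mem_domD_neg_natCast hm, neg_neg]
    exact branchVal_mem_near hm (norm_flipCoeff_lt hψ).le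

lemma IsEigenvalue.exists_branchVal {l : ℂ} (h : IsEigenvalue ψ l) (hl : 0 ≤ l.re) :
    ∃ m : ℕ, 1 ≤ m ∧ l = branchVal m (contCoeff ψ) := by
  obtain ⟨_, _, _, _, _, _, hP, hne⟩ := h.exists_pair (p_ae_eq ψ)
  exact hP.exists_branchVal (coeffs_contCoeff ψ) (norm_contCoeff_lt hψ).le hl hne

lemma IsEigenvalue.exists_branchVal_flip {l : ℂ} (h : IsEigenvalue ψ l) (hl : l.re ≤ 0) :
    ∃ m : ℕ, 1 ≤ m ∧ -l = branchVal m (flipCoeff ψ) := by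
  obtain ⟨_, _, _, _, _, _, hP, x, hx, hne⟩ := h.exists_pair (p_ae_eq ψ)
  exact hP.reflect_zero.exists_branchVal (coeffs_flipCoeff ψ) (norm_flipCoeff_lt hψ).le
    (by rw [Complex.neg_re]; linarith)
    ⟨1 - x, reflect_mem01 hx, by rw [sub_sub_cancel]; exact hne.symm⟩

/-- Each eigenvalue has nonnegative or nonpositive real part; the second case is the first for the
reflected coefficients. -/
lemma IsEigenvalue.exists_muVal {l : ℂ} (h : IsEigenvalue ψ l) : ∃ n : ℤ, n ≠ 0 ∧ l = muVal n ψ := by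
  rcases le_total 0 l.re with hl | hl
  · obtain ⟨m, hm, e⟩ := h.exists_branchVal hψ hl
    exact ⟨m, by omega, by rw [e, muVal_natCast]⟩
  · obtain ⟨m, hm, e⟩ := h.exists_branchVal_flip hψ hl
    exact ⟨-m, by omega, by simp only [muVal_neg_natCast hm, ← e, neg_neg]⟩

/-- An eigenvalue in the domain with label n lies in the corresponding open half plane, so it is a
branch value with some label k; it then lies also in the domain of k, and disjointness gives k =
|n|. -/
lemma mem_domD_and_isEigenvalue {n : ℤ} (hn : n ≠ 0) (l : ℂ) :
    l ∈ domD n ∧ IsEigenvalue ψ l ↔ l = muVal n ψ := by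
  refine ⟨fun ⟨hd, he⟩ => ?_, fun h => h ▸ ⟨muVal_mem_domD hψ hn,
    (isSimpleEigenvalue_muVal hψ hn).isEigenvalue⟩⟩
  obtain ⟨m, hm, rfl | rfl⟩ := exists_natCast hn
  · rw [mem_domD_natCast] at hd
    obtain ⟨k, hk, e⟩ := he.exists_branchVal hψ (re_pos_of_mem_near hm hd).le
    have := branchVal_mem_near hk (norm_contCoeff_lt hψ).le
    rw [← e] at this
    rw [muVal_natCast, eq_of_mem_near hd this, e]
  · rw [mem_domD_neg_natCast hm] at hd
    have h1 := re_pos_of_mem_near hm hd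
    rw [Complex.neg_re] at h1
    obtain ⟨k, hk, e⟩ := he.exists_branchVal_flip hψ (by linarith)
    have := branchVal_mem_near hk (norm_flipCoeff_lt hψ).le
    rw [← e] at this
    rw [eq_of_mem_near hd this]
    simp only [muVal_neg_natCast hk, ← e, neg_neg]

lemma mu_eq_muVal {n : ℤ} (hn : n ≠ 0) : mu n ψ = muVal n ψ := by
  have h : ∃ l, l ∈ domD n ∧ IsEigenvalue ψ l := ⟨_, (mem_domD_and_isEigenvalue hψ hn _).2 rfl⟩
  exact (mem_domD_and_isEigenvalue hψ hn _).1 (Classical.epsilon_spec h)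

lemma mu_eventuallyEq {n : ℤ} (hn : n ≠ 0) : mu n =ᶠ[nhds ψ] muVal n := by
  have : ∀ᶠ φ : Coeff in nhds ψ, ‖φ‖ < ballRadius := continuous_norm.continuousAt.eventually_lt_const hψ
  filter_upwards [this] with φ hφ
  exact mu_eq_muVal hφ hn

lemma analyticAt_muVal {n : ℤ} (hn : n ≠ 0) : AnalyticAt ℂ (muVal n) ψ := by
  obtain ⟨m, hm, rfl | rfl⟩ := exists_natCast hn
  · rw [muVal_natCast]
    have h := ContinuousLinearMap.analyticAt (𝕜 := ℂ) (E := Coeff) (F := Cont × Cont) contCoeff ψ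
    exact (analyticAt_branchVal hm (norm_contCoeff_lt hψ).le).comp h
  · rw [muVal_neg_natCast hm]
    have h := ContinuousLinearMap.analyticAt (𝕜 := ℂ) (E := Coeff) (F := Cont × Cont) flipCoeff ψ
    exact ((analyticAt_branchVal hm (norm_flipCoeff_lt hψ).le).comp h).neg

lemma analyticAt_mu {n : ℤ} (hn : n ≠ 0) : AnalyticAt ℂ (mu n) ψ :=
  (analyticAt_muVal hψ hn).congr (mu_eventuallyEq hψ hn).symm

lemma fderiv_mu_natCast {m : ℕ} (hm : 1 ≤ m) (φ : Coeff) : fderiv ℂ (mu m) ψ φ =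
    base m * fderiv ℂ (branchH m) (contCoeff ψ) (contCoeff φ) := by
  have he := (norm_contCoeff_lt hψ).le
  rw [(mu_eventuallyEq hψ (by omega : (m : ℤ) ≠ 0)).fderiv_eq, muVal_natCast,
    ← fderiv_branchVal hm he]
  exact congrArg (fun f => f φ) ((analyticAt_branchVal hm he).differentiableAt.hasFDerivAt.comp ψ
    contCoeff.hasFDerivAt).fderiv

lemma fderiv_mu_neg_natCast {m : ℕ} (hm : 1 ≤ m) (φ : Coeff) : fderiv ℂ (mu (-m)) ψ φ =
    -(base m * fderiv ℂ (branchH m) (flipCoeff ψ) (flipCoeff φ)) := by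
  have he := (norm_flipCoeff_lt hψ).le
  rw [(mu_eventuallyEq hψ (by omega : -(m : ℤ) ≠ 0)).fderiv_eq, muVal_neg_natCast hm,
    ← fderiv_branchVal hm he]
  exact congrArg (fun f => f φ) ((analyticAt_branchVal hm he).differentiableAt.hasFDerivAt.comp ψ
    flipCoeff.hasFDerivAt).neg.fderiv

lemma im_muVal (hr : ψ.IsReal) {n : ℤ} (hn : n ≠ 0) : (muVal n ψ).im = 0 := by
  obtain ⟨m, hm, rfl | rfl⟩ := exists_natCast hn
  · rw [muVal_natCast]
    exact (coeffs_contCoeff ψ).im_branchVal hr.realCoeffs (norm_contCoeff_lt hψ).le hm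
  · rw [muVal_neg_natCast hm, Complex.neg_im, neg_eq_zero]
    exact (coeffs_flipCoeff ψ).im_branchVal hr.realCoeffs.reflect (norm_flipCoeff_lt hψ).le hm

theorem norm_mu_asymptotic {n : ℤ} (hn : n ≠ 0) :
    ‖(mu n ψ - ((zo n ^ 3 : ℝ) : ℂ)) + fourierSin ψ.dp n / ((Real.sqrt 3 : ℝ) : ℂ)
      + fourierCos ψ.q n - fourierCos ψ.dp n / 3 + fourierSin ψ.q n / ((Real.sqrt 3 : ℝ) : ℂ)‖
      ≤ 10 ^ 12 * ‖ψ‖ ^ 2 / |(n : ℝ)| := by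
  have hN := norm_nonneg ψ
  have hdp : ∫ x in (0 : ℝ)..1, ‖ψ.dp x‖ ≤ 3 * ‖ψ‖ := by
    linarith [(integral_norm_onLine_le (H1.deriv ψ.fst)).trans (norm_deriv_le ψ), show
      ∫ x in (0 : ℝ)..1, ‖ψ.dp x‖ = ∫ x in (0 : ℝ)..1, ‖onLine (H1.deriv ψ.fst) x‖ from rfl]
  have hq : ∫ x in (0 : ℝ)..1, ‖ψ.q x‖ ≤ 3 * ‖ψ‖ := by
    linarith [(integral_norm_onLine_le ψ.snd).trans (norm_snd_coeff_le ψ), show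
      ∫ x in (0 : ℝ)..1, ‖ψ.q x‖ = ∫ x in (0 : ℝ)..1, ‖onLine ψ.snd x‖ from rfl]
  -- All data are bounded by N = 3‖ψ‖, and 9·3·10¹⁰ ≤ 10¹².
  have hfin : ∀ m : ℕ, 3 * 10 ^ 10 * (3 * ‖ψ‖) ^ 2 / m ≤ 10 ^ 12 * ‖ψ‖ ^ 2 / (m : ℝ) := fun m => by
    refine div_le_div_of_nonneg_right ?_ (Nat.cast_nonneg m)
    linarith [sq_nonneg ‖ψ‖, mul_pow 3 ‖ψ‖ 2]
  rw [mu_eq_muVal hψ hn]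
  obtain ⟨m, hm, rfl | rfl⟩ := exists_natCast hn
  · have h := (coeffs_contCoeff ψ).norm_branchVal (norm_contCoeff_lt hψ).le hm
      (norm_contCoeff_le ψ) hdp hq (integral_contP ψ) (integral_q ψ)
    rw [← fourierSin_natCast, ← fourierSin_natCast, ← fourierCos_natCast, ← fourierCos_natCast] at h
    rw [muVal_natCast, zo_natCast, Int.cast_natCast, Nat.abs_cast, Complex.ofReal_pow]
    exact h.trans (hfin m)
  · have h := (coeffs_flipCoeff ψ).norm_branchVal (norm_flipCoeff_lt hψ).le hm
      (norm_flipCoeff_le ψ) (by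
        simp only [norm_neg]
        exact (integral_reflect fun x => ‖ψ.dp x‖).le.trans hdp) (by
        simp only [norm_neg]
        exact (integral_reflect fun x => ‖ψ.q x‖).le.trans hq)
      ((integral_reflect _).trans (integral_contP ψ)) (by
        rw [intervalIntegral.integral_neg, integral_reflect, integral_q, neg_zero])
    rw [← fourierSin_natCast, ← fourierSin_natCast, ← fourierCos_natCast, ← fourierCos_natCast,
      fourierSin_reflect, fourierSin_reflect, fourierCos_reflect, fourierCos_reflect] at h
    rw [muVal_neg_natCast hm, zo_neg, zo_natCast, Int.cast_neg, Int.cast_natCast, abs_neg,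
      Nat.abs_cast, fourierSin_neg, fourierSin_neg, fourierCos_neg, fourierCos_neg, ← norm_neg]
    -- For the label −m the whole expression is minus the one for the reflected coefficients: under
    -- f ↦ −f(1 − x) sine coefficients are kept and cosine coefficients change sign, while n ↦ −n
    -- does the opposite.
    refine (le_of_eq (congrArg norm ?_)).trans (h.trans (hfin m))
    push_cast
    ring

theorem exists_gradient_mu (hr : ψ.IsReal) {n : ℤ} (hn : n ≠ 0) :
    ∃ gp gq : C(UnitAddCircle, ℝ), IsGradient (mu n) ψ gp gq ∧
      (∀ t ∈ Icc (0 : ℝ) 1, |gp (t : UnitAddCircle) - zo n * aFun n t| ≤ 10 ^ 12 * ‖ψ‖) ∧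
      (∀ t ∈ Icc (0 : ℝ) 1, |gq (t : UnitAddCircle) + aFun n t| ≤ 10 ^ 12 * ‖ψ‖ / |(n : ℝ)|) := by
  have hN := norm_nonneg ψ
  have hd := (analyticAt_mu hψ hn).differentiableAt
  suffices hs : ∃ a b : Cont, (star a = a ∧ star b = b) ∧ (total a = 0 ∧ total b = 0) ∧
      (ext a 0 = ext a 1 ∧ ext b 0 = ext b 1) ∧
      (∀ φ : Coeff, fderiv ℂ (mu n) ψ φ =
        ∫ x in (0 : ℝ)..1, (ext a x * contP φ x + ext b x * φ.q x)) ∧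
      ∀ t ∈ Icc (0 : ℝ) 1, ‖ext a t - (zo n * aFun n t : ℝ)‖ ≤ 10 ^ 12 * ‖ψ‖ ∧
        ‖ext b t + (aFun n t : ℝ)‖ ≤ 10 ^ 12 * ‖ψ‖ / |(n : ℝ)| by
    obtain ⟨a, b, ⟨ha, hb⟩, ⟨ha0, hb0⟩, ⟨ha', hb'⟩, hf, hbd⟩ := hs
    obtain ⟨gp, gq, hg, he⟩ := exists_isGradient ha hb ha0 hb0 ha' hb' hd hf
    refine ⟨gp, gq, hg, fun t ht => ?_, fun t ht => ?_⟩
    · have := (hbd t ht).1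
      rwa [← (he t ht).1, ← Complex.ofReal_sub, Complex.norm_real, Real.norm_eq_abs] at this
    · have := (hbd t ht).2
      rwa [← (he t ht).2, ← Complex.ofReal_add, Complex.norm_real, Real.norm_eq_abs] at this
  have hbound : ∀ {m : ℕ} {w : ℂ}, 1 ≤ m → ∀ {e : Cont × Cont}, ‖e‖ ≤ 3 * ‖ψ‖ →
      base m * ‖w‖ ≤ 2 * 10 ^ 9 * ‖e‖ → ‖w‖ ≤ 10 ^ 12 * ‖ψ‖ / (m : ℝ) := by
    intro m w hm e he hw
    rw [le_div_iff₀ (by exact_mod_cast hm), mul_comm]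
    refine (mul_le_mul_of_nonneg_right (nat_le_base m) (norm_nonneg _)).trans (hw.trans ?_)
    linarith
  obtain ⟨m, hm, rfl | rfl⟩ := exists_natCast hn
  · obtain ⟨R, X, φ, h⟩ := isBranch_branchH hm
    obtain ⟨A, B, hs, ht, hp, hf, hb⟩ := h.exists_gradient (coeffs_contCoeff ψ) hr.realCoeffs
      (norm_contCoeff_lt hψ)
    refine ⟨A, B, hs, ht, hp, fun φ => ?_, fun t ht => ⟨?_, ?_⟩⟩
    · rw [fderiv_mu_natCast hψ hm]
      exact hf _ _ _ _ (coeffs_contCoeff φ) (integral_contP φ) (integral_q φ)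
    · rw [Complex.ofReal_mul, ← waveA_eq, zo_natCast]
      linarith [(hb t ht).1, norm_contCoeff_le ψ]
    · rw [← waveA_eq, Int.cast_natCast, Nat.abs_cast]
      exact hbound hm (norm_contCoeff_le ψ) (hb t ht).2
  · obtain ⟨R, X, φ, h⟩ := isBranch_branchH hm
    obtain ⟨A, B, hs, ht, hp, hf, hb⟩ := h.exists_gradient (coeffs_flipCoeff ψ)
      hr.realCoeffs.reflect (norm_flipCoeff_lt hψ)
    have sf : ∀ {a : Cont}, star a = a → star (flip a) = flip a := fun {a} ha => by
      refine cont_ext fun x hx => ?_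
      rw [ext_star, ext_flip _ hx, ← ext_star, ha]
    have tf : ∀ {a : Cont}, total a = 0 → total (flip a) = 0 := fun {a} ha => by
      rw [total_apply, integral_congr01 zero_mem01 one_mem01 fun x hx => ext_flip a hx,
        integral_reflect (ext a), ← total_apply, ha]
    have pf : ∀ {a : Cont}, ext a 0 = ext a 1 → ext (flip a) 0 = ext (flip a) 1 := fun {a} ha => by
      rw [ext_flip _ zero_mem01, ext_flip _ one_mem01, sub_zero, sub_self, ha]
    have en : ∀ x, ext (-flip A) x = -ext (flip A) x := fun _ => rfl
    -- The eigenvalue with label −m is minus the branch at (p(1 − x), −q(1 − x)). The minus sign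
    -- stays for p and cancels for q.
    refine ⟨-flip A, flip B, ⟨by rw [star_neg, sf hs.1], sf hs.2⟩,
      ⟨by rw [map_neg, tf ht.1, neg_zero], tf ht.2⟩, ⟨by rw [en, en, pf hp.1], pf hp.2⟩,
      fun φ => ?_, fun t ht => ⟨?_, ?_⟩⟩
    · rw [fderiv_mu_neg_natCast hψ hm, hf _ _ _ _ (coeffs_flipCoeff φ)
        ((integral_reflect _).trans (integral_contP φ)) (by
          rw [intervalIntegral.integral_neg, integral_reflect, integral_q, neg_zero]),
        ← integral_reflect, ← intervalIntegral.integral_neg]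
      refine integral_congr01 zero_mem01 one_mem01 fun x hx => ?_
      rw [en, ext_flip _ hx, ext_flip _ hx, sub_sub_cancel]
      ring
    · have := (hb _ (reflect_mem01 ht)).1
      rw [en, ext_flip _ ht, aFun_neg, zo_neg, zo_natCast, neg_mul, Complex.ofReal_neg,
        Complex.ofReal_mul, ← waveA_eq, neg_sub_neg, norm_sub_rev]
      linarith [norm_flipCoeff_le ψ]
    · rw [ext_flip _ ht, aFun_neg, ← waveA_eq, Int.cast_neg, abs_neg, Int.cast_natCast,
        Nat.abs_cast]
      exact hbound hm (norm_flipCoeff_le ψ) (hb _ (reflect_mem01 ht)).2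

end

end ThreePoint

end

/-! ### Assembly of the four claims. -/

theorem theorem1 :
    ∃ ε₀ : ℝ, 0 < ε₀ ∧ ∃ C : ℝ, 0 < C ∧ ∀ ε : ℝ, 0 < ε → ε ≤ ε₀ →
      -- the eigenvalues are the `μ_n`, one simple eigenvalue in each domain, real for real `ψ`
      (∀ ψ ∈ Metric.ball (0 : ThreePoint.Coeff) ε,
        (∀ n : ℤ, n ≠ 0 →
          (∀ l : ℂ, l ∈ ThreePoint.domD n ∧ ThreePoint.IsEigenvalue ψ l ↔
            l = ThreePoint.mu n ψ) ∧
          ThreePoint.IsSimpleEigenvalue ψ (ThreePoint.mu n ψ) ∧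
          (ψ.IsReal → (ThreePoint.mu n ψ).im = 0)) ∧
        (∀ l : ℂ, ThreePoint.IsEigenvalue ψ l → ∃ n : ℤ, n ≠ 0 ∧ l = ThreePoint.mu n ψ)) ∧
      -- analyticity on the complex ball
      (∀ n : ℤ, n ≠ 0 →
        AnalyticOnNhd ℂ (ThreePoint.mu n) (Metric.ball (0 : ThreePoint.Coeff) ε)) ∧
      -- asymptotics of the eigenvalues and of their gradients on the real ball
      (∀ ψ ∈ Metric.ball (0 : ThreePoint.Coeff) ε, ψ.IsReal → ∀ n : ℤ, n ≠ 0 →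
        ‖(ThreePoint.mu n ψ - ((ThreePoint.zo n ^ 3 : ℝ) : ℂ))
            + ThreePoint.fourierSin ψ.dp n / ((Real.sqrt 3 : ℝ) : ℂ)
            + ThreePoint.fourierCos ψ.q n
            - ThreePoint.fourierCos ψ.dp n / 3
            + ThreePoint.fourierSin ψ.q n / ((Real.sqrt 3 : ℝ) : ℂ)‖
          ≤ C * ‖ψ‖ ^ 2 / |(n : ℝ)| ∧
        ∃ gp gq : C(UnitAddCircle, ℝ), ThreePoint.IsGradient (ThreePoint.mu n) ψ gp gq ∧
          (∀ t ∈ Set.Icc (0 : ℝ) 1,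
            |gp (t : UnitAddCircle) - ThreePoint.zo n * ThreePoint.aFun n t| ≤ C * ‖ψ‖) ∧
          (∀ t ∈ Set.Icc (0 : ℝ) 1,
            |gq (t : UnitAddCircle) + ThreePoint.aFun n t| ≤ C * ‖ψ‖ / |(n : ℝ)|)) := by
  -- The sup norm data of ψ have norm at most 3‖ψ‖, so the radius 10⁻¹⁶ keeps them below `tiny`; the
  -- constant 10¹² serves both the asymptotics and the gradients.
  refine ⟨ThreePoint.ballRadius, by norm_num [ThreePoint.ballRadius], 10 ^ 12, by norm_num,
    fun ε _ hε => ?_⟩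
  have hball : ∀ ψ ∈ Metric.ball (0 : ThreePoint.Coeff) ε, ‖ψ‖ < ThreePoint.ballRadius :=
    fun ψ hψ => (mem_ball_zero_iff.1 hψ).trans_le hε
  refine ⟨fun ψ hψ => ⟨fun n hn => ?_, fun l hl => ?_⟩,
    fun n hn ψ hψ => ThreePoint.analyticAt_mu (hball ψ hψ) hn,
    fun ψ hψ hr n hn => ⟨ThreePoint.norm_mu_asymptotic (hball ψ hψ) hn,
      ThreePoint.exists_gradient_mu (hball ψ hψ) hr hn⟩⟩
  · rw [ThreePoint.mu_eq_muVal (hball ψ hψ) hn]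
    exact ⟨ThreePoint.mem_domD_and_isEigenvalue (hball ψ hψ) hn,
      ThreePoint.isSimpleEigenvalue_muVal (hball ψ hψ) hn,
      fun hr => ThreePoint.im_muVal (hball ψ hψ) hr hn⟩
  · obtain ⟨n, hn, h⟩ := hl.exists_muVal (hball ψ hψ)
    exact ⟨n, hn, h.trans (ThreePoint.mu_eq_muVal (hball ψ hψ) hn).symm⟩
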